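/- **Setting.** Let $D\ge 1$ and $\Lambda=\mathbb Z_L^D$ with the $\ell_\infty$ distance; a cube of linear size $R$ is a translate of $\{0,\dots,R\}^D$ (mod $L$), and an elementary cube is a cube of linear size $1$. At most $q$ qubits sit at each site. A *code Hamiltonian* is $H=-J\sum_a G_a$, $J>0$, where the generators $G_a$ are pairwise commuting signed multi-qubit Pauli operators, each acting nontrivially only on qubits at the vertices of an elementary cube assigned to it, with at most $r$ generators per elementary cube; $H$ is frustration-free, i.e. the $G_a$ have a common nonzero $+1$ eigenvector. The ground space has dimension $2^{k(L)}$. The syndrome $S(P)$ of a Pauli operator $P$ is the set of generators (defects) that anticommute with $P$; $P$ is said to create $S(P)$. Fix $\alpha\ge 1$, $\gamma>0$ and assume that for some integer $L_{tqo}$ with $L^\gamma\le L_{tqo}\le L/2$: * (TQO1) every Pauli operator with empty syndrome, supported in a cube of linear size $L_{tqo}$, is, up to a phase, a product of generators. * (TQO2) Call a set $S$ of defects *neutral* if $S=S(P)$ for some Pauli operator $P$ supported in a cube of linear size $L_{tqo}$. Every neutral $S$ equals $S(P)$ for some $P$ supported on the $1$-neighbourhood of a smallest cube enclosing (the elementary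 cubes of) $S$. * (No-strings rule) If a Pauli operator, supported in a cube of linear size $L_{tqo}$, creates only defects contained in the union of two cubes of linear size $w$, and the defects contained in one of these two cubes form a non-neutral set, then the distance between the two cubes is at most $\alpha w$. **Bath.** The coupling operators $A_\mu$ are self-adjoint, $\|A_\mu\|\le 1$, each acts on at most $w_0$ qubits, and there are at most $\kappa L^D$ of them. With $e^{iHt}A_\mu e^{-iHt}=\sum_\omega e^{-i\omega t}A_{\mu,\omega}$ let $$\mathcal L(\rho)=\sum_{\mu,\omega}h(\mu,\omega)\Big(A_{\mu,\omega}\rho A_{\mu,\omega}^\dagger-\tfrac12\{\rho,A_{\mu,\omega}^\dagger A_{\mu,\omega}\}\Big),\qquad 0\le h\le h_{\max},\qquad h(\mu,-\omega)=e^{-\beta\omega}h(\mu,\omega),$$ and let $\dot\rho(t)=-i[H,\rho(t)]+\mathcal L(\rho(t))$ for $t\ge 0$, where $\rho(0)$ is a density matrix supported on the ground space. **Decoder.** A decoder $S\mapsto P_{ec}(S)$ assigns a Pauli operator to each syndrome and acts by $\Phi_{ec}(\rho)=\sum_S P_{ec}(S)\Pi_S\rho\,\Pi_SP_{ec}(S)^\dagger$,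 where $\Pi_S$ projects onto the subspace with syndrome $S$. The RG decoder proceeds through the levels $p=0,1,\dots$ with $2^p<L_{tqo}$. At level $p$ it splits the current set of defects into its $2^p$-connected components; for each component $C$ for which a smallest enclosing cube $B$ has linear size at most $L_{tqo}$ and some Pauli operator supported on the $1$-neighbourhood of $B$ has syndrome $C$, it applies such an operator, and it leaves the other components alone. If no defects are left at the end it returns the product of the applied operators; otherwise it returns any Pauli operator consistent with the measured syndrome. **Theorem.** There are constants $c,c',C>0$ and $L_0,K\in\mathbb N$ and a single random-access-machine program (integer registers and memory cells, indirect addressing, addition and truncated subtraction at unit cost), depending only on $D,q,r,\alpha,\gamma,J,w_0,\kappa,h_{\max}$, such that for all $L\ge L_0$ and every code Hamiltonian as above the following hold. 1. Given the code, $L_{tqo}$ and a syndrome as input, the program computes an RG decoder $\Phi_{ec}$ in at most $K L^K$ steps. 2. For every $\beta>0$ with $L\le e^{c'\beta}$, every bath as above at inverse temperature $\beta$, every $\rho(0)$ and every $t\ge0$, $$\epsilon(t):=\|\rho(0)-\Phi_{ec}(\rho(t))\|_1\le C\,t\cdot 2^{k(L)}\cdot L^{D-c\beta}.$$ 3. Consequently,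 for every tolerance $\epsilon>0$, the memory time $T_{mem}=\inf\{t\ge0:\epsilon(t)\ge\epsilon\}$ satisfies $T_{mem}\ge \frac{\epsilon}{C\,2^{k(L)}}L^{c\beta-D}$ whenever $L\le e^{c'\beta}$. 4. Moreover, for every $\epsilon>0$, $k_0\in\mathbb N$ and $0<\delta<\mu\le1$ there is $\beta_0$ such that $T_{mem}\ge e^{\delta cc'\beta^2}$ whenever $\beta\ge\beta_0$, $k(L)\le k_0$ and $e^{\mu c'\beta}\le L\le e^{c'\beta}$. -/

import Mathlib

open Matrix
open scoped ComplexOrder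

noncomputable section

namespace MemoryTime

/-! ## The periodic lattice -/

/-- Sites of the periodic cubic lattice of linear size `L` in `D` dimensions. -/
abbrev Site (D L : ℕ) : Type := Fin D → ZMod L

variable {D L : ℕ}

/-- The `ℓ∞` distance on the torus. -/
def dist (u v : Site D L) : ℕ :=
  Finset.univ.sup fun i => (u i - v i).valMinAbs.natAbs

/-- The cube of linear size `R` with lower corner `a`, as a set of sites. A cube of linear size `1`
is (the set of vertices of) an elementary cube. -/
def box (a : Site D L) (R : ℕ) : Set (Site D L) :=
  {u | ∀ i, (u i - a i).val ≤ R}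

/-- The `s`-neighbourhood of a set of sites. -/
def nbhd (s : ℕ) (A : Set (Site D L)) : Set (Site D L) :=
  {u | ∃ v ∈ A, dist u v ≤ s}

/-! ## Pauli operators -/

/-- Pauli operators on `n` qubits modulo phases, in the binary representation: the entry `(x, z)` at
a qubit stands for `X` if `(1, 0)`, for `Z` if `(0, 1)`, for `Y` if `(1, 1)` and for the identity if
`(0, 0)`. Multiplication of Pauli operators is addition. -/
abbrev Pauli (n : ℕ) : Type := Fin n → ZMod 2 × ZMod 2

/-- The symplectic form: two Pauli operators commute if it is `0` and anticommute if it is `1`. -/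
def symp {n : ℕ} (P Q : Pauli n) : ZMod 2 :=
  ∑ j, ((P j).1 * (Q j).2 + (P j).2 * (Q j).1)

/-- Operators on the Hilbert space of `n` qubits, as matrices in the computational basis. -/
abbrev Op (n : ℕ) : Type := Matrix (Fin n → Fin 2) (Fin n → Fin 2) ℂ

/-- The single-qubit Pauli matrices. -/
def pauliOne (p : ZMod 2 × ZMod 2) : Matrix (Fin 2) (Fin 2) ℂ :=
  if p = (0, 0) then 1
  else if p = (1, 0) then !![0, 1; 1, 0]
  else if p = (0, 1) then !![1, 0; 0, -1]
  else !![0, -Complex.I; Complex.I, 0]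

/-- The tensor product of single-qubit Pauli matrices described by `P`. -/
def pauliOp {n : ℕ} (P : Pauli n) : Op n :=
  Matrix.of fun a b => ∏ j, pauliOne (P j) (a j) (b j)

/-- The operator `A` acts nontrivially only on the qubits in `s`: it is a linear combination of
Pauli operators supported on `s`. -/
def ActsOn {n : ℕ} (A : Op n) (s : Finset (Fin n)) : Prop :=
  A ∈ Submodule.span ℂ {B : Op n | ∃ P : Pauli n, (∀ j, P j ≠ 0 → j ∈ s) ∧ B = pauliOp P}

/-! ## Code Hamiltonians -/

/-- The signed Pauli operator `± P`; the sign is negative if `s` is true. -/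
def signedOp {n : ℕ} (s : Bool) (P : Pauli n) : Op n :=
  (if s then (-1 : ℂ) else 1) • pauliOp P

/-- A frustration-free code Hamiltonian on the periodic lattice: qubits located at sites, and
pairwise commuting signed Pauli operators (the generators), each located at an elementary cube
(labelled by its lower corner) and acting nontrivially only on qubits at the vertices of its cube.
It is frustration-free: some nonzero vector is a `+1` eigenvector of all the generators. -/
structure Code (D L : ℕ) where
  n : ℕ
  site : Fin n → Site D L
  M : ℕ
  cube : Fin M → Site D L
  gen : Fin M → Pauli n
  sign : Fin M → Bool
  gen_local : ∀ a j, gen a j ≠ 0 → site j ∈ box (cube a) 1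
  gen_comm : ∀ a b, symp (gen a) (gen b) = 0
  frustration_free : ∃ ψ : (Fin n → Fin 2) → ℂ, ψ ≠ 0 ∧
    ∀ a, signedOp (sign a) (gen a) *ᵥ ψ = ψ

namespace Code

variable (Q : Code D L)

/-- The generator `G_a`. -/
def G (a : Fin Q.M) : Op Q.n := signedOp (Q.sign a) (Q.gen a)

/-- The Hamiltonian `H = - J ∑ G_a`. -/
def H (J : ℝ) : Op Q.n := -((J : ℂ) • ∑ a, Q.G a)

/-- The stabilizer group (modulo signs). -/
def stab : Submodule (ZMod 2) (Pauli Q.n) := Submodule.span (ZMod 2) (Set.range Q.gen)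

/-- The number `k` of encoded qubits: the number of qubits minus the number of independent
generators. The ground space has dimension `2 ^ k`. -/
def k : ℕ := Q.n - Module.finrank (ZMod 2) Q.stab

/-- Clusters of defects; a defect is a flipped generator. -/
abbrev Cluster : Type := Finset (Fin Q.M)

/-- The syndrome caused by a Pauli operator. -/
def syn (P : Pauli Q.n) : Q.Cluster := Finset.univ.filter fun a => symp (Q.gen a) P ≠ 0

/-- The support of `P` lies in the set `A` of sites. -/
def SuppIn (P : Pauli Q.n) (A : Set (Site D L)) : Prop := ∀ j, P j ≠ 0 → Q.site j ∈ A

/-- The elementary cube of the generator `a` is contained in the set `A` of sites. -/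
def CubeIn (a : Fin Q.M) (A : Set (Site D L)) : Prop := box (Q.cube a) 1 ⊆ A

/-- The cube of linear size `R` at `c` is a smallest cube that encloses the cluster `S`. -/
def IsMinCube (S : Q.Cluster) (c : Site D L) (R : ℕ) : Prop :=
  (∀ a ∈ S, Q.CubeIn a (box c R)) ∧ ∀ c' R', (∀ a ∈ S, Q.CubeIn a (box c' R')) → R ≤ R'

/-- The cluster `S` can be created from the vacuum, without any other defect, by a Pauli operator
whose support is enclosed by a cube of linear size `ℓ`. -/
def Neutral (ℓ : ℕ) (S : Q.Cluster) : Prop :=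
  ∃ P, Q.syn P = S ∧ ∃ c, Q.SuppIn P (box c ℓ)

/-- First topological order condition at the length scale `ℓ`. -/
def TQO1 (ℓ : ℕ) : Prop :=
  ∀ P, Q.syn P = ∅ → (∃ c, Q.SuppIn P (box c ℓ)) → P ∈ Q.stab

/-- Second topological order condition at the length scale `ℓ`. -/
def TQO2 (ℓ : ℕ) : Prop :=
  ∀ S, Q.Neutral ℓ S →
    ∃ c R, Q.IsMinCube S c R ∧ ∃ P, Q.syn P = S ∧ Q.SuppIn P (nbhd 1 (box c R))

open Classical in
/-- The defects of `S` whose elementary cubes are contained in `A`. -/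
def restrict (S : Q.Cluster) (A : Set (Site D L)) : Q.Cluster :=
  S.filter fun a => Q.CubeIn a A

/-- `P` is a string segment of width `w` with anchor boxes at `c₁` and `c₂`: its support is enclosed
by a cube of linear size `ℓ`, and all the defects that it creates are contained in the union of the
two boxes of linear size `w`. -/
def IsStringSegment (ℓ : ℕ) (P : Pauli Q.n) (c₁ c₂ : Site D L) (w : ℕ) : Prop :=
  (∃ c, Q.SuppIn P (box c ℓ)) ∧
    ∀ a ∈ Q.syn P, Q.CubeIn a (box c₁ w) ∨ Q.CubeIn a (box c₂ w)

/-- The no-strings rule with constant `α`: if one of the anchor boxes of a string segment of width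
`w` contains a nontrivial charge, then the distance between the boxes is at most `α w`. -/
def NoStrings (α : ℝ) (ℓ : ℕ) : Prop :=
  ∀ P c₁ c₂ w, Q.IsStringSegment ℓ P c₁ c₂ w →
    (¬ Q.Neutral ℓ (Q.restrict (Q.syn P) (box c₁ w)) ∨
      ¬ Q.Neutral ℓ (Q.restrict (Q.syn P) (box c₂ w))) →
    ∃ u ∈ box c₁ w, ∃ v ∈ box c₂ w, (dist u v : ℝ) ≤ α * w

/-- At most `q` qubits per site and at most `r` generators per elementary cube; topological order
at a length scale `ℓ` with `L ^ γ ≤ ℓ ≤ L / 2`; the no-strings rule with constant `α`. -/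
structure Admissible (q r : ℕ) (α γ : ℝ) (ℓ : ℕ) : Prop where
  site_le : ∀ u, (Finset.univ.filter fun j => Q.site j = u).card ≤ q
  cube_le : ∀ c, (Finset.univ.filter fun a => Q.cube a = c).card ≤ r
  scale_ge : (L : ℝ) ^ γ ≤ ℓ
  scale_le : 2 * ℓ ≤ L
  tqo1 : Q.TQO1 ℓ
  tqo2 : Q.TQO2 ℓ
  no_strings : Q.NoStrings α ℓ

/-! ## The renormalization group decoder -/

/-- Specification of the subroutine TestNeutral. If some smallest cube `B` enclosing `S` has linear
size at most `ℓ` and some Pauli operator supported on the `1`-neighbourhood of `B` has syndrome `S`,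
such an operator is returned; otherwise the identity is returned. -/
def IsTestNeutral (ℓ : ℕ) (T : Q.Cluster → Pauli Q.n) : Prop :=
  ∀ S,
    let good : Pauli Q.n → Prop := fun P =>
      ∃ c R, Q.IsMinCube S c R ∧ R ≤ ℓ ∧ Q.syn P = S ∧ Q.SuppIn P (nbhd 1 (box c R))
    ((∃ P, good P) → good (T S)) ∧ ((¬ ∃ P, good P) → T S = 0)

/-- The defects `a` and `b` of `S` belong to the same `s`-connected component of `S`. -/
def Connected (s : ℕ) (S : Q.Cluster) : Fin Q.M → Fin Q.M → Prop :=
  Relation.ReflTransGen fun a b => a ∈ S ∧ b ∈ S ∧ dist (Q.cube a) (Q.cube b) ≤ s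

open Classical in
/-- The set of the `s`-connected components of `S`. -/
def components (s : ℕ) (S : Q.Cluster) : Finset Q.Cluster :=
  S.image fun a => S.filter fun b => Q.Connected s S a b

/-- The level-`p` error correction EC(`p`). -/
def EC (T : Q.Cluster → Pauli Q.n) (p : ℕ) (S : Q.Cluster) : Pauli Q.n :=
  ∑ C ∈ Q.components (2 ^ p) S, T C

/-- The remaining syndrome and the accumulated correction after the levels below `p`. -/
def rgRun (T : Q.Cluster → Pauli Q.n) (S : Q.Cluster) : ℕ → Q.Cluster × Pauli Q.n
  | 0 => (S, 0)
  | p + 1 =>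
    let s := rgRun T S p
    (symmDiff s.1 (Q.syn (Q.EC T p s.1)), s.2 + Q.EC T p s.1)

/-- `dec` is an RG decoder: it runs the levels `p` with `2 ^ p < ℓ` (these are `Nat.clog 2 ℓ` levels)
and returns the accumulated correction if no defect is left. Otherwise it returns any operator
consistent with the measured syndrome. -/
def IsRGDecoder (ℓ : ℕ) (dec : Q.Cluster → Pauli Q.n) : Prop :=
  ∃ T, Q.IsTestNeutral ℓ T ∧
    (∀ S, (Q.rgRun T S (Nat.clog 2 ℓ)).1 = ∅ → dec S = (Q.rgRun T S (Nat.clog 2 ℓ)).2) ∧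
    ∀ P, Q.syn (dec (Q.syn P)) = Q.syn P

/-- The projector `Π_S` onto the subspace with syndrome `S`: the product of the commuting projectors
`(1 ± G_a) / 2`, with the minus sign exactly for `a ∈ S`. -/
def proj (S : Q.Cluster) : Op Q.n :=
  (List.ofFn fun a => (1 / 2 : ℂ) • (1 + (if a ∈ S then (-1 : ℂ) else 1) • Q.G a)).prod

/-- The action of a decoder on states: measure the syndrome, then apply the correcting operator. -/
def decoderMap (dec : Q.Cluster → Pauli Q.n) (ρ : Op Q.n) : Op Q.n :=
  ∑ S, pauliOp (dec S) * Q.proj S * ρ * Q.proj S * (pauliOp (dec S))ᴴ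

/-! ## Thermal dynamics -/

/-- The eigenvalue of `H = - J ∑ G_a` on the subspace with syndrome `S`. -/
def energy (J : ℝ) (S : Q.Cluster) : ℝ := J * (2 * S.card - Q.M)

/-- The differences of energy levels. -/
def bohr (J : ℝ) : Finset ℝ :=
  Finset.univ.image fun p : Q.Cluster × Q.Cluster => Q.energy J p.1 - Q.energy J p.2

/-- The spectral component `A_ω` in `exp (i H t) A exp (- i H t) = ∑_ω exp (- i ω t) A_ω`; it maps
eigenvectors of `H` with energy `E` to eigenvectors with energy `E - ω`. -/
def jump (J : ℝ) (A : Op Q.n) (ω : ℝ) : Op Q.n :=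
  ∑ p : Q.Cluster × Q.Cluster,
    if Q.energy J p.1 - Q.energy J p.2 = ω then Q.proj p.2 * A * Q.proj p.1 else 0

/-- Data of a heat bath: coupling operators and jump rates `h α ω`. -/
structure Bath (n : ℕ) where
  m : ℕ
  A : Fin m → Op n
  h : Fin m → ℝ → ℝ

/-- The bath at inverse temperature `β`: at most `κ L ^ D` self-adjoint coupling operators of norm at
most `1`, each acting on at most `w` qubits, with nonnegative rates bounded by `hmax` that obey
detailed balance. -/
structure IsDaviesBath (w : ℕ) (κ hmax β : ℝ) (B : Bath Q.n) : Prop where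
  card_le : (B.m : ℝ) ≤ κ * (L : ℝ) ^ D
  selfAdjoint : ∀ α, (B.A α).IsHermitian
  norm_le : ∀ α, ‖Matrix.toEuclideanCLM (𝕜 := ℂ) (B.A α)‖ ≤ 1
  local_op : ∀ α, ∃ s : Finset (Fin Q.n), s.card ≤ w ∧ ActsOn (B.A α) s
  rate_nonneg : ∀ α ω, 0 ≤ B.h α ω
  rate_le : ∀ α ω, B.h α ω ≤ hmax
  detailed_balance : ∀ α ω, B.h α (-ω) = Real.exp (-β * ω) * B.h α ω

/-- The Lindblad generator. -/
def lindblad (J : ℝ) (B : Bath Q.n) (ρ : Op Q.n) : Op Q.n :=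
  ∑ α, ∑ ω ∈ Q.bohr J,
    (B.h α ω : ℂ) • (Q.jump J (B.A α) ω * ρ * (Q.jump J (B.A α) ω)ᴴ -
      (1 / 2 : ℂ) • (ρ * ((Q.jump J (B.A α) ω)ᴴ * Q.jump J (B.A α) ω) +
        (Q.jump J (B.A α) ω)ᴴ * Q.jump J (B.A α) ω * ρ))

/-- `ρ` is a solution for `t ≥ 0` of the master equation `ρ' = - i [H, ρ] + 𝓛 ρ` (stated entrywise)
whose initial value is a density matrix supported on the ground space. -/
structure IsEvolution (J : ℝ) (B : Bath Q.n) (ρ : ℝ → Op Q.n) : Prop where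
  posSemidef : (ρ 0).PosSemidef
  trace_one : (ρ 0).trace = 1
  ground : ∀ a, Q.G a * ρ 0 = ρ 0
  master : ∀ t, 0 ≤ t → ∀ x y,
    HasDerivWithinAt (fun s => ρ s x y)
      ((-(Complex.I • (Q.H J * ρ t - ρ t * Q.H J)) + Q.lindblad J B (ρ t)) x y) (Set.Ici 0) t

end Code

/-- The trace norm: the sum of the singular values. -/
def traceNorm {n : ℕ} (X : Op n) : ℝ :=
  ∑ i, √((Matrix.isHermitian_conjTranspose_mul_self X).eigenvalues i)

/-- The storage error `ε(t)` of a decoder. -/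
def Code.storageError (Q : Code D L) (dec : Q.Cluster → Pauli Q.n) (ρ : ℝ → Op Q.n) (t : ℝ) : ℝ :=
  traceNorm (ρ 0 - Q.decoderMap dec (ρ t))

/-- The memory time: the infimum of the times `t ≥ 0` at which the error `err t` reaches the
tolerance `ε` (infinite if there is no such time). -/
def memoryTime (err : ℝ → ℝ) (ε : ℝ) : ENNReal :=
  sInf (ENNReal.ofReal '' {t | 0 ≤ t ∧ ε ≤ err t})

/-! ## Running time

Programs for a random access machine whose registers and memory cells hold natural numbers, with
indirect addressing and unit cost. The only arithmetic operations are addition and truncated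
subtraction, so that a polynomial number of steps amounts to polynomial time on a Turing machine. -/

/-- Structured programs; `x`, `y`, `z` are names of registers. -/
inductive Program : Type
  | const (x c : ℕ)
  | add (x y z : ℕ)
  | sub (x y z : ℕ)
  | load (x y : ℕ)
  | store (x y : ℕ)
  | seq (p₁ p₂ : Program)
  | cond (x : ℕ) (p₁ p₂ : Program)
  | loop (x : ℕ) (p : Program)

/-- A machine state: the contents of the registers and of the memory. -/
structure State : Type where
  reg : ℕ → ℕ
  mem : ℕ → ℕ

/-- `Runs p σ k τ`: started in the state `σ`, the program `p` halts after `k` steps in the state `τ`.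
Every basic instruction and every test of a register costs one step. -/
inductive Runs : Program → State → ℕ → State → Prop
  | const (x c : ℕ) (σ : State) :
      Runs (.const x c) σ 1 ⟨Function.update σ.reg x c, σ.mem⟩
  | add (x y z : ℕ) (σ : State) :
      Runs (.add x y z) σ 1 ⟨Function.update σ.reg x (σ.reg y + σ.reg z), σ.mem⟩
  | sub (x y z : ℕ) (σ : State) :
      Runs (.sub x y z) σ 1 ⟨Function.update σ.reg x (σ.reg y - σ.reg z), σ.mem⟩
  | load (x y : ℕ) (σ : State) :
      Runs (.load x y) σ 1 ⟨Function.update σ.reg x (σ.mem (σ.reg y)), σ.mem⟩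
  | store (x y : ℕ) (σ : State) :
      Runs (.store x y) σ 1 ⟨σ.reg, Function.update σ.mem (σ.reg x) (σ.reg y)⟩
  | seq {p₁ p₂ : Program} {σ τ υ : State} {k₁ k₂ : ℕ} :
      Runs p₁ σ k₁ τ → Runs p₂ τ k₂ υ → Runs (.seq p₁ p₂) σ (k₁ + k₂) υ
  | cond_true {x : ℕ} {p₁ p₂ : Program} {σ τ : State} {k : ℕ} :
      σ.reg x ≠ 0 → Runs p₁ σ k τ → Runs (.cond x p₁ p₂) σ (k + 1) τ
  | cond_false {x : ℕ} {p₁ p₂ : Program} {σ τ : State} {k : ℕ} :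
      σ.reg x = 0 → Runs p₂ σ k τ → Runs (.cond x p₁ p₂) σ (k + 1) τ
  | loop_done {x : ℕ} {p : Program} {σ : State} :
      σ.reg x = 0 → Runs (.loop x p) σ 1 σ
  | loop_step {x : ℕ} {p : Program} {σ τ υ : State} {k₁ k₂ : ℕ} :
      σ.reg x ≠ 0 → Runs p σ k₁ τ → Runs (.loop x p) τ k₂ υ →
        Runs (.loop x p) σ (k₁ + k₂ + 1) υ

/-- The input of a decoding algorithm as a list of numbers: a header, the locations of the qubits and
of the generators, the binary description of the generators, and the measured syndrome. -/
def Code.input (Q : Code D L) (ℓ : ℕ) (S : Q.Cluster) : List ℕ :=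
  [D, L, ℓ, Q.n, Q.M] ++
    ((List.finRange Q.n).flatMap fun j => (List.finRange D).map fun i => (Q.site j i).val) ++
    ((List.finRange Q.M).flatMap fun a => (List.finRange D).map fun i => (Q.cube a i).val) ++
    ((List.finRange Q.M).flatMap fun a => (List.finRange Q.n).flatMap fun j =>
      [(Q.gen a j).1.val, (Q.gen a j).2.val]) ++
    ((List.finRange Q.M).map fun a => if a ∈ S then 1 else 0)

/-- The program computes the decoder within `T` steps on every syndrome. Initially the registers are
zero and the memory holds the input followed by zeros; in the end the first `2 n` memory cells
hold the correcting Pauli operator. -/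
def Code.ComputesWithin (Q : Code D L) (ℓ : ℕ) (prog : Program) (dec : Q.Cluster → Pauli Q.n)
    (T : ℕ) : Prop :=
  ∀ S : Q.Cluster, ∃ k τ,
    Runs prog ⟨fun _ => 0, fun i => (Q.input ℓ S).getD i 0⟩ k τ ∧ k ≤ T ∧
      ∀ j : Fin Q.n, τ.mem (2 * j) = (dec S j).1.val ∧ τ.mem (2 * j + 1) = (dec S j).2.val

end MemoryTime

end

/-! ### Lattice geometry, syndromes and sparse configurations of defects -/

noncomputable section

namespace MemoryTime

variable {D L : ℕ}

/-! ## Geometry of the torus -/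

/-! An error built up while at most `m` defects are present is undone by the decoder, for some `m`
of order `log L`. To exceed `m` defects the bath must supply an energy of order `J log L`, and
detailed balance suppresses this by a power `L ^ (-c β)`. The proof has a combinatorial, an analytic
and an algorithmic half.

Combinatorics. A syndrome with at most `m` defects is sparse at one of any `m + 1` consecutive
levels (`exists_gap`): no distance lies between `scale a p` and `scaleTop a p`, so the defects form
small, well separated clusters. A neutral cluster can be erased locally by `TQO2`; a charged one
cannot move far by the no-strings rule (`charged_near`); a piece of an operator that creates nothing
is a stabilizer by `TQO1` (`trim`). A path of errors is grouped hierarchically: a block of level `p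
+ 1` is a string of blocks of level `p` joined at syndromes that are sparse at level `p`
(`Run.comp`). By induction on `p`, a block of level `p` is supported, modulo stabilizers, within
`scale a p` of the defects at its ends (`Run.near`). In the induction step neutral clusters are
erased at each junction and the charged ones stay in place, so the radius does not grow with the
number of blocks (`Chained.snoc`). The final syndrome is sparse at a level between `m + 1` and `2 m
+ 1`. When the scale `2 ^ j` of the decoder enters this gap, all remaining clusters are neutral and
are annihilated (`syn_EC_eq`), and the error times the correction is a stabilizer
(`IsRGDecoder.corrects`). This needs the scale of level about `2 m` to be at most `L ^ γ`, whence
`m` is of order `log L`.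

Analysis. Let `N` count the defects. By detailed balance the generator is dissipative for the
Hilbert-Schmidt norm of `exp (J β N) ρ` (`dissipative`). This norm is at most `1` initially, as `N =
0` on the ground space. Hence an observable living on at least `m'` defects has expectation at most
its norm times the square root of `2 ^ k * exp (-J β m') * (1 + exp (-J β)) ^ M`
(`norm_trace_mul_le_of_high`). The last factor is bounded if `L ^ D ≤ exp (J β)`, which is the
condition `L ≤ exp (c' β)`. Now take a contraction `U` that attains the trace norm and pull it back
through the decoder to an observable `obs` on the reachable syndromes. Since reachable errors are
corrected, it commutes with the couplings except close to the barrier of `m` defects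
(`drift_mul_proj`), so its expectation hardly changes. The case `U = 1` bounds the weight of the
unreachable syndromes, and positivity of `ρ t` controls the rest (`storageError_le`).

Algorithm. The decoder is a command of a small language whose compiled programs run in polynomial
time (`Cmd.ex_compile`). The neutrality test tries all smallest enclosing cubes and solves linear
systems over the field of two elements (`mem_rowSpan_elim`). The lexicographically greatest solution
is taken, so that the choice is a function which the abstract decoder `rgDecoder` shares with the
program (`exec_decoder`). -/

theorem dist_le_iff {u v : Site D L} {s : ℕ} :
    dist u v ≤ s ↔ ∀ i, (u i - v i).valMinAbs.natAbs ≤ s := by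
  simp [dist, Finset.sup_le_iff]

theorem dist_self (u : Site D L) : dist u u = 0 := by
  have : dist u u ≤ 0 := dist_le_iff.2 fun i => by simp
  omega

theorem dist_comm (u v : Site D L) : dist u v = dist v u := by
  unfold dist
  congr 1
  funext i
  rw [← neg_sub, ZMod.natAbs_valMinAbs_neg]

theorem dist_triangle (u v w : Site D L) : dist u w ≤ dist u v + dist v w := by
  refine dist_le_iff.2 fun i => ?_
  have h1 := dist_le_iff.1 (le_refl (dist u v)) i
  have h2 := dist_le_iff.1 (le_refl (dist v w)) i
  have h3 := ZMod.natAbs_valMinAbs_add_le (u i - v i) (v i - w i)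
  rw [sub_add_sub_cancel] at h3
  omega

theorem box_mono (c : Site D L) {R R' : ℕ} (h : R ≤ R') : box c R ⊆ box c R' :=
  fun _ hu i => (hu i).trans h

theorem self_mem_box (c : Site D L) (R : ℕ) : c ∈ box c R := fun i => by simp

theorem natAbs_valMinAbs_natCast_le [NeZero L] (k : ℕ) : ((k : ZMod L)).valMinAbs.natAbs ≤ k := by
  rw [ZMod.valMinAbs_natAbs_eq_min, ZMod.val_natCast]
  exact (min_le_left _ _).trans (Nat.mod_le _ _)

theorem dist_le_of_mem_box [NeZero L] {c u v : Site D L} {R : ℕ} (hu : u ∈ box c R) (hv : v ∈ box c R) :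
    dist u v ≤ R := by
  refine dist_le_iff.2 fun i => ?_
  have h1 := hu i
  have h2 := hv i
  have e : u i - v i = ((u i - c i).val : ZMod L) - ((v i - c i).val : ZMod L) := by
    simp
  rcases le_total (u i - c i).val (v i - c i).val with h | h
  · rw [e, ← neg_sub, ZMod.natAbs_valMinAbs_neg, ← Nat.cast_sub h]
    exact (natAbs_valMinAbs_natCast_le _).trans (by omega)
  · rw [e, ← Nat.cast_sub h]
    exact (natAbs_valMinAbs_natCast_le _).trans (by omega)

/-- The shift by `s` turns signed differences between `-s` and `s` into numbers between `0` and `2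
s`. This survives wrapping around the torus, because reduction modulo `L` only decreases a natural
number. -/
theorem val_add_le_of_dist [NeZero L] {u v : Site D L} {s : ℕ} (h : dist u v ≤ s) (i : Fin D) :
    (u i - (v i - (s : ZMod L))).val ≤ 2 * s := by
  have h1 := dist_le_iff.1 h i
  have e : u i - (v i - (s : ZMod L)) = (((u i - v i).valMinAbs + s).toNat : ZMod L) := by
    rw [← Int.cast_natCast (R := ZMod L) (Int.toNat _), Int.toNat_of_nonneg (by omega)]
    simp
    ring
  rw [e, ZMod.val_natCast]
  refine (Nat.mod_le _ _).trans ?_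
  omega

/-- The lower corner of the cube of linear size `2 s` centred at `v`. -/
def corner (v : Site D L) (s : ℕ) : Site D L := fun i => v i - (s : ZMod L)

theorem mem_box_corner [NeZero L] {u v : Site D L} {s : ℕ} (h : dist u v ≤ s) : u ∈ box (corner v s) (2 * s) :=
  fun i => val_add_le_of_dist h i

theorem box_one_subset [NeZero L] {u v : Site D L} {s : ℕ} (h : dist u v ≤ s) :
    box u 1 ⊆ box (corner v s) (2 * s + 1) := by
  intro x hx i
  have h1 := val_add_le_of_dist h i
  have h2 := hx i
  have e : x i - corner v s i = (u i - (v i - (s : ZMod L))) + (x i - u i) := by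
    simp [corner]
  rw [e]
  exact (ZMod.val_add_le _ _).trans (by omega)

namespace Code

variable (Q : Code D L)

theorem dist_site_cube [NeZero L] {a : Fin Q.M} {j : Fin Q.n} (h : Q.gen a j ≠ 0) :
    dist (Q.site j) (Q.cube a) ≤ 1 :=
  dist_le_of_mem_box (Q.gen_local a j h) (self_mem_box _ _)

theorem CubeIn.mem {Q : Code D L} {a : Fin Q.M} {A : Set (Site D L)} (h : Q.CubeIn a A) :
    Q.cube a ∈ A := h (self_mem_box _ _)

end Code

/-! ## Syndromes -/

section Symp

variable {n : ℕ}

theorem symp_add (P A B : Pauli n) : symp P (A + B) = symp P A + symp P B := by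
  simp only [symp, ← Finset.sum_add_distrib]
  refine Finset.sum_congr rfl fun j _ => ?_
  simp only [Pi.add_apply, Prod.fst_add, Prod.snd_add]
  ring

theorem symp_comm (P A : Pauli n) : symp P A = symp A P := by
  simp only [symp]
  exact Finset.sum_congr rfl fun j _ => by ring

theorem symp_smul (P A : Pauli n) (c : ZMod 2) : symp P (c • A) = c * symp P A := by
  simp only [symp, Finset.mul_sum]
  refine Finset.sum_congr rfl fun j _ => ?_
  simp only [Pi.smul_apply, Prod.smul_fst, Prod.smul_snd, smul_eq_mul]
  ring

theorem symp_zero (P : Pauli n) : symp P 0 = 0 := by simp [symp]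

theorem symp_congr {P A B : Pauli n} (h : ∀ j, P j ≠ 0 → A j = B j) : symp P A = symp P B := by
  refine Finset.sum_congr rfl fun j _ => ?_
  by_cases hj : P j = 0
  · simp [hj]
  · rw [h j hj]

theorem symp_sum {ι : Type*} (s : Finset ι) (P : Pauli n) (f : ι → Pauli n) :
    symp P (∑ i ∈ s, f i) = ∑ i ∈ s, symp P (f i) := by
  classical
  induction s using Finset.induction_on with
  | empty => simp [symp_zero]
  | insert a s ha ih => rw [Finset.sum_insert ha, Finset.sum_insert ha, symp_add, ih]

theorem pauli_add_self (A : Pauli n) : A + A = 0 := by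
  funext j
  exact Prod.ext (CharTwo.add_self_eq_zero _) (CharTwo.add_self_eq_zero _)

theorem zmod_two_ne_zero_iff {x : ZMod 2} : x ≠ 0 ↔ x = 1 := by
  revert x; decide

end Symp

namespace Code

variable (Q : Code D L)

theorem mem_syn {P : Pauli Q.n} {a : Fin Q.M} : a ∈ Q.syn P ↔ symp (Q.gen a) P ≠ 0 := by
  simp [syn]

theorem syn_zero : Q.syn 0 = ∅ := by
  ext a; simp [mem_syn, symp_zero]

theorem syn_add (A B : Pauli Q.n) : Q.syn (A + B) = symmDiff (Q.syn A) (Q.syn B) := by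
  ext a
  rw [mem_syn, symp_add, Finset.mem_symmDiff, mem_syn, mem_syn]
  generalize symp (Q.gen a) A = x
  generalize symp (Q.gen a) B = y
  revert x y
  decide

theorem syn_of_mem_stab {P : Pauli Q.n} (h : P ∈ Q.stab) : Q.syn P = ∅ := by
  ext a
  simp only [mem_syn, Finset.notMem_empty, iff_false, not_not]
  induction h using Submodule.span_induction with
  | mem x hx => obtain ⟨b, rfl⟩ := hx; exact Q.gen_comm a b
  | zero => exact symp_zero _
  | add x y _ _ hx hy => rw [symp_add, hx, hy, add_zero]
  | smul c x _ hx => rw [symp_smul, hx, mul_zero]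

/-- Equality of Pauli operators up to stabilizers. -/
def Equi (A B : Pauli Q.n) : Prop := A + B ∈ Q.stab

variable {Q}

theorem Equi.refl (A : Pauli Q.n) : Q.Equi A A := by
  unfold Equi; rw [pauli_add_self]; exact Q.stab.zero_mem

theorem Equi.trans {A B C : Pauli Q.n} (h : Q.Equi A B) (h' : Q.Equi B C) : Q.Equi A C := by
  have := Q.stab.add_mem h h'
  unfold Equi
  rwa [show A + B + (B + C) = A + C + (B + B) by abel, pauli_add_self, add_zero] at this

theorem Equi.add {A B A' B' : Pauli Q.n} (h : Q.Equi A A') (h' : Q.Equi B B') :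
    Q.Equi (A + B) (A' + B') := by
  have := Q.stab.add_mem h h'
  unfold Equi
  rwa [show A + A' + (B + B') = A + B + (A' + B') by abel] at this

theorem Equi.syn_eq {A B : Pauli Q.n} (h : Q.Equi A B) : Q.syn A = Q.syn B := by
  have := Q.syn_of_mem_stab h
  rw [syn_add] at this
  exact symmDiff_eq_bot.1 this

variable (Q)

/-- `P` is supported in the `s`-neighbourhood of the defects `X`. -/
def Near (s : ℕ) (P : Pauli Q.n) (X : Q.Cluster) : Prop :=
  ∀ j, P j ≠ 0 → ∃ a ∈ X, dist (Q.site j) (Q.cube a) ≤ s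

open Classical in
/-- The part of `P` on the qubits in `A`. -/
def cut (P : Pauli Q.n) (A : Fin Q.n → Prop) : Pauli Q.n := fun j => if A j then P j else 0

variable {Q}

theorem Near.mono {s s' : ℕ} {P : Pauli Q.n} {X X' : Q.Cluster} (h : Q.Near s P X) (hs : s ≤ s')
    (hX : X ⊆ X') : Q.Near s' P X' := fun j hj => by
  obtain ⟨a, ha, h⟩ := h j hj
  exact ⟨a, hX ha, h.trans hs⟩

theorem Near.add {s : ℕ} {P P' : Pauli Q.n} {X : Q.Cluster} (h : Q.Near s P X)
    (h' : Q.Near s P' X) : Q.Near s (P + P') X := fun j hj => by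
  by_cases h0 : P j = 0
  · exact h' j fun h1 => hj (by simp [h0, h1])
  · exact h j h0

theorem Near.zero (s : ℕ) (X : Q.Cluster) : Q.Near s 0 X := fun _ hj => absurd rfl hj

theorem Near.thicken {s t : ℕ} {P : Pauli Q.n} {X Y : Q.Cluster} (h : Q.Near s P X)
    (hX : ∀ a ∈ X, ∃ b ∈ Y, dist (Q.cube a) (Q.cube b) ≤ t) : Q.Near (s + t) P Y := fun j hj => by
  obtain ⟨a, ha, h⟩ := h j hj
  obtain ⟨b, hb, h'⟩ := hX a ha
  exact ⟨b, hb, (dist_triangle _ (Q.cube a) _).trans (by omega)⟩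

theorem exists_touch {P : Pauli Q.n} {b : Fin Q.M} (h : b ∈ Q.syn P) :
    ∃ j, Q.gen b j ≠ 0 ∧ P j ≠ 0 := by
  by_contra! h'
  refine Q.mem_syn.1 h ?_
  rw [symp_congr (B := 0) fun j hj => h' j hj, symp_zero]

theorem Near.syn [NeZero L] {s : ℕ} {P : Pauli Q.n} {X : Q.Cluster} (h : Q.Near s P X) {b : Fin Q.M}
    (hb : b ∈ Q.syn P) : ∃ a ∈ X, dist (Q.cube b) (Q.cube a) ≤ s + 1 := by
  obtain ⟨j, hj, hj'⟩ := exists_touch hb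
  obtain ⟨a, ha, h⟩ := h j hj'
  refine ⟨a, ha, ?_⟩
  have := Q.dist_site_cube hj
  have := dist_triangle (Q.cube b) (Q.site j) (Q.cube a)
  rw [dist_comm (Q.cube b) (Q.site j)] at this
  omega

-- Cutting may create defects along the cut; the hypothesis excludes this. A generator within `s +
-- 1` of `K` meets the same part of `P` before and after cutting, and a generator farther away meets
-- nothing of the cut operator.
open Classical in
theorem syn_cut [NeZero L] {s : ℕ} {P : Pauli Q.n} {K : Q.Cluster}
    (h : ∀ j b, P j ≠ 0 → Q.gen b j ≠ 0 → (∃ a ∈ K, dist (Q.cube b) (Q.cube a) ≤ s + 1) →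
      ∃ a ∈ K, dist (Q.site j) (Q.cube a) ≤ s) :
    Q.syn (Q.cut P fun j => ∃ a ∈ K, dist (Q.site j) (Q.cube a) ≤ s) =
      (Q.syn P).filter fun b => ∃ a ∈ K, dist (Q.cube b) (Q.cube a) ≤ s + 1 := by
  ext b
  rw [Finset.mem_filter]
  by_cases hb : ∃ a ∈ K, dist (Q.cube b) (Q.cube a) ≤ s + 1
  · simp only [hb, and_true, mem_syn]
    rw [symp_congr fun j hj => ?_]
    unfold cut
    split_ifs with hA
    · rfl
    · by_contra hP
      exact hA (h j b (fun h0 => hP h0.symm) hj hb)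
  · simp only [hb, and_false, iff_false]
    intro hb'
    refine hb (Near.syn (s := s) (X := K) (fun j hj => ?_) hb')
    by_contra hA
    exact hj (if_neg hA)

/-- The enclosing cube makes `TQO1`, the no-strings rule and the definition of neutrality applicable
to a cut operator. -/
theorem cut_suppIn [NeZero L] {s ξ ℓ : ℕ} {P : Pauli Q.n} {K : Q.Cluster} {a : Fin Q.M}
    (hK : ∀ b ∈ K, dist (Q.cube a) (Q.cube b) ≤ ξ) (hℓ : 2 * (s + ξ) ≤ ℓ) :
    ∃ c, Q.SuppIn (Q.cut P fun j => ∃ a ∈ K, dist (Q.site j) (Q.cube a) ≤ s) (box c ℓ) := by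
  refine ⟨corner (Q.cube a) (s + ξ), fun j hj => box_mono _ hℓ (mem_box_corner ?_)⟩
  have : ∃ a ∈ K, dist (Q.site j) (Q.cube a) ≤ s := by
    by_contra hA
    exact hj (if_neg hA)
  obtain ⟨b, hb, h⟩ := this
  have h1 := hK b hb
  have h2 := dist_triangle (Q.site j) (Q.cube b) (Q.cube a)
  rw [dist_comm (Q.cube b) (Q.cube a)] at h2
  omega

/-! ## Sparse syndromes -/

variable (Q)

/-- No distance between two defects of `X` lies between `ξ` and `η`. -/
def Gap (ξ η : ℕ) (X : Q.Cluster) : Prop :=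
  ∀ a ∈ X, ∀ b ∈ X, dist (Q.cube a) (Q.cube b) ≤ η → dist (Q.cube a) (Q.cube b) ≤ ξ

/-- The defects of `X` at a distance at most `ξ` from `a`. -/
def clus (ξ : ℕ) (X : Q.Cluster) (a : Fin Q.M) : Q.Cluster :=
  X.filter fun b => dist (Q.cube a) (Q.cube b) ≤ ξ

open Classical in
/-- The union of the non-neutral clusters of `X`. -/
def charged (ℓ ξ : ℕ) (X : Q.Cluster) : Q.Cluster :=
  X.filter fun a => ¬ Q.Neutral ℓ (Q.clus ξ X a)

variable {Q}

theorem mem_clus {ξ : ℕ} {X : Q.Cluster} {a b : Fin Q.M} :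
    b ∈ Q.clus ξ X a ↔ b ∈ X ∧ dist (Q.cube a) (Q.cube b) ≤ ξ := by simp [clus]

theorem mem_charged {ℓ ξ : ℕ} {X : Q.Cluster} {a : Fin Q.M} :
    a ∈ Q.charged ℓ ξ X ↔ a ∈ X ∧ ¬ Q.Neutral ℓ (Q.clus ξ X a) := by simp [charged]

theorem charged_subset {ℓ ξ : ℕ} {X : Q.Cluster} : Q.charged ℓ ξ X ⊆ X := by
  simp [charged]

/-- Within a sparse set, being at distance at most `ξ` is transitive, since `2 ξ` falls into the
gap. Clusters are therefore equivalence classes. -/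
theorem Gap.clus_eq {ξ η : ℕ} {X : Q.Cluster} (h : Q.Gap ξ η X) (hη : 2 * ξ ≤ η) {a b : Fin Q.M}
    (ha : a ∈ X) (hb : b ∈ X) (hab : dist (Q.cube a) (Q.cube b) ≤ ξ) :
    Q.clus ξ X a = Q.clus ξ X b := by
  ext c
  simp only [mem_clus]
  refine and_congr_right fun hc => ⟨fun h' => h b hb c hc ?_, fun h' => h a ha c hc ?_⟩
  · have := dist_triangle (Q.cube b) (Q.cube a) (Q.cube c)
    rw [dist_comm (Q.cube b) (Q.cube a)] at this
    omega
  · have := dist_triangle (Q.cube a) (Q.cube b) (Q.cube c)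
    omega

theorem Gap.mem_charged_iff {ξ η ℓ : ℕ} {X : Q.Cluster} (h : Q.Gap ξ η X) (hη : 2 * ξ ≤ η)
    {a b : Fin Q.M} (ha : a ∈ X) (hb : b ∈ X) (hab : dist (Q.cube a) (Q.cube b) ≤ ξ) :
    a ∈ Q.charged ℓ ξ X ↔ b ∈ Q.charged ℓ ξ X := by
  simp [mem_charged, ha, hb, h.clus_eq hη ha hb hab]

/-- The map `f` labels the classes of a partition. A pair violating the gap at level `p` lies in two
different classes, as its distance exceeds their diameter bound `lev p`. Merging the two costs one
class and gives a diameter of at most `2 lev p + gapTop p`. -/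
theorem exists_gap_aux {lev gapTop : ℕ → ℕ} (hstep : ∀ p, 2 * lev p + gapTop p ≤ lev (p + 1))
    (X : Q.Cluster) (p₀ j : ℕ) (h : ∀ p, p₀ ≤ p → p < p₀ + j → ¬ Q.Gap (lev p) (gapTop p) X) :
    ∃ f : Fin Q.M → Fin Q.M, (X.image f).card + j ≤ X.card ∧
      ∀ a ∈ X, ∀ b ∈ X, f a = f b → dist (Q.cube a) (Q.cube b) ≤ lev (p₀ + j) := by
  induction j with
  | zero =>
    refine ⟨id, by simp, fun a _ b _ hab => ?_⟩
    rw [id, id] at hab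
    rw [hab, dist_self]; exact Nat.zero_le _
  | succ j ih =>
    obtain ⟨f, hf, hd⟩ := ih fun p h1 h2 => h p h1 (by omega)
    have := h (p₀ + j) (by omega) (by omega)
    simp only [Gap, not_forall] at this
    obtain ⟨a, ha, b, hb, hab, hab'⟩ := this
    have hne : f a ≠ f b := fun e => hab' (hd a ha b hb e)
    have hs := hstep (p₀ + j)
    refine ⟨fun x => if f x = f b then f a else f x, ?_, ?_⟩
    · have hsub : X.image (fun x => if f x = f b then f a else f x) ⊆ (X.image f).erase (f b) := by
        intro y hy
        obtain ⟨x, hx, rfl⟩ := Finset.mem_image.1 hy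
        split_ifs with hxb
        · exact Finset.mem_erase.2 ⟨hne, Finset.mem_image_of_mem _ ha⟩
        · exact Finset.mem_erase.2 ⟨hxb, Finset.mem_image_of_mem _ hx⟩
      have h1 := Finset.card_le_card hsub
      rw [Finset.card_erase_of_mem (Finset.mem_image_of_mem _ hb)] at h1
      have h2 : 0 < (X.image f).card := Finset.card_pos.2 ⟨_, Finset.mem_image_of_mem f hb⟩
      omega
    · have key : ∀ x ∈ X, ∀ y ∈ X, f x = f b → f y = f a →
          dist (Q.cube x) (Q.cube y) ≤ lev (p₀ + j + 1) := by
        intro x hx y hy h1 h2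
        have d1 := hd x hx b hb h1
        have d2 := hd y hy a ha h2
        have t1 := dist_triangle (Q.cube x) (Q.cube b) (Q.cube y)
        have t2 := dist_triangle (Q.cube b) (Q.cube a) (Q.cube y)
        rw [dist_comm (Q.cube b) (Q.cube a), dist_comm (Q.cube a) (Q.cube y)] at t2
        omega
      intro x hx y hy hxy
      dsimp only at hxy
      rw [← Nat.add_assoc]
      split_ifs at hxy with h1 h2 h2
      · exact (hd x hx y hy (h1.trans h2.symm)).trans (by omega)
      · exact key x hx y hy h1 hxy.symm
      · rw [dist_comm]; exact key y hy x hx h2 hxy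
      · exact (hd x hx y hy hxy).trans (by omega)

/-- A syndrome with `m` defects is sparse at one of `m + 1` consecutive levels. -/
theorem exists_gap {lev gapTop : ℕ → ℕ} (hstep : ∀ p, 2 * lev p + gapTop p ≤ lev (p + 1))
    (X : Q.Cluster) (p₀ : ℕ) : ∃ p, p₀ ≤ p ∧ p ≤ p₀ + X.card ∧ Q.Gap (lev p) (gapTop p) X := by
  by_contra! h
  -- Starting from `X.card` classes, one cannot merge `X.card + 1` times.
  obtain ⟨f, hf, -⟩ := exists_gap_aux hstep X p₀ (X.card + 1) fun p h1 h2 => h p h1 (by omega)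
  omega

/-! ## Removing trivial parts of an error -/

theorem clus_suppIn_helper {ξ : ℕ} {X : Q.Cluster} {a : Fin Q.M} :
    ∀ b ∈ Q.clus ξ X a, dist (Q.cube a) (Q.cube b) ≤ ξ := fun _ hb => (mem_clus.1 hb).2

/-- The part of `G` around a cluster of `Y` far from `Z` can be erased. The gap of `Y` isolates this
piece, so its defects are defects of `G` and hence charged defects of `W`. If there were one, the
piece would create precisely the cluster of `W` that contains it, which would then be neutral. So
the piece creates nothing and is a stabilizer by `TQO1`. Erasing it lowers the weight of `G`, on
which the induction runs. -/
theorem trim [NeZero L] {s ξ η ℓ : ℕ} (ht : Q.TQO1 ℓ) {Y W Z : Q.Cluster} (hY : Q.Gap ξ η Y)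
    (hW : Q.Gap ξ η W) (hη : 2 * s + 2 + 2 * ξ ≤ η) (hℓ : 2 * (s + ξ) ≤ ℓ) (G : Pauli Q.n)
    (hG : Q.Near s G (Z ∪ Y))
    (hs : ∀ a, (∀ z ∈ Z, s + 1 < dist (Q.cube a) (Q.cube z)) →
      (a ∈ Q.syn G ↔ a ∈ Q.charged ℓ ξ W)) :
    ∃ G', Q.Equi G G' ∧ Q.Near (3 * s + 2 * ξ + 2) G' Z := by
  classical
  induction hN : (Finset.univ.filter fun j => G j ≠ 0).card using Nat.strong_induction_on
    generalizing G with
  | _ N ih =>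
  by_cases hfin : Q.Near (3 * s + 2 * ξ + 2) G Z
  · exact ⟨G, Equi.refl G, hfin⟩
  simp only [Near, not_forall, not_exists, not_and, not_le] at hfin
  obtain ⟨j, hj, hjZ⟩ := hfin
  obtain ⟨y, hy, hjy⟩ := hG j hj
  rcases Finset.mem_union.1 hy with hy | hy
  · have := hjZ y hy; omega
  set K := Q.clus ξ Y y with hK
  have hyK : y ∈ K := mem_clus.2 ⟨hy, by rw [dist_self]; omega⟩
  -- the cluster is far from `Z`
  have hfar : ∀ b, (∃ a ∈ K, dist (Q.cube b) (Q.cube a) ≤ s + 1 + ξ) → ∀ z ∈ Z,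
      s + 1 < dist (Q.cube b) (Q.cube z) := by
    rintro b ⟨a, ha, hab⟩ z hz
    have h1 := hjZ z hz
    have h2 := (mem_clus.1 ha).2
    have t1 := dist_triangle (Q.site j) (Q.cube y) (Q.cube z)
    have t2 := dist_triangle (Q.cube y) (Q.cube a) (Q.cube z)
    have t3 := dist_triangle (Q.cube a) (Q.cube b) (Q.cube z)
    rw [dist_comm (Q.cube a) (Q.cube b)] at t3
    omega
  -- elements of `Y` that are not far from `K` belong to `K`
  have hclose : ∀ b, (∃ a ∈ K, dist (Q.cube b) (Q.cube a) ≤ s + 1 + ξ) → ∀ y' ∈ Y,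
      dist (Q.cube b) (Q.cube y') ≤ s + 1 → y' ∈ K := by
    rintro b ⟨a, ha, hab⟩ y' hy' hby'
    have h2 := (mem_clus.1 ha)
    refine mem_clus.2 ⟨hy', ?_⟩
    have t1 := dist_triangle (Q.cube y) (Q.cube a) (Q.cube y')
    have t2 := dist_triangle (Q.cube a) (Q.cube b) (Q.cube y')
    rw [dist_comm (Q.cube a) (Q.cube b)] at t2
    exact hY y hy y' hy' (by omega)
  set G_K := Q.cut G fun j => ∃ a ∈ K, dist (Q.site j) (Q.cube a) ≤ s with hGK
  have hsyn := syn_cut (P := G) (K := K) (s := s) (by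
    intro i b hi hb hbK
    obtain ⟨x, hx, hix⟩ := hG i hi
    have hd := Q.dist_site_cube hb
    have t1 := dist_triangle (Q.cube b) (Q.site i) (Q.cube x)
    rw [dist_comm (Q.cube b) (Q.site i)] at t1
    have hb' : ∃ a ∈ K, dist (Q.cube b) (Q.cube a) ≤ s + 1 + ξ := by
      obtain ⟨a, ha, h⟩ := hbK
      exact ⟨a, ha, by omega⟩
    rcases Finset.mem_union.1 hx with hx | hx
    · have := hfar b hb' x hx
      omega
    · exact ⟨x, hclose b hb' x hx (by omega), hix⟩)
  rw [← hGK] at hsyn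
  have hsupp : ∃ c, Q.SuppIn G_K (box c ℓ) := cut_suppIn (P := G) clus_suppIn_helper hℓ
  -- A defect `b₀` of the piece would make the piece a witness of neutrality for the charged cluster
  -- of `b₀`.
  have hempty : Q.syn G_K = ∅ := by
    by_contra hne
    obtain ⟨b₀, hb₀⟩ := Finset.nonempty_iff_ne_empty.2 hne
    have hb₀' := hb₀
    rw [hsyn, Finset.mem_filter] at hb₀
    obtain ⟨hb₀G, a₀, ha₀, hba₀⟩ := hb₀
    have hc₀ := (hs b₀ (hfar b₀ ⟨a₀, ha₀, by omega⟩)).1 hb₀G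
    obtain ⟨hb₀W, hb₀n⟩ := mem_charged.1 hc₀
    refine hb₀n ⟨G_K, ?_, hsupp⟩
    ext b
    rw [hsyn, Finset.mem_filter, mem_clus]
    constructor
    · rintro ⟨hbG, a, ha, hba⟩
      have hb := (mem_charged.1 ((hs b (hfar b ⟨a, ha, by omega⟩)).1 hbG)).1
      refine ⟨hb, hW b₀ hb₀W b hb ?_⟩
      have t1 := dist_triangle (Q.cube b₀) (Q.cube a₀) (Q.cube b)
      have t2 := dist_triangle (Q.cube a₀) (Q.cube y) (Q.cube b)
      have t3 := dist_triangle (Q.cube y) (Q.cube a) (Q.cube b)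
      have h1 := (mem_clus.1 ha₀).2
      have h2 := (mem_clus.1 ha).2
      rw [dist_comm (Q.cube a₀) (Q.cube y)] at t2
      rw [dist_comm (Q.cube a) (Q.cube b)] at t3
      omega
    · rintro ⟨hb, hbb₀⟩
      have hbK : ∃ a ∈ K, dist (Q.cube b) (Q.cube a) ≤ s + 1 + ξ := by
        refine ⟨a₀, ha₀, ?_⟩
        have t1 := dist_triangle (Q.cube b) (Q.cube b₀) (Q.cube a₀)
        rw [dist_comm (Q.cube b) (Q.cube b₀)] at t1
        omega
      have hbG : b ∈ Q.syn G :=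
        (hs b (hfar b hbK)).2 ((hW.mem_charged_iff (by omega) hb₀W hb hbb₀).1 hc₀)
      refine ⟨hbG, ?_⟩
      obtain ⟨x, hx, hbx⟩ := hG.syn hbG
      rcases Finset.mem_union.1 hx with hx | hx
      · have := hfar b hbK x hx
        omega
      · exact ⟨x, hclose b hbK x hx hbx, hbx⟩
  have hstab : G_K ∈ Q.stab := ht G_K hempty hsupp
  have hval : ∀ i, (G + G_K) i ≠ 0 → G i ≠ 0 := by
    intro i hi h0
    apply hi
    simp [hGK, cut, h0]
  have hjK : (G + G_K) j = 0 := by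
    have : G_K j = G j := if_pos ⟨y, hyK, hjy⟩
    rw [Pi.add_apply, this]
    exact congrFun (pauli_add_self G) j
  obtain ⟨G', h1, h2⟩ := ih _ (by
      rw [← hN]
      refine Finset.card_lt_card ⟨fun i hi => ?_, fun hsub => ?_⟩
      · simp only [Finset.mem_filter, Finset.mem_univ, true_and] at hi ⊢
        exact hval i hi
      · have := hsub (Finset.mem_filter.2 ⟨Finset.mem_univ j, hj⟩)
        exact (Finset.mem_filter.1 this).2 hjK) (G + G_K)
    (fun i hi => hG i (hval i hi))
    (fun a ha => by
      rw [syn_add, hempty, show symmDiff (Q.syn G) ∅ = Q.syn G from symmDiff_bot _]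
      exact hs a ha) rfl
  refine ⟨G', Equi.trans ?_ h1, h2⟩
  unfold Equi
  rwa [← add_assoc, pauli_add_self, zero_add]

end Code

end MemoryTime

/-! ### Neutral clusters can be erased, charged clusters are pinned; hierarchical paths -/

namespace MemoryTime

variable {D L : ℕ}

namespace Code

variable {Q : Code D L}

theorem IsMinCube.size_le [NeZero L] {S : Q.Cluster} {c : Site D L} {R ξ : ℕ} {a : Fin Q.M}
    (h : Q.IsMinCube S c R) (hd : ∀ b ∈ S, dist (Q.cube a) (Q.cube b) ≤ ξ) : R ≤ 2 * ξ + 1 :=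
  h.2 (corner (Q.cube a) ξ) (2 * ξ + 1) fun b hb =>
    box_one_subset (by rw [dist_comm]; exact hd b hb)

theorem IsMinCube.dist_le [NeZero L] {S : Q.Cluster} {c : Site D L} {R : ℕ} {u : Site D L}
    {a : Fin Q.M} (h : Q.IsMinCube S c R) (ha : a ∈ S) (hu : u ∈ nbhd 1 (box c R)) :
    dist u (Q.cube a) ≤ R + 1 := by
  obtain ⟨v, hv, huv⟩ := hu
  have h1 := dist_le_of_mem_box hv (h.1 a ha).mem
  have := dist_triangle u v (Q.cube a)
  omega

/-- The neutral clusters of a sparse syndrome can be removed by a local operator. -/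
theorem exists_remove_neutral [NeZero L] {ξ η ℓ : ℕ} (ht : Q.TQO2 ℓ) {X : Q.Cluster}
    (hX : Q.Gap ξ η X) (hη : 2 * ξ ≤ η) (hξ : 1 ≤ ξ) (N : Q.Cluster) (hN : N ⊆ X)
    (hneu : ∀ a ∈ N, Q.Neutral ℓ (Q.clus ξ X a)) (hcl : ∀ a ∈ N, Q.clus ξ X a ⊆ N) :
    ∃ O, Q.syn O = N ∧ Q.Near (4 * ξ) O N := by
  induction hc : N.card using Nat.strong_induction_on generalizing N with
  | _ k ih =>
  rcases N.eq_empty_or_nonempty with rfl | ⟨a, ha⟩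
  · exact ⟨0, Q.syn_zero, Near.zero _ _⟩
  have haK : a ∈ Q.clus ξ X a := mem_clus.2 ⟨hN ha, by rw [dist_self]; omega⟩
  obtain ⟨c, R, hmin, P, hP, hPs⟩ := ht _ (hneu a ha)
  have hR := hmin.size_le (a := a) fun b hb => (mem_clus.1 hb).2
  obtain ⟨O, hO, hOn⟩ := ih _ (by
      rw [← hc]
      exact Finset.card_lt_card (Finset.sdiff_ssubset (hcl a ha) ⟨a, haK⟩))
    (N \ Q.clus ξ X a) (Finset.sdiff_subset.trans hN)
    (fun b hb => hneu b (Finset.mem_sdiff.1 hb).1)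
    (fun b hb => by
      obtain ⟨hb, hba⟩ := Finset.mem_sdiff.1 hb
      intro x hx
      refine Finset.mem_sdiff.2 ⟨hcl b hb hx, fun hxa => hba ?_⟩
      obtain ⟨hx, hxb⟩ := mem_clus.1 hx
      rw [hX.clus_eq hη (hN ha) hx (mem_clus.1 hxa).2]
      exact mem_clus.2 ⟨hN hb, by rwa [dist_comm]⟩) rfl
  refine ⟨O + P, ?_, (hOn.mono le_rfl Finset.sdiff_subset).add fun j hj => ?_⟩
  · rw [syn_add, hO, hP, symmDiff_eq_sup_sdiff_inf]
    simp [hcl a ha]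
  · exact ⟨a, ha, (hmin.dist_le haK (hPs j hj)).trans (by omega)⟩

/-- This operator is inserted twice at each junction of an error path, so that the path can be
thought of as passing through the charged clusters alone. -/
theorem exists_neutralize [NeZero L] {ξ η ℓ : ℕ} (ht : Q.TQO2 ℓ) {X : Q.Cluster}
    (hX : Q.Gap ξ η X) (hη : 2 * ξ ≤ η) (hξ : 1 ≤ ξ) :
    ∃ O, Q.syn O = symmDiff X (Q.charged ℓ ξ X) ∧ Q.Near (4 * ξ) O X := by
  obtain ⟨O, h1, h2⟩ := exists_remove_neutral ht hX hη hξ (X \ Q.charged ℓ ξ X)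
    Finset.sdiff_subset
    (fun a ha => by
      simp only [Finset.mem_sdiff, mem_charged, not_and, not_not] at ha
      exact ha.2 ha.1)
    (fun a ha b hb => by
      obtain ⟨ha, ha'⟩ := Finset.mem_sdiff.1 ha
      obtain ⟨hb, hab⟩ := mem_clus.1 hb
      exact Finset.mem_sdiff.2 ⟨hb, fun h => ha' ((hX.mem_charged_iff hη ha hb hab).2 h)⟩)
  refine ⟨O, ?_, h2.mono le_rfl Finset.sdiff_subset⟩
  rw [h1, symmDiff_eq_sup_sdiff_inf]
  simp [charged_subset]

/-- By the no-strings rule, charged clusters of sparse syndromes do not move. -/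
theorem charged_near [NeZero L] {α : ℝ} {ξ η ℓ ρ ρ₁ a : ℕ} (hns : Q.NoStrings α ℓ) (hα : α ≤ a)
    {X Y : Q.Cluster} (hX : Q.Gap ξ η X) (hY : Q.Gap ξ η Y) (hη : 2 * ρ + 2 + 2 * ξ ≤ η)
    (hℓ : 2 * (ρ + ξ) ≤ ℓ) (hρ₁ : a * (2 * ξ + 1) + 2 * (2 * ξ + 1) ≤ ρ₁) (F : Pauli Q.n)
    (hF : Q.Near ρ F (Q.charged ℓ ξ X))
    (hs : Q.syn F = symmDiff (Q.charged ℓ ξ X) (Q.charged ℓ ξ Y)) :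
    ∀ b ∈ Q.charged ℓ ξ Y, ∃ a ∈ Q.charged ℓ ξ X, dist (Q.cube b) (Q.cube a) ≤ ρ₁ := by
  classical
  intro b hb
  by_cases hbX : b ∈ Q.charged ℓ ξ X
  · exact ⟨b, hbX, by rw [dist_self]; omega⟩
  -- The support of `F` gives a charged defect of `X` within `ρ + 1` only. The aim is to improve
  -- this to `ρ₁`, for which a bound in terms of `a` and `ξ` is enough, whatever `ρ` is.
  obtain ⟨a₀, ha₀, hba₀⟩ := hF.syn (hs ▸ Finset.mem_symmDiff.2 (Or.inr ⟨hb, hbX⟩))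
  refine ⟨a₀, ha₀, ?_⟩
  by_contra hfar
  push Not at hfar
  have ha₀X := (mem_charged.1 ha₀).1
  have hbY := (mem_charged.1 hb).1
  set K := Q.clus ξ X a₀ with hK
  set K' := Q.clus ξ Y b with hK'
  have hKc : ∀ x ∈ K, x ∈ Q.charged ℓ ξ X := fun x hx =>
    (hX.mem_charged_iff (by omega) ha₀X (mem_clus.1 hx).1 (mem_clus.1 hx).2).1 ha₀
  have hKc' : ∀ x ∈ K', x ∈ Q.charged ℓ ξ Y := fun x hx =>
    (hY.mem_charged_iff (by omega) hbY (mem_clus.1 hx).1 (mem_clus.1 hx).2).1 hb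
  have hclose : ∀ x, (∃ y ∈ K, dist (Q.cube x) (Q.cube y) ≤ ρ + 1 + ξ) → ∀ z ∈ X,
      dist (Q.cube x) (Q.cube z) ≤ ρ + 1 → z ∈ K := by
    rintro x ⟨y, hy, hxy⟩ z hz hxz
    have h2 := mem_clus.1 hy
    refine mem_clus.2 ⟨hz, hX a₀ ha₀X z hz ?_⟩
    have t1 := dist_triangle (Q.cube a₀) (Q.cube y) (Q.cube z)
    have t2 := dist_triangle (Q.cube y) (Q.cube x) (Q.cube z)
    rw [dist_comm (Q.cube y) (Q.cube x)] at t2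
    omega
  set F_K := Q.cut F fun j => ∃ a ∈ K, dist (Q.site j) (Q.cube a) ≤ ρ with hFK
  have hsyn := syn_cut (P := F) (K := K) (s := ρ) (by
    intro i x hi hx hxK
    obtain ⟨y, hy, hiy⟩ := hF i hi
    have hd := Q.dist_site_cube hx
    have t1 := dist_triangle (Q.cube x) (Q.site i) (Q.cube y)
    rw [dist_comm (Q.cube x) (Q.site i)] at t1
    obtain ⟨z, hz, h⟩ := hxK
    exact ⟨y, hclose x ⟨z, hz, by omega⟩ y (charged_subset hy) (by omega), hiy⟩)
  rw [← hFK] at hsyn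
  have hsupp : ∃ c, Q.SuppIn F_K (box c ℓ) := cut_suppIn (P := F) clus_suppIn_helper hℓ
  have hdisj : ∀ x ∈ K, x ∉ K' := by
    intro x hx hx'
    have h1 := (mem_clus.1 hx).2
    have h2 := (mem_clus.1 hx').2
    have t := dist_triangle (Q.cube b) (Q.cube x) (Q.cube a₀)
    rw [dist_comm (Q.cube x) (Q.cube a₀)] at t
    omega
  -- the restricted operator creates exactly the two clusters
  have hsynK : Q.syn F_K = K ∪ K' := by
    ext x
    rw [hsyn, Finset.mem_filter, hs, Finset.mem_symmDiff, Finset.mem_union]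
    constructor
    · rintro ⟨⟨hxX, hxY⟩ | ⟨hxY, hxX⟩, y, hy, hxy⟩
      · exact Or.inl (hclose x ⟨y, hy, by omega⟩ x (charged_subset hxX) (by rw [dist_self]; omega))
      · refine Or.inr (mem_clus.2 ⟨charged_subset hxY, hY b hbY x (charged_subset hxY) ?_⟩)
        have h2 := (mem_clus.1 hy).2
        have t1 := dist_triangle (Q.cube b) (Q.cube a₀) (Q.cube x)
        have t2 := dist_triangle (Q.cube a₀) (Q.cube y) (Q.cube x)
        rw [dist_comm (Q.cube y) (Q.cube x)] at t2
        omega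
    · intro hx
      have key : ∀ x, x ∈ K' → ∃ y ∈ K, dist (Q.cube x) (Q.cube y) ≤ ρ + 1 := by
        intro x hx
        have hxc := hKc' x hx
        have hxa : ∃ y ∈ K, dist (Q.cube x) (Q.cube y) ≤ ρ + 1 + ξ := by
          refine ⟨a₀, mem_clus.2 ⟨ha₀X, by rw [dist_self]; omega⟩, ?_⟩
          have h2 := (mem_clus.1 hx).2
          have t1 := dist_triangle (Q.cube x) (Q.cube b) (Q.cube a₀)
          rw [dist_comm (Q.cube x) (Q.cube b)] at t1
          omega
        by_cases hxX : x ∈ Q.charged ℓ ξ X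
        · exact ⟨x, hclose x hxa x (charged_subset hxX) (by rw [dist_self]; omega),
            by rw [dist_self]; omega⟩
        · obtain ⟨y, hy, hxy⟩ := hF.syn (hs ▸ Finset.mem_symmDiff.2 (Or.inr ⟨hxc, hxX⟩))
          exact ⟨y, hclose x hxa y (charged_subset hy) hxy, hxy⟩
      rcases hx with hx | hx
      · refine ⟨Or.inl ⟨hKc x hx, fun hxY => hdisj x hx ?_⟩, x, hx, by rw [dist_self]; omega⟩
        refine mem_clus.2 ⟨charged_subset hxY, hY b hbY x (charged_subset hxY) ?_⟩
        have h2 := (mem_clus.1 hx).2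
        have t1 := dist_triangle (Q.cube b) (Q.cube a₀) (Q.cube x)
        omega
      · obtain ⟨y, hy, hxy⟩ := key x hx
        refine ⟨Or.inr ⟨hKc' x hx, fun hxX => hdisj x ?_ hx⟩, y, hy, hxy⟩
        exact hclose x ⟨y, hy, by omega⟩ x (charged_subset hxX) (by rw [dist_self]; omega)
  have hin : ∀ x ∈ K, Q.CubeIn x (box (corner (Q.cube a₀) ξ) (2 * ξ + 1)) := fun x hx =>
    box_one_subset (by rw [dist_comm]; exact (mem_clus.1 hx).2)
  have hin' : ∀ x ∈ K', Q.CubeIn x (box (corner (Q.cube b) ξ) (2 * ξ + 1)) := fun x hx =>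
    box_one_subset (by rw [dist_comm]; exact (mem_clus.1 hx).2)
  have ha₀in : Q.cube a₀ ∈ box (corner (Q.cube a₀) ξ) (2 * ξ + 1) :=
    box_mono _ (by omega) (mem_box_corner (by rw [dist_self]; omega))
  have hbin : Q.cube b ∈ box (corner (Q.cube b) ξ) (2 * ξ + 1) :=
    box_mono _ (by omega) (mem_box_corner (by rw [dist_self]; omega))
  have hrestr : Q.restrict (Q.syn F_K) (box (corner (Q.cube a₀) ξ) (2 * ξ + 1)) = K := by
    ext x
    rw [restrict, Finset.mem_filter, hsynK, Finset.mem_union]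
    refine ⟨?_, fun hx => ⟨Or.inl hx, hin x hx⟩⟩
    rintro ⟨hx | hx, hxin⟩
    · exact hx
    · have h1 := dist_le_of_mem_box hxin.mem ha₀in
      have h2 := (mem_clus.1 hx).2
      have t1 := dist_triangle (Q.cube b) (Q.cube x) (Q.cube a₀)
      omega
  -- The piece `F_K` is a string segment between two boxes of width `2 ξ + 1`, one around each
  -- cluster. The charge in the first box is `K`, which is not neutral.
  obtain ⟨u, hu, v, hv, huv⟩ := hns F_K (corner (Q.cube a₀) ξ) (corner (Q.cube b) ξ) (2 * ξ + 1)
    ⟨hsupp, fun x hx => by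
      rw [hsynK, Finset.mem_union] at hx
      exact hx.imp (hin x) (hin' x)⟩
    (Or.inl (by rw [hrestr]; exact (mem_charged.1 ha₀).2))
  have huv' : dist u v ≤ a * (2 * ξ + 1) := by
    have : (dist u v : ℝ) ≤ ((a * (2 * ξ + 1) : ℕ) : ℝ) := by
      push_cast
      push_cast at huv
      refine huv.trans ?_
      gcongr
    exact_mod_cast this
  have h1 := dist_le_of_mem_box hu ha₀in
  have h2 := dist_le_of_mem_box hbin hv
  have t1 := dist_triangle (Q.cube b) v (Q.cube a₀)
  have t2 := dist_triangle v u (Q.cube a₀)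
  rw [dist_comm v u] at t2
  omega

/-! ## Renormalization of error paths -/

/-- `Run G p S S' E`: the error `E` is the product of single-qubit errors along a path from `S` to
`S'` whose intermediate syndromes are sparse at levels below `p` (`G p` says sparse at level `p`),
arranged hierarchically. -/
inductive Run (G : ℕ → Q.Cluster → Prop) : ℕ → Q.Cluster → Q.Cluster → Pauli Q.n → Prop
  | single (S : Q.Cluster) (F : Pauli Q.n) (h : ∀ i j, F i ≠ 0 → F j ≠ 0 → i = j) :
      Run G 0 S (symmDiff S (Q.syn F)) F
  | lift {p : ℕ} {S S' : Q.Cluster} {E : Pauli Q.n} : Run G p S S' E → Run G (p + 1) S S' E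
  | snoc {p : ℕ} {S X S' : Q.Cluster} {E F : Pauli Q.n} : Run G (p + 1) S X E → G p X →
      Run G p X S' F → Run G (p + 1) S S' (E + F)

/-- If the junction is sparse at the highest level available, the blocks of the second path are
appended to the first one by one. Otherwise the last block of the first path and the first block of
the second are merged at the next lower level by induction, and the remaining blocks are appended.
-/
theorem Run.comp {G : ℕ → Q.Cluster → Prop} {p : ℕ} {S X S' : Q.Cluster} {E F : Pauli Q.n}
    (h : Run G p S X E) (h' : Run G p X S' F) (hX : ∃ p' < p, G p' X) : Run G p S S' (E + F) := by
  induction p generalizing S X S' E F with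
  | zero => obtain ⟨p', hp', -⟩ := hX; omega
  | succ p ih =>
    by_cases hXp : G p X
    · generalize hq : p + 1 = q at h'
      induction h' with
      | single => omega
      | lift h' _ =>
        obtain rfl : p = _ := Nat.succ_injective hq
        exact h.snoc hXp h'
      | snoc h1 hY h2 ih1 _ =>
        obtain rfl : p = _ := Nat.succ_injective hq
        rw [← add_assoc]
        exact (ih1 h hX hXp rfl).snoc hY h2
    · have hX' : ∃ p' < p, G p' X := by
        obtain ⟨p', hp', hg⟩ := hX
        refine ⟨p', lt_of_le_of_ne (Nat.lt_succ_iff.1 hp') ?_, hg⟩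
        rintro rfl
        exact hXp hg
      generalize hq : p + 1 = q at h'
      induction h' with
      | single => omega
      | lift h' _ =>
        obtain rfl : p = _ := Nat.succ_injective hq
        cases h with
        | lift h => exact (ih h h' hX').lift
        | snoc h1 hY h2 =>
          rw [add_assoc]
          exact h1.snoc hY (ih h2 h' hX')
      | snoc h1 hY h2 ih1 _ =>
        obtain rfl : p = _ := Nat.succ_injective hq
        rw [← add_assoc]
        exact (ih1 h hX hXp hX' rfl).snoc hY h2

theorem Run.of_zero {G : ℕ → Q.Cluster → Prop} {p : ℕ} {S S' : Q.Cluster} {E : Pauli Q.n}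
    (h : Run G 0 S S' E) : Run G p S S' E := by
  induction p with
  | zero => exact h
  | succ p ih => exact ih.lift

theorem Run.syn_eq {G : ℕ → Q.Cluster → Prop} {p : ℕ} {S S' : Q.Cluster} {E : Pauli Q.n}
    (h : Run G p S S' E) : Q.syn E = symmDiff S S' := by
  induction h with
  | single => simp
  | lift _ ih => exact ih
  | snoc _ _ _ ih1 ih2 => rw [syn_add, ih1, ih2, symmDiff_assoc, symmDiff_symmDiff_cancel_left]

end Code

end MemoryTime

/-! ### Error paths are localized near the defects at their ends -/

namespace MemoryTime

variable {D L : ℕ}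

namespace Code

variable {Q : Code D L}

variable (Q) in
/-- An error from `S` to `X`, composed of a part near `S` that leads to a charged configuration, a part
that keeps the charged clusters in place, and a last part. -/
def Chained (ξ η ℓ ρ : ℕ) (S X : Q.Cluster) (E : Pauli Q.n) : Prop :=
  (∃ E', Q.Equi E E' ∧ Q.Near ξ E' (S ∪ X)) ∨
  ∃ X₁ X' E₁ F G, Q.Gap ξ η X₁ ∧ Q.Gap ξ η X' ∧ Q.Equi E (E₁ + F + G) ∧
    Q.Near (16 * ξ) E₁ S ∧ Q.syn E₁ = symmDiff S (Q.charged ℓ ξ X₁) ∧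
    Q.Near ρ F (Q.charged ℓ ξ X₁) ∧
    Q.syn F = symmDiff (Q.charged ℓ ξ X₁) (Q.charged ℓ ξ X') ∧
    Q.Near (4 * ξ) G (X' ∪ X) ∧ Q.syn G = symmDiff (Q.charged ℓ ξ X') X

/-- The form of `trim` in use: a radius `4 ξ` turns into `16 ξ`, and `16 ξ` into `52 ξ`. -/
theorem trim_near [NeZero L] {ξ η ℓ : ℕ} (ht : Q.TQO1 ℓ) (hξ : 1 ≤ ξ)
    (hη : 40 * ξ ≤ η) (hℓ : η ≤ ℓ) {Y W Z V : Q.Cluster} (hY : Q.Gap ξ η Y) (hW : Q.Gap ξ η W)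
    {s : ℕ} (hs : s ≤ 16 * ξ) (hV : V ⊆ Z)
    {G : Pauli Q.n} (hG : Q.Near s G (Z ∪ Y)) (hsyn : Q.syn G = symmDiff V (Q.charged ℓ ξ W)) :
    ∃ G', Q.Equi G G' ∧ Q.Near (3 * s + 4 * ξ) G' Z := by
  obtain ⟨G', h1, h2⟩ := trim ht hY hW (by omega) (by omega) G hG fun a ha => by
    have haV : a ∉ V := fun h => by
      have := ha a (hV h)
      rw [dist_self] at this
      omega
    simp [hsyn, Finset.mem_symmDiff, haV]
  exact ⟨G', h1, h2.mono (by omega) subset_rfl⟩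

/-- Insert the square of the neutralizing operator `O` of `X` at the junction. Then `G + O` leads
from the charged clusters of `X'` to those of `X` and can be trimmed to a neighbourhood of the
former, while `O + F'` becomes the new last part. By `charged_near` the charged clusters of `X'` lie
near those of `X₁`, so the middle part remains near its anchor `X₁`. The anchor never changes, which
is why `ρ` is the same for any number of blocks. -/
theorem Chained.snoc [NeZero L] {α : ℝ} {ξ η ℓ ρ a : ℕ} (h1 : Q.TQO1 ℓ) (h2 : Q.TQO2 ℓ)
    (hns : Q.NoStrings α ℓ) (hα : α ≤ a) (hξ : 1 ≤ ξ) (hη : 2 * ρ + 4 * ξ ≤ η) (hℓ : η ≤ ℓ)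
    (hρ : a * (2 * ξ + 1) + 2 * (2 * ξ + 1) + 52 * ξ ≤ ρ) {S X S' : Q.Cluster} {E F : Pauli Q.n}
    (hE : Q.syn E = symmDiff S X) (hF : Q.syn F = symmDiff X S') (hX : Q.Gap ξ η X)
    (h : Q.Chained ξ η ℓ ρ S X E) (h' : ∃ F', Q.Equi F F' ∧ Q.Near ξ F' (X ∪ S')) :
    Q.Chained ξ η ℓ ρ S S' (E + F) := by
  obtain ⟨O, hO, hOn⟩ := exists_neutralize h2 hX (by omega) hξ
  obtain ⟨F', hFF', hF'⟩ := h'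
  right
  have hOF : Q.Near (4 * ξ) (O + F') (X ∪ S') :=
    (hOn.mono le_rfl Finset.subset_union_left).add (hF'.mono (by omega) subset_rfl)
  have hOF' : Q.syn (O + F') = symmDiff (Q.charged ℓ ξ X) S' := by
    rw [syn_add, hO, ← hFF'.syn_eq, hF, symmDiff_comm X, symmDiff_assoc,
      symmDiff_symmDiff_cancel_left]
  rcases h with ⟨E', hEE', hE'⟩ | ⟨X₁, X', E₁, F₁, G, hX₁, hX', hEq, hE₁, hE₁s, hF₁, hF₁s, hG, hGs⟩
  · obtain ⟨E₁, hE₁, hE₁n⟩ := trim_near h1 hξ (by omega) hℓ hX hX (s := 4 * ξ) (by omega)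
      (subset_refl S) (G := E' + O)
      ((hE'.mono (by omega) subset_rfl).add (hOn.mono le_rfl Finset.subset_union_right))
      (by rw [syn_add, hO, ← hEE'.syn_eq, hE, symmDiff_assoc, symmDiff_symmDiff_cancel_left])
    refine ⟨X, X, E₁, 0, O + F', hX, hX, ?_, hE₁n.mono (by omega) subset_rfl, ?_, Near.zero _ _,
      by simp [syn_zero], hOF, hOF'⟩
    · have := hE₁.add (Equi.refl (O + F'))
      rw [show E' + O + (O + F') = E' + F' + (O + O) by abel, pauli_add_self, add_zero] at this
      rw [add_zero]
      exact (hEE'.add hFF').trans this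
    · rw [← hE₁.syn_eq, syn_add, hO, ← hEE'.syn_eq, hE, symmDiff_assoc,
        symmDiff_symmDiff_cancel_left]
  · have hGO : Q.syn (G + O) = symmDiff (Q.charged ℓ ξ X') (Q.charged ℓ ξ X) := by
      rw [syn_add, hO, hGs, symmDiff_assoc, symmDiff_symmDiff_cancel_left]
    -- Two trimmings: this one detaches the operator from `X`, the next one from the neutral
    -- clusters of `X'`.
    obtain ⟨G₁, hG₁, hG₁n⟩ := trim_near h1 hξ (by omega) hℓ hX hX (s := 4 * ξ) (by omega)
      charged_subset (G := G + O) (hG.add (hOn.mono le_rfl Finset.subset_union_right)) hGO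
    obtain ⟨G₂, hG₂, hG₂n⟩ := trim_near h1 hξ (by omega) hℓ hX' hX (s := 16 * ξ) (by omega)
      (subset_refl (Q.charged ℓ ξ X')) (G := G₁)
      (hG₁n.mono (by omega) Finset.subset_union_right) (by rw [← hG₁.syn_eq, hGO])
    have hstay := charged_near hns hα hX₁ hX' (ρ₁ := a * (2 * ξ + 1) + 2 * (2 * ξ + 1))
      (by omega) (by omega) le_rfl F₁ hF₁ hF₁s
    refine ⟨X₁, X, E₁, F₁ + G₂, O + F', hX₁, hX, ?_, hE₁, hE₁s,
      hF₁.add ((hG₂n.thicken hstay).mono (by omega) subset_rfl), ?_, hOF, hOF'⟩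
    · have := ((Equi.refl (E₁ + F₁)).add (hG₁.trans hG₂)).add (Equi.refl (O + F'))
      rw [show E₁ + F₁ + (G + O) + (O + F') = E₁ + F₁ + G + F' + (O + O) by abel, pauli_add_self,
        add_zero, show E₁ + F₁ + G₂ = E₁ + (F₁ + G₂) by abel] at this
      exact (hEq.add hFF').trans this
    · rw [syn_add, hF₁s, ← hG₂.syn_eq, ← hG₁.syn_eq, hGO, symmDiff_assoc,
        symmDiff_symmDiff_cancel_left]

/-- A charged defect of `X₁` belongs to `S` or is created by `E₁`, hence lies within `16 ξ + 1` of
`S`; so the middle part is near `S`. The last part is trimmed to a neighbourhood of `X`. -/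
theorem Chained.near [NeZero L] {ξ η ℓ ρ : ℕ} (h1 : Q.TQO1 ℓ) (hξ : 1 ≤ ξ) (hη : 40 * ξ ≤ η)
    (hℓ : η ≤ ℓ) {S X : Q.Cluster} {E : Pauli Q.n} (h : Q.Chained ξ η ℓ ρ S X E) :
    ∃ E', Q.Equi E E' ∧ Q.Near (ρ + 17 * ξ) E' (S ∪ X) := by
  rcases h with ⟨E', hEE', hE'⟩ | ⟨X₁, X', E₁, F₁, G, hX₁, hX', hEq, hE₁, hE₁s, hF₁, hF₁s, hG, hGs⟩
  · exact ⟨E', hEE', hE'.mono (by omega) subset_rfl⟩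
  obtain ⟨G', hG', hG'n⟩ := trim_near h1 hξ hη hℓ hX' hX' (s := 4 * ξ) (by omega)
    (subset_refl X) (G := G) (by rwa [Finset.union_comm]) (by rw [hGs, symmDiff_comm])
  refine ⟨E₁ + F₁ + G', hEq.trans ((Equi.refl _).add hG'), ((hE₁.mono (by omega)
    Finset.subset_union_left).add ?_).add (hG'n.mono (by omega) Finset.subset_union_right)⟩
  refine (hF₁.thicken (t := 17 * ξ) (Y := S) fun b hb => ?_).mono le_rfl Finset.subset_union_left
  by_cases hbS : b ∈ S
  · exact ⟨b, hbS, by rw [dist_self]; omega⟩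
  · obtain ⟨a, ha, h⟩ := hE₁.syn (hE₁s ▸ Finset.mem_symmDiff.2 (Or.inr ⟨hb, hbS⟩))
    exact ⟨a, ha, by omega⟩

/-- The length scales of the renormalization: `μ = 6 a + 130`, `ξ p = (μ + 2) ^ p`. -/
def scale (a p : ℕ) : ℕ := (6 * a + 132) ^ p

/-- The lower bound on the distance of distinct clusters at level `p`. -/
def scaleTop (a p : ℕ) : ℕ := (6 * a + 130) * scale a p

theorem scale_pos (a p : ℕ) : 1 ≤ scale a p := Nat.one_le_pow _ _ (by omega)

theorem scale_succ (a p : ℕ) : scale a (p + 1) = scaleTop a p + 2 * scale a p := by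
  simp only [scaleTop, scale]; ring

theorem scale_mono (a : ℕ) {p p' : ℕ} (h : p ≤ p') : scale a p ≤ scale a p' :=
  Nat.pow_le_pow_right (by omega) h

/-- Induction on the level. A single-qubit error either creates a defect next to its qubit or is a
stabilizer by `TQO1`. On a higher level the blocks are appended one at a time, keeping `Chained`. -/
theorem Run.near [NeZero L] {α : ℝ} {ℓ a : ℕ} (h1 : Q.TQO1 ℓ) (h2 : Q.TQO2 ℓ)
    (hns : Q.NoStrings α ℓ) (hα : α ≤ a) {p : ℕ} {S S' : Q.Cluster} {E : Pauli Q.n}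
    (h : Run (fun p X => Q.Gap (scale a p) (scaleTop a p) X) p S S' E) (hp : scale a p ≤ ℓ) :
    ∃ E', Q.Equi E E' ∧ Q.Near (scale a p) E' (S ∪ S') := by
  induction p generalizing S S' E with
  | zero =>
    generalize hq : 0 = q at h
    cases h with
    | lift => omega
    | snoc => omega
    | single S F hj =>
      rcases (Q.syn E).eq_empty_or_nonempty with he | ⟨b, hb⟩
      · refine ⟨0, ?_, Near.zero _ _⟩
        unfold Equi
        rw [add_zero]
        by_cases h0 : E = 0
        · rw [h0]
          exact Q.stab.zero_mem
        · obtain ⟨j, hj0⟩ := Function.ne_iff.1 h0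
          refine h1 E he ⟨Q.site j, fun i hi => ?_⟩
          rw [hj i j hi hj0]
          exact self_mem_box _ _
      · refine ⟨E, Equi.refl E, fun i hi => ?_⟩
        obtain ⟨i', h1, h2⟩ := exists_touch hb
        rw [hj i i' hi h2]
        refine ⟨b, ?_, (Q.dist_site_cube h1).trans (scale_pos _ _)⟩
        rw [Finset.mem_union, Finset.mem_symmDiff]
        by_cases hbS : b ∈ S
        · exact Or.inl hbS
        · exact Or.inr (Or.inr ⟨hb, hbS⟩)
  | succ p ih =>
    set ξ := scale a p with hξ
    have hξ1 : 1 ≤ ξ := scale_pos a p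
    have hsucc := scale_succ a p
    have htop : scaleTop a p = 6 * (a * ξ) + 130 * ξ := by rw [scaleTop, ← hξ]; ring
    have haξ : a ≤ a * ξ := Nat.le_mul_of_pos_right _ hξ1
    have hmul : a * (2 * ξ + 1) = 2 * (a * ξ) + a := by ring
    -- The radius `ρ = 3 a ξ + 58 ξ` exceeds the bound `2 a ξ + a + 56 ξ + 2` required by
    -- `Chained.snoc`. Moreover `2 ρ + 4 ξ = 6 a ξ + 120 ξ` is below the gap and `ρ + 17 ξ` is below
    -- the next scale.
    suffices hc : Q.Chained ξ (scaleTop a p) ℓ (3 * (a * ξ) + 58 * ξ) S S' E by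
      obtain ⟨E', h3, h4⟩ := hc.near h1 hξ1 (by omega) (by omega)
      exact ⟨E', h3, h4.mono (by omega) subset_rfl⟩
    generalize hq : p + 1 = q at h
    induction h with
    | single => omega
    | lift h' _ =>
      obtain rfl : p = _ := Nat.succ_injective hq
      exact Or.inl (ih h' (by omega))
    | snoc h3 hX h4 ih3 _ =>
      obtain rfl : p = _ := Nat.succ_injective hq
      exact (ih3 rfl).snoc h1 h2 hns hα hξ1 (by omega) (by omega) (by omega)
        h3.syn_eq h4.syn_eq hX (ih h4 (by omega))

/-- Errors that can be built up from single-qubit errors without ever creating more than `m`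
defects. -/
inductive LowPath (Q : Code D L) (m : ℕ) : Pauli Q.n → Prop
  | zero : LowPath Q m 0
  | step {E F : Pauli Q.n} (j : Fin Q.n) : LowPath Q m E → (∀ i, i ≠ j → F i = 0) →
      (Q.syn (E + F)).card ≤ m → LowPath Q m (E + F)

theorem LowPath.card_le {m : ℕ} {E : Pauli Q.n} (h : LowPath Q m E) : (Q.syn E).card ≤ m := by
  cases h with
  | zero => simp [syn_zero]
  | step _ _ _ h => exact h

/-- Every intermediate syndrome has at most `m` defects, hence is sparse at one of the levels `0, …,
m`. At level `m + 1` every junction is therefore admissible in `Run.comp`. -/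
theorem LowPath.run {m a : ℕ} {E : Pauli Q.n} (h : LowPath Q m E) :
    Run (fun p X => Q.Gap (scale a p) (scaleTop a p) X) (m + 1) ∅ (Q.syn E) E := by
  induction h with
  | zero =>
    have := Run.single (Q := Q) (G := fun p X => Q.Gap (scale a p) (scaleTop a p) X) ∅ 0
      fun i _ hi => absurd rfl hi
    rw [syn_zero, symmDiff_self] at this
    rw [syn_zero]
    exact this.of_zero
  | @step E F j h hF hc ih =>
    have := Run.single (G := fun p X => Q.Gap (scale a p) (scaleTop a p) X) (Q.syn E) F
      fun i i' hi hi' => by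
        rw [not_imp_comm.1 (hF i) hi, not_imp_comm.1 (hF i') hi']
    rw [← syn_add] at this
    obtain ⟨p, -, hp, hg⟩ := exists_gap (lev := scale a) (gapTop := scaleTop a)
      (fun p => by rw [scale_succ]; omega) (Q.syn E) 0
    exact ih.comp this.of_zero ⟨p, by have := h.card_le; omega, hg⟩

end Code

end MemoryTime

namespace MemoryTime

variable {D L : ℕ}

namespace Code

variable {Q : Code D L}

/-! ## The decoder corrects low-energy errors -/

/-- A chain with steps of length at most `η` cannot leave a cluster of a sparse set: the gap shrinks
each step to `ξ`, and then the total distance from `2 ξ` to `ξ`. -/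
theorem Connected.dist_le {ξ η s : ℕ} {X : Q.Cluster} (hX : Q.Gap ξ η X) (hη : 2 * ξ ≤ η)
    (hs : s ≤ η) {a b : Fin Q.M} (ha : a ∈ X) (h : Q.Connected s X a b) :
    b ∈ X ∧ dist (Q.cube a) (Q.cube b) ≤ ξ := by
  induction h with
  | refl => exact ⟨ha, by rw [dist_self]; omega⟩
  | @tail b c _ hbc ih =>
    refine ⟨hbc.2.1, hX a ha c hbc.2.1 ?_⟩
    have h1 := hX b hbc.1 c hbc.2.1 (hbc.2.2.trans hs)
    have := dist_triangle (Q.cube a) (Q.cube b) (Q.cube c)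
    omega

theorem mem_components {s : ℕ} {X C : Q.Cluster} :
    C ∈ Q.components s X ↔ ∃ a ∈ X, ∀ b, b ∈ C ↔ b ∈ X ∧ Q.Connected s X a b := by
  classical
  simp only [components, Finset.mem_image]
  refine exists_congr fun a => and_congr_right fun _ => ?_
  rw [Finset.ext_iff]
  simp [iff_comm]

theorem Connected.symm {s : ℕ} {X : Q.Cluster} {a b : Fin Q.M} (h : Q.Connected s X a b) :
    Q.Connected s X b a := by
  induction h with
  | refl => exact .refl
  | tail _ h ih => exact .head ⟨h.2.1, h.1, by rw [dist_comm]; exact h.2.2⟩ ih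

theorem exists_mem_syn_of_sum {ι : Type*} {s : Finset ι} {f : ι → Pauli Q.n} {a : Fin Q.M}
    (h : a ∈ Q.syn (∑ i ∈ s, f i)) : ∃ i ∈ s, a ∈ Q.syn (f i) := by
  rw [mem_syn, symp_sum] at h
  obtain ⟨i, hi, h⟩ := Finset.exists_ne_zero_of_sum_ne_zero h
  exact ⟨i, hi, Q.mem_syn.2 h⟩

theorem Near.sum {ι : Type*} {t : Finset ι} {f : ι → Pauli Q.n} {s : ℕ} {X : Q.Cluster}
    (h : ∀ i ∈ t, Q.Near s (f i) X) : Q.Near s (∑ i ∈ t, f i) X := by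
  classical
  induction t using Finset.induction_on with
  | empty => exact Near.zero _ _
  | insert a t ha ih =>
    rw [Finset.sum_insert ha]
    exact (h a (Finset.mem_insert_self _ _)).add
      (ih fun i hi => h i (Finset.mem_insert_of_mem hi))

theorem IsTestNeutral.near [NeZero L] {ℓ ξ : ℕ} {T : Q.Cluster → Pauli Q.n}
    (hT : Q.IsTestNeutral ℓ T) (hξ : 1 ≤ ξ) {C : Q.Cluster} {a : Fin Q.M} (ha : a ∈ C)
    (hC : ∀ b ∈ C, dist (Q.cube a) (Q.cube b) ≤ ξ) :
    Q.Near (4 * ξ) (T C) C ∧ Q.syn (T C) ⊆ C := by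
  obtain ⟨h1, h2⟩ := hT C
  by_cases hg : ∃ P, ∃ c R, Q.IsMinCube C c R ∧ R ≤ ℓ ∧ Q.syn P = C ∧
      Q.SuppIn P (nbhd 1 (box c R))
  · obtain ⟨c, R, hmin, -, hsyn, hsupp⟩ := h1 hg
    have := hmin.size_le hC
    exact ⟨fun j hj => ⟨a, ha, (hmin.dist_le ha (hsupp j hj)).trans (by omega)⟩, hsyn.subset⟩
  · rw [h2 hg, syn_zero]
    exact ⟨Near.zero _ _, by simp⟩

theorem EC_near [NeZero L] {ℓ ξ η p : ℕ} {T : Q.Cluster → Pauli Q.n} (hT : Q.IsTestNeutral ℓ T)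
    (hξ : 1 ≤ ξ) (hη : 2 * ξ ≤ η) (hp : 2 ^ p ≤ η) {X : Q.Cluster} (hX : Q.Gap ξ η X) :
    Q.Near (4 * ξ) (Q.EC T p X) X ∧ Q.syn (Q.EC T p X) ⊆ X := by
  have key : ∀ C ∈ Q.components (2 ^ p) X, C ⊆ X ∧ Q.Near (4 * ξ) (T C) C ∧ Q.syn (T C) ⊆ C := by
    intro C hC
    obtain ⟨a, ha, hC⟩ := mem_components.1 hC
    refine ⟨fun b hb => ((hC b).1 hb).1, hT.near hξ ((hC a).2 ⟨ha, .refl⟩) fun b hb => ?_⟩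
    exact (((hC b).1 hb).2.dist_le hX hη hp ha).2
  refine ⟨Near.sum fun C hC => ((key C hC).2.1).mono le_rfl (key C hC).1, fun a ha => ?_⟩
  obtain ⟨C, hC, ha⟩ := exists_mem_syn_of_sum ha
  exact (key C hC).1 ((key C hC).2.2 ha)

theorem Gap.subset {ξ η : ℕ} {X Y : Q.Cluster} (h : Q.Gap ξ η X) (hY : Y ⊆ X) : Q.Gap ξ η Y :=
  fun a ha b hb => h a (hY ha) b (hY hb)

/-- Up to the scale `η` the components seen by the decoder stay inside the clusters of the measured
syndrome. The lower levels can thus only remove defects, and they act near `S`. -/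
theorem rgRun_near [NeZero L] {ℓ ξ η : ℕ} {T : Q.Cluster → Pauli Q.n} (hT : Q.IsTestNeutral ℓ T)
    (hξ : 1 ≤ ξ) (hη : 2 * ξ ≤ η) {S : Q.Cluster} (hS : Q.Gap ξ η S) (p : ℕ)
    (hp : ∀ p' < p, 2 ^ p' ≤ η) :
    (Q.rgRun T S p).1 ⊆ S ∧ Q.Near (4 * ξ) (Q.rgRun T S p).2 S := by
  induction p with
  | zero => exact ⟨subset_rfl, Near.zero _ _⟩
  | succ p ih =>
    obtain ⟨h1, h2⟩ := ih fun p' h => hp p' (by omega)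
    obtain ⟨h3, h4⟩ := EC_near hT hξ hη (hp p (by omega)) (hS.subset h1)
    refine ⟨fun a ha => ?_, h2.add (h3.mono le_rfl h1)⟩
    rcases Finset.mem_symmDiff.1 ha with h | h
    · exact h1 h.1
    · exact h1 (h4 h.1)

theorem syn_rgRun (T : Q.Cluster → Pauli Q.n) (S : Q.Cluster) (p : ℕ) :
    Q.syn (Q.rgRun T S p).2 = symmDiff S (Q.rgRun T S p).1 := by
  induction p with
  | zero => simp [rgRun, syn_zero]
  | succ p ih => simp only [rgRun, syn_add, ih, symmDiff_assoc]

theorem EC_empty (T : Q.Cluster → Pauli Q.n) (p : ℕ) : Q.EC T p ∅ = 0 := by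
  simp [EC, components]

theorem rgRun_eq_of_empty (T : Q.Cluster → Pauli Q.n) (S : Q.Cluster) {p p' : ℕ} (h : p ≤ p')
    (hp : (Q.rgRun T S p).1 = ∅) : Q.rgRun T S p' = Q.rgRun T S p := by
  induction p', h using Nat.le_induction with
  | base => rfl
  | succ p' _ ih => simp only [rgRun, ih, hp, EC_empty, syn_zero, add_zero, symmDiff_self]
                    exact Prod.ext (by simp [hp]) rfl

/-- At a level between the size and the distance of the clusters all defects are annihilated. -/
theorem syn_EC_eq [NeZero L] {ℓ ξ η p : ℕ} {T : Q.Cluster → Pauli Q.n} (hT : Q.IsTestNeutral ℓ T)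
    (h2 : Q.TQO2 ℓ) (hη : 16 * ξ + 4 ≤ η) (hℓ : η ≤ ℓ) (hp : 2 ^ p ≤ η)
    (hpξ : ξ ≤ 2 ^ p) {S X : Q.Cluster} (hS : Q.Gap ξ η S) (hX : X ⊆ S) {G : Pauli Q.n}
    (hG : Q.Near (4 * ξ) G S) (hGX : Q.syn G = X) : Q.syn (Q.EC T p X) = X := by
  classical
  have key : ∀ C ∈ Q.components (2 ^ p) X, Q.syn (T C) = C := by
    intro C hC
    obtain ⟨a, ha, hC⟩ := mem_components.1 hC
    have haS := hX ha
    have hCd : ∀ b ∈ C, dist (Q.cube a) (Q.cube b) ≤ ξ := fun b hb =>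
      (((hC b).1 hb).2.dist_le (hS.subset hX) (by omega) hp ha).2
    have hclose : ∀ x, (∃ y ∈ Q.clus ξ S a, dist (Q.cube x) (Q.cube y) ≤ 4 * ξ + 1) → ∀ z ∈ S,
        dist (Q.cube x) (Q.cube z) ≤ 4 * ξ + 1 → z ∈ Q.clus ξ S a := by
      rintro x ⟨y, hy, hxy⟩ z hz hxz
      have h2 := mem_clus.1 hy
      refine mem_clus.2 ⟨hz, hS a haS z hz ?_⟩
      have t1 := dist_triangle (Q.cube a) (Q.cube y) (Q.cube z)
      have t2 := dist_triangle (Q.cube y) (Q.cube x) (Q.cube z)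
      rw [dist_comm (Q.cube y) (Q.cube x)] at t2
      omega
    have hsyn := syn_cut (P := G) (K := Q.clus ξ S a) (s := 4 * ξ) (by
      intro i x hi hx hxK
      obtain ⟨y, hy, hiy⟩ := hG i hi
      have hd := Q.dist_site_cube hx
      have t1 := dist_triangle (Q.cube x) (Q.site i) (Q.cube y)
      rw [dist_comm (Q.cube x) (Q.site i)] at t1
      exact ⟨y, hclose x hxK y hy (by omega), hiy⟩)
    -- `G` creates all the remaining defects, and the gap separates its action near the cluster of
    -- `a` from the rest. The cut operator creates exactly the component `C`.
    have hneu : Q.Neutral ℓ C := by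
      refine ⟨_, ?_, cut_suppIn (P := G) (s := 4 * ξ) (K := Q.clus ξ S a) clus_suppIn_helper
        (by omega)⟩
      rw [hsyn, hGX]
      ext b
      rw [Finset.mem_filter, hC]
      refine and_congr_right fun hb => ⟨fun h => ?_, fun h => ?_⟩
      · have hb' := (mem_clus.1 (hclose b h b (hX hb) (by rw [dist_self]; omega))).2
        exact .single ⟨ha, hb, hb'.trans hpξ⟩
      · have := (h.dist_le (hS.subset hX) (by omega) hp ha).2
        exact ⟨a, mem_clus.2 ⟨haS, by rw [dist_self]; omega⟩, by rw [dist_comm]; omega⟩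
    obtain ⟨c, R, hmin, P, hP, hPs⟩ := h2 C hneu
    have hR := hmin.size_le hCd
    obtain ⟨c', R', -, -, h, -⟩ := (hT C).1 ⟨P, c, R, hmin, by omega, hP, hPs⟩
    exact h
  ext a
  rw [mem_syn, EC, symp_sum]
  by_cases ha : a ∈ X
  · simp only [ha, iff_true]
    set C₀ := X.filter fun b => Q.Connected (2 ^ p) X a b with hC₀
    have hC₀m : C₀ ∈ Q.components (2 ^ p) X := mem_components.2 ⟨a, ha, fun b => by simp [hC₀]⟩
    rw [Finset.sum_eq_single_of_mem C₀ hC₀m]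
    · rw [← mem_syn, key C₀ hC₀m, hC₀, Finset.mem_filter]
      exact ⟨ha, .refl⟩
    · intro C hCm hne
      by_contra hs
      have haC : a ∈ C := by rw [← key C hCm]; exact Q.mem_syn.2 hs
      obtain ⟨b, hb, hC⟩ := mem_components.1 hCm
      apply hne
      ext x
      rw [hC, hC₀, Finset.mem_filter]
      have hab := ((hC a).1 haC).2
      exact and_congr_right fun _ => ⟨fun h => hab.symm.trans h, fun h => hab.trans h⟩
  · simp only [ha, iff_false, not_not]
    refine Finset.sum_eq_zero fun C hCm => ?_
    by_contra hs
    have haC : a ∈ C := by rw [← key C hCm]; exact Q.mem_syn.2 hs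
    obtain ⟨b, hb, hC⟩ := mem_components.1 hCm
    exact ha ((hC a).1 haC).1

/-- The decoder corrects, up to stabilizers, every error that can be created with few defects. -/
theorem IsRGDecoder.corrects [NeZero L] {α : ℝ} {ℓ a m : ℕ} (h1 : Q.TQO1 ℓ) (h2 : Q.TQO2 ℓ)
    (hns : Q.NoStrings α ℓ) (hα : α ≤ a) {dec : Q.Cluster → Pauli Q.n}
    (hdec : Q.IsRGDecoder ℓ dec) (hℓ : scaleTop a (2 * m + 1) ≤ ℓ) {E : Pauli Q.n}
    (hE : LowPath Q m E) : Q.Equi E (dec (Q.syn E)) := by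
  obtain ⟨T, hT, hd, -⟩ := hdec
  set S := Q.syn E with hS
  -- The search starts at level `m + 1`, so that the cluster size `ξ` dominates the distance `scale
  -- a (m + 1)` of the error from its syndrome.
  obtain ⟨p, hp1, hp2, hg⟩ := exists_gap (lev := scale a) (gapTop := scaleTop a)
    (fun p => by rw [scale_succ]; omega) S (m + 1)
  have hp3 : p ≤ 2 * m + 1 := by have := hE.card_le; rw [← hS] at this; omega
  have hξ1 := scale_pos a p
  have hηle : scaleTop a p ≤ ℓ := le_trans (Nat.mul_le_mul_left _ (scale_mono a hp3)) hℓ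
  have hη : 130 * scale a p ≤ scaleTop a p := Nat.mul_le_mul_right _ (by omega)
  obtain ⟨E', hEE', hE'⟩ := hE.run.near h1 h2 hns hα
    ((scale_mono a (show m + 1 ≤ p from hp1)).trans (by omega))
  rw [Finset.empty_union] at hE'
  set ξ := scale a p with hξ
  have hE'ξ : Q.Near (4 * ξ) E' S := hE'.mono ((scale_mono a hp1).trans (by omega)) subset_rfl
  have hξ2 : 1 < ξ := Nat.one_lt_pow (by omega) (by omega)
  have hlow : ξ ≤ 2 ^ Nat.clog 2 ξ := Nat.le_pow_clog (by omega) _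
  have hhigh : 2 ^ Nat.clog 2 ξ ≤ 2 * ξ := by
    have h := Nat.pow_pred_clog_lt_self (b := 2) (by omega) hξ2
    have h0 : 0 < Nat.clog 2 ξ := Nat.clog_pos (by omega) hξ2
    obtain ⟨k, hk⟩ : ∃ k, Nat.clog 2 ξ = k + 1 := ⟨_, (Nat.succ_pred_eq_of_pos h0).symm⟩
    rw [hk] at h ⊢
    rw [Nat.pred_succ] at h
    rw [pow_succ]
    omega
  -- The first level of the decoder with `ξ ≤ 2 ^ j`. As `2 ^ j ≤ 2 ξ`, it is still within the gap.
  set j := Nat.clog 2 ξ with hj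
  have hsmall : ∀ j' < j + 1, 2 ^ j' ≤ scaleTop a p := fun j' hj' =>
    (Nat.pow_le_pow_right (by omega) (Nat.lt_succ_iff.1 hj')).trans (by omega)
  obtain ⟨h3, h4⟩ := rgRun_near hT hξ1 (by omega) hg j fun j' h => hsmall j' (by omega)
  have hsynj := syn_rgRun T S j
  have hempty : (Q.rgRun T S (j + 1)).1 = ∅ := by
    have := syn_EC_eq hT h2 (by omega) hηle (hsmall j (by omega)) hlow hg h3 (G := E' + (Q.rgRun T S j).2)
      (hE'ξ.add h4) (by
        rw [syn_add, ← hEE'.syn_eq, ← hS, hsynj, symmDiff_symmDiff_cancel_left])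
    simp only [rgRun, this, symmDiff_self]
    rfl
  have hle : j + 1 ≤ Nat.clog 2 ℓ := (Nat.lt_clog_iff_pow_lt (by omega)).2 (by omega)
  have hfin := rgRun_eq_of_empty T S hle hempty
  rw [hd S (by rw [hfin, hempty]), hfin]
  have h5 := (rgRun_near hT hξ1 (by omega) hg (j + 1) hsmall).2
  have h6 := syn_rgRun T S (j + 1)
  rw [hempty] at h6
  have hgap0 : Q.Gap ξ (scaleTop a p) ∅ := fun a ha => absurd ha (Finset.notMem_empty a)
  -- The error times the correction creates no defects and is supported near the sparse set `S`.
  -- Nothing has to remain after trimming, so it is a stabilizer.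
  obtain ⟨G', hG', hG'n⟩ := trim h1 (Z := ∅) hg hgap0 (s := 4 * ξ) (by omega) (by omega)
    (E' + (Q.rgRun T S (j + 1)).2) (by rw [Finset.empty_union]; exact hE'ξ.add h5) fun a _ => by
      rw [syn_add, ← hEE'.syn_eq, ← hS, h6]
      simp [charged]
  have hG'0 : G' = 0 := by
    funext i
    by_contra hi
    obtain ⟨a, ha, -⟩ := hG'n i hi
    exact absurd ha (Finset.notMem_empty a)
  refine hEE'.trans ?_
  unfold Equi at *
  simpa [hG'0] using hG'

end Code

end MemoryTime

namespace MemoryTime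

/-! ## Pauli operators as matrices -/

section Tensor

variable {n : ℕ}

/-- The tensor product of single-qubit operators. -/
def tens (f : Fin n → Matrix (Fin 2) (Fin 2) ℂ) : Op n :=
  Matrix.of fun a b => ∏ j, f j (a j) (b j)

theorem pauliOp_eq_tens (P : Pauli n) : pauliOp P = tens fun j => pauliOne (P j) := rfl

theorem tens_mul (f g : Fin n → Matrix (Fin 2) (Fin 2) ℂ) :
    tens f * tens g = tens fun j => f j * g j := by
  ext a b
  simp only [tens, Matrix.mul_apply, Matrix.of_apply, ← Finset.prod_mul_distrib]
  rw [Finset.prod_univ_sum, Fintype.piFinset_univ]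

theorem tens_one : tens (fun _ : Fin n => (1 : Matrix (Fin 2) (Fin 2) ℂ)) = 1 := by
  ext a b
  simp only [tens, Matrix.of_apply, Matrix.one_apply]
  by_cases h : a = b
  · simp [h]
  · rw [if_neg h]
    obtain ⟨j, hj⟩ := Function.ne_iff.1 h
    exact Finset.prod_eq_zero (Finset.mem_univ j) (by simp [hj])

theorem tens_smul (c : Fin n → ℂ) (f : Fin n → Matrix (Fin 2) (Fin 2) ℂ) :
    (tens fun j => c j • f j) = (∏ j, c j) • tens f := by
  ext a b
  simp [tens, Finset.prod_mul_distrib]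

theorem tens_conjTranspose (f : Fin n → Matrix (Fin 2) (Fin 2) ℂ) :
    (tens f)ᴴ = tens fun j => (f j)ᴴ := by
  ext a b
  simp [tens, Matrix.conjTranspose_apply]

theorem zmod_two_cases (x : ZMod 2) : x = 0 ∨ x = 1 := by
  revert x; decide

theorem pauli_cases (p : ZMod 2 × ZMod 2) : p = (0, 0) ∨ p = (1, 0) ∨ p = (0, 1) ∨ p = (1, 1) := by
  revert p; decide

theorem pauliOne_zero : pauliOne (0, 0) = 1 := if_pos rfl

theorem pauliOne_X : pauliOne (1, 0) = !![0, 1; 1, 0] := by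
  rw [pauliOne, if_neg (by decide), if_pos rfl]

theorem pauliOne_Z : pauliOne (0, 1) = !![1, 0; 0, -1] := by
  rw [pauliOne, if_neg (by decide), if_neg (by decide), if_pos rfl]

theorem pauliOne_Y : pauliOne (1, 1) = !![0, -Complex.I; Complex.I, 0] := by
  rw [pauliOne, if_neg (by decide), if_neg (by decide), if_neg (by decide)]

theorem one_add_one_zmod_two : (1 : ZMod 2) + 1 = 0 := by decide

theorem pauliOne_mul (p q : ZMod 2 × ZMod 2) :
    ∃ c : ℂ, star c * c = 1 ∧ pauliOne p * pauliOne q = c • pauliOne (p + q) := by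
  rcases pauli_cases p with rfl | rfl | rfl | rfl <;>
  rcases pauli_cases q with rfl | rfl | rfl | rfl <;>
  simp only [Prod.mk_add_mk, add_zero, zero_add, one_add_one_zmod_two, pauliOne_zero, pauliOne_X,
    pauliOne_Y, pauliOne_Z, Matrix.one_fin_two] <;>
  first
  | (refine ⟨1, by simp, ?_⟩; simp; done)
  | (refine ⟨Complex.I, by simp, ?_⟩; simp; done)
  | (refine ⟨-Complex.I, by simp, ?_⟩; simp; done)

theorem pauliOne_comm (p q : ZMod 2 × ZMod 2) :
    pauliOne p * pauliOne q =
      (if p.1 * q.2 + p.2 * q.1 = 0 then (1 : ℂ) else -1) • (pauliOne q * pauliOne p) := by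
  rcases pauli_cases p with rfl | rfl | rfl | rfl <;>
  rcases pauli_cases q with rfl | rfl | rfl | rfl <;>
  simp [add_zero, zero_add, one_add_one_zmod_two, pauliOne_zero, pauliOne_X,
    pauliOne_Y, pauliOne_Z, Matrix.one_fin_two]

theorem pauliOne_conjTranspose (p : ZMod 2 × ZMod 2) : (pauliOne p)ᴴ = pauliOne p := by
  rcases pauli_cases p with rfl | rfl | rfl | rfl <;>
  simp only [pauliOne_zero, pauliOne_X, pauliOne_Y, pauliOne_Z] <;>
  ext i j <;> fin_cases i <;> fin_cases j <;> simp [Matrix.one_fin_two]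

theorem pauliOne_mul_self (p : ZMod 2 × ZMod 2) : pauliOne p * pauliOne p = 1 := by
  rcases pauli_cases p with rfl | rfl | rfl | rfl <;>
  simp [pauliOne_zero, pauliOne_X, pauliOne_Y, pauliOne_Z, Matrix.one_fin_two]

theorem exists_pauliOne_sum (A : Matrix (Fin 2) (Fin 2) ℂ) :
    ∃ c : ZMod 2 × ZMod 2 → ℂ, A = ∑ p, c p • pauliOne p := by
  have hI : Complex.I * Complex.I = -1 := Complex.I_mul_I
  obtain ⟨f, h0, h1, h2, h3⟩ : ∃ f : ZMod 2 × ZMod 2 → ℂ, f (0, 0) = (A 0 0 + A 1 1) / 2 ∧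
      f (1, 0) = (A 0 1 + A 1 0) / 2 ∧ f (0, 1) = (A 0 0 - A 1 1) / 2 ∧
      f (1, 1) = Complex.I * (A 0 1 - A 1 0) / 2 :=
    ⟨fun p => if p = (0, 0) then (A 0 0 + A 1 1) / 2 else if p = (1, 0) then
      (A 0 1 + A 1 0) / 2 else if p = (0, 1) then (A 0 0 - A 1 1) / 2 else
      Complex.I * (A 0 1 - A 1 0) / 2, if_pos rfl, by simp, by simp, by simp⟩
  refine ⟨f, ?_⟩
  have hu : (Finset.univ : Finset (ZMod 2)) = {0, 1} := rfl
  rw [Fintype.sum_prod_type]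
  simp only [hu, Finset.sum_pair (zero_ne_one : (0 : ZMod 2) ≠ 1), h0, h1, h2, h3, pauliOne_zero,
    pauliOne_X, pauliOne_Y, pauliOne_Z]
  ext i j
  fin_cases i <;> fin_cases j <;> simp
  · ring
  · linear_combination ((A 0 1 - A 1 0) / 2) * hI
  · linear_combination (-(A 0 1 - A 1 0) / 2) * hI
  · ring

theorem pauliOp_mul (P R : Pauli n) :
    ∃ c : ℂ, star c * c = 1 ∧ pauliOp P * pauliOp R = c • pauliOp (P + R) := by
  choose c hc h using fun j => pauliOne_mul (P j) (R j)
  refine ⟨∏ j, c j, ?_, ?_⟩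
  · rw [star_prod, ← Finset.prod_mul_distrib]
    exact Finset.prod_eq_one fun j _ => hc j
  · rw [pauliOp_eq_tens, pauliOp_eq_tens, tens_mul, pauliOp_eq_tens, ← tens_smul]
    simp only [h]
    rfl

/-- The sign with which two Pauli operators commute. -/
def sgn (x : ZMod 2) : ℂ := if x = 0 then 1 else -1

theorem sgn_add (x y : ZMod 2) : sgn (x + y) = sgn x * sgn y := by
  rcases zmod_two_cases x with rfl | rfl <;> rcases zmod_two_cases y with rfl | rfl <;>
  simp [sgn, one_add_one_zmod_two]

theorem sgn_sum {ι : Type*} (s : Finset ι) (f : ι → ZMod 2) :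
    sgn (∑ i ∈ s, f i) = ∏ i ∈ s, sgn (f i) := by
  classical
  induction s using Finset.induction_on with
  | empty => simp [sgn]
  | insert a s ha ih => rw [Finset.sum_insert ha, Finset.prod_insert ha, sgn_add, ih]

theorem pauliOp_comm (P R : Pauli n) :
    pauliOp P * pauliOp R = sgn (symp P R) • (pauliOp R * pauliOp P) := by
  rw [pauliOp_eq_tens, pauliOp_eq_tens, tens_mul, tens_mul, symp, sgn_sum, ← tens_smul]
  congr 1
  funext j
  exact pauliOne_comm (P j) (R j)

theorem pauliOp_conjTranspose (P : Pauli n) : (pauliOp P)ᴴ = pauliOp P := by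
  simp only [pauliOp_eq_tens, tens_conjTranspose, pauliOne_conjTranspose]

theorem pauliOp_mul_self (P : Pauli n) : pauliOp P * pauliOp P = 1 := by
  simp only [pauliOp_eq_tens, tens_mul, pauliOne_mul_self, tens_one]

theorem pauliOp_zero : pauliOp (0 : Pauli n) = 1 := by
  rw [pauliOp_eq_tens, ← tens_one]
  congr 1

theorem tens_mem_span (f : Fin n → Matrix (Fin 2) (Fin 2) ℂ) :
    tens f ∈ Submodule.span ℂ (Set.range (pauliOp (n := n))) := by
  choose c hc using fun j => exists_pauliOne_sum (f j)
  have : tens f = ∑ P : Pauli n, (∏ j, c j (P j)) • pauliOp P := by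
    ext a b
    rw [Matrix.sum_apply]
    simp only [tens, pauliOp, Matrix.of_apply, Matrix.smul_apply, smul_eq_mul,
      ← Finset.prod_mul_distrib]
    rw [← Fintype.piFinset_univ, ← Finset.prod_univ_sum (fun _ => Finset.univ)
      (fun j p => c j p * pauliOne p (a j) (b j))]
    refine Finset.prod_congr rfl fun j _ => ?_
    conv_lhs => rw [hc j]
    simp [Matrix.sum_apply]
  rw [this]
  exact Submodule.sum_mem _ fun P _ => Submodule.smul_mem _ _ (Submodule.subset_span ⟨P, rfl⟩)

/-- Pauli operators span all operators. -/
theorem mem_span_pauliOp (A : Op n) : A ∈ Submodule.span ℂ (Set.range (pauliOp (n := n))) := by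
  rw [Matrix.matrix_eq_sum_single A]
  refine Submodule.sum_mem _ fun a _ => Submodule.sum_mem _ fun b _ => ?_
  have : Matrix.single a b (A a b) =
      A a b • tens fun j => Matrix.single (a j) (b j) (1 : ℂ) := by
    ext x y
    simp only [tens, Matrix.smul_apply, Matrix.of_apply, Matrix.single_apply, smul_eq_mul]
    by_cases h : a = x ∧ b = y
    · obtain ⟨rfl, rfl⟩ := h
      simp
    · rw [if_neg h]
      have : ∃ j, ¬ (a j = x j ∧ b j = y j) := by
        by_contra! h'
        exact h ⟨funext fun j => (h' j).1, funext fun j => (h' j).2⟩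
      obtain ⟨j, hj⟩ := this
      rw [Finset.prod_eq_zero (Finset.mem_univ j) (if_neg hj), mul_zero]
  rw [this]
  exact Submodule.smul_mem _ _ (tens_mem_span _)

/-- Pauli operators span the full matrix algebra, which is prime: a matrix unit placed between
nonzero entries of `A` and `B` gives a nonzero product. -/
theorem mul_mul_eq_zero_of_pauli {A B : Op n} (h : ∀ P, A * pauliOp P * B = 0) : A = 0 ∨ B = 0 := by
  have h' : ∀ X : Op n, A * X * B = 0 := by
    intro X
    induction mem_span_pauliOp X using Submodule.span_induction with
    | mem x hx => obtain ⟨P, rfl⟩ := hx; exact h P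
    | zero => simp
    | add x y _ _ hx hy => rw [mul_add, add_mul, hx, hy, add_zero]
    | smul c x _ hx => simp [hx]
  by_contra! hne
  obtain ⟨hA, hB⟩ := hne
  have h1 : ∃ i k, A i k ≠ 0 := by
    by_contra! h0
    exact hA (Matrix.ext h0)
  have h2 : ∃ l j, B l j ≠ 0 := by
    by_contra! h0
    exact hB (Matrix.ext h0)
  obtain ⟨i, k, hA⟩ := h1
  obtain ⟨l, j, hB⟩ := h2
  have h3 := congrFun (congrFun (h' (Matrix.single k l 1)) i) j
  rw [Matrix.mul_assoc, Matrix.mul_apply, Finset.sum_eq_single k] at h3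
  · rw [Matrix.single_mul_apply_same] at h3
    simp [hA, hB] at h3
  · intro b _ hb
    rw [Matrix.single_mul_apply_of_ne _ _ _ _ _ hb]
    simp
  · simp

end Tensor

end MemoryTime

namespace MemoryTime

/-! ## Products of commuting factors -/

section OfFn

theorem semiconjBy_prod_ofFn {R : Type*} [Monoid R] {m : ℕ} {x : R} {f g : Fin m → R}
    (h : ∀ i, SemiconjBy x (f i) (g i)) :
    SemiconjBy x (List.ofFn f).prod (List.ofFn g).prod := by
  induction m with
  | zero => simp
  | succ m ih =>
    simp only [List.ofFn_succ, List.prod_cons]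
    exact (h 0).mul_right (ih fun i => h i.succ)

theorem star_prod_ofFn {R : Type*} [Monoid R] [StarMul R] {m : ℕ} {f : Fin m → R}
    (hs : ∀ i, star (f i) = f i) (hc : ∀ i j, Commute (f i) (f j)) :
    star (List.ofFn f).prod = (List.ofFn f).prod := by
  induction m with
  | zero => simp
  | succ m ih =>
    simp only [List.ofFn_succ, List.prod_cons, star_mul, hs]
    rw [ih (fun i => hs i.succ) fun i j => hc i.succ j.succ]
    exact (semiconjBy_prod_ofFn fun i => hc 0 i.succ).eq.symm

theorem exists_prod_ofFn_eq_mul {R : Type*} [Monoid R] {m : ℕ} {f : Fin m → R}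
    (hc : ∀ i j, Commute (f i) (f j)) (i : Fin m) : ∃ r, (List.ofFn f).prod = f i * r := by
  induction m with
  | zero => exact i.elim0
  | succ m ih =>
    simp only [List.ofFn_succ, List.prod_cons]
    refine Fin.cases ⟨_, rfl⟩ (fun j => ?_) i
    obtain ⟨r, hr⟩ := ih (fun i j => hc i.succ j.succ) j
    exact ⟨f 0 * r, by rw [hr, ← mul_assoc, (hc 0 j.succ).eq, mul_assoc]⟩

theorem prod_ofFn_mul_of_eigen {R : Type*} [Ring R] [Algebra ℂ R] {m : ℕ} {f : Fin m → R} {x : R}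
    {c : Fin m → ℂ} (h : ∀ i, f i * x = c i • x) : (List.ofFn f).prod * x = (∏ i, c i) • x := by
  induction m with
  | zero => simp
  | succ m ih =>
    simp only [List.ofFn_succ, List.prod_cons]
    rw [mul_assoc, ih fun i => h i.succ, mul_smul_comm, h, smul_smul, Fin.prod_univ_succ, mul_comm]

/-- The distributive law for ordered products. It expands `1 = ∏ ((1 - G_a) / 2 + (1 + G_a) / 2)`
into the syndrome projectors. -/
theorem sum_prod_ofFn {R : Type*} [Ring R] {m : ℕ} (f g : Fin m → R) :
    ∑ s : Fin m → Bool, (List.ofFn fun i => if s i then f i else g i).prod =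
      (List.ofFn fun i => f i + g i).prod := by
  induction m with
  | zero => simp
  | succ m ih =>
    rw [← (Fin.consEquiv fun _ => Bool).sum_comp, Fintype.sum_prod_type]
    simp only [List.ofFn_succ, List.prod_cons, Fin.consEquiv_apply, Fin.cons_zero, Fin.cons_succ]
    simp only [← Finset.mul_sum, ih fun i => f i.succ]
    simp [← add_mul]

end OfFn

variable {D L : ℕ}

namespace Code

variable (Q : Code D L)

/-! ## Syndrome projectors -/

theorem G_eq (a : Fin Q.M) :
    ∃ c : ℂ, star c = c ∧ c * c = 1 ∧ Q.G a = c • pauliOp (Q.gen a) := by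
  refine ⟨if Q.sign a then -1 else 1, ?_, ?_, rfl⟩ <;> split_ifs <;> simp

theorem G_mul_self (a : Fin Q.M) : Q.G a * Q.G a = 1 := by
  obtain ⟨c, -, h, hG⟩ := Q.G_eq a
  rw [hG, smul_mul_smul_comm, h, pauliOp_mul_self, one_smul]

theorem G_conjTranspose (a : Fin Q.M) : (Q.G a)ᴴ = Q.G a := by
  obtain ⟨c, h, -, hG⟩ := Q.G_eq a
  rw [hG, conjTranspose_smul, h, pauliOp_conjTranspose]

theorem pauliOp_mul_G (P : Pauli Q.n) (a : Fin Q.M) :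
    pauliOp P * Q.G a = sgn (symp (Q.gen a) P) • (Q.G a * pauliOp P) := by
  obtain ⟨c, -, -, hG⟩ := Q.G_eq a
  rw [hG, mul_smul_comm, pauliOp_comm, symp_comm, smul_mul_assoc, smul_comm]

theorem G_commute (a b : Fin Q.M) : Commute (Q.G a) (Q.G b) := by
  obtain ⟨c, -, -, hG⟩ := Q.G_eq a
  rw [hG]
  refine Commute.smul_left ?_ _
  have := Q.pauliOp_mul_G (Q.gen a) b
  rw [Q.gen_comm] at this
  rw [sgn, if_pos rfl, one_smul] at this
  exact this

/-- The sign of the generator `a` on the subspace with syndrome `S`. -/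
def sg (S : Q.Cluster) (a : Fin Q.M) : ℂ := if a ∈ S then -1 else 1

theorem sg_mul_self (S : Q.Cluster) (a : Fin Q.M) : Q.sg S a * Q.sg S a = 1 := by
  unfold sg; split_ifs <;> simp

theorem sg_symmDiff (S : Q.Cluster) (P : Pauli Q.n) (a : Fin Q.M) :
    Q.sg (symmDiff S (Q.syn P)) a = Q.sg S a * sgn (symp (Q.gen a) P) := by
  by_cases h : symp (Q.gen a) P = 0
  · have h1 : a ∉ Q.syn P := fun h' => Q.mem_syn.1 h' h
    simp [sg, sgn, Finset.mem_symmDiff, h, h1]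
  · have h1 : a ∈ Q.syn P := Q.mem_syn.2 h
    by_cases h2 : a ∈ S <;> simp [sg, sgn, Finset.mem_symmDiff, h, h1, h2]

theorem proj_eq (S : Q.Cluster) :
    Q.proj S = (List.ofFn fun a => (1 / 2 : ℂ) • (1 + Q.sg S a • Q.G a)).prod := rfl

theorem fac_commute (S : Q.Cluster) (a b : Fin Q.M) :
    Commute ((1 / 2 : ℂ) • (1 + Q.sg S a • Q.G a)) ((1 / 2 : ℂ) • (1 + Q.sg S b • Q.G b)) := by
  refine Commute.smul_left (Commute.smul_right ?_ _) _
  exact (Commute.one_left _).add_left ((Commute.one_right _).add_right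
    (((Q.G_commute a b).smul_left _).smul_right _))

theorem G_mul_proj (S : Q.Cluster) (a : Fin Q.M) : Q.G a * Q.proj S = Q.sg S a • Q.proj S := by
  obtain ⟨r, hr⟩ := exists_prod_ofFn_eq_mul (Q.fac_commute S) a
  rw [proj_eq, hr, ← mul_assoc, ← smul_mul_assoc]
  congr 1
  rw [mul_smul_comm, mul_add, mul_one, mul_smul_comm, G_mul_self,
    smul_comm (Q.sg S a) (1 / 2 : ℂ)]
  congr 1
  rw [smul_add, smul_smul, sg_mul_self, one_smul, add_comm]

theorem proj_conjTranspose (S : Q.Cluster) : (Q.proj S)ᴴ = Q.proj S := by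
  refine star_prod_ofFn (fun a => ?_) (Q.fac_commute S)
  have : star (Q.sg S a) = Q.sg S a := by unfold sg; split_ifs <;> simp
  change star ((1 / 2 : ℂ) • (1 + Q.sg S a • Q.G a)) = (1 / 2 : ℂ) • (1 + Q.sg S a • Q.G a)
  rw [star_smul, star_add, star_smul, this, star_one, star_eq_conjTranspose, G_conjTranspose]
  simp

/-- Each factor of the scalar is `1` or `0` according as the two syndromes agree at `a` or not; this
gives idempotence and orthogonality together. -/
theorem proj_mul_proj_eq_smul (S S' : Q.Cluster) :
    Q.proj S' * Q.proj S = (∏ a, (1 / 2 * (1 + Q.sg S' a * Q.sg S a))) • Q.proj S := by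
  rw [Q.proj_eq S']
  refine prod_ofFn_mul_of_eigen fun a => ?_
  rw [smul_mul_assoc, add_mul, one_mul, smul_mul_assoc, G_mul_proj, mul_smul, add_smul,
    one_smul, mul_smul]

theorem proj_mul_self (S : Q.Cluster) : Q.proj S * Q.proj S = Q.proj S := by
  rw [proj_mul_proj_eq_smul, Finset.prod_eq_one, one_smul]
  intro a _
  rw [sg_mul_self]; norm_num

theorem proj_mul_proj {S S' : Q.Cluster} (h : S ≠ S') : Q.proj S * Q.proj S' = 0 := by
  rw [proj_mul_proj_eq_smul]
  have : ∃ a, Q.sg S a * Q.sg S' a = -1 := by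
    by_contra! h'
    apply h
    ext a
    have := h' a
    by_cases h1 : a ∈ S <;> by_cases h2 : a ∈ S' <;> simp [sg, h1, h2] at this ⊢
  obtain ⟨a, ha⟩ := this
  rw [Finset.prod_eq_zero (Finset.mem_univ a) (by rw [ha]; norm_num), zero_smul]

theorem sum_proj : ∑ S, Q.proj S = 1 := by
  have h := sum_prod_ofFn (fun a => (1 / 2 : ℂ) • (1 + (-1 : ℂ) • Q.G a))
    (fun a => (1 / 2 : ℂ) • (1 + (1 : ℂ) • Q.G a))
  have e : ∀ a : Fin Q.M, (1 / 2 : ℂ) • (1 + (-1 : ℂ) • Q.G a) +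
      (1 / 2 : ℂ) • (1 + (1 : ℂ) • Q.G a) = 1 := by
    intro a
    rw [← smul_add, add_add_add_comm, ← add_smul, ← two_smul ℂ (1 : Op Q.n), neg_add_cancel,
      zero_smul, add_zero, smul_smul]
    norm_num
  simp only [e] at h
  rw [show (List.ofFn fun _ : Fin Q.M => (1 : Op Q.n)).prod = 1 by
    rw [List.ofFn_const]; simp] at h
  rw [← h]
  refine Fintype.sum_equiv ⟨fun S a => decide (a ∈ S), fun s => Finset.univ.filter fun a => s a,
    fun S => by ext; simp, fun s => by ext; simp⟩ _ _ fun S => ?_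
  rw [proj_eq]
  congr 2
  funext a
  by_cases ha : a ∈ S <;> simp [sg, ha]

theorem pauliOp_mul_proj (P : Pauli Q.n) (S : Q.Cluster) :
    pauliOp P * Q.proj S = Q.proj (symmDiff S (Q.syn P)) * pauliOp P := by
  refine (semiconjBy_prod_ofFn (x := pauliOp P) fun a => ?_).eq
  change pauliOp P * ((1 / 2 : ℂ) • (1 + Q.sg S a • Q.G a)) =
    (1 / 2 : ℂ) • (1 + Q.sg (symmDiff S (Q.syn P)) a • Q.G a) * pauliOp P
  rw [mul_smul_comm, smul_mul_assoc, mul_add, add_mul, mul_one, one_mul, mul_smul_comm,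
    smul_mul_assoc, pauliOp_mul_G, sg_symmDiff, smul_smul]

/-- Frustration-freeness enters here: the common eigenvector is fixed by each factor of the
projector. -/
theorem proj_empty_ne_zero : Q.proj ∅ ≠ 0 := by
  obtain ⟨ψ, hψ, h⟩ := Q.frustration_free
  intro h0
  apply hψ
  have : ∀ l : List (Op Q.n), (∀ x ∈ l, x *ᵥ ψ = ψ) → l.prod *ᵥ ψ = ψ := by
    intro l hl
    induction l with
    | nil => simp
    | cons x l ih =>
      rw [List.prod_cons, ← Matrix.mulVec_mulVec, ih fun y hy => hl y (List.mem_cons_of_mem _ hy),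
        hl x List.mem_cons_self]
  rw [← this (List.ofFn fun a => (1 / 2 : ℂ) • (1 + Q.sg ∅ a • Q.G a)), ← proj_eq, h0,
    Matrix.zero_mulVec]
  intro x hx
  obtain ⟨a, rfl⟩ := (List.mem_ofFn' _ _).1 hx
  rw [Matrix.smul_mulVec, Matrix.add_mulVec, Matrix.one_mulVec, Matrix.smul_mulVec, G, h a]
  simp only [sg, Finset.notMem_empty, if_false, one_smul]
  rw [← two_smul ℂ ψ, smul_smul]
  norm_num

/-- If no Pauli operator had syndrome `S`, then none would have a nonzero matrix block from the
ground space to the subspace of `S`, although Pauli operators span everything. -/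
theorem exists_syn_of_proj_ne_zero {S : Q.Cluster} (h : Q.proj S ≠ 0) : ∃ P, Q.syn P = S := by
  by_contra! hS
  have key : ∀ P, Q.proj S * pauliOp P * Q.proj ∅ = 0 := fun P => by
    have hP : S ≠ symmDiff ∅ (Q.syn P) := by
      rw [show symmDiff ∅ (Q.syn P) = Q.syn P from bot_symmDiff _]
      exact (hS P).symm
    rw [mul_assoc, pauliOp_mul_proj, ← mul_assoc, Q.proj_mul_proj hP, zero_mul]
  rcases mul_mul_eq_zero_of_pauli key with h' | h'
  · exact h h'
  · exact Q.proj_empty_ne_zero h'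

/-- Signs and phases are lost in the binary representation, so a stabilizer acts on the ground space
as some phase, of which only the modulus is recorded. -/
theorem pauliOp_stab_mul_proj {P : Pauli Q.n} (h : P ∈ Q.stab) :
    ∃ c : ℂ, star c * c = 1 ∧ pauliOp P * Q.proj ∅ = c • Q.proj ∅ := by
  induction h using Submodule.span_induction with
  | mem x hx =>
    obtain ⟨a, rfl⟩ := hx
    obtain ⟨c, h1, h2, hG⟩ := Q.G_eq a
    refine ⟨c, by rw [h1, h2], ?_⟩
    have h3 : pauliOp (Q.gen a) = c • Q.G a := by rw [hG, smul_smul, h2, one_smul]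
    rw [h3, smul_mul_assoc, G_mul_proj]
    simp [sg]
  | zero => exact ⟨1, by simp, by simp [pauliOp_zero]⟩
  | add x y _ _ hx hy =>
    obtain ⟨c, h1, hx⟩ := hx
    obtain ⟨d, h2, hy⟩ := hy
    obtain ⟨e, h3, hxy⟩ := pauliOp_mul x y
    have h3' : e * star e = 1 := by rw [mul_comm]; exact h3
    refine ⟨star e * (c * d), ?_, ?_⟩
    · simp only [star_mul, star_star]
      linear_combination (star c * c * (star d * d)) * h3' + star d * d * h1 + h2
    · have : pauliOp (x + y) = star e • (pauliOp x * pauliOp y) := by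
        rw [hxy, smul_smul, h3, one_smul]
      rw [this, smul_mul_assoc, mul_assoc, hy, mul_smul_comm, hx, smul_smul, smul_smul]
      congr 1
      ring
  | smul z x _ hx =>
    rcases zmod_two_cases z with rfl | rfl
    · exact ⟨1, by simp, by simp [pauliOp_zero]⟩
    · simpa using hx

/-! ## The dimension of the syndrome subspaces -/

theorem trace_proj_syn (P : Pauli Q.n) : (Q.proj (Q.syn P)).trace = (Q.proj ∅).trace := by
  have h := Q.pauliOp_mul_proj P ∅
  rw [show symmDiff ∅ (Q.syn P) = Q.syn P from bot_symmDiff _] at h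
  have h2 : Q.proj (Q.syn P) = pauliOp P * Q.proj ∅ * pauliOp P := by
    rw [h, mul_assoc, pauliOp_mul_self, mul_one]
  rw [h2, Matrix.trace_mul_comm, ← mul_assoc, pauliOp_mul_self, one_mul]

theorem trace_proj_nonneg (S : Q.Cluster) : 0 ≤ (Q.proj S).trace := by
  have : (Q.proj S).PosSemidef := by
    have h := Matrix.posSemidef_conjTranspose_mul_self (Q.proj S)
    rwa [proj_conjTranspose, proj_mul_self] at h
  exact this.trace_nonneg

/-- The symplectic form as a bilinear form. -/
def sympForm (n : ℕ) : LinearMap.BilinForm (ZMod 2) (Pauli n) :=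
  LinearMap.mk₂ (ZMod 2) symp
    (fun a b c => by rw [symp_comm, symp_add, symp_comm c, symp_comm c])
    (fun r a b => by rw [symp_comm, symp_smul, symp_comm b, smul_eq_mul])
    (fun a b c => symp_add a b c) (fun r a b => by rw [symp_smul, smul_eq_mul])

theorem symp_single {n : ℕ} (P : Pauli n) (j : Fin n) (x : ZMod 2 × ZMod 2) :
    symp P (Pi.single j x) = (P j).1 * x.2 + (P j).2 * x.1 := by
  rw [symp, Finset.sum_eq_single j]
  · simp
  · intro i _ hi
    simp [Pi.single_eq_of_ne hi]
  · simp

theorem sympForm_nondegenerate (n : ℕ) : (sympForm n).Nondegenerate := by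
  have key : ∀ P : Pauli n, (∀ R, symp P R = 0) → P = 0 := by
    intro P hP
    funext j
    have h1 := hP (Pi.single j (0, 1))
    have h2 := hP (Pi.single j (1, 0))
    rw [symp_single] at h1 h2
    exact Prod.ext (by simpa using h1) (by simpa using h2)
  refine ⟨fun P hP => key P hP, fun P hP => key P fun R => ?_⟩
  rw [symp_comm]
  exact hP R

/-- The number of syndromes of Pauli operators. -/
theorem card_image_syn :
    (Finset.univ.image Q.syn).card = 2 ^ Module.finrank (ZMod 2) Q.stab := by
  classical
  let φ : Pauli Q.n →ₗ[ZMod 2] (Fin Q.M → ZMod 2) := LinearMap.pi fun a => sympForm Q.n (Q.gen a)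
  -- The Pauli operators without defects form the symplectic complement of the stabilizer group. The
  -- form being nondegenerate, the syndromes form a space with the dimension of the stabilizer
  -- group.
  have hker : φ.ker = (sympForm Q.n).orthogonal Q.stab := by
    ext P
    rw [LinearMap.mem_ker, LinearMap.BilinForm.mem_orthogonal_iff]
    constructor
    · intro h S hS
      change symp S P = 0
      induction hS using Submodule.span_induction with
      | mem x hx => obtain ⟨a, rfl⟩ := hx; exact congrFun h a
      | zero => rw [symp_comm, symp_zero]
      | add x y _ _ hx hy => rw [symp_comm, symp_add, symp_comm P, symp_comm P, hx, hy, add_zero]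
      | smul c x _ hx => rw [symp_comm, symp_smul, symp_comm P, hx, mul_zero]
    · intro h
      funext a
      exact h _ (Submodule.subset_span ⟨a, rfl⟩)
  have hfin : Module.finrank (ZMod 2) φ.range = Module.finrank (ZMod 2) Q.stab := by
    have h1 := φ.finrank_range_add_finrank_ker
    have h2 := LinearMap.BilinForm.finrank_orthogonal (sympForm_nondegenerate Q.n) Q.stab
    have h3 := Submodule.finrank_le Q.stab
    rw [hker] at h1
    omega
  have hcard : Fintype.card φ.range = 2 ^ Module.finrank (ZMod 2) Q.stab := by
    rw [Module.card_eq_pow_finrank (K := ZMod 2), hfin, ZMod.card]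
  rw [← hcard]
  have himg : (Finset.univ.image Q.syn).card = (Finset.univ.image φ).card := by
    have : Finset.univ.image Q.syn =
        (Finset.univ.image φ).image fun v => Finset.univ.filter fun a => v a ≠ 0 := by
      rw [Finset.image_image]
      rfl
    rw [this, Finset.card_image_of_injective]
    intro v v' h
    funext a
    have h1 := Finset.ext_iff.1 h a
    simp only [Finset.mem_filter, Finset.mem_univ, true_and] at h1
    rcases zmod_two_cases (v a) with h2 | h2 <;> rcases zmod_two_cases (v' a) with h3 | h3 <;>
      simp_all
  rw [himg, ← Set.toFinset_range, Set.toFinset_card]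
  exact Fintype.card_congr (Equiv.refl _)

/-- A syndrome subspace has dimension at most `2 ^ k`. -/
theorem trace_proj_le (S : Q.Cluster) : (Q.proj S).trace.re ≤ 2 ^ Q.k := by
  classical
  by_cases hS : Q.proj S = 0
  · rw [hS]; simp
  obtain ⟨P, rfl⟩ := Q.exists_syn_of_proj_ne_zero hS
  rw [trace_proj_syn]
  -- The subspaces of all Pauli syndromes are images of the ground space under Pauli operators, so
  -- they have the same dimension. Their number times this dimension is at most `2 ^ n`.
  have h1 : ∑ S : Q.Cluster, (Q.proj S).trace.re = 2 ^ Q.n := by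
    rw [← Complex.re_sum, ← Matrix.trace_sum, sum_proj, Matrix.trace_one]
    rw [Fintype.card_fun, Fintype.card_fin, Fintype.card_fin]
    norm_cast
  have h2 : ∑ S ∈ Finset.univ.image Q.syn, (Q.proj S).trace.re ≤ 2 ^ Q.n := by
    rw [← h1]
    exact Finset.sum_le_sum_of_subset_of_nonneg (Finset.subset_univ _) fun S _ _ =>
      (Complex.le_def.1 (Q.trace_proj_nonneg S)).1
  rw [Finset.sum_congr rfl (g := fun _ => (Q.proj ∅).trace.re) fun S hS => by
    obtain ⟨P, -, rfl⟩ := Finset.mem_image.1 hS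
    rw [trace_proj_syn], Finset.sum_const, card_image_syn, nsmul_eq_mul] at h2
  push_cast at h2
  -- Only an inequality is needed, so it does not matter that `k` is a truncated difference.
  have h3 : (2 : ℝ) ^ Q.n ≤ 2 ^ Module.finrank (ZMod 2) Q.stab * 2 ^ Q.k := by
    rw [← pow_add]
    exact pow_le_pow_right₀ (by norm_num) (by unfold k; omega)
  exact le_of_mul_le_mul_left (h2.trans h3) (by positivity)

end Code

end MemoryTime

namespace MemoryTime

/-! ## Norms of operators -/

section Norms

open scoped Matrix.Norms.L2Operator

variable {n : ℕ}

/-- The squared Euclidean norm. -/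
def nsq (v : (Fin n → Fin 2) → ℂ) : ℝ := ∑ i, ‖v i‖ ^ 2

/-- The squared Hilbert-Schmidt norm. -/
def hs (X : Op n) : ℝ := ∑ j, nsq fun i => X i j

theorem nsq_nonneg (v : (Fin n → Fin 2) → ℂ) : 0 ≤ nsq v := Finset.sum_nonneg fun _ _ => sq_nonneg _

theorem hs_nonneg (X : Op n) : 0 ≤ hs X := Finset.sum_nonneg fun _ _ => nsq_nonneg _

theorem nsq_eq (v : (Fin n → Fin 2) → ℂ) : nsq v = ‖(WithLp.toLp 2 v : EuclideanSpace ℂ _)‖ ^ 2 := by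
  rw [EuclideanSpace.norm_sq_eq]; rfl

theorem dotProduct_star_self_eq (v : (Fin n → Fin 2) → ℂ) : star v ⬝ᵥ v = (nsq v : ℂ) := by
  simp only [dotProduct, nsq, Pi.star_apply, Complex.ofReal_sum]
  refine Finset.sum_congr rfl fun i _ => ?_
  rw [Complex.ofReal_pow, ← Complex.conj_mul']
  rfl

theorem nsq_mulVec (X : Op n) (v : (Fin n → Fin 2) → ℂ) :
    (nsq (X *ᵥ v) : ℂ) = star v ⬝ᵥ ((Xᴴ * X) *ᵥ v) := by
  rw [← dotProduct_star_self_eq, Matrix.star_mulVec, ← Matrix.mulVec_mulVec,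
    Matrix.dotProduct_mulVec (star v)]

theorem nsq_mulVec_le (X : Op n) (v : (Fin n → Fin 2) → ℂ) : nsq (X *ᵥ v) ≤ ‖X‖ ^ 2 * nsq v := by
  have h := Matrix.l2_opNorm_mulVec X (WithLp.toLp 2 v)
  have h2 := pow_le_pow_left₀ (norm_nonneg _) h 2
  rw [mul_pow] at h2
  rw [nsq_eq, nsq_eq]
  exact h2

theorem norm_le_one_of_nsq {X : Op n} (h : ∀ v, nsq (X *ᵥ v) ≤ nsq v) : ‖X‖ ≤ 1 := by
  rw [Matrix.cstar_norm_def]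
  refine ContinuousLinearMap.opNorm_le_bound _ zero_le_one fun v => ?_
  rw [one_mul]
  have := h v.ofLp
  rw [nsq_eq, nsq_eq] at this
  exact (pow_le_pow_iff_left₀ (norm_nonneg _) (norm_nonneg _) (by norm_num)).1 this

theorem trace_conjTranspose_mul_self_eq (X : Op n) : (Xᴴ * X).trace = (hs X : ℂ) := by
  simp only [hs, Complex.ofReal_sum, ← dotProduct_star_self_eq]
  rfl

theorem hs_conjTranspose (X : Op n) : hs Xᴴ = hs X := by
  unfold hs nsq
  rw [Finset.sum_comm]
  simp [Matrix.conjTranspose_apply]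

theorem hs_mul_le (B A : Op n) : hs (B * A) ≤ ‖B‖ ^ 2 * hs A := by
  unfold hs
  rw [Finset.mul_sum]
  refine Finset.sum_le_sum fun j _ => ?_
  exact nsq_mulVec_le B fun i => A i j

theorem hs_mul_le' (A B : Op n) : hs (A * B) ≤ ‖B‖ ^ 2 * hs A := by
  rw [← hs_conjTranspose (A * B), Matrix.conjTranspose_mul, ← hs_conjTranspose A,
    ← Matrix.l2_opNorm_conjTranspose B]
  exact hs_mul_le _ _

theorem norm_trace_mul_le (A B : Op n) : ‖(A * B).trace‖ ≤ √(hs A) * √(hs B) := by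
  have h1 : (A * B).trace = ∑ p : (Fin n → Fin 2) × (Fin n → Fin 2), A p.1 p.2 * B p.2 p.1 := by
    rw [Fintype.sum_prod_type]; rfl
  have h2 : hs A = ∑ p : (Fin n → Fin 2) × (Fin n → Fin 2), ‖A p.1 p.2‖ ^ 2 := by
    rw [Fintype.sum_prod_type, hs, Finset.sum_comm]
    simp only [nsq]
  have h3 : hs B = ∑ p : (Fin n → Fin 2) × (Fin n → Fin 2), ‖B p.2 p.1‖ ^ 2 := by
    rw [Fintype.sum_prod_type]; rfl
  rw [h1, h2, h3, ← Real.sqrt_mul (Finset.sum_nonneg fun _ _ => sq_nonneg _)]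
  refine Real.le_sqrt_of_sq_le ?_
  refine le_trans ?_ (Finset.sum_mul_sq_le_sq_mul_sq _ _ _)
  refine pow_le_pow_left₀ (norm_nonneg _) ((norm_sum_le _ _).trans_eq ?_) 2
  exact Finset.sum_congr rfl fun _ _ => norm_mul _ _

open scoped MatrixOrder in
theorem exists_eq_of_posSemidef {τ : Op n} (hτ : τ.PosSemidef) : ∃ B : Op n, τ = Bᴴ * B :=
  CStarAlgebra.nonneg_iff_eq_star_mul_self.mp hτ.nonneg

/-- A positive operator pairs with a bounded operator as its trace does. -/
theorem norm_trace_mul_posSemidef_le {τ : Op n} (hτ : τ.PosSemidef) (X : Op n) :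
    ‖(X * τ).trace‖ ≤ ‖X‖ * τ.trace.re := by
  obtain ⟨B, rfl⟩ := exists_eq_of_posSemidef hτ
  rw [trace_conjTranspose_mul_self_eq, Complex.ofReal_re]
  have h1 : (X * (Bᴴ * B)).trace = (B * X * Bᴴ).trace := by
    rw [← Matrix.mul_assoc, Matrix.trace_mul_comm, Matrix.mul_assoc]
  rw [h1]
  refine (norm_trace_mul_le _ _).trans ?_
  rw [hs_conjTranspose]
  have h2 := Real.sqrt_le_sqrt (hs_mul_le' B X)
  rw [Real.sqrt_mul (by positivity), Real.sqrt_sq (norm_nonneg _)] at h2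
  calc _ ≤ ‖X‖ * √(hs B) * √(hs B) := by gcongr
    _ = ‖X‖ * hs B := by rw [mul_assoc, Real.mul_self_sqrt (hs_nonneg _)]

theorem hs_le_of_posSemidef {τ : Op n} (hτ : τ.PosSemidef) : hs τ ≤ τ.trace.re ^ 2 := by
  obtain ⟨B, rfl⟩ := exists_eq_of_posSemidef hτ
  have h : (hs (Bᴴ * B) : ℂ) = ((B * Bᴴ) * (B * Bᴴ)).trace := by
    rw [← trace_conjTranspose_mul_self_eq, Matrix.conjTranspose_mul,
      Matrix.conjTranspose_conjTranspose, Matrix.trace_mul_comm, Matrix.mul_assoc,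
      Matrix.trace_mul_comm]
    simp only [Matrix.mul_assoc]
  rw [trace_conjTranspose_mul_self_eq, Complex.ofReal_re]
  have h1 : ∀ i j, ‖(Bᴴ * B) i j‖ ^ 2 ≤ nsq (fun k => B k i) * nsq (fun k => B k j) := by
    intro i j
    rw [Matrix.mul_apply]
    refine le_trans (pow_le_pow_left₀ (norm_nonneg _) (norm_sum_le _ _) 2) ?_
    simp only [norm_mul, Matrix.conjTranspose_apply, norm_star]
    exact Finset.sum_mul_sq_le_sq_mul_sq _ _ _
  calc hs (Bᴴ * B) = ∑ j, ∑ i, ‖(Bᴴ * B) i j‖ ^ 2 := rfl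
    _ ≤ ∑ j, ∑ i, nsq (fun k => B k i) * nsq (fun k => B k j) :=
        Finset.sum_le_sum fun j _ => Finset.sum_le_sum fun i _ => h1 i j
    _ = hs B ^ 2 := by
        rw [sq, hs, Finset.sum_mul_sum, Finset.sum_comm]

/-- The contractions `X i` act on orthogonal subspaces and have orthogonal ranges, so Pythagoras
applies on both sides. -/
theorem norm_sum_block_le {ι : Type*} [Fintype ι] [DecidableEq ι] {X p : ι → Op n}
    (hX : ∀ i, X i * p i = X i) (hXo : ∀ i j, i ≠ j → (X i)ᴴ * X j = 0) (hn : ∀ i, ‖X i‖ ≤ 1)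
    (hpH : ∀ i, (p i)ᴴ = p i) (hpp : ∀ i, p i * p i = p i) (hsum : ∑ i, p i = 1) :
    ‖∑ i, X i‖ ≤ 1 := by
  refine norm_le_one_of_nsq fun v => ?_
  have h1 : nsq ((∑ i, X i) *ᵥ v) = ∑ i, nsq (X i *ᵥ v) := by
    have : (nsq ((∑ i, X i) *ᵥ v) : ℂ) = ((∑ i, nsq (X i *ᵥ v) : ℝ) : ℂ) := by
      rw [nsq_mulVec, Complex.ofReal_sum]
      simp only [nsq_mulVec]
      rw [← dotProduct_sum, ← Matrix.sum_mulVec]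
      congr 2
      rw [Matrix.conjTranspose_sum, Finset.sum_mul_sum]
      exact Finset.sum_congr rfl fun i _ =>
        Finset.sum_eq_single_of_mem i (Finset.mem_univ i) fun j _ hj => hXo i j hj.symm
    exact_mod_cast this
  have h2 : ∑ i, nsq (p i *ᵥ v) = nsq v := by
    have : ((∑ i, nsq (p i *ᵥ v) : ℝ) : ℂ) = (nsq v : ℂ) := by
      rw [Complex.ofReal_sum]
      simp only [nsq_mulVec, hpH, hpp]
      rw [← dotProduct_sum, ← Matrix.sum_mulVec, hsum, Matrix.one_mulVec, dotProduct_star_self_eq]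
    exact_mod_cast this
  rw [h1, ← h2]
  refine Finset.sum_le_sum fun i _ => ?_
  rw [← hX i, ← Matrix.mulVec_mulVec]
  refine (nsq_mulVec_le _ _).trans ?_
  have : ‖X i‖ ^ 2 ≤ 1 := pow_le_one₀ (norm_nonneg _) (hn i)
  exact mul_le_of_le_one_left (nsq_nonneg _) this

theorem norm_le_one_of_proj {p : Op n} (h1 : pᴴ = p) (h2 : p * p = p) : ‖p‖ ≤ 1 := by
  have := Matrix.l2_opNorm_conjTranspose_mul_self p
  rw [h1, h2] at this
  by_contra! h
  nlinarith

theorem norm_le_one_of_conjTranspose_mul_self {u : Op n} (h : uᴴ * u = 1) : ‖u‖ ≤ 1 := by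
  have h1 := Matrix.l2_opNorm_conjTranspose_mul_self u
  have h2 : ‖(1 : Op n)‖ ≤ 1 := norm_le_one_of_proj (by simp) (by simp)
  rw [h] at h1
  by_contra! h
  nlinarith

/-- The trace norm is attained on a contraction. -/
theorem exists_traceNorm_eq (X : Op n) : ∃ U : Op n, ‖U‖ ≤ 1 ∧ (U * X).trace = (traceNorm X : ℂ) := by
  classical
  set hH := Matrix.isHermitian_conjTranspose_mul_self X
  set d := hH.eigenvalues with hd
  have hd0 : ∀ i, 0 ≤ d i := (Matrix.posSemidef_conjTranspose_mul_self X).eigenvalues_nonneg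
  set W : Op n := (hH.eigenvectorUnitary : Op n) with hW
  have hWW : Wᴴ * W = 1 := (Matrix.mem_unitaryGroup_iff'.1 hH.eigenvectorUnitary.2)
  have hsp : Xᴴ * X = W * Matrix.diagonal (fun i => (d i : ℂ)) * Wᴴ := by
    have := hH.spectral_theorem
    rw [this]
    rfl
  -- The inverse of zero is zero, so `U` becomes the adjoint of the partial isometry in the polar
  -- decomposition of `X`, and `U * X` is the absolute value of `X`.
  set f : (Fin n → Fin 2) → ℂ := fun i => ((√(d i))⁻¹ : ℝ) with hf
  have hfH : (Matrix.diagonal f)ᴴ = Matrix.diagonal f := by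
    rw [Matrix.diagonal_conjTranspose]
    congr 1
    funext i
    simp [hf]
  have hfd : ∀ i, f i * (d i : ℂ) = (√(d i) : ℂ) := by
    intro i
    rw [hf, ← Complex.ofReal_mul]
    congr 1
    by_cases h : d i = 0
    · simp [h]
    · have : √(d i) ≠ 0 := (Real.sqrt_ne_zero (hd0 i)).2 h
      field_simp
      exact (Real.sq_sqrt (hd0 i)).symm
  set U := W * Matrix.diagonal f * Wᴴ * Xᴴ with hU
  have hUX : ∀ Y : Op n, W * Matrix.diagonal f * Wᴴ * Xᴴ * (X * Y) =
      W * Matrix.diagonal (fun i => (√(d i) : ℂ)) * (Wᴴ * Y) := by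
    intro Y
    have : W * Matrix.diagonal f * Wᴴ * Xᴴ * (X * Y) =
        W * Matrix.diagonal f * Wᴴ * (Xᴴ * X) * Y := by simp only [Matrix.mul_assoc]
    rw [this, hsp]
    have : W * Matrix.diagonal f * Wᴴ * (W * Matrix.diagonal (fun i => (d i : ℂ)) * Wᴴ) * Y =
        W * (Matrix.diagonal f * (Wᴴ * W) * Matrix.diagonal (fun i => (d i : ℂ))) * (Wᴴ * Y) := by
      simp only [Matrix.mul_assoc]
    rw [this, hWW, Matrix.mul_one, Matrix.diagonal_mul_diagonal]
    simp only [hfd]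
  refine ⟨U, ?_, ?_⟩
  · have h1 : U * Uᴴ = W * Matrix.diagonal (fun i => (√(d i) : ℂ) * f i) * Wᴴ := by
      rw [hU]
      have : (W * Matrix.diagonal f * Wᴴ * Xᴴ)ᴴ = X * (W * Matrix.diagonal f * Wᴴ) := by
        simp only [Matrix.conjTranspose_mul, Matrix.conjTranspose_conjTranspose, hfH,
          Matrix.mul_assoc]
      rw [this, hUX]
      have : W * Matrix.diagonal (fun i => (√(d i) : ℂ)) * (Wᴴ * (W * Matrix.diagonal f * Wᴴ)) =
          W * (Matrix.diagonal (fun i => (√(d i) : ℂ)) * (Wᴴ * W) * Matrix.diagonal f) * Wᴴ := by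
        simp only [Matrix.mul_assoc]
      rw [this, hWW, Matrix.mul_one, Matrix.diagonal_mul_diagonal]
    have hWn := norm_le_one_of_conjTranspose_mul_self hWW
    have hWn' : ‖Wᴴ‖ ≤ 1 := by rwa [Matrix.l2_opNorm_conjTranspose]
    have hdiag : ‖Matrix.diagonal (fun i => (√(d i) : ℂ) * f i)‖ ≤ 1 := by
      rw [Matrix.l2_opNorm_diagonal]
      refine (pi_norm_le_iff_of_nonneg zero_le_one).2 fun i => ?_
      rw [hf, ← Complex.ofReal_mul, Complex.norm_real, Real.norm_eq_abs, abs_of_nonneg (by positivity)]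
      exact mul_inv_le_one
    have h2 := Matrix.l2_opNorm_conjTranspose_mul_self Uᴴ
    rw [Matrix.conjTranspose_conjTranspose, Matrix.l2_opNorm_conjTranspose, h1] at h2
    have h3 : ‖W * Matrix.diagonal (fun i => (√(d i) : ℂ) * f i) * Wᴴ‖ ≤ 1 := by
      refine (norm_mul_le _ _).trans (mul_le_one₀ ((norm_mul_le _ _).trans
        (mul_le_one₀ hWn (norm_nonneg _) hdiag)) (norm_nonneg _) hWn')
    rw [h2] at h3
    by_contra! h
    nlinarith
  · have := hUX 1
    rw [Matrix.mul_one, Matrix.mul_one] at this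
    rw [hU, this, Matrix.trace_mul_comm, ← Matrix.mul_assoc, hWW, Matrix.one_mul,
      Matrix.trace_diagonal, traceNorm, Complex.ofReal_sum]

end Norms

end MemoryTime

namespace MemoryTime

variable {D L : ℕ}

namespace Code

variable (Q : Code D L)

/-! ## Functions of the syndrome and jump operators -/

/-- The operator acting as the scalar `f S` on the subspace with syndrome `S`. -/
def wt (f : Q.Cluster → ℂ) : Op Q.n := ∑ S, f S • Q.proj S

theorem wt_mul_proj (f : Q.Cluster → ℂ) (S : Q.Cluster) : Q.wt f * Q.proj S = f S • Q.proj S := by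
  rw [wt, Finset.sum_mul, Finset.sum_eq_single S]
  · rw [smul_mul_assoc, proj_mul_self]
  · intro S' _ h
    rw [smul_mul_assoc, proj_mul_proj _ h, smul_zero]
  · simp

theorem proj_mul_wt (f : Q.Cluster → ℂ) (S : Q.Cluster) : Q.proj S * Q.wt f = f S • Q.proj S := by
  rw [wt, Finset.mul_sum, Finset.sum_eq_single S]
  · rw [mul_smul_comm, proj_mul_self]
  · intro S' _ h
    rw [mul_smul_comm, proj_mul_proj _ h.symm, smul_zero]
  · simp

theorem ext_proj_right {X Y : Op Q.n} (h : ∀ S, X * Q.proj S = Y * Q.proj S) : X = Y := by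
  rw [← mul_one X, ← mul_one Y, ← Q.sum_proj, Finset.mul_sum, Finset.mul_sum]
  exact Finset.sum_congr rfl fun S _ => h S

theorem ext_proj_left {X Y : Op Q.n} (h : ∀ S, Q.proj S * X = Q.proj S * Y) : X = Y := by
  rw [← one_mul X, ← one_mul Y, ← Q.sum_proj, Finset.sum_mul, Finset.sum_mul]
  exact Finset.sum_congr rfl fun S _ => h S

theorem ext_proj {X Y : Op Q.n}
    (h : ∀ S S', Q.proj S' * X * Q.proj S = Q.proj S' * Y * Q.proj S) : X = Y :=
  Q.ext_proj_right fun S => Q.ext_proj_left fun S' => by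
    rw [← mul_assoc, h S S', mul_assoc]

theorem wt_mul (f g : Q.Cluster → ℂ) : Q.wt f * Q.wt g = Q.wt (f * g) :=
  Q.ext_proj_right fun S => by
    rw [mul_assoc, wt_mul_proj, mul_smul_comm, wt_mul_proj, wt_mul_proj, smul_smul, mul_comm]
    rfl

theorem wt_conjTranspose (f : Q.Cluster → ℂ) : (Q.wt f)ᴴ = Q.wt (star f) := by
  rw [wt, conjTranspose_sum, wt]
  refine Finset.sum_congr rfl fun S _ => ?_
  rw [conjTranspose_smul, proj_conjTranspose]
  rfl

theorem wt_one : Q.wt 1 = 1 := by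
  rw [wt, ← Q.sum_proj]
  simp

theorem H_eq_wt (J : ℝ) : Q.H J = Q.wt fun S => (Q.energy J S : ℂ) :=
  Q.ext_proj_right fun S => by
    rw [wt_mul_proj, H, neg_mul, smul_mul_assoc, Finset.sum_mul]
    simp only [G_mul_proj]
    rw [← Finset.sum_smul, smul_smul, ← neg_smul]
    congr 1
    have : ∑ a, Q.sg S a = Q.M - 2 * S.card := by
      have h : ∀ a, Q.sg S a = 1 - 2 * (if a ∈ S then 1 else 0) := by
        intro a; unfold sg; split_ifs <;> norm_num
      simp only [h, Finset.sum_sub_distrib, ← Finset.mul_sum]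
      simp
    rw [this, energy]
    push_cast
    ring

theorem proj_jump_proj (J : ℝ) (A : Op Q.n) (ω : ℝ) (S S' : Q.Cluster) :
    Q.proj S' * Q.jump J A ω * Q.proj S =
      if Q.energy J S - Q.energy J S' = ω then Q.proj S' * A * Q.proj S else 0 := by
  rw [jump, Finset.mul_sum, Finset.sum_mul, Finset.sum_eq_single (S, S')]
  · split_ifs
    · have : Q.proj S' * (Q.proj S' * A * Q.proj S) * Q.proj S =
          (Q.proj S' * Q.proj S') * A * (Q.proj S * Q.proj S) := by simp only [mul_assoc]
      rw [this, proj_mul_self, proj_mul_self]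
    · simp
  · rintro ⟨T, T'⟩ - h
    split_ifs
    · have e : Q.proj S' * (Q.proj T' * A * Q.proj T) * Q.proj S =
          (Q.proj S' * Q.proj T') * A * (Q.proj T * Q.proj S) := by simp only [mul_assoc]
      rw [e]
      by_cases h1 : T = S
      · have h2 : S' ≠ T' := fun h2 => h (by rw [h1, h2])
        rw [proj_mul_proj _ h2, zero_mul, zero_mul]
      · rw [proj_mul_proj _ h1, mul_zero]
    · simp
  · simp

theorem jump_mul_wt (J : ℝ) (A : Op Q.n) (ω : ℝ) {f g : Q.Cluster → ℂ} {c : ℂ}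
    (h : ∀ S S', Q.energy J S - Q.energy J S' = ω → f S = c * g S') :
    Q.jump J A ω * Q.wt f = c • (Q.wt g * Q.jump J A ω) :=
  Q.ext_proj fun S S' => by
    have e1 : Q.proj S' * (Q.jump J A ω * Q.wt f) * Q.proj S =
        Q.proj S' * Q.jump J A ω * (Q.wt f * Q.proj S) := by simp only [mul_assoc]
    have e2 : Q.proj S' * (c • (Q.wt g * Q.jump J A ω)) * Q.proj S =
        c • (Q.proj S' * Q.wt g * Q.jump J A ω * Q.proj S) := by
      rw [mul_smul_comm, smul_mul_assoc]; simp only [mul_assoc]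
    rw [e1, e2, wt_mul_proj, proj_mul_wt, mul_smul_comm, smul_mul_assoc, smul_mul_assoc, smul_smul,
      proj_jump_proj]
    split_ifs with hω
    · rw [h S S' hω]
    · simp

theorem jump_conjTranspose (J : ℝ) {A : Op Q.n} (hA : A.IsHermitian) (ω : ℝ) :
    (Q.jump J A ω)ᴴ = Q.jump J A (-ω) :=
  Q.ext_proj fun S S' => by
    have e : Q.proj S' * (Q.jump J A ω)ᴴ * Q.proj S = (Q.proj S * Q.jump J A ω * Q.proj S')ᴴ := by
      simp only [conjTranspose_mul, proj_conjTranspose, mul_assoc]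
    rw [e, proj_jump_proj, proj_jump_proj]
    have hiff : Q.energy J S' - Q.energy J S = ω ↔ Q.energy J S - Q.energy J S' = -ω := by
      constructor <;> intro h <;> linarith
    simp only [hiff]
    split_ifs
    · simp only [conjTranspose_mul, proj_conjTranspose, hA.eq, mul_assoc]
    · simp

theorem neg_mem_bohr {J ω : ℝ} (h : ω ∈ Q.bohr J) : -ω ∈ Q.bohr J := by
  simp only [bohr, Finset.mem_image, Finset.mem_univ, true_and, Prod.exists] at h ⊢
  obtain ⟨S, S', h⟩ := h
  exact ⟨S', S, by linarith⟩

/-- The weight `y ^ |S|`. -/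
def pwt (y : ℝ) : Op Q.n := Q.wt fun S => ((y ^ S.card : ℝ) : ℂ)

theorem pwt_mul_pwt (y z : ℝ) : Q.pwt y * Q.pwt z = Q.pwt (y * z) := by
  rw [pwt, pwt, wt_mul, pwt]
  congr 1
  funext S
  simp only [Pi.mul_apply]
  rw [← Complex.ofReal_mul, mul_pow]

theorem pwt_one : Q.pwt 1 = 1 := by
  rw [← wt_one, pwt]
  congr 1
  funext S
  simp

theorem pwt_conjTranspose (y : ℝ) : (Q.pwt y)ᴴ = Q.pwt y := by
  rw [pwt, wt_conjTranspose]
  congr 1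
  funext S
  simp

theorem energy_sub (J : ℝ) (S S' : Q.Cluster) :
    Q.energy J S - Q.energy J S' = 2 * J * (S.card - S'.card) := by
  simp only [energy]; ring

/-- A defect costs the energy `2 J`, so the weight `exp (-2 J β) ^ |S|` is the Gibbs state up to a
factor. The identity expresses that the jump lowers the energy by `ω`. -/
theorem jump_mul_pwt (J β : ℝ) (A : Op Q.n) (ω : ℝ) :
    Q.jump J A ω * Q.pwt (Real.exp (-(2 * J * β))) =
      ((Real.exp (-β * ω) : ℝ) : ℂ) • (Q.pwt (Real.exp (-(2 * J * β))) * Q.jump J A ω) :=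
  Q.jump_mul_wt J A ω fun S S' h => by
    rw [← Complex.ofReal_mul, ← Real.exp_nat_mul, ← Real.exp_nat_mul, ← Real.exp_add, ← h,
      energy_sub]
    congr 2
    ring

theorem jumpH_mul_pwt (J β : ℝ) {A : Op Q.n} (hA : A.IsHermitian) (ω : ℝ) :
    (Q.jump J A ω)ᴴ * Q.jump J A ω * Q.pwt (Real.exp (-(2 * J * β))) =
      Q.pwt (Real.exp (-(2 * J * β))) * ((Q.jump J A ω)ᴴ * Q.jump J A ω) := by
  rw [mul_assoc, jump_mul_pwt, mul_smul_comm, jump_conjTranspose _ _ hA, ← mul_assoc, jump_mul_pwt,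
    smul_mul_assoc, smul_smul, ← Complex.ofReal_mul, ← Real.exp_add]
  simp [mul_assoc]

theorem H_conjTranspose (J : ℝ) : (Q.H J)ᴴ = Q.H J := by
  rw [H_eq_wt, wt_conjTranspose]
  congr 1
  funext S
  simp

theorem H_mul_wt (J : ℝ) (f : Q.Cluster → ℂ) : Q.H J * Q.wt f = Q.wt f * Q.H J := by
  rw [H_eq_wt, wt_mul, wt_mul, mul_comm]

/-! ## The generator is dissipative -/

/-- The right-hand side of the master equation. -/
def liouvillian (J : ℝ) (B : Bath Q.n) (ρ : Op Q.n) : Op Q.n :=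
  -(Complex.I • (Q.H J * ρ - ρ * Q.H J)) + Q.lindblad J B ρ

theorem star_trace_eq {n : ℕ} {X : Op n} (h : Xᴴ = X) : X.trace.im = 0 := by
  have : star X.trace = X.trace := by rw [← trace_conjTranspose, h]
  exact Complex.conj_eq_iff_im.1 this

theorem trace_H_term (J y : ℝ) (X : Op Q.n) :
    (Xᴴ * (-(Complex.I • (Q.H J * (Q.pwt y * X) - Q.pwt y * X * Q.H J)))).trace.re = 0 := by
  have h1 : ((Xᴴ * (Q.H J * (Q.pwt y * X))).trace).im = 0 := by
    refine star_trace_eq ?_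
    simp only [conjTranspose_mul, conjTranspose_conjTranspose, pwt_conjTranspose, H_conjTranspose]
    rw [pwt, mul_assoc, mul_assoc, ← mul_assoc (Q.wt _), ← H_mul_wt, mul_assoc]
  have h2 : ((Xᴴ * (Q.pwt y * X * Q.H J)).trace).im = 0 := by
    refine Complex.conj_eq_iff_im.1 ?_
    change star _ = _
    rw [← trace_conjTranspose]
    simp only [conjTranspose_mul, conjTranspose_conjTranspose, pwt_conjTranspose, H_conjTranspose]
    rw [mul_assoc, trace_mul_comm]
    simp only [mul_assoc]
  rw [mul_neg, mul_smul_comm, trace_neg, trace_smul, mul_sub, trace_sub, smul_eq_mul, Complex.neg_re,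
    Complex.mul_re, Complex.sub_im, h1, h2]
  simp

/-- Completing the square with the commutator of `Vᴴ` and `X`. The first term on the right has a
sign for positive `σ`; the other two cancel after summation over the frequencies, by `sum_rate_eq`.
-/
theorem trace_dissipator {n : ℕ} {V X σ : Op n} (hσ : σᴴ = σ) :
    (Xᴴ * (V * (σ * X) * Vᴴ - (1 / 2 : ℂ) • (σ * X * (Vᴴ * V) + Vᴴ * V * (σ * X)))).trace.re =
      -(1 / 2) * (((Vᴴ * X - X * Vᴴ)ᴴ * (σ * (Vᴴ * X - X * Vᴴ))).trace.re) +
      1 / 2 * (Xᴴ * (V * σ * Vᴴ) * X).trace.re - 1 / 2 * (Xᴴ * (Vᴴ * V * σ) * X).trace.re := by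
  have e1 : (Xᴴ * (V * (σ * X) * Vᴴ - (1 / 2 : ℂ) • (σ * X * (Vᴴ * V) + Vᴴ * V * (σ * X)))).trace =
      (Xᴴ * (V * (σ * X) * Vᴴ)).trace - (1 / 2 : ℂ) * ((Xᴴ * (σ * X * (Vᴴ * V))).trace +
        (Xᴴ * (Vᴴ * V * σ) * X).trace) := by
    rw [mul_sub, mul_smul_comm, mul_add, trace_sub, trace_smul, trace_add, smul_eq_mul]
    simp only [mul_assoc]
  have e2 : ((Vᴴ * X - X * Vᴴ)ᴴ * (σ * (Vᴴ * X - X * Vᴴ))).trace =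
      (Xᴴ * (V * σ * Vᴴ) * X).trace - (Xᴴ * (V * (σ * X) * Vᴴ)).trace -
        ((Xᴴ * (V * (σ * X) * Vᴴ))ᴴ).trace + (Xᴴ * (σ * X * (Vᴴ * V))).trace := by
    have c1 : (V * (Xᴴ * (σ * (X * Vᴴ)))).trace = (Xᴴ * (σ * X * (Vᴴ * V))).trace := by
      rw [trace_mul_comm]; simp only [mul_assoc]
    rw [← c1]
    simp only [conjTranspose_sub, conjTranspose_mul, conjTranspose_conjTranspose, hσ, sub_mul,
      mul_sub, trace_sub, mul_assoc]
    ring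
  have e3 : ((Xᴴ * (V * (σ * X) * Vᴴ))ᴴ).trace.re = (Xᴴ * (V * (σ * X) * Vᴴ)).trace.re := by
    rw [trace_conjTranspose]; rfl
  rw [e1, e2]
  simp only [Complex.sub_re, Complex.add_re, e3, Complex.mul_re]
  norm_num
  ring

/-- Moving the Gibbs weight through the jump produces `exp (-β ω)`, which detailed balance absorbs
into the rate at `-ω`. The adjoint of a jump is the jump at `-ω`, so the two sums match under `ω ↦
-ω`. -/
theorem sum_rate_eq {J β κ hmax : ℝ} {w : ℕ} {B : Bath Q.n} (hB : Q.IsDaviesBath w κ hmax β B)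
    (i : Fin B.m) :
    ∑ ω ∈ Q.bohr J, (B.h i ω : ℂ) • (Q.jump J (B.A i) ω * Q.pwt (Real.exp (-(2 * J * β))) *
        (Q.jump J (B.A i) ω)ᴴ) =
      ∑ ω ∈ Q.bohr J, (B.h i ω : ℂ) • ((Q.jump J (B.A i) ω)ᴴ * Q.jump J (B.A i) ω *
        Q.pwt (Real.exp (-(2 * J * β)))) := by
  refine Finset.sum_nbij' (fun ω => -ω) (fun ω => -ω) (fun ω h => Q.neg_mem_bohr h)
    (fun ω h => Q.neg_mem_bohr h) (fun ω _ => neg_neg ω) (fun ω _ => neg_neg ω) fun ω _ => ?_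
  rw [jump_mul_pwt, smul_mul_assoc, smul_smul, ← Complex.ofReal_mul, mul_comm (B.h i ω),
    ← hB.detailed_balance, jumpH_mul_pwt _ _ _ (hB.selfAdjoint i),
    jump_conjTranspose _ _ (hB.selfAdjoint i), jump_conjTranspose _ _ (hB.selfAdjoint i), neg_neg,
    mul_assoc]

/-- With `σ` the Gibbs weight and `X = σ⁻¹ ρ`, this is half of the time derivative of `tr (ρᴴ σ⁻¹
ρ)`. The commutator term of `trace_dissipator` is a squared norm, because `σ` is the square of a
self-adjoint weight. -/
theorem dissipative {J β κ hmax : ℝ} {w : ℕ} {B : Bath Q.n} (hB : Q.IsDaviesBath w κ hmax β B)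
    (X : Op Q.n) :
    (Xᴴ * Q.liouvillian J B (Q.pwt (Real.exp (-(2 * J * β))) * X)).trace.re ≤ 0 := by
  set σ := Q.pwt (Real.exp (-(2 * J * β))) with hσ
  have hσH : σᴴ = σ := Q.pwt_conjTranspose _
  have hsq : σ = Q.pwt (Real.exp (-(J * β))) * Q.pwt (Real.exp (-(J * β))) := by
    rw [pwt_mul_pwt, ← Real.exp_add, hσ]; congr 2; ring
  rw [liouvillian, mul_add, trace_add, Complex.add_re, trace_H_term, zero_add, lindblad,
    Finset.mul_sum, trace_sum, Complex.re_sum]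
  refine Finset.sum_nonpos fun i _ => ?_
  rw [Finset.mul_sum, trace_sum, Complex.re_sum]
  have key : ∀ ω ∈ Q.bohr J, (Xᴴ * ((B.h i ω : ℂ) • (Q.jump J (B.A i) ω * (σ * X) *
      (Q.jump J (B.A i) ω)ᴴ - (1 / 2 : ℂ) • (σ * X * ((Q.jump J (B.A i) ω)ᴴ * Q.jump J (B.A i) ω) +
        (Q.jump J (B.A i) ω)ᴴ * Q.jump J (B.A i) ω * (σ * X))))).trace.re ≤
      1 / 2 * ((Xᴴ * ((B.h i ω : ℂ) • (Q.jump J (B.A i) ω * σ * (Q.jump J (B.A i) ω)ᴴ)) * X).trace.re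
        - (Xᴴ * ((B.h i ω : ℂ) • ((Q.jump J (B.A i) ω)ᴴ * Q.jump J (B.A i) ω * σ)) * X).trace.re) := by
    intro ω _
    simp only [mul_smul_comm, smul_mul_assoc, trace_smul, smul_eq_mul, Complex.re_ofReal_mul]
    rw [trace_dissipator hσH]
    set V := Q.jump J (B.A i) ω
    have hN : 0 ≤ ((Vᴴ * X - X * Vᴴ)ᴴ * (σ * (Vᴴ * X - X * Vᴴ))).trace.re := by
      set N := Vᴴ * X - X * Vᴴ
      have : Nᴴ * (σ * N) = (Q.pwt (Real.exp (-(J * β))) * N)ᴴ * (Q.pwt (Real.exp (-(J * β))) * N) := by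
        rw [hsq, conjTranspose_mul, pwt_conjTranspose]; simp only [mul_assoc]
      rw [this, trace_conjTranspose_mul_self_eq, Complex.ofReal_re]
      exact hs_nonneg _
    nlinarith [mul_nonneg (hB.rate_nonneg i ω) hN]
  refine (Finset.sum_le_sum key).trans_eq ?_
  rw [← Finset.mul_sum, Finset.sum_sub_distrib, ← Complex.re_sum, ← Complex.re_sum, ← trace_sum,
    ← trace_sum, ← Finset.sum_mul, ← Finset.sum_mul, ← Finset.mul_sum, ← Finset.mul_sum,
    Q.sum_rate_eq hB i, sub_self, mul_zero]

end Code

end MemoryTime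

/-! ### Weighted norm, self-adjointness and positivity along the evolution -/

namespace MemoryTime

variable {D L : ℕ}

section EntrywiseDeriv

variable {n : ℕ}

/-- Entrywise differentiability on the half line `t ≥ 0`. -/
def HasEntryDeriv (f : ℝ → Op n) (f' : Op n) (t : ℝ) : Prop :=
  ∀ x y, HasDerivWithinAt (fun s => f s x y) (f' x y) (Set.Ici 0) t

namespace HasEntryDeriv

variable {f g : ℝ → Op n} {f' g' : Op n} {t : ℝ}

theorem const (A : Op n) (t : ℝ) : HasEntryDeriv (fun _ => A) 0 t :=
  fun _ _ => hasDerivWithinAt_const _ _ _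

theorem sub (hf : HasEntryDeriv f f' t) (hg : HasEntryDeriv g g' t) :
    HasEntryDeriv (fun s => f s - g s) (f' - g') t := fun x y => (hf x y).sub (hg x y)

theorem mul (hf : HasEntryDeriv f f' t) (hg : HasEntryDeriv g g' t) :
    HasEntryDeriv (fun s => f s * g s) (f' * g t + f t * g') t := fun x y => by
  have h := HasDerivWithinAt.fun_sum (u := Finset.univ)
    fun k _ => (hf x k).mul (hg k y)
  simpa only [Matrix.add_apply, Matrix.mul_apply, Finset.sum_add_distrib, Pi.mul_apply] using h

theorem const_mul (A : Op n) (hf : HasEntryDeriv f f' t) :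
    HasEntryDeriv (fun s => A * f s) (A * f') t := by
  simpa using (const A t).mul hf

theorem conjTranspose (hf : HasEntryDeriv f f' t) : HasEntryDeriv (fun s => (f s)ᴴ) f'ᴴ t :=
  fun x y => (hf y x).star

theorem trace (hf : HasEntryDeriv f f' t) :
    HasDerivWithinAt (fun s => (f s).trace) f'.trace (Set.Ici 0) t :=
  HasDerivWithinAt.fun_sum fun k _ => hf k k

theorem continuousWithinAt (hf : HasEntryDeriv f f' t) : ContinuousWithinAt f (Set.Ici 0) t :=
  continuousWithinAt_pi.2 fun x => continuousWithinAt_pi.2 fun y => (hf x y).continuousWithinAt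

end HasEntryDeriv

theorem HasDerivWithinAt.complex_re {f : ℝ → ℂ} {f' : ℂ} {s : Set ℝ} {t : ℝ}
    (h : HasDerivWithinAt f f' s t) : HasDerivWithinAt (fun s => (f s).re) f'.re s t :=
  Complex.reCLM.hasFDerivAt.comp_hasDerivWithinAt t h

/-- The quadratic form of an operator. -/
def quad (X : Op n) (v : (Fin n → Fin 2) → ℂ) : ℝ := (star v ⬝ᵥ (X *ᵥ v)).re

theorem quad_add (X Y : Op n) (v : (Fin n → Fin 2) → ℂ) : quad (X + Y) v = quad X v + quad Y v := by
  simp [quad, Matrix.add_mulVec, dotProduct_add]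

theorem quad_smul (c : ℝ) (X : Op n) (v : (Fin n → Fin 2) → ℂ) :
    quad ((c : ℂ) • X) v = c * quad X v := by
  simp [quad, Matrix.smul_mulVec, dotProduct_smul]

theorem quad_one (v : (Fin n → Fin 2) → ℂ) : quad 1 v = nsq v := by
  rw [quad, Matrix.one_mulVec, dotProduct_star_self_eq, Complex.ofReal_re]

theorem quad_smul_vec (X : Op n) (c : ℝ) (v : (Fin n → Fin 2) → ℂ) :
    quad X ((c : ℂ) • v) = c ^ 2 * quad X v := by
  simp [quad, Matrix.mulVec_smul, dotProduct_smul, star_smul, smul_dotProduct, sq, mul_assoc]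

theorem posSemidef_of_quad {X : Op n} (hX : Xᴴ = X) (h : ∀ v, nsq v = 1 → 0 ≤ quad X v) :
    X.PosSemidef := by
  refine Matrix.PosSemidef.of_dotProduct_mulVec_nonneg hX fun v => ?_
  have him : (star v ⬝ᵥ (X *ᵥ v)).im = 0 := Matrix.IsHermitian.im_star_dotProduct_mulVec_self hX v
  have hre : 0 ≤ quad X v := by
    by_cases hv : nsq v = 0
    · have : v = 0 := by
        funext i
        have := (Finset.sum_eq_zero_iff_of_nonneg (fun i _ => sq_nonneg _)).1 hv i (Finset.mem_univ i)
        simpa using this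
      simp [this, quad]
    · have hpos : 0 < nsq v := lt_of_le_of_ne (nsq_nonneg v) (Ne.symm hv)
      have h1 : nsq ((((√(nsq v))⁻¹ : ℝ) : ℂ) • v) = 1 := by
        rw [← quad_one, quad_smul_vec, quad_one, inv_pow, Real.sq_sqrt hpos.le,
          inv_mul_cancel₀ hv]
      have h2 := h _ h1
      rw [quad_smul_vec] at h2
      exact nonneg_of_mul_nonneg_right h2 (by positivity)
  rw [Complex.le_def]
  exact ⟨hre, him.symm⟩

theorem quad_nonneg {X : Op n} (h : X.PosSemidef) (v : (Fin n → Fin 2) → ℂ) : 0 ≤ quad X v :=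
  (Complex.le_def.1 (h.dotProduct_mulVec_nonneg v)).1

theorem continuous_quad : Continuous fun p : Op n × ((Fin n → Fin 2) → ℂ) => quad p.1 p.2 := by
  unfold quad
  refine Complex.continuous_re.comp ?_
  refine Continuous.dotProduct ?_ ?_
  · fun_prop
  · exact Continuous.matrix_mulVec continuous_fst continuous_snd

theorem isCompact_nsq_one : IsCompact {v : (Fin n → Fin 2) → ℂ | nsq v = 1} := by
  refine (isCompact_closedBall (0 : (Fin n → Fin 2) → ℂ) 1).of_isClosed_subset ?_ ?_
  · refine isClosed_eq ?_ continuous_const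
    unfold nsq
    fun_prop
  · intro v hv
    rw [mem_closedBall_zero_iff]
    refine (pi_norm_le_iff_of_nonneg zero_le_one).2 fun i => ?_
    have : ‖v i‖ ^ 2 ≤ nsq v := Finset.single_le_sum (f := fun i => ‖v i‖ ^ 2)
      (fun i _ => sq_nonneg _) (Finset.mem_univ i)
    rw [hv] at this
    exact (sq_le_one_iff₀ (norm_nonneg _)).1 this

theorem HasEntryDeriv.quad {f : ℝ → Op n} {f' : Op n} {t : ℝ} (hf : HasEntryDeriv f f' t)
    (v : (Fin n → Fin 2) → ℂ) :
    HasDerivWithinAt (fun s => MemoryTime.quad (f s) v) (MemoryTime.quad f' v) (Set.Ici 0) t := by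
  refine HasDerivWithinAt.complex_re ?_
  have : ∀ X : Op n, star v ⬝ᵥ (X *ᵥ v) = (X * Matrix.vecMulVec v (star v)).trace := by
    intro X
    rw [Matrix.mul_vecMulVec, Matrix.trace_vecMulVec, dotProduct_comm]
  simp only [this]
  have h := (hf.mul (HasEntryDeriv.const (Matrix.vecMulVec v (star v)) t)).trace
  simpa using h

end EntrywiseDeriv

namespace Code

variable (Q : Code D L)

theorem liouvillian_sub (J : ℝ) (B : Bath Q.n) (X Y : Op Q.n) :
    Q.liouvillian J B (X - Y) = Q.liouvillian J B X - Q.liouvillian J B Y := by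
  have h : Q.lindblad J B (X - Y) = Q.lindblad J B X - Q.lindblad J B Y := by
    simp only [lindblad, ← Finset.sum_sub_distrib, ← smul_sub]
    refine Finset.sum_congr rfl fun i _ => Finset.sum_congr rfl fun ω _ => ?_
    congr 1
    simp only [mul_sub, sub_mul, smul_sub, smul_add]
    abel
  rw [liouvillian, liouvillian, liouvillian, h]
  simp only [mul_sub, sub_mul, smul_sub]
  abel

theorem liouvillian_smul (J : ℝ) (B : Bath Q.n) (c : ℂ) (X : Op Q.n) :
    Q.liouvillian J B (c • X) = c • Q.liouvillian J B X := by
  have h : Q.lindblad J B (c • X) = c • Q.lindblad J B X := by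
    rw [lindblad, lindblad, Finset.smul_sum]
    refine Finset.sum_congr rfl fun i _ => ?_
    rw [Finset.smul_sum]
    refine Finset.sum_congr rfl fun ω _ => ?_
    rw [mul_smul_comm, smul_mul_assoc, smul_mul_assoc, mul_smul_comm, ← smul_add,
      smul_comm (1 / 2 : ℂ) c, ← smul_sub, smul_comm]
  have h2 : -(Complex.I • (Q.H J * (c • X) - c • X * Q.H J)) =
      c • -(Complex.I • (Q.H J * X - X * Q.H J)) := by
    generalize Q.H J = Y
    rw [Matrix.mul_smul, Matrix.smul_mul]
    module
  rw [liouvillian, h, h2, liouvillian, smul_add]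

theorem liouvillian_conjTranspose (J : ℝ) (B : Bath Q.n) (X : Op Q.n) :
    (Q.liouvillian J B X)ᴴ = Q.liouvillian J B Xᴴ := by
  rw [liouvillian, liouvillian, conjTranspose_add, lindblad, lindblad, conjTranspose_sum]
  refine congrArg₂ (· + ·) ?_ ?_
  · simp only [conjTranspose_neg, conjTranspose_smul, conjTranspose_sub, conjTranspose_mul,
      H_conjTranspose]
    rw [← smul_neg, neg_sub, ← neg_smul]
    simp [smul_sub]
  · refine Finset.sum_congr rfl fun i _ => ?_
    rw [conjTranspose_sum]
    refine Finset.sum_congr rfl fun ω _ => ?_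
    simp only [conjTranspose_smul, conjTranspose_sub, conjTranspose_add, conjTranspose_mul,
      conjTranspose_conjTranspose, mul_assoc]
    simp [add_comm]

/-- `ρ` solves the master equation. -/
def Solves (J : ℝ) (B : Bath Q.n) (ρ : ℝ → Op Q.n) : Prop :=
  ∀ t, 0 ≤ t → HasEntryDeriv ρ (Q.liouvillian J B (ρ t)) t

/-- The weighted Hilbert-Schmidt norm decreases. -/
theorem Solves.hs_le {J β κ hmax : ℝ} {w : ℕ} {B : Bath Q.n} (hB : Q.IsDaviesBath w κ hmax β B)
    {ρ : ℝ → Op Q.n} (h : Q.Solves J B ρ) {t : ℝ} (ht : 0 ≤ t) :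
    hs (Q.pwt (Real.exp (J * β)) * ρ t) ≤ hs (Q.pwt (Real.exp (J * β)) * ρ 0) := by
  set W := Q.pwt (Real.exp (J * β)) with hW
  have hWH : Wᴴ = W := Q.pwt_conjTranspose _
  set σ := Q.pwt (Real.exp (-(2 * J * β))) with hσ
  have hσW : σ * (W * W) = 1 := by
    rw [hσ, hW, pwt_mul_pwt, pwt_mul_pwt, ← Real.exp_add, ← Real.exp_add, ← pwt_one]
    congr 1
    rw [Real.exp_eq_one_iff]; ring
  have hre : ∀ X : Op Q.n, hs X = (Xᴴ * X).trace.re := fun X => by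
    rw [trace_conjTranspose_mul_self_eq, Complex.ofReal_re]
  have hd : ∀ s, 0 ≤ s → HasDerivWithinAt (fun s => hs (W * ρ s))
      (2 * ((W * (W * ρ s))ᴴ * Q.liouvillian J B (ρ s)).trace.re) (Set.Ici 0) s := by
    intro s hs
    have h1 := (h s hs).const_mul W
    have h2 := HasDerivWithinAt.complex_re (h1.conjTranspose.mul h1).trace
    simp only [hre]
    convert h2 using 1
    rw [trace_add, Complex.add_re]
    have e1 : ((W * Q.liouvillian J B (ρ s))ᴴ * (W * ρ s)).trace.re =
        ((W * ρ s)ᴴ * (W * Q.liouvillian J B (ρ s))).trace.re := by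
      have : (W * Q.liouvillian J B (ρ s))ᴴ * (W * ρ s) =
          ((W * ρ s)ᴴ * (W * Q.liouvillian J B (ρ s)))ᴴ := by
        simp only [conjTranspose_mul, conjTranspose_conjTranspose, mul_assoc]
      rw [this, trace_conjTranspose]; rfl
    rw [e1]
    have e2 : (W * (W * ρ s))ᴴ * Q.liouvillian J B (ρ s) =
        (W * ρ s)ᴴ * (W * Q.liouvillian J B (ρ s)) := by
      rw [conjTranspose_mul W (W * ρ s), hWH, mul_assoc]
    rw [e2]; ring
  have hanti : AntitoneOn (fun s => hs (W * ρ s)) (Set.Ici 0) := by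
    refine antitoneOn_of_deriv_nonpos (convex_Ici 0) (fun s hs => (hd s hs).continuousWithinAt) ?_ ?_
    · intro s hs
      rw [interior_Ici] at hs
      exact ((hd s (le_of_lt hs)).hasDerivAt (Ici_mem_nhds hs)).differentiableAt.differentiableWithinAt
    · intro s hs
      rw [interior_Ici] at hs
      rw [((hd s (le_of_lt hs)).hasDerivAt (Ici_mem_nhds hs)).deriv]
      -- The operator `X = W (W ρ)` is `σ⁻¹ ρ`, so the generator is evaluated at `σ X = ρ`.
      have := Q.dissipative hB (J := J) (W * (W * ρ s))
      rw [← hσ, ← mul_assoc W, ← mul_assoc σ, hσW, one_mul] at this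
      rw [← mul_assoc W]
      linarith
  exact hanti (Set.mem_Ici.2 le_rfl) ht ht

theorem eq_zero_of_hs {n : ℕ} {X : Op n} (h : hs X = 0) : X = 0 := by
  have h1 : (Xᴴ * X).trace = 0 := by rw [trace_conjTranspose_mul_self_eq, h]; simp
  exact Matrix.trace_conjTranspose_mul_self_eq_zero_iff.1 h1

/-- The difference of `ρ` and its adjoint is a solution that starts at zero, and the decreasing
weighted norm keeps it there. -/
theorem Solves.hermitian {J β κ hmax : ℝ} {w : ℕ} {B : Bath Q.n}
    (hB : Q.IsDaviesBath w κ hmax β B) {ρ : ℝ → Op Q.n} (h : Q.Solves J B ρ)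
    (h0 : (ρ 0)ᴴ = ρ 0) {t : ℝ} (ht : 0 ≤ t) : (ρ t)ᴴ = ρ t := by
  have hs' : Q.Solves J B fun s => (ρ s)ᴴ - ρ s := fun s hs => by
    rw [liouvillian_sub, ← liouvillian_conjTranspose]
    exact (h s hs).conjTranspose.sub (h s hs)
  have h1 := Solves.hs_le Q hB hs' ht
  have h2 : hs (Q.pwt (Real.exp (J * β)) * ((ρ 0)ᴴ - ρ 0)) = 0 := by
    rw [h0, sub_self, mul_zero]; simp [hs, nsq]
  rw [h2] at h1
  have h3 := eq_zero_of_hs (le_antisymm h1 (hs_nonneg _))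
  have h4 : Q.pwt (Real.exp (-(J * β))) * (Q.pwt (Real.exp (J * β)) * ((ρ t)ᴴ - ρ t)) = 0 := by
    rw [h3, mul_zero]
  rw [← mul_assoc, pwt_mul_pwt, ← Real.exp_add, neg_add_cancel, Real.exp_zero, pwt_one, one_mul] at h4
  exact sub_eq_zero.1 h4

/-- Every term with `Y` next to `v` vanishes. What remains are the gain terms, quadratic forms of
`Y` at the vectors `Vᴴ v` with nonnegative rates. -/
theorem quad_liouvillian_nonneg {J β κ hmax : ℝ} {w : ℕ} {B : Bath Q.n}
    (hB : Q.IsDaviesBath w κ hmax β B) {Y : Op Q.n} (hY : Y.PosSemidef)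
    {v : (Fin Q.n → Fin 2) → ℂ} (hv : Y *ᵥ v = 0) : 0 ≤ quad (Q.liouvillian J B Y) v := by
  have hr : ∀ X : Op Q.n, star v ⬝ᵥ ((X * Y) *ᵥ v) = 0 := fun X => by
    rw [← mulVec_mulVec, hv, mulVec_zero, dotProduct_zero]
  have hl : ∀ X : Op Q.n, star v ⬝ᵥ ((Y * X) *ᵥ v) = 0 := fun X => by
    have : star v ᵥ* Y = 0 := by
      have h := congrArg star hv
      rwa [star_mulVec, hY.1, star_zero] at h
    rw [← mulVec_mulVec, dotProduct_mulVec, this, zero_dotProduct]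
  rw [liouvillian, quad_add]
  have h1 : quad (-(Complex.I • (Q.H J * Y - Y * Q.H J))) v = 0 := by
    rw [quad, neg_mulVec, smul_mulVec, sub_mulVec, dotProduct_neg, dotProduct_smul, dotProduct_sub,
      hr, hl]
    simp
  rw [h1, zero_add, lindblad, quad]
  simp only [Matrix.sum_mulVec, dotProduct_sum, Complex.re_sum, smul_mulVec, sub_mulVec, add_mulVec,
    dotProduct_smul, dotProduct_sub, dotProduct_add, hr, hl]
  refine Finset.sum_nonneg fun i _ => Finset.sum_nonneg fun ω _ => ?_
  simp only [add_zero, smul_eq_mul, Complex.re_ofReal_mul]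
  refine mul_nonneg (hB.rate_nonneg i ω) ?_
  have := quad_nonneg hY ((Q.jump J (B.A i) ω)ᴴ *ᵥ v)
  rw [quad, star_mulVec, conjTranspose_conjTranspose, ← dotProduct_mulVec, mulVec_mulVec,
    mulVec_mulVec] at this
  rwa [mul_zero, sub_zero]

/-- A first-exit argument. Add the multiple `ε exp ((C + 1) t)` of the identity and take the first
time at which the quadratic form vanishes at a unit vector `u`. There the operator is positive and
annihilates `u`, so by `quad_liouvillian_nonneg` the form has a strictly positive derivative at `u`.
But it comes down to zero from positive values. Finally let `ε` be small. -/
theorem IsEvolution.posSemidef_of_nonneg {J β κ hmax : ℝ} {w : ℕ} {B : Bath Q.n}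
    (hB : Q.IsDaviesBath w κ hmax β B) {ρ : ℝ → Op Q.n} (h : Q.IsEvolution J B ρ)
    {t : ℝ} (ht : 0 ≤ t) : (ρ t).PosSemidef := by
  have hH : ∀ s, 0 ≤ s → (ρ s)ᴴ = ρ s := fun s hs => Solves.hermitian Q hB h.master h.posSemidef.1 hs
  have hsol : Q.Solves J B ρ := h.master
  obtain ⟨C, hC⟩ := isCompact_nsq_one.exists_bound_of_continuousOn
    (f := fun v => quad (Q.liouvillian J B 1) v)
    (continuous_quad.comp (Continuous.prodMk_right _)).continuousOn
  have main : ∀ ε : ℝ, 0 < ε → ∀ v, nsq v = 1 →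
      0 < quad (ρ t) v + ε * Real.exp ((C + 1) * t) := by
    intro ε hε v hv
    by_contra! hneg
    -- Replacing the time by its maximum with `0` extends the solution continuously to negative
    -- times, where nothing is known about it.
    set φ : ℝ → ((Fin Q.n → Fin 2) → ℂ) → ℝ :=
      fun s v => quad (ρ (max s 0)) v + ε * Real.exp ((C + 1) * s) with hφ
    have hcont : Continuous fun s => ρ (max s 0) := by
      have h1 : ContinuousOn ρ (Set.Ici 0) := fun s hs => (hsol s hs).continuousWithinAt
      exact h1.comp_continuous (by fun_prop) fun s => Set.mem_Ici.2 (le_max_right s 0)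
    have hφc : Continuous fun p : ℝ × ((Fin Q.n → Fin 2) → ℂ) => φ p.1 p.2 := by
      refine Continuous.add ?_ (by fun_prop)
      exact continuous_quad.comp ((hcont.comp continuous_fst).prodMk continuous_snd)
    set K : Set (ℝ × ((Fin Q.n → Fin 2) → ℂ)) :=
      (Set.Icc 0 t ×ˢ {v | nsq v = 1}) ∩ {p | φ p.1 p.2 ≤ 0} with hK
    have hKc : IsCompact K :=
      (isCompact_Icc.prod isCompact_nsq_one).inter_right (isClosed_le hφc continuous_const)
    have hKn : K.Nonempty := ⟨(t, v), ⟨⟨ht, le_rfl⟩, hv⟩, by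
      simp only [hφ, Set.mem_ofPred_eq, max_eq_left ht]; exact hneg⟩
    obtain ⟨⟨s, u⟩, ⟨⟨⟨hs0, hst⟩, hu⟩, hsu⟩, hmin⟩ := hKc.exists_isMinOn hKn
      continuous_fst.continuousOn
    have hbefore : ∀ s', 0 ≤ s' → s' < s → ∀ u', nsq u' = 1 → 0 < φ s' u' := by
      intro s' h0 hlt u' hu'
      by_contra! hle
      have := hmin (show (s', u') ∈ K from ⟨⟨⟨h0, (hlt.le.trans hst)⟩, hu'⟩, hle⟩)
      exact absurd this (not_le.2 hlt)
    have hspos : 0 < s := by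
      rcases hs0.lt_or_eq with h' | h'
      · exact h'
      · exfalso
        have h1 : 0 ≤ quad (ρ 0) u := quad_nonneg h.posSemidef u
        simp only at hs0 h'
        subst h'
        simp only [hφ, Set.mem_ofPred_eq, max_self, mul_zero, Real.exp_zero] at hsu
        linarith
    set e := ε * Real.exp ((C + 1) * s) with he
    have hepos : 0 < e := by positivity
    set Y : Op Q.n := ρ s + (e : ℂ) • 1 with hY
    have hYq : ∀ u', nsq u' = 1 → quad Y u' = φ s u' := by
      intro u' hu'
      rw [hY, quad_add, quad_smul, quad_one, hu', mul_one, hφ]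
      simp only [max_eq_left hspos.le, he]
    have hleft : ∀ u', nsq u' = 1 → 0 ≤ φ s u' := by
      intro u' hu'
      have h1 : Filter.Tendsto (fun s' => φ s' u') (nhdsWithin s (Set.Iio s)) (nhds (φ s u')) :=
        ((hφc.comp (Continuous.prodMk_left u')).tendsto s).mono_left nhdsWithin_le_nhds
      refine ge_of_tendsto h1 ?_
      filter_upwards [Ioo_mem_nhdsLT hspos] with s' hs'
      exact (hbefore s' hs'.1.le hs'.2 u' hu').le
    have hYP : Y.PosSemidef := by
      refine posSemidef_of_quad ?_ fun u' hu' => by rw [hYq u' hu']; exact hleft u' hu'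
      rw [hY, conjTranspose_add, hH s hspos.le, conjTranspose_smul, conjTranspose_one]
      simp
    have hφ0 : φ s u = 0 := le_antisymm hsu (hleft u hu)
    have hYu : Y *ᵥ u = 0 := by
      refine (hYP.dotProduct_mulVec_zero_iff u).1 ?_
      refine Complex.ext ?_ (Matrix.IsHermitian.im_star_dotProduct_mulVec_self hYP.1 u)
      change quad Y u = 0
      rw [hYq u hu, hφ0]
    have hder : HasDerivAt (fun s' => φ s' u)
        (quad (Q.liouvillian J B (ρ s)) u + ε * (Real.exp ((C + 1) * s) * (C + 1))) s := by
      have h1 : HasDerivAt (fun s' => quad (ρ s') u) (quad (Q.liouvillian J B (ρ s)) u) s :=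
        ((hsol s hspos.le).quad u).hasDerivAt (Ici_mem_nhds hspos)
      have h2 : HasDerivAt (fun s' => quad (ρ (max s' 0)) u) (quad (Q.liouvillian J B (ρ s)) u) s := by
        refine h1.congr_of_eventuallyEq ?_
        filter_upwards [Ioi_mem_nhds hspos] with s' hs'
        rw [max_eq_left (le_of_lt hs')]
      refine h2.add (HasDerivAt.const_mul ε ?_)
      have h3 : HasDerivAt (fun s' : ℝ => (C + 1) * s') (C + 1) s := by
        simpa using (hasDerivAt_id s).const_mul (C + 1)
      exact h3.exp
    have hdle : quad (Q.liouvillian J B (ρ s)) u + ε * (Real.exp ((C + 1) * s) * (C + 1)) ≤ 0 := by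
      have h1 := hder.tendsto_slope.mono_left
        (nhdsWithin_mono s (show Set.Iio s ⊆ {s}ᶜ from fun x hx => ne_of_lt hx))
      refine le_of_tendsto h1 ?_
      filter_upwards [Ioo_mem_nhdsLT hspos] with s' hs'
      rw [slope_def_field, hφ0, sub_zero]
      exact div_nonpos_of_nonneg_of_nonpos (hbefore s' hs'.1.le hs'.2 u hu).le (by linarith [hs'.2])
    have hρ : Q.liouvillian J B (ρ s) = Q.liouvillian J B Y - (e : ℂ) • Q.liouvillian J B 1 := by
      rw [← liouvillian_smul, ← liouvillian_sub, hY, add_sub_cancel_right]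
    have h1 : quad (Q.liouvillian J B (ρ s)) u =
        quad (Q.liouvillian J B Y) u - e * quad (Q.liouvillian J B 1) u := by
      rw [hρ, sub_eq_add_neg, quad_add, ← neg_smul, ← Complex.ofReal_neg, quad_smul]; ring
    have h2 := Q.quad_liouvillian_nonneg hB (J := J) hYP hYu
    have h3 := (le_abs_self _).trans (hC u hu)
    rw [h1] at hdle
    have h4 : e * quad (Q.liouvillian J B 1) u ≤ e * C := by gcongr
    have h5 : ε * (Real.exp ((C + 1) * s) * (C + 1)) = e * C + e := by rw [he]; ring
    linarith
  refine posSemidef_of_quad (hH t ht) fun v hv => ?_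
  by_contra! hneg
  have := main (-quad (ρ t) v / Real.exp ((C + 1) * t)) (by
    have := Real.exp_pos ((C + 1) * t); exact div_pos (by linarith) this) v hv
  rw [div_mul_cancel₀ _ (Real.exp_pos _).ne'] at this
  linarith

end Code

end MemoryTime

namespace MemoryTime

variable {D L : ℕ}

namespace Code

variable (Q : Code D L)

/-! ## Counting generators and defects -/

/-- The lower corner of a generator that touches the qubit has in each direction the coordinate of
the qubit or one less, which leaves `2 ^ D` cubes. -/
theorem card_gen_at_le [NeZero L] {r : ℕ}
    (hr : ∀ c, (Finset.univ.filter fun a => Q.cube a = c).card ≤ r) (j : Fin Q.n) :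
    (Finset.univ.filter fun a => Q.gen a j ≠ 0).card ≤ 2 ^ D * r := by
  classical
  set cs : Finset (Site D L) :=
    Fintype.piFinset fun i => ({Q.site j i, Q.site j i - 1} : Finset (ZMod L)) with hcs
  have h1 : (Finset.univ.filter fun a => Q.gen a j ≠ 0) ⊆
      cs.biUnion fun c => Finset.univ.filter fun a => Q.cube a = c := by
    intro a ha
    have hb := Q.gen_local a j (Finset.mem_filter.1 ha).2
    refine Finset.mem_biUnion.2 ⟨Q.cube a, Fintype.mem_piFinset.2 fun i => ?_, by simp⟩
    have h := hb i
    rw [Finset.mem_insert, Finset.mem_singleton]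
    rcases Nat.le_one_iff_eq_zero_or_eq_one.1 h with h | h
    · left
      rw [ZMod.val_eq_zero, sub_eq_zero] at h
      exact h.symm
    · right
      have : Q.site j i - Q.cube a i = 1 := by
        rw [← ZMod.natCast_zmod_val (Q.site j i - Q.cube a i), h, Nat.cast_one]
      rw [← this]; ring
  calc _ ≤ _ := Finset.card_le_card h1
    _ ≤ ∑ c ∈ cs, (Finset.univ.filter fun a => Q.cube a = c).card := Finset.card_biUnion_le
    _ ≤ ∑ c ∈ cs, r := Finset.sum_le_sum fun c _ => hr c
    _ = cs.card * r := by rw [Finset.sum_const, smul_eq_mul]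
    _ ≤ 2 ^ D * r := by
        gcongr
        rw [hcs, Fintype.card_piFinset]
        calc _ ≤ ∏ _i : Fin D, 2 := Finset.prod_le_prod' fun i _ => Finset.card_le_two
          _ = 2 ^ D := by simp

theorem card_syn_le [NeZero L] {r : ℕ}
    (hr : ∀ c, (Finset.univ.filter fun a => Q.cube a = c).card ≤ r) {F : Pauli Q.n}
    {s : Finset (Fin Q.n)} (hF : ∀ j, F j ≠ 0 → j ∈ s) :
    (Q.syn F).card ≤ s.card * (2 ^ D * r) := by
  classical
  have h1 : Q.syn F ⊆ s.biUnion fun j => Finset.univ.filter fun a => Q.gen a j ≠ 0 := by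
    intro a ha
    rw [mem_syn, symp] at ha
    obtain ⟨j, -, hj⟩ := Finset.exists_ne_zero_of_sum_ne_zero ha
    refine Finset.mem_biUnion.2 ⟨j, hF j fun h => hj (by simp [h]), ?_⟩
    exact Finset.mem_filter.2 ⟨Finset.mem_univ _, fun h => hj (by simp [h])⟩
  calc _ ≤ _ := Finset.card_le_card h1
    _ ≤ ∑ j ∈ s, (Finset.univ.filter fun a => Q.gen a j ≠ 0).card := Finset.card_biUnion_le
    _ ≤ ∑ _j ∈ s, 2 ^ D * r := Finset.sum_le_sum fun j _ => Q.card_gen_at_le hr j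
    _ = s.card * (2 ^ D * r) := by rw [Finset.sum_const, smul_eq_mul]

theorem card_symmDiff_le {ι : Type*} [DecidableEq ι] (S T : Finset ι) :
    (symmDiff S T).card ≤ S.card + T.card :=
  (Finset.card_le_card (Finset.symmDiff_subset_union)).trans (Finset.card_union_le _ _)

theorem card_le_mul_pow [NeZero L] {ι : Type*} [Fintype ι] {r : ℕ} {f : ι → Site D L}
    (hr : ∀ c, (Finset.univ.filter fun a => f a = c).card ≤ r) : Fintype.card ι ≤ r * L ^ D := by
  classical
  have h := Finset.card_le_mul_card_image_of_maps_to (s := Finset.univ) (t := Finset.univ) (f := f)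
    (fun a _ => Finset.mem_univ _) r fun c _ => hr c
  simpa [ZMod.card] using h

/-! ### Reachable errors and observables seen through the decoder -/

/-- Errors built from steps that act on at most `w` qubits, with never more than `m` defects. -/
inductive Reach (Q : Code D L) (w m : ℕ) : Pauli Q.n → Prop
  | zero : Reach Q w m 0
  | step {E F : Pauli Q.n} (s : Finset (Fin Q.n)) : s.card ≤ w → Reach Q w m E →
      (∀ j, F j ≠ 0 → j ∈ s) → (Q.syn (E + F)).card ≤ m → Reach Q w m (E + F)

variable {Q}

theorem Reach.card_le {w m : ℕ} {E : Pauli Q.n} (h : Reach Q w m E) : (Q.syn E).card ≤ m := by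
  cases h with
  | zero => simp [syn_zero]
  | step _ _ _ _ h => exact h

/-- A step on `w` qubits is carried out qubit by qubit. At each stage the part already applied has
created at most `w 2 ^ D r` defects in addition to the initial ones. -/
theorem LowPath.add [NeZero L] {r m w : ℕ}
    (hr : ∀ c, (Finset.univ.filter fun a => Q.cube a = c).card ≤ r) {E : Pauli Q.n}
    (hE : (Q.syn E).card ≤ m) (h : LowPath Q (m + w * (2 ^ D * r)) E) (s : Finset (Fin Q.n)) :
    s.card ≤ w → ∀ F : Pauli Q.n, (∀ j, F j ≠ 0 → j ∈ s) →
      LowPath Q (m + w * (2 ^ D * r)) (E + F) := by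
  classical
  induction s using Finset.induction_on with
  | empty =>
    intro _ F hF
    have : F = 0 := funext fun j => by
      by_contra h0; simpa using hF j h0
    rwa [this, add_zero]
  | insert j s hj ih =>
    intro hs F hF
    have hF0 : F = Function.update F j 0 + Pi.single j (F j) := by
      funext i
      by_cases hi : i = j
      · subst hi; simp
      · simp [Function.update_of_ne hi, Pi.single_eq_of_ne hi]
    have h1 := ih ((Finset.card_le_card (Finset.subset_insert j s)).trans hs) (Function.update F j 0)
      (fun i hi => by
        by_cases hij : i = j
        · subst hij; simp at hi
        · rw [Function.update_of_ne hij] at hi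
          exact Finset.mem_of_mem_insert_of_ne (hF i hi) hij)
    rw [hF0, ← add_assoc]
    refine .step j h1 (fun i hi => Pi.single_eq_of_ne hi _) ?_
    rw [add_assoc, ← hF0, syn_add]
    refine (card_symmDiff_le _ _).trans (add_le_add hE ((Q.card_syn_le hr hF).trans ?_))
    gcongr

theorem Reach.lowPath [NeZero L] {r m w : ℕ}
    (hr : ∀ c, (Finset.univ.filter fun a => Q.cube a = c).card ≤ r) {E : Pauli Q.n}
    (h : Reach Q w m E) : LowPath Q (m + w * (2 ^ D * r)) E := by
  induction h with
  | zero => exact .zero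
  | step s hs hE hF _ ih => exact LowPath.add hr hE.card_le ih s hs _ hF

variable (Q)

/-- The syndromes of the reachable errors. -/
def ReachSyn (w m : ℕ) (S : Q.Cluster) : Prop := ∃ E, Reach Q w m E ∧ Q.syn E = S

theorem ReachSyn.step {w m : ℕ} {S : Q.Cluster} (h : Q.ReachSyn w m S) {F : Pauli Q.n}
    {s : Finset (Fin Q.n)} (hs : s.card ≤ w) (hF : ∀ j, F j ≠ 0 → j ∈ s)
    (hc : (symmDiff S (Q.syn F)).card ≤ m) : Q.ReachSyn w m (symmDiff S (Q.syn F)) := by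
  obtain ⟨E, hE, rfl⟩ := h
  rw [← syn_add] at hc ⊢
  exact ⟨E + F, .step s hs hE hF hc, rfl⟩

/-- The observable `U` seen through the decoder on the subspace with syndrome `S`. -/
def blk (dec : Q.Cluster → Pauli Q.n) (U : Op Q.n) (S : Q.Cluster) : Op Q.n :=
  Q.proj S * pauliOp (dec S) * U * pauliOp (dec S) * Q.proj S

open Classical in
/-- The observable `U` seen through the decoder on the subspaces with syndromes in `R`. -/
def obs (dec : Q.Cluster → Pauli Q.n) (R : Q.Cluster → Prop) (U : Op Q.n) : Op Q.n :=
  ∑ S ∈ Finset.univ.filter R, Q.blk dec U S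

variable (dec : Q.Cluster → Pauli Q.n) (R : Q.Cluster → Prop) (U : Op Q.n)

theorem proj_mul_blk_of_ne {S S' : Q.Cluster} (h : S' ≠ S) : Q.proj S' * Q.blk dec U S = 0 := by
  rw [blk]; simp only [← mul_assoc]; rw [proj_mul_proj _ h]; simp only [zero_mul]

theorem blk_mul_proj_of_ne {S S' : Q.Cluster} (h : S' ≠ S) : Q.blk dec U S * Q.proj S' = 0 := by
  rw [blk, mul_assoc, proj_mul_proj _ h.symm, mul_zero]

theorem proj_mul_blk (S : Q.Cluster) : Q.proj S * Q.blk dec U S = Q.blk dec U S := by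
  rw [blk]; simp only [← mul_assoc]; rw [proj_mul_self]

theorem blk_mul_proj (S : Q.Cluster) : Q.blk dec U S * Q.proj S = Q.blk dec U S := by
  rw [blk, mul_assoc, proj_mul_self]

theorem proj_mul_obs {S : Q.Cluster} (h : R S) : Q.proj S * Q.obs dec R U = Q.blk dec U S := by
  rw [obs, Finset.mul_sum, Finset.sum_eq_single S, proj_mul_blk]
  · intro T _ hT
    exact Q.proj_mul_blk_of_ne dec U hT.symm
  · intro h'; exact absurd (by simpa using h) h'

theorem proj_mul_obs_of_not {S : Q.Cluster} (h : ¬ R S) : Q.proj S * Q.obs dec R U = 0 := by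
  rw [obs, Finset.mul_sum]
  refine Finset.sum_eq_zero fun T hT => Q.proj_mul_blk_of_ne dec U ?_
  rintro rfl
  exact h (by simpa using hT)

theorem obs_mul_proj {S : Q.Cluster} (h : R S) : Q.obs dec R U * Q.proj S = Q.blk dec U S := by
  rw [obs, Finset.sum_mul, Finset.sum_eq_single S, blk_mul_proj]
  · intro T _ hT
    exact Q.blk_mul_proj_of_ne dec U hT.symm
  · intro h'; exact absurd (by simpa using h) h'

theorem obs_mul_proj_of_not {S : Q.Cluster} (h : ¬ R S) : Q.obs dec R U * Q.proj S = 0 := by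
  rw [obs, Finset.sum_mul]
  refine Finset.sum_eq_zero fun T hT => Q.blk_mul_proj_of_ne dec U ?_
  rintro rfl
  exact h (by simpa using hT)

theorem proj_mul_obs_comm (S : Q.Cluster) :
    Q.proj S * Q.obs dec R U = Q.obs dec R U * Q.proj S := by
  by_cases h : R S
  · rw [proj_mul_obs _ _ _ _ h, obs_mul_proj _ _ _ _ h]
  · rw [proj_mul_obs_of_not _ _ _ _ h, obs_mul_proj_of_not _ _ _ _ h]

theorem wt_mul_obs_comm (f : Q.Cluster → ℂ) : Q.wt f * Q.obs dec R U = Q.obs dec R U * Q.wt f := by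
  rw [wt, Finset.sum_mul, Finset.mul_sum]
  refine Finset.sum_congr rfl fun S _ => ?_
  rw [smul_mul_assoc, mul_smul_comm, proj_mul_obs_comm]

theorem proj_pauliOp_proj_of_ne {F : Pauli Q.n} {S S' : Q.Cluster}
    (h : S' ≠ symmDiff S (Q.syn F)) : Q.proj S' * pauliOp F * Q.proj S = 0 := by
  rw [mul_assoc, pauliOp_mul_proj, ← mul_assoc, proj_mul_proj _ h, zero_mul]

theorem proj_syn_mul {P : Pauli Q.n} {S : Q.Cluster} (h : Q.syn P = S) :
    Q.proj S * pauliOp P = pauliOp P * Q.proj ∅ := by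
  rw [pauliOp_mul_proj, show symmDiff ∅ (Q.syn P) = Q.syn P from bot_symmDiff _, h]

theorem mul_proj_syn {P : Pauli Q.n} {S : Q.Cluster} (h : Q.syn P = S) :
    pauliOp P * Q.proj S = Q.proj ∅ * pauliOp P := by
  rw [pauliOp_mul_proj, h, symmDiff_self]; rfl

variable {dec}

/-- Carried to the ground space by the decoder, `F` becomes a stabilizer, hence a scalar, which
moves past `U`. -/
theorem commutator_block_eq_zero {F : Pauli Q.n} {S S' : Q.Cluster} (hS : Q.syn (dec S) = S)
    (hS' : Q.syn (dec S') = S') (h : dec S' + F + dec S ∈ Q.stab) :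
    Q.blk dec U S' * pauliOp F * Q.proj S = Q.proj S' * pauliOp F * Q.blk dec U S := by
  obtain ⟨c₁, -, h1⟩ := pauliOp_mul (dec S') F
  obtain ⟨c₂, -, h2⟩ := pauliOp_mul (dec S' + F) (dec S)
  obtain ⟨c₃, -, h3⟩ := Q.pauliOp_stab_mul_proj h
  have hW : pauliOp (dec S') * pauliOp F * pauliOp (dec S) * Q.proj ∅ =
      (c₁ * (c₂ * c₃)) • Q.proj ∅ := by
    rw [h1, smul_mul_assoc, h2, smul_mul_assoc, smul_mul_assoc, h3, smul_smul, smul_smul, mul_assoc]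
  have hb : ∀ T, Q.syn (dec T) = T → Q.blk dec U T =
      pauliOp (dec T) * Q.proj ∅ * U * (Q.proj ∅ * pauliOp (dec T)) := fun T hT => by
    rw [blk, Q.proj_syn_mul hT, mul_assoc _ (pauliOp (dec T)) (Q.proj T), Q.mul_proj_syn hT]
  have hp : ∀ T, Q.syn (dec T) = T → Q.proj T = pauliOp (dec T) * (Q.proj ∅ * pauliOp (dec T)) :=
    fun T hT => by rw [← Q.mul_proj_syn hT, ← mul_assoc, pauliOp_mul_self, one_mul]
  rw [hb S hS, hb S' hS', hp S hS, hp S' hS']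
  have e1 : pauliOp (dec S') * Q.proj ∅ * U * (Q.proj ∅ * pauliOp (dec S')) * pauliOp F *
      (pauliOp (dec S) * (Q.proj ∅ * pauliOp (dec S))) =
      pauliOp (dec S') * Q.proj ∅ * U * (Q.proj ∅ *
        (pauliOp (dec S') * pauliOp F * pauliOp (dec S) * Q.proj ∅) * pauliOp (dec S)) := by
    simp only [mul_assoc]
  have e2 : pauliOp (dec S') * (Q.proj ∅ * pauliOp (dec S')) * pauliOp F *
      (pauliOp (dec S) * Q.proj ∅ * U * (Q.proj ∅ * pauliOp (dec S))) =
      pauliOp (dec S') * (Q.proj ∅ *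
        (pauliOp (dec S') * pauliOp F * pauliOp (dec S) * Q.proj ∅)) * U *
        (Q.proj ∅ * pauliOp (dec S)) := by
    simp only [mul_assoc]
  rw [e1, e2, hW]
  simp only [mul_smul_comm, smul_mul_assoc, proj_mul_self, mul_assoc]

/-- The decoder corrects all errors whose syndrome has been reached with few defects. -/
def Corrects (Q : Code D L) (dec : Q.Cluster → Pauli Q.n) (w m : ℕ) : Prop :=
  ∀ E, Reach Q w m E → Q.Equi E (dec (Q.syn E))

/-- The only relevant `S'` is the syndrome after the step `F`. If `E` reaches `S`, then `E` and `E +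
F` are both corrected, and the product of the two resulting stabilizers is `dec S' + F + dec S`. If
`S` is not reachable, then neither is `S'`, since the step could be undone without exceeding `m`
defects; both terms vanish. -/
theorem commutator_pauli_eq_zero [NeZero L] {r w m : ℕ}
    (hr : ∀ c, (Finset.univ.filter fun a => Q.cube a = c).card ≤ r)
    (hdec : ∀ P, Q.syn (dec (Q.syn P)) = Q.syn P) (hc : Q.Corrects dec w m)
    {S S' : Q.Cluster} (hS : S.card + w * (2 ^ D * r) ≤ m) {F : Pauli Q.n} {s : Finset (Fin Q.n)}
    (hs : s.card ≤ w) (hF : ∀ j, F j ≠ 0 → j ∈ s) :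
    Q.proj S' * (Q.obs dec (Q.ReachSyn w m) U * pauliOp F -
      pauliOp F * Q.obs dec (Q.ReachSyn w m) U) * Q.proj S = 0 := by
  set Θ := Q.obs dec (Q.ReachSyn w m) U with hΘ
  have e : Q.proj S' * (Θ * pauliOp F - pauliOp F * Θ) * Q.proj S =
      Q.proj S' * Θ * pauliOp F * Q.proj S - Q.proj S' * pauliOp F * (Θ * Q.proj S) := by
    simp only [mul_sub, sub_mul, mul_assoc]
  rw [e]
  by_cases hne : S' = symmDiff S (Q.syn F)
  · have hFc : (Q.syn F).card ≤ w * (2 ^ D * r) :=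
      (Q.card_syn_le hr hF).trans (Nat.mul_le_mul_right _ hs)
    have hS'c : S'.card ≤ m := by
      rw [hne]; exact ((card_symmDiff_le _ _).trans (by gcongr)).trans hS
    by_cases hR : Q.ReachSyn w m S
    · have hR' : Q.ReachSyn w m S' := by
        rw [hne] at hS'c ⊢; exact ReachSyn.step Q hR hs hF hS'c
      rw [hΘ, proj_mul_obs _ _ _ _ hR', obs_mul_proj _ _ _ _ hR]
      obtain ⟨E, hE, rfl⟩ := hR
      have hS'' : Q.syn (E + F) = S' := by rw [syn_add, hne]
      have hE' : Reach Q w m (E + F) := .step s hs hE hF (by rw [hS'']; exact hS'c)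
      refine sub_eq_zero.2 (Q.commutator_block_eq_zero U (hdec E) ?_ ?_)
      · rw [← hS'']; exact hdec _
      · have h1 := hc _ hE
        have h2 := hc _ hE'
        rw [hS''] at h2
        have h3 : dec S' + F + dec (Q.syn E) = (E + F + dec S') + (E + dec (Q.syn E)) := by
          have : E + E = 0 := pauli_add_self E
          calc _ = dec S' + F + dec (Q.syn E) + (E + E) := by rw [this, add_zero]
            _ = _ := by abel
        rw [h3]
        exact Q.stab.add_mem h2 h1
    · have hR' : ¬ Q.ReachSyn w m S' := fun h => by
        apply hR
        have h1 : symmDiff S' (Q.syn F) = S := by rw [hne, symmDiff_symmDiff_cancel_right]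
        rw [← h1]
        exact ReachSyn.step Q h hs hF (by rw [h1]; omega)
      rw [hΘ, proj_mul_obs_of_not _ _ _ _ hR', obs_mul_proj_of_not _ _ _ _ hR]
      simp
  · have h0 := Q.proj_pauliOp_proj_of_ne hne
    have e1 : Q.proj S' * Θ * pauliOp F * Q.proj S = Θ * (Q.proj S' * pauliOp F * Q.proj S) := by
      rw [hΘ, proj_mul_obs_comm]; simp only [mul_assoc]
    have e2 : Q.proj S' * pauliOp F * (Θ * Q.proj S) = Q.proj S' * pauliOp F * Q.proj S * Θ := by
      rw [hΘ, ← proj_mul_obs_comm]; simp only [mul_assoc]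
    rw [e1, e2, h0, mul_zero, zero_mul, sub_zero]

theorem commutator_actsOn_eq_zero [NeZero L] {r w m : ℕ}
    (hr : ∀ c, (Finset.univ.filter fun a => Q.cube a = c).card ≤ r)
    (hdec : ∀ P, Q.syn (dec (Q.syn P)) = Q.syn P) (hc : Q.Corrects dec w m)
    {S S' : Q.Cluster} (hS : S.card + w * (2 ^ D * r) ≤ m) {A : Op Q.n} {s : Finset (Fin Q.n)}
    (hs : s.card ≤ w) (hA : ActsOn A s) :
    Q.proj S' * (Q.obs dec (Q.ReachSyn w m) U * A - A * Q.obs dec (Q.ReachSyn w m) U) * Q.proj S =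
      0 := by
  induction hA using Submodule.span_induction with
  | mem X hX =>
    obtain ⟨F, hF, rfl⟩ := hX
    exact Q.commutator_pauli_eq_zero U hr hdec hc hS hs hF
  | zero => simp
  | add X Y _ _ hX hY =>
    rw [mul_add, add_mul, add_sub_add_comm, mul_add, add_mul, hX, hY, add_zero]
  | smul c X _ hX =>
    rw [mul_smul_comm, smul_mul_assoc, ← smul_sub, mul_smul_comm, smul_mul_assoc, hX, smul_zero]

theorem proj_actsOn_proj_eq_zero [NeZero L] {r w : ℕ}
    (hr : ∀ c, (Finset.univ.filter fun a => Q.cube a = c).card ≤ r)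
    {S S' : Q.Cluster} (hS : S.card + w * (2 ^ D * r) < S'.card) {A : Op Q.n} {s : Finset (Fin Q.n)}
    (hs : s.card ≤ w) (hA : ActsOn A s) : Q.proj S' * A * Q.proj S = 0 := by
  induction hA using Submodule.span_induction with
  | mem X hX =>
    obtain ⟨F, hF, rfl⟩ := hX
    refine Q.proj_pauliOp_proj_of_ne fun h => ?_
    have hFc : (Q.syn F).card ≤ w * (2 ^ D * r) :=
      (Q.card_syn_le hr hF).trans (Nat.mul_le_mul_right _ hs)
    have := card_symmDiff_le S (Q.syn F)
    rw [← h] at this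
    omega
  | zero => simp
  | add X Y _ _ hX hY => rw [mul_add, add_mul, hX, hY, add_zero]
  | smul c X _ hX => rw [mul_smul_comm, smul_mul_assoc, hX, smul_zero]

theorem commutator_jump_mul_proj [NeZero L] {r w m : ℕ}
    (hr : ∀ c, (Finset.univ.filter fun a => Q.cube a = c).card ≤ r)
    (hdec : ∀ P, Q.syn (dec (Q.syn P)) = Q.syn P) (hc : Q.Corrects dec w m)
    {S : Q.Cluster} (hS : S.card + w * (2 ^ D * r) ≤ m) {A : Op Q.n} {s : Finset (Fin Q.n)}
    (hs : s.card ≤ w) (hA : ActsOn A s) (J ω : ℝ) :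
    (Q.obs dec (Q.ReachSyn w m) U * Q.jump J A ω - Q.jump J A ω * Q.obs dec (Q.ReachSyn w m) U) *
      Q.proj S = 0 := by
  refine Q.ext_proj_left fun S' => ?_
  set Θ := Q.obs dec (Q.ReachSyn w m) U with hΘ
  have h := Q.commutator_actsOn_eq_zero U hr hdec hc (S' := S') hS hs hA
  rw [← hΘ] at h
  have hl : Q.proj S' * Θ = Θ * Q.proj S' := Q.proj_mul_obs_comm _ _ _ _
  have hr : Q.proj S * Θ = Θ * Q.proj S := Q.proj_mul_obs_comm _ _ _ _
  have e : ∀ X : Op Q.n, Q.proj S' * ((Θ * X - X * Θ) * Q.proj S) =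
      Θ * (Q.proj S' * X * Q.proj S) - Q.proj S' * X * Q.proj S * Θ := fun X => by
    calc _ = Q.proj S' * Θ * X * Q.proj S - Q.proj S' * X * (Θ * Q.proj S) := by
          simp only [mul_sub, sub_mul, mul_assoc]
      _ = _ := by rw [hl, ← hr]; simp only [mul_assoc]
  rw [mul_assoc, e] at h
  rw [e, proj_jump_proj, mul_zero]
  split_ifs
  · exact h
  · simp

theorem proj_jump_proj_eq_zero [NeZero L] {r w : ℕ}
    (hr : ∀ c, (Finset.univ.filter fun a => Q.cube a = c).card ≤ r)
    {S S' : Q.Cluster} (hS : S.card + w * (2 ^ D * r) < S'.card) {A : Op Q.n} {s : Finset (Fin Q.n)}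
    (hs : s.card ≤ w) (hA : ActsOn A s) (J ω : ℝ) : Q.proj S' * Q.jump J A ω * Q.proj S = 0 := by
  rw [proj_jump_proj, Q.proj_actsOn_proj_eq_zero hr hS hs hA, ite_self]

/-- The Heisenberg drift of the observable involves only syndromes with many defects. -/
theorem drift_mul_proj [NeZero L] {r w m : ℕ}
    (hr : ∀ c, (Finset.univ.filter fun a => Q.cube a = c).card ≤ r)
    (hdec : ∀ P, Q.syn (dec (Q.syn P)) = Q.syn P) (hc : Q.Corrects dec w m)
    {S : Q.Cluster} (hS : S.card + 2 * (w * (2 ^ D * r)) ≤ m) {A : Op Q.n} (hAh : A.IsHermitian)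
    {s : Finset (Fin Q.n)} (hs : s.card ≤ w) (hA : ActsOn A s) (J ω : ℝ) :
    ((Q.jump J A ω)ᴴ * (Q.obs dec (Q.ReachSyn w m) U * Q.jump J A ω -
        Q.jump J A ω * Q.obs dec (Q.ReachSyn w m) U) -
      (Q.obs dec (Q.ReachSyn w m) U * (Q.jump J A ω)ᴴ -
        (Q.jump J A ω)ᴴ * Q.obs dec (Q.ReachSyn w m) U) * Q.jump J A ω) * Q.proj S = 0 := by
  rw [sub_mul, mul_assoc, Q.commutator_jump_mul_proj U hr hdec hc (by omega) hs hA, mul_zero,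
    zero_sub, neg_eq_zero, jump_conjTranspose _ _ hAh, mul_assoc]
  conv_lhs => rw [← one_mul (Q.jump J A ω * Q.proj S), ← Q.sum_proj, Finset.sum_mul, Finset.mul_sum]
  refine Finset.sum_eq_zero fun T _ => ?_
  -- The jump next to the projector may raise the number of defects by `w 2 ^ D r` before the
  -- commutator acts. This is why twice that number is kept in reserve.
  by_cases hT : T.card ≤ S.card + w * (2 ^ D * r)
  · rw [← mul_assoc, Q.commutator_jump_mul_proj U hr hdec hc (by omega) hs hA, zero_mul]
  · rw [← mul_assoc (Q.proj T), Q.proj_jump_proj_eq_zero hr (not_le.1 hT) hs hA, mul_zero]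

end Code

end MemoryTime

/-! ### Norm bounds and the drift of the observable -/

namespace MemoryTime

variable {D L : ℕ}

namespace Code

open scoped Matrix.Norms.L2Operator

variable (Q : Code D L)

theorem norm_pauliOp_le {n : ℕ} (P : Pauli n) : ‖pauliOp P‖ ≤ 1 :=
  norm_le_one_of_conjTranspose_mul_self (by rw [pauliOp_conjTranspose, pauliOp_mul_self])

theorem norm_proj_le (S : Q.Cluster) : ‖Q.proj S‖ ≤ 1 :=
  norm_le_one_of_proj (Q.proj_conjTranspose S) (Q.proj_mul_self S)

theorem norm_mul_le_one {n : ℕ} {X Y : Op n} (hX : ‖X‖ ≤ 1) (hY : ‖Y‖ ≤ 1) : ‖X * Y‖ ≤ 1 :=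
  (norm_mul_le _ _).trans (mul_le_one₀ hX (norm_nonneg _) hY)

theorem norm_blk_le (dec : Q.Cluster → Pauli Q.n) {U : Op Q.n} (hU : ‖U‖ ≤ 1) (S : Q.Cluster) :
    ‖Q.blk dec U S‖ ≤ 1 :=
  norm_mul_le_one (norm_mul_le_one (norm_mul_le_one (norm_mul_le_one (Q.norm_proj_le S)
    (norm_pauliOp_le _)) hU) (norm_pauliOp_le _)) (Q.norm_proj_le S)

theorem norm_obs_le (dec : Q.Cluster → Pauli Q.n) (R : Q.Cluster → Prop) {U : Op Q.n}
    (hU : ‖U‖ ≤ 1) : ‖Q.obs dec R U‖ ≤ 1 := by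
  classical
  rw [obs, Finset.sum_filter]
  have hconj : ∀ S, (if R S then Q.blk dec U S else 0)ᴴ * Q.proj S =
      (if R S then Q.blk dec U S else 0)ᴴ := fun S => by
    split_ifs
    · conv_rhs => rw [← Q.proj_mul_blk dec U S]
      rw [conjTranspose_mul, proj_conjTranspose]
    · simp
  have hl : ∀ S, Q.proj S * (if R S then Q.blk dec U S else 0) =
      if R S then Q.blk dec U S else 0 := fun S => by
    split_ifs
    · exact Q.proj_mul_blk dec U S
    · simp
  convert norm_sum_block_le (X := fun S => if R S then Q.blk dec U S else 0) (p := Q.proj)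
    (fun S => ?_) (fun S S' h => ?_) (fun S => ?_) Q.proj_conjTranspose Q.proj_mul_self Q.sum_proj
  · split_ifs
    · exact Q.blk_mul_proj dec U S
    · simp
  · rw [← hconj S, ← hl S', mul_assoc, ← mul_assoc (Q.proj S), proj_mul_proj _ h, zero_mul, mul_zero]
  · split_ifs
    · exact Q.norm_blk_le dec hU S
    · simp

open Classical in
/-- The projector onto the subspaces with `d` defects. -/
def cardProj (d : ℕ) : Op Q.n := Q.wt fun S => if S.card = d then 1 else 0

theorem norm_wt_ite_le (p : Q.Cluster → Prop) [DecidablePred p] :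
    ‖Q.wt fun S => if p S then 1 else 0‖ ≤ 1 := by
  refine norm_le_one_of_proj ?_ ?_
  · rw [wt_conjTranspose]; congr 1; funext S; simp only [Pi.star_apply]; split_ifs <;> simp
  · rw [wt_mul]; congr 1; funext S; simp only [Pi.mul_apply]; split_ifs <;> simp

/-- The energy depends on the number of defects only, so the sum over exponentially many pairs of
syndromes collapses to `(M + 1) ^ 2` blocks. This yields the polynomial bound in `norm_jump_le`. -/
theorem jump_eq_sum (J : ℝ) (A : Op Q.n) (ω : ℝ) :
    Q.jump J A ω = ∑ d ∈ Finset.range (Q.M + 1), ∑ d' ∈ Finset.range (Q.M + 1),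
      if 2 * J * ((d : ℝ) - d') = ω then Q.cardProj d' * A * Q.cardProj d else 0 := by
  refine Q.ext_proj fun S S' => ?_
  have hS : ∀ T : Q.Cluster, T.card ∈ Finset.range (Q.M + 1) := fun T => by
    have := Finset.card_le_univ T
    rw [Fintype.card_fin] at this
    exact Finset.mem_range.2 (by omega)
  rw [proj_jump_proj, energy_sub]
  simp only [Finset.mul_sum, Finset.sum_mul]
  rw [Finset.sum_eq_single_of_mem _ (hS S), Finset.sum_eq_single_of_mem _ (hS S')]
  · split_ifs
    · have : Q.proj S' * (Q.cardProj S'.card * A * Q.cardProj S.card) * Q.proj S =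
          (Q.proj S' * Q.cardProj S'.card) * A * (Q.cardProj S.card * Q.proj S) := by
        simp only [mul_assoc]
      rw [this, cardProj, cardProj, proj_mul_wt, wt_mul_proj, if_pos rfl, if_pos rfl, one_smul,
        one_smul]
    · simp
  · intro d' _ hd'
    split_ifs
    · rw [mul_assoc (Q.cardProj _), ← mul_assoc (Q.proj _), cardProj, proj_mul_wt, if_neg hd'.symm]
      simp
    · simp
  · intro d _ hd
    refine Finset.sum_eq_zero fun d' _ => ?_
    split_ifs
    · have h0 : Q.cardProj d * Q.proj S = 0 := by
        rw [cardProj, wt_mul_proj, if_neg hd.symm, zero_smul]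
      rw [mul_assoc (Q.proj _), mul_assoc _ (Q.cardProj d), h0]
      simp
    · simp

theorem norm_jump_le (J : ℝ) {A : Op Q.n} (hA : ‖A‖ ≤ 1) (ω : ℝ) :
    ‖Q.jump J A ω‖ ≤ ((Q.M : ℝ) + 1) ^ 2 := by
  classical
  rw [jump_eq_sum]
  have h : ∀ d d' : ℕ, ‖(if 2 * J * ((d : ℝ) - d') = ω then Q.cardProj d' * A * Q.cardProj d else 0 :
      Op Q.n)‖ ≤ 1 := fun d d' => by
    split_ifs
    · exact norm_mul_le_one (norm_mul_le_one (by rw [cardProj]; convert Q.norm_wt_ite_le _) hA)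
        (by rw [cardProj]; convert Q.norm_wt_ite_le _)
    · simp
  refine (norm_sum_le_of_le _ fun d _ => norm_sum_le_of_le _ fun d' _ => h d d').trans_eq ?_
  simp
  ring

theorem card_bohr_le (J : ℝ) : ((Q.bohr J).card : ℝ) ≤ ((Q.M : ℝ) + 1) ^ 2 := by
  classical
  have h1 : Q.bohr J ⊆ (Finset.range (Q.M + 1) ×ˢ Finset.range (Q.M + 1)).image
      fun p => 2 * J * ((p.1 : ℝ) - p.2) := by
    intro ω hω
    simp only [bohr, Finset.mem_image, Finset.mem_univ, true_and, Prod.exists] at hω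
    obtain ⟨S, S', rfl⟩ := hω
    refine Finset.mem_image.2 ⟨(S.card, S'.card), ?_, (Q.energy_sub J S S').symm⟩
    have h := Finset.card_le_univ S
    have h' := Finset.card_le_univ S'
    rw [Fintype.card_fin] at h h'
    simp only [Finset.mem_product, Finset.mem_range]
    omega
  have h2 := (Finset.card_le_card h1).trans Finset.card_image_le
  rw [Finset.card_product, Finset.card_range, ← sq] at h2
  exact_mod_cast h2

theorem hs_wt (f : Q.Cluster → ℝ) :
    hs (Q.wt fun S => (f S : ℂ)) = ∑ S, f S ^ 2 * (Q.proj S).trace.re := by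
  have h : (hs (Q.wt fun S => (f S : ℂ)) : ℂ).re = _ :=
    congrArg Complex.re (trace_conjTranspose_mul_self_eq (Q.wt fun S => (f S : ℂ))).symm
  rw [Complex.ofReal_re] at h
  rw [h, wt_conjTranspose, wt_mul, wt, trace_sum, Complex.re_sum]
  refine Finset.sum_congr rfl fun S _ => ?_
  rw [trace_smul, smul_eq_mul, Pi.mul_apply, Pi.star_apply, Complex.star_def, Complex.conj_ofReal,
    ← Complex.ofReal_mul, Complex.re_ofReal_mul, sq]

/-- Operators living on syndromes with many defects have small expectation in states that are
bounded in the weighted Hilbert-Schmidt norm. -/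
theorem norm_trace_mul_le_of_high {Y ρ : Op Q.n} {m' : ℕ} {y : ℝ} (hy : 0 < y) (hy1 : y ≤ 1)
    (hY : ∀ S : Q.Cluster, S.card < m' → Y * Q.proj S = 0)
    (hρ : hs (Q.pwt y⁻¹ * ρ) ≤ 1) :
    ‖(Y * ρ).trace‖ ≤ ‖Y‖ * √(2 ^ Q.k * y ^ m' * (1 + y) ^ Q.M) := by
  classical
  set g : Q.Cluster → ℝ := fun S => if S.card < m' then 0 else y ^ S.card with hg
  have h1 : Y * Q.pwt y = Y * Q.wt fun S => (g S : ℂ) := Q.ext_proj_right fun S => by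
    rw [mul_assoc, pwt, wt_mul_proj, mul_assoc, wt_mul_proj, mul_smul_comm, mul_smul_comm, hg]
    dsimp only
    split_ifs with h
    · rw [hY S h]; simp
    · rfl
  -- The weight `y ^ |S|` is taken from the state and given to the observable, where small numbers
  -- of defects do not count.
  have h2 : Y * ρ = (Y * Q.wt fun S => (g S : ℂ)) * (Q.pwt y⁻¹ * ρ) := by
    rw [← h1, mul_assoc, ← mul_assoc (Q.pwt y), pwt_mul_pwt, mul_inv_cancel₀ hy.ne', pwt_one, one_mul]
  -- Of the squared weight `y ^ (2 |S|)`, one factor is bounded by `y ^ m'` and the other is summed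
  -- over all syndromes by the binomial theorem.
  have h3 : hs (Q.wt fun S => (g S : ℂ)) ≤ 2 ^ Q.k * y ^ m' * (1 + y) ^ Q.M := by
    rw [hs_wt]
    have hsum : ∑ S : Q.Cluster, y ^ S.card = (1 + y) ^ Q.M := by
      have h := Fintype.sum_pow_mul_eq_add_pow (Fin Q.M) y 1
      simp only [one_pow, mul_one, Fintype.card_fin] at h
      rw [h, add_comm]
    rw [← hsum, Finset.mul_sum]
    refine Finset.sum_le_sum fun S _ => ?_
    have ht := Q.trace_proj_le S
    have ht0 : 0 ≤ (Q.proj S).trace.re := (Complex.le_def.1 (Q.trace_proj_nonneg S)).1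
    rw [hg]
    dsimp only
    split_ifs with h
    · rw [zero_pow two_ne_zero, zero_mul]; positivity
    · have h5 : y ^ S.card ≤ y ^ m' := pow_le_pow_of_le_one hy.le hy1 (not_lt.1 h)
      calc (y ^ S.card) ^ 2 * (Q.proj S).trace.re ≤ (y ^ m' * y ^ S.card) * 2 ^ Q.k := by
            rw [sq]; gcongr
        _ = _ := by ring
  rw [h2]
  refine (norm_trace_mul_le _ _).trans ?_
  calc √(hs (Y * Q.wt fun S => (g S : ℂ))) * √(hs (Q.pwt y⁻¹ * ρ))
      ≤ √(‖Y‖ ^ 2 * (2 ^ Q.k * y ^ m' * (1 + y) ^ Q.M)) * √1 := by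
        refine mul_le_mul (Real.sqrt_le_sqrt ((hs_mul_le _ _).trans ?_)) (Real.sqrt_le_sqrt hρ)
          (Real.sqrt_nonneg _) (Real.sqrt_nonneg _)
        gcongr
    _ = _ := by rw [Real.sqrt_one, mul_one, Real.sqrt_mul (sq_nonneg _), Real.sqrt_sq (norm_nonneg _)]

/-- The Heisenberg form of the dissipator involves `Θ` only through commutators with `V` and its
adjoint. With `Θ = 1` it shows that the trace is preserved. -/
theorem trace_obs_dissipator {n : ℕ} (Θ V ρ : Op n) :
    (Θ * (V * ρ * Vᴴ - (1 / 2 : ℂ) • (ρ * (Vᴴ * V) + Vᴴ * V * ρ))).trace =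
      (1 / 2 : ℂ) * ((Vᴴ * (Θ * V - V * Θ) - (Θ * Vᴴ - Vᴴ * Θ) * V) * ρ).trace := by
  have c1 : (Θ * (V * ρ * Vᴴ)).trace = (Vᴴ * Θ * V * ρ).trace := by
    have : Θ * (V * ρ * Vᴴ) = (Θ * V * ρ) * Vᴴ := by simp only [mul_assoc]
    rw [this, trace_mul_comm]; simp only [mul_assoc]
  have c2 : (Θ * (ρ * (Vᴴ * V))).trace = (Vᴴ * V * Θ * ρ).trace := by
    rw [← mul_assoc, trace_mul_comm]; simp only [mul_assoc]
  have c3 : (Θ * (Vᴴ * V * ρ)).trace = (Θ * Vᴴ * V * ρ).trace := by simp only [mul_assoc]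
  rw [mul_sub, mul_smul_comm, mul_add, trace_sub, trace_smul, trace_add, c1, c2, c3]
  simp only [mul_sub, sub_mul, trace_sub, smul_eq_mul, ← mul_assoc]
  ring

variable {dec : Q.Cluster → Pauli Q.n}

/-- The Hamiltonian part vanishes because the observable is block diagonal in the syndrome. The
drift due to the bath lives on syndromes close to the barrier, where the weighted norm makes the
state small. One factor `(M + 1) ^ 2` counts the frequencies, and `(M + 1) ^ 4` bounds the two jump
operators. -/
theorem norm_trace_obs_liouvillian_le [NeZero L] {r w m : ℕ} {J β κ hmax : ℝ} {B : Bath Q.n}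
    (hr : ∀ c, (Finset.univ.filter fun a => Q.cube a = c).card ≤ r)
    (hdec : ∀ P, Q.syn (dec (Q.syn P)) = Q.syn P) (hc : Q.Corrects dec w m)
    (hB : Q.IsDaviesBath w κ hmax β B) (hJβ : 0 ≤ J * β) {U ρ : Op Q.n} (hU : ‖U‖ ≤ 1)
    (hρ : hs (Q.pwt (Real.exp (J * β)) * ρ) ≤ 1) :
    ‖(Q.obs dec (Q.ReachSyn w m) U * Q.liouvillian J B ρ).trace‖ ≤
      (B.m : ℝ) * (((Q.M : ℝ) + 1) ^ 2 * (|hmax| * (2 * ((Q.M : ℝ) + 1) ^ 4 *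
        √(2 ^ Q.k * Real.exp (-(J * β)) ^ (m + 1 - 2 * (w * (2 ^ D * r))) *
          (1 + Real.exp (-(J * β))) ^ Q.M)))) := by
  set Θ := Q.obs dec (Q.ReachSyn w m) U with hΘ
  set G := √(2 ^ Q.k * Real.exp (-(J * β)) ^ (m + 1 - 2 * (w * (2 ^ D * r))) *
          (1 + Real.exp (-(J * β))) ^ Q.M) with hG
  have hΘn : ‖Θ‖ ≤ 1 := Q.norm_obs_le dec _ hU
  have hH : (Θ * (-(Complex.I • (Q.H J * ρ - ρ * Q.H J)))).trace = 0 := by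
    rw [mul_neg, mul_smul_comm, trace_neg, trace_smul, mul_sub, trace_sub, ← mul_assoc Θ ρ,
      trace_mul_comm (Θ * ρ), ← mul_assoc, ← mul_assoc, hΘ, H_eq_wt, wt_mul_obs_comm, sub_self]
    simp
  rw [liouvillian, mul_add, trace_add, hH, zero_add, lindblad]
  simp only [Finset.mul_sum, trace_sum]
  have key : ∀ i, ∀ ω ∈ Q.bohr J, ‖(Θ * ((B.h i ω : ℂ) • (Q.jump J (B.A i) ω * ρ *
      (Q.jump J (B.A i) ω)ᴴ - (1 / 2 : ℂ) • (ρ * ((Q.jump J (B.A i) ω)ᴴ * Q.jump J (B.A i) ω) +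
        (Q.jump J (B.A i) ω)ᴴ * Q.jump J (B.A i) ω * ρ)))).trace‖ ≤
      |hmax| * (2 * ((Q.M : ℝ) + 1) ^ 4 * G) := by
    intro i ω _
    obtain ⟨s, hs, hA⟩ := hB.local_op i
    rw [mul_smul_comm, trace_smul, trace_obs_dissipator, smul_eq_mul, norm_mul, norm_mul]
    have hdr : ∀ S : Q.Cluster, S.card < m + 1 - 2 * (w * (2 ^ D * r)) → _ := fun S hS =>
      Q.drift_mul_proj U hr hdec hc (S := S) (by omega) (hB.selfAdjoint i) hs hA J ω
    rw [← hΘ] at hdr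
    set V := Q.jump J (B.A i) ω with hV
    have hVn : ‖V‖ ≤ ((Q.M : ℝ) + 1) ^ 2 := Q.norm_jump_le J (hB.norm_le i) ω
    have hVn' : ‖Vᴴ‖ ≤ ((Q.M : ℝ) + 1) ^ 2 := by rwa [Matrix.l2_opNorm_conjTranspose]
    have h1 := Q.norm_trace_mul_le_of_high (Y := Vᴴ * (Θ * V - V * Θ) - (Θ * Vᴴ - Vᴴ * Θ) * V)
      (Real.exp_pos (-(J * β))) (Real.exp_le_one_iff.2 (by linarith)) hdr (ρ := ρ)
      (by rw [← Real.exp_neg, neg_neg]; exact hρ)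
    have hN : (0 : ℝ) ≤ ((Q.M : ℝ) + 1) ^ 2 := by positivity
    have h2 : ‖Vᴴ * (Θ * V - V * Θ) - (Θ * Vᴴ - Vᴴ * Θ) * V‖ ≤ 4 * ((Q.M : ℝ) + 1) ^ 4 := by
      have a1 : ‖Θ * V‖ ≤ ((Q.M : ℝ) + 1) ^ 2 :=
        (norm_mul_le _ _).trans ((mul_le_of_le_one_left (norm_nonneg _) hΘn).trans hVn)
      have a2 : ‖V * Θ‖ ≤ ((Q.M : ℝ) + 1) ^ 2 :=
        (norm_mul_le _ _).trans ((mul_le_of_le_one_right (norm_nonneg _) hΘn).trans hVn)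
      have a3 : ‖Θ * Vᴴ‖ ≤ ((Q.M : ℝ) + 1) ^ 2 :=
        (norm_mul_le _ _).trans ((mul_le_of_le_one_left (norm_nonneg _) hΘn).trans hVn')
      have a4 : ‖Vᴴ * Θ‖ ≤ ((Q.M : ℝ) + 1) ^ 2 :=
        (norm_mul_le _ _).trans ((mul_le_of_le_one_right (norm_nonneg _) hΘn).trans hVn')
      have b1 : ‖Θ * V - V * Θ‖ ≤ 2 * ((Q.M : ℝ) + 1) ^ 2 := (norm_sub_le _ _).trans (by linarith)
      have b2 : ‖Θ * Vᴴ - Vᴴ * Θ‖ ≤ 2 * ((Q.M : ℝ) + 1) ^ 2 := (norm_sub_le _ _).trans (by linarith)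
      calc _ ≤ ‖Vᴴ‖ * ‖Θ * V - V * Θ‖ + ‖Θ * Vᴴ - Vᴴ * Θ‖ * ‖V‖ :=
            (norm_sub_le _ _).trans (add_le_add (norm_mul_le _ _) (norm_mul_le _ _))
        _ ≤ ((Q.M : ℝ) + 1) ^ 2 * (2 * ((Q.M : ℝ) + 1) ^ 2) +
            2 * ((Q.M : ℝ) + 1) ^ 2 * ((Q.M : ℝ) + 1) ^ 2 := by gcongr
        _ = _ := by ring
    have h3 : ‖(B.h i ω : ℂ)‖ ≤ |hmax| := by
      rw [Complex.norm_real, Real.norm_eq_abs, abs_of_nonneg (hB.rate_nonneg i ω)]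
      exact (hB.rate_le i ω).trans (le_abs_self _)
    have hG0 : 0 ≤ G := Real.sqrt_nonneg _
    calc _ ≤ |hmax| * (1 / 2 * (4 * ((Q.M : ℝ) + 1) ^ 4 * G)) := by
          gcongr
          · simp
          · exact h1.trans (by gcongr)
      _ = _ := by ring
  refine (norm_sum_le_of_le _ fun i _ => norm_sum_le_of_le _ (key i)).trans ?_
  simp only [Finset.sum_const, Finset.card_univ, Fintype.card_fin, nsmul_eq_mul]
  have hG0 : 0 ≤ G := Real.sqrt_nonneg _
  gcongr
  exact Q.card_bohr_le J

end Code

end MemoryTime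

/-! ### From the drift to the storage error -/

namespace MemoryTime

variable {D L : ℕ}

namespace Code

open scoped Matrix.Norms.L2Operator

variable (Q : Code D L)

theorem IsRGDecoder.empty {ℓ : ℕ} {dec : Q.Cluster → Pauli Q.n} (h : Q.IsRGDecoder ℓ dec) :
    dec ∅ = 0 := by
  obtain ⟨T, -, h, -⟩ := h
  have h0 := Q.rgRun_eq_of_empty T ∅ (Nat.zero_le (Nat.clog 2 ℓ)) rfl
  have := h ∅ (by rw [h0]; rfl)
  rw [this, h0]; rfl

variable {Q} in
theorem IsEvolution.proj_mul {J : ℝ} {B : Bath Q.n} {ρ : ℝ → Op Q.n} (h : Q.IsEvolution J B ρ) :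
    Q.proj ∅ * ρ 0 = ρ 0 := by
  rw [proj_eq, prod_ofFn_mul_of_eigen (c := fun _ => 1)]
  · simp
  · intro a
    have : Q.sg ∅ a = 1 := by simp [sg]
    rw [this, one_smul, one_smul, smul_mul_assoc, add_mul, one_mul, h.ground, ← two_smul ℂ, smul_smul]
    norm_num

variable {Q} in
theorem IsEvolution.mul_proj {J : ℝ} {B : Bath Q.n} {ρ : ℝ → Op Q.n} (h : Q.IsEvolution J B ρ) :
    ρ 0 * Q.proj ∅ = ρ 0 := by
  have := congrArg conjTranspose h.proj_mul
  rwa [conjTranspose_mul, proj_conjTranspose, h.posSemidef.1] at this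

theorem trace_liouvillian (J : ℝ) (B : Bath Q.n) (ρ : Op Q.n) :
    (Q.liouvillian J B ρ).trace = 0 := by
  rw [liouvillian, trace_add, trace_neg, trace_smul, trace_sub, trace_mul_comm, sub_self, smul_zero,
    neg_zero, zero_add, lindblad, trace_sum]
  refine Finset.sum_eq_zero fun i _ => ?_
  rw [trace_sum]
  refine Finset.sum_eq_zero fun ω _ => ?_
  generalize Q.jump J (B.A i) ω = V
  have h := trace_obs_dissipator 1 V ρ
  simp only [one_mul, mul_one, sub_self, mul_zero, zero_mul, trace_zero] at h
  rw [trace_smul, h, smul_zero]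

variable {Q} in
theorem norm_sub_le_of_hasDerivWithinAt {f f' : ℝ → ℂ} {C : ℝ}
    (hf : ∀ t, 0 ≤ t → HasDerivWithinAt f (f' t) (Set.Ici 0) t) (hC : ∀ t, 0 ≤ t → ‖f' t‖ ≤ C)
    {t : ℝ} (ht : 0 ≤ t) : ‖f t - f 0‖ ≤ C * t := by
  have h := (convex_Ici (0 : ℝ)).norm_image_sub_le_of_norm_hasDerivWithin_le hf hC
    (Set.mem_Ici.2 le_rfl) (Set.mem_Ici.2 ht)
  rwa [sub_zero, Real.norm_eq_abs, abs_of_nonneg ht] at h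

theorem obs_one_eq_wt (dec : Q.Cluster → Pauli Q.n) (R : Q.Cluster → Prop) [DecidablePred R] :
    Q.obs dec R 1 = Q.wt fun S => if R S then 1 else 0 := by
  refine Q.ext_proj_right fun S => ?_
  rw [wt_mul_proj]
  split_ifs with h
  · rw [obs_mul_proj _ _ _ _ h, blk, mul_one, mul_assoc (Q.proj S), pauliOp_mul_self, mul_one,
      proj_mul_self, one_smul]
  · rw [obs_mul_proj_of_not _ _ _ _ h, zero_smul]

theorem trace_mul_decoderMap (dec : Q.Cluster → Pauli Q.n) (R : Q.Cluster → Prop) (U ρ : Op Q.n) :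
    (U * Q.decoderMap dec ρ).trace =
      (Q.obs dec R U * ρ).trace + (Q.obs dec (fun S => ¬ R S) U * ρ).trace := by
  classical
  have h : (U * Q.decoderMap dec ρ).trace = ∑ S, (Q.blk dec U S * ρ).trace := by
    rw [decoderMap, Finset.mul_sum, trace_sum]
    refine Finset.sum_congr rfl fun S _ => ?_
    rw [pauliOp_conjTranspose, blk]
    have e : U * (pauliOp (dec S) * Q.proj S * ρ * Q.proj S * pauliOp (dec S)) =
        (U * pauliOp (dec S) * Q.proj S * ρ) * (Q.proj S * pauliOp (dec S)) := by
      simp only [mul_assoc]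
    rw [e, trace_mul_comm]
    simp only [mul_assoc]
  rw [h, obs, obs, Finset.sum_mul, Finset.sum_mul, trace_sum, trace_sum, ← Finset.sum_filter_add_sum_filter_not _ R]
  congr!

/-- The observable is a contraction sandwiched between the projectors onto the syndromes outside
`R`. For a positive state its expectation is thus at most the probability of these syndromes. -/
theorem norm_trace_obs_not_le (dec : Q.Cluster → Pauli Q.n) (R : Q.Cluster → Prop) {U ρ : Op Q.n}
    (hU : ‖U‖ ≤ 1) (hρ : ρ.PosSemidef) :
    ‖(Q.obs dec (fun S => ¬ R S) U * ρ).trace‖ ≤ ρ.trace.re - (Q.obs dec R 1 * ρ).trace.re := by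
  classical
  set p : Op Q.n := Q.wt fun S => if R S then 0 else 1 with hp
  have hpH : pᴴ = p := by
    rw [hp, wt_conjTranspose]; congr 1; funext S; simp only [Pi.star_apply]; split_ifs <;> simp
  have hpp : p * p = p := by
    rw [hp, wt_mul]; congr 1; funext S; simp only [Pi.mul_apply]; split_ifs <;> simp
  set Z := Q.obs dec (fun S => ¬ R S) U with hZ
  have hpZ : p * Z = Z := Q.ext_proj_left fun S => by
    rw [hp, ← mul_assoc, proj_mul_wt, smul_mul_assoc]
    split_ifs with h
    · rw [zero_smul, hZ, proj_mul_obs_of_not _ _ _ _ (not_not.2 h)]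
    · rw [one_smul]
  have hZp : Z * p = Z := Q.ext_proj_right fun S => by
    rw [hp, mul_assoc, wt_mul_proj, mul_smul_comm]
    split_ifs with h
    · rw [zero_smul, hZ, obs_mul_proj_of_not _ _ _ _ (not_not.2 h)]
    · rw [one_smul]
  have h1 : (Z * ρ).trace = (Z * (p * ρ * pᴴ)).trace := by
    rw [hpH]
    have : Z * (p * ρ * p) = (Z * p * ρ) * p := by simp only [mul_assoc]
    rw [this, hZp, trace_mul_comm (Z * ρ), ← mul_assoc, hpZ]
  have h2 : (p * ρ * pᴴ).trace = ρ.trace - (Q.obs dec R 1 * ρ).trace := by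
    rw [hpH, trace_mul_comm, ← mul_assoc, hpp, ← trace_sub, obs_one_eq_wt]
    have : p = 1 - Q.wt fun S => if R S then 1 else 0 := by
      rw [hp, ← Q.wt_one, wt, wt, wt, ← Finset.sum_sub_distrib]
      refine Finset.sum_congr rfl fun S _ => ?_
      rw [← sub_smul, Pi.one_apply]
      split_ifs <;> simp
    rw [this, sub_mul, one_mul]
  rw [h1, ← Complex.sub_re, ← h2]
  refine (norm_trace_mul_posSemidef_le (hρ.mul_mul_conjTranspose_same p) Z).trans ?_
  refine mul_le_of_le_one_left ?_ (Q.norm_obs_le dec _ hU)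
  exact (Complex.le_def.1 (hρ.mul_mul_conjTranspose_same p).trace_nonneg).1

/-- Test with a contraction `U` that attains the trace norm. On the reachable syndromes the decoded
expectation drifts from the initial one by at most `C t`. The rest is bounded by the weight of the
unreachable syndromes, which is at most `C t` by the same drift bound for `U = 1`. Hence the factor
`2`. -/
theorem storageError_le [NeZero L] {r w m : ℕ} {J β κ hmax : ℝ} {B : Bath Q.n}
    {dec : Q.Cluster → Pauli Q.n}
    (hr : ∀ c, (Finset.univ.filter fun a => Q.cube a = c).card ≤ r)
    (hdec : ∀ P, Q.syn (dec (Q.syn P)) = Q.syn P) (hc : Q.Corrects dec w m) (h0 : dec ∅ = 0)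
    (hB : Q.IsDaviesBath w κ hmax β B) (hJβ : 0 ≤ J * β) {ρ : ℝ → Op Q.n}
    (hρ : Q.IsEvolution J B ρ) {t : ℝ} (ht : 0 ≤ t) :
    Q.storageError dec ρ t ≤ 2 * ((B.m : ℝ) * (((Q.M : ℝ) + 1) ^ 2 * (|hmax| *
      (2 * ((Q.M : ℝ) + 1) ^ 4 * √(2 ^ Q.k * Real.exp (-(J * β)) ^ (m + 1 - 2 * (w * (2 ^ D * r))) *
          (1 + Real.exp (-(J * β))) ^ Q.M))))) * t := by
  set C := (B.m : ℝ) * (((Q.M : ℝ) + 1) ^ 2 * (|hmax| *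
      (2 * ((Q.M : ℝ) + 1) ^ 4 * √(2 ^ Q.k * Real.exp (-(J * β)) ^ (m + 1 - 2 * (w * (2 ^ D * r))) *
          (1 + Real.exp (-(J * β))) ^ Q.M)))) with hC
  have hsol : Q.Solves J B ρ := hρ.master
  -- The weight is `1` on the ground space, where there are no defects.
  have hhs0 : hs (Q.pwt (Real.exp (J * β)) * ρ 0) ≤ 1 := by
    have e : Q.pwt (Real.exp (J * β)) * ρ 0 = ρ 0 := by
      conv_lhs => rw [← hρ.proj_mul]
      rw [← mul_assoc, pwt, wt_mul_proj, Finset.card_empty, pow_zero, Complex.ofReal_one, one_smul,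
        hρ.proj_mul]
    rw [e]
    refine (hs_le_of_posSemidef hρ.posSemidef).trans ?_
    rw [hρ.trace_one]; simp
  have hhs : ∀ s, 0 ≤ s → hs (Q.pwt (Real.exp (J * β)) * ρ s) ≤ 1 := fun s hs =>
    (Solves.hs_le Q hB hsol hs).trans hhs0
  have drift : ∀ U : Op Q.n, ‖U‖ ≤ 1 → ‖(Q.obs dec (Q.ReachSyn w m) U * ρ t).trace -
      (Q.obs dec (Q.ReachSyn w m) U * ρ 0).trace‖ ≤ C * t := fun U hU =>
    norm_sub_le_of_hasDerivWithinAt (fun s hs => ((hsol s hs).const_mul _).trace)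
      (fun s hs => Q.norm_trace_obs_liouvillian_le hr hdec hc hB hJβ hU (hhs s hs)) ht
  have hR : Q.ReachSyn w m ∅ := ⟨0, .zero, Q.syn_zero⟩
  have init : ∀ U : Op Q.n, (Q.obs dec (Q.ReachSyn w m) U * ρ 0).trace = (U * ρ 0).trace := by
    intro U
    have e1 : Q.obs dec (Q.ReachSyn w m) U * ρ 0 = Q.proj ∅ * (U * ρ 0) := by
      conv_lhs => rw [← hρ.proj_mul]
      rw [← mul_assoc, obs_mul_proj _ _ _ _ hR, blk, h0, pauliOp_zero, mul_one, mul_one, mul_assoc,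
        hρ.proj_mul, mul_assoc]
    rw [e1, trace_mul_comm, mul_assoc, hρ.mul_proj]
  have htr : (ρ t).trace = 1 := by
    have h := norm_sub_le_of_hasDerivWithinAt (C := 0) (fun s hs => (hsol s hs).trace)
      (fun s _ => by rw [trace_liouvillian, norm_zero]) ht
    rw [zero_mul] at h
    rw [← hρ.trace_one]
    exact sub_eq_zero.1 (norm_le_zero_iff.1 h)
  obtain ⟨U, hU, hUX⟩ := exists_traceNorm_eq (ρ 0 - Q.decoderMap dec (ρ t))
  rw [mul_sub, trace_sub, Q.trace_mul_decoderMap dec (Q.ReachSyn w m), ← init U] at hUX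
  have h1 := drift U hU
  have h2 := drift 1 (norm_le_one_of_proj (by simp) (by simp))
  rw [init 1, one_mul, hρ.trace_one] at h2
  have h3 := Q.norm_trace_obs_not_le dec (Q.ReachSyn w m) hU (hρ.posSemidef_of_nonneg Q hB ht)
  rw [htr, Complex.one_re] at h3
  have h4 : 1 - (Q.obs dec (Q.ReachSyn w m) 1 * ρ t).trace.re ≤ C * t := by
    refine le_trans ?_ ((Complex.abs_re_le_norm _).trans h2)
    rw [Complex.sub_re, Complex.one_re, abs_sub_comm]
    exact le_abs_self _
  have h5 : Q.storageError dec ρ t = traceNorm (ρ 0 - Q.decoderMap dec (ρ t)) := rfl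
  have h6 : (traceNorm (ρ 0 - Q.decoderMap dec (ρ t)) : ℝ) ≤
      ‖(traceNorm (ρ 0 - Q.decoderMap dec (ρ t)) : ℂ)‖ := by
    rw [Complex.norm_real]; exact le_abs_self _
  rw [h5]
  refine h6.trans ?_
  rw [← hUX, ← sub_sub]
  refine (norm_sub_le _ _).trans ?_
  rw [norm_sub_rev] at h1
  linarith [h3.trans h4]

end Code

end MemoryTime

/-! ### Choice of the constants and the memory time -/

namespace MemoryTime

variable {D L : ℕ}

namespace Code

variable (Q : Code D L)

theorem IsRGDecoder.corrects_reach [NeZero L] {q r : ℕ} {α γ : ℝ} {ℓ : ℕ}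
    (hQ : Q.Admissible q r α γ ℓ) {dec : Q.Cluster → Pauli Q.n} (h : Q.IsRGDecoder ℓ dec)
    {w m : ℕ} (hℓ : scaleTop ⌈α⌉₊ (2 * (m + w * (2 ^ D * r)) + 1) ≤ ℓ) : Q.Corrects dec w m :=
  fun _ hE => IsRGDecoder.corrects hQ.tqo1 hQ.tqo2 hQ.no_strings (Nat.le_ceil α) h hℓ
    (hE.lowPath hQ.cube_le)

theorem scaleTop_le_rpow (a p : ℕ) {γ : ℝ} {L : ℕ} (hL : 0 < L)
    (h : ((p : ℝ) + 1) * Real.log (6 * a + 132) ≤ γ * Real.log L) :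
    (scaleTop a p : ℝ) ≤ (L : ℝ) ^ γ := by
  have hL' : (0 : ℝ) < L := by exact_mod_cast hL
  have hb : (0 : ℝ) < 6 * a + 132 := by positivity
  calc (scaleTop a p : ℝ) ≤ (6 * a + 132 : ℝ) ^ (p + 1) := by
        rw [scaleTop, scale, pow_succ]; push_cast
        rw [mul_comm]
        gcongr
        norm_num
    _ = Real.exp (((p : ℝ) + 1) * Real.log (6 * a + 132)) := by
        rw [← Real.exp_log (pow_pos hb (p + 1)), Real.log_pow]; push_cast; rfl
    _ ≤ Real.exp (γ * Real.log L) := Real.exp_le_exp.2 h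
    _ = (L : ℝ) ^ γ := by rw [Real.rpow_def_of_pos hL', mul_comm]

theorem sqrt_bound {k M r N : ℕ} {J β lam : ℝ} (hJβ : 0 ≤ J * β)
    (hM : M * Real.exp (-(J * β)) ≤ r) (hN : lam ≤ N) :
    √(2 ^ k * Real.exp (-(J * β)) ^ N * (1 + Real.exp (-(J * β))) ^ M) ≤
      2 ^ k * Real.exp (-(J * β) * lam / 2) * Real.exp r := by
  have h1 : (1 + Real.exp (-(J * β))) ^ M ≤ Real.exp r := by
    calc (1 + Real.exp (-(J * β))) ^ M ≤ Real.exp (Real.exp (-(J * β))) ^ M := by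
          gcongr
          rw [add_comm]
          exact Real.add_one_le_exp _
      _ = Real.exp (M * Real.exp (-(J * β))) := by rw [← Real.exp_nat_mul]
      _ ≤ _ := Real.exp_le_exp.2 hM
  have h2 : Real.exp (-(J * β)) ^ N ≤ Real.exp (-(J * β) * lam / 2) ^ 2 := by
    rw [← Real.exp_nat_mul, ← Real.exp_nat_mul]
    apply Real.exp_le_exp.2
    push_cast
    nlinarith
  have h3 : (2 : ℝ) ^ k ≤ (2 ^ k) ^ 2 := by
    have : (1 : ℝ) ≤ 2 ^ k := one_le_pow₀ (by norm_num)
    nlinarith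
  have h4 : Real.exp r ≤ Real.exp r ^ 2 := by
    have : (1 : ℝ) ≤ Real.exp r := Real.one_le_exp (by positivity)
    nlinarith
  refine Real.sqrt_le_iff.2 ⟨by positivity, ?_⟩
  rw [mul_pow, mul_pow]
  gcongr
  exact h1.trans h4

theorem exists_error_bound (D q r w : ℕ) (α γ J κ hmax : ℝ) (hD : 1 ≤ D) (hγ : 0 < γ) (hJ : 0 < J) :
    ∃ (c c' C : ℝ) (L₀ : ℕ), 0 < c ∧ 0 < c' ∧ 0 < C ∧
      ∀ (L : ℕ) [NeZero L] (Q : Code D L) (ℓ : ℕ), L₀ ≤ L → Q.Admissible q r α γ ℓ →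
        ∀ β : ℝ, 0 < β → (L : ℝ) ≤ Real.exp (c' * β) →
        ∀ dec : Q.Cluster → Pauli Q.n, Q.IsRGDecoder ℓ dec →
        ∀ B : Bath Q.n, Q.IsDaviesBath w κ hmax β B →
        ∀ ρ : ℝ → Op Q.n, Q.IsEvolution J B ρ → ∀ t : ℝ, 0 ≤ t →
          Q.storageError dec ρ t ≤ C * t * 2 ^ Q.k * (L : ℝ) ^ ((D : ℝ) - c * β) := by
  set W := w * (2 ^ D * r) with hW
  set b : ℝ := Real.log (6 * (⌈α⌉₊ : ℝ) + 132) with hb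
  have hbpos : 0 < b := Real.log_pos (by
    have : (0 : ℝ) ≤ (⌈α⌉₊ : ℝ) := Nat.cast_nonneg _
    linarith)
  -- The number `m` of defects will be the integer part of `c₀ log L`. Then `2 m` levels use up half
  -- of the exponent `γ`; the other half covers the remaining `2 W + 2`.
  set c₀ := γ / (4 * b) with hc₀
  have hc₀pos : 0 < c₀ := by positivity
  have hDpos : (0 : ℝ) < D := by exact_mod_cast hD
  -- The suppression is `L ^ (-J c₀ β / 4) = L ^ (-2 c β)`: one factor `1 / 2` comes from the square
  -- root, another from bounding `m + 1 - 2 W` below by half of `c₀ log L`. Half of this exponent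
  -- will absorb powers of `L`.
  set c := J * c₀ / 8 with hc
  have hcpos : 0 < c := by positivity
  -- For `L ≤ exp (c' β)` one has `L ^ D ≤ exp (J β)`, so `M exp (-J β) ≤ r` and `(1 + exp (-J β)) ^
  -- M` is bounded.
  set c' := J / D with hc'
  have hc'pos : 0 < c' := by positivity
  -- Lower bounds for `log L`. Together with `log L ≤ c' β` the last one forces `6 D ≤ c β`, so that
  -- six of the seven factors `L ^ D` are absorbed; small `β` are thereby excluded.
  set T := max ((2 * W + 2) * b / (γ / 2)) (max (2 * W / (c₀ / 2)) (6 * D / c * c')) with hT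
  refine ⟨c, c', 4 * |κ| * |hmax| * (r + 1) ^ 6 * Real.exp r + 1, ⌈Real.exp T⌉₊, hcpos, hc'pos,
    by positivity, ?_⟩
  intro L _ Q ℓ hL hQ β hβ hLβ dec hdec B hB ρ hρ t ht
  have hL1 : 1 ≤ L := Nat.one_le_iff_ne_zero.2 (NeZero.ne L)
  have hLpos : (0 : ℝ) < L := by exact_mod_cast hL1
  have hlog : T ≤ Real.log L := by
    rw [Real.le_log_iff_exp_le hLpos]
    exact Nat.ceil_le.1 hL
  set lg := Real.log L with hlg
  have hlg0 : 0 ≤ lg := Real.log_natCast_nonneg L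
  have hT1 : (2 * W + 2) * b ≤ γ / 2 * lg := by
    have := (le_max_left _ _).trans hlog
    rwa [div_le_iff₀ (by positivity), mul_comm lg] at this
  have hT2 : 2 * (W : ℝ) ≤ c₀ / 2 * lg := by
    have := ((le_max_left _ _).trans (le_max_right _ _)).trans hlog
    rwa [div_le_iff₀ (by positivity), mul_comm lg] at this
  have hlgβ : lg ≤ c' * β := by
    rw [hlg, Real.log_le_iff_le_exp hLpos]; exact hLβ
  have hT3 : 6 * D ≤ c * β := by
    have h1 := (((le_max_right _ _).trans (le_max_right _ _)).trans hlog).trans hlgβ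
    rw [mul_comm, mul_le_mul_iff_right₀ hc'pos, div_le_iff₀ hcpos] at h1
    linarith
  set m := ⌊c₀ * lg⌋₊ with hm
  have hm1 : (m : ℝ) ≤ c₀ * lg := Nat.floor_le (by positivity)
  have hm2 : c₀ * lg < m + 1 := Nat.lt_floor_add_one _
  have hscale : scaleTop ⌈α⌉₊ (2 * (m + W) + 1) ≤ ℓ := by
    have h : (scaleTop ⌈α⌉₊ (2 * (m + W) + 1) : ℝ) ≤ (L : ℝ) ^ γ := by
      refine scaleTop_le_rpow _ _ hL1 ?_
      rw [← hb, ← hlg]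
      push_cast
      have e : c₀ * lg * (2 * b) = γ / 2 * lg := by rw [hc₀]; field_simp; ring
      have : (m : ℝ) * (2 * b) ≤ γ / 2 * lg := by
        rw [← e]; gcongr
      linarith
    exact_mod_cast h.trans hQ.scale_ge
  have hJβ : 0 ≤ J * β := by positivity
  have hsyn : ∀ P, Q.syn (dec (Q.syn P)) = Q.syn P := hdec.choose_spec.2.2
  have key := Q.storageError_le hQ.cube_le hsyn (hdec.corrects_reach Q hQ hscale) (hdec.empty Q) hB hJβ
    hρ ht
  refine key.trans ?_
  have hMn : Q.M ≤ r * L ^ D := by simpa using card_le_mul_pow hQ.cube_le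
  have hMr : (Q.M : ℝ) ≤ r * (L : ℝ) ^ D := by exact_mod_cast hMn
  have hLD1 : (1 : ℝ) ≤ (L : ℝ) ^ D := one_le_pow₀ (by exact_mod_cast hL1)
  have hM1 : (Q.M : ℝ) + 1 ≤ (r + 1) * (L : ℝ) ^ D := by linarith
  have hLDe : (L : ℝ) ^ D ≤ Real.exp (J * β) := by
    calc (L : ℝ) ^ D ≤ Real.exp (c' * β) ^ D := by gcongr
      _ = Real.exp (J * β) := by rw [← Real.exp_nat_mul, hc']; congr 1; field_simp
  have hMy : Q.M * Real.exp (-(J * β)) ≤ r := by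
    calc Q.M * Real.exp (-(J * β)) ≤ r * Real.exp (J * β) * Real.exp (-(J * β)) := by
          gcongr; exact hMr.trans (by gcongr)
      _ = r := by rw [mul_assoc, ← Real.exp_add, add_neg_cancel, Real.exp_zero, mul_one]
  have hN : c₀ / 2 * lg ≤ ((m + 1 - 2 * W : ℕ) : ℝ) := by
    have : (m : ℝ) + 1 ≤ ((m + 1 - 2 * W : ℕ) : ℝ) + 2 * W := by
      have h : m + 1 ≤ m + 1 - 2 * W + 2 * W := by omega
      exact_mod_cast h
    linarith
  have hsq := sqrt_bound (k := Q.k) (M := Q.M) (r := r) hJβ hMy hN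
  set s := √(2 ^ Q.k * Real.exp (-(J * β)) ^ (m + 1 - 2 * W) * (1 + Real.exp (-(J * β))) ^ Q.M)
  have hBm : (B.m : ℝ) ≤ |κ| * (L : ℝ) ^ D :=
    hB.card_le.trans (mul_le_mul_of_nonneg_right (le_abs_self κ) (by positivity))
  have hexp : Real.exp (-(J * β) * (c₀ / 2 * lg) / 2) = (L : ℝ) ^ (-(2 * c * β)) := by
    rw [Real.rpow_def_of_pos hLpos, ← hlg, hc]; congr 1; ring
  have hpow : ((L : ℝ) ^ D) ^ 7 * (L : ℝ) ^ (-(2 * c * β)) ≤ (L : ℝ) ^ ((D : ℝ) - c * β) := by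
    rw [← pow_mul, ← Real.rpow_natCast, ← Real.rpow_add hLpos]
    refine Real.rpow_le_rpow_of_exponent_le (by exact_mod_cast hL1) ?_
    push_cast
    linarith
  calc 2 * ((B.m : ℝ) * (((Q.M : ℝ) + 1) ^ 2 * (|hmax| * (2 * ((Q.M : ℝ) + 1) ^ 4 * s)))) * t
      ≤ 2 * ((|κ| * (L : ℝ) ^ D) * (((r + 1) * (L : ℝ) ^ D) ^ 2 * (|hmax| *
          (2 * ((r + 1) * (L : ℝ) ^ D) ^ 4 *
            (2 ^ Q.k * Real.exp (-(J * β) * (c₀ / 2 * lg) / 2) * Real.exp r))))) * t := by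
        gcongr
    _ = (4 * |κ| * |hmax| * (r + 1) ^ 6 * Real.exp r) * t * 2 ^ Q.k *
          (((L : ℝ) ^ D) ^ 7 * (L : ℝ) ^ (-(2 * c * β))) := by rw [hexp]; ring
    _ ≤ (4 * |κ| * |hmax| * (r + 1) ^ 6 * Real.exp r + 1) * t * 2 ^ Q.k *
          (L : ℝ) ^ ((D : ℝ) - c * β) := by
        gcongr
        linarith

theorem le_memoryTime {err : ℝ → ℝ} {K x ε : ℝ} (hK : 0 < K) (hx : 0 < x)
    (h : ∀ t, 0 ≤ t → err t ≤ K * t * x⁻¹) :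
    ENNReal.ofReal (ε / K * x) ≤ memoryTime err ε := by
  refine le_sInf ?_
  rintro _ ⟨t, ⟨ht, hε⟩, rfl⟩
  refine ENNReal.ofReal_le_ofReal ?_
  have h1 := hε.trans (h t ht)
  rw [← div_eq_mul_inv, le_div_iff₀ hx] at h1
  rw [div_mul_eq_mul_div, div_le_iff₀ hK]
  linarith

/-- The power of `L` is at least `exp (μ c' β (c β - D))`. Its quadratic exponent exceeds the
desired one by `(μ - δ) c c' β ^ 2`, which beats the linear and constant terms for large `β`. -/
theorem exists_beta {c c' C D : ℝ} (hc : 0 < c) (hc' : 0 < c') (hC : 0 < C) (L₀ k₀ : ℕ)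
    {ε μ δ : ℝ} (hε : 0 < ε) (hδ : 0 < δ) (hδμ : δ < μ) :
    ∃ β₀ : ℝ, ∀ β, β₀ ≤ β → 0 < β ∧ ∀ (L k : ℕ), Real.exp (μ * c' * β) ≤ L → k ≤ k₀ → L₀ ≤ L ∧
      Real.exp (δ * c * c' * β ^ 2) ≤ ε / (C * 2 ^ k) * (L : ℝ) ^ (c * β - D) := by
  have hμ : 0 < μ := hδ.trans hδμ
  set a := (μ - δ) * c * c' with ha
  have hapos : 0 < a := by have := sub_pos.2 hδμ; positivity
  set e := Real.log (ε / (C * 2 ^ k₀)) with he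
  set β₁ := (|μ * c' * D| + |e|) / a + 1 with hβ₁
  refine ⟨max β₁ (max (|D| / c) (L₀ / (μ * c'))), fun β hβ => ?_⟩
  have h1 : β₁ ≤ β := (le_max_left _ _).trans hβ
  have h2 : |D| / c ≤ β := ((le_max_left _ _).trans (le_max_right _ _)).trans hβ
  have h3 : L₀ / (μ * c') ≤ β := ((le_max_right _ _).trans (le_max_right _ _)).trans hβ
  have hβ1 : 1 ≤ β := le_trans (by rw [hβ₁]; have : 0 ≤ (|μ * c' * D| + |e|) / a := by positivity
                                   linarith) h1
  have hβpos : 0 < β := by linarith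
  refine ⟨hβpos, fun L k hL hk => ?_⟩
  have hLpos : (0 : ℝ) < L := (Real.exp_pos _).trans_le hL
  constructor
  · rw [div_le_iff₀ (by positivity)] at h3
    have h4 : (L₀ : ℝ) ≤ L := by
      have := Real.add_one_le_exp (μ * c' * β)
      linarith
    exact_mod_cast h4
  · have hD : 0 ≤ c * β - D := by
      rw [div_le_iff₀ hc] at h2
      have := le_abs_self D
      linarith
    have h5 : Real.exp (μ * c' * β * (c * β - D)) ≤ (L : ℝ) ^ (c * β - D) := by
      rw [Real.exp_mul]
      exact Real.rpow_le_rpow (Real.exp_pos _).le hL hD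
    have h6 : Real.exp e ≤ ε / (C * 2 ^ k) := by
      rw [he, Real.exp_log (by positivity)]
      gcongr
      norm_num
    calc Real.exp (δ * c * c' * β ^ 2) ≤ Real.exp (e + μ * c' * β * (c * β - D)) := by
          apply Real.exp_le_exp.2
          have h7 : (|μ * c' * D| + |e|) ≤ a * β := by
            have : (|μ * c' * D| + |e|) / a ≤ β := by linarith
            rw [div_le_iff₀ hapos] at this
            linarith
          have h8 := neg_abs_le e
          have h9 := le_abs_self (μ * c' * D)
          have h10 : (|μ * c' * D| + |e|) * β ≤ a * β * β := by gcongr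
          have h11 : |e| ≤ |e| * β := le_mul_of_one_le_right (abs_nonneg _) hβ1
          have h12 : μ * c' * D * β ≤ |μ * c' * D| * β := by gcongr
          have h13 : a * β * β = μ * c' * β * (c * β) - δ * c * c' * β ^ 2 := by rw [ha]; ring
          nlinarith
      _ ≤ _ := by rw [Real.exp_add]; gcongr

end Code

end MemoryTime

namespace MemoryTime

/-! ## A small imperative language

Expressions and commands over read-only variables, a read-only input and a family of two-dimensional
arrays. They compile to programs of the random access machine that run in polynomial time. -/

/-- Expressions. Variables and arrays are named by numbers; array indices and loop bounds are
variables. -/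
inductive Expr : Type
  | cst (c : ℕ)
  | var (x : ℕ)
  | add (a b : Expr)
  | sub (a b : Expr)
  | ite (c a b : Expr)
  | inp (a : Expr)
  | get (id x y : ℕ)
  | bsum (x y : ℕ) (a : Expr)
  | bpar (x y : ℕ) (a : Expr)

/-- Commands. -/
inductive Cmd : Type
  | skip
  | store (id x y : ℕ) (a : Expr)
  | seq (c₁ c₂ : Cmd)
  | ite (a : Expr) (c₁ c₂ : Cmd)
  | loop (x y : ℕ) (c : Cmd)

/-- The contents of the arrays. -/
abbrev Arrays : Type := ℕ → ℕ → ℕ → ℕ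

/-- Repeat the step `f i` for `i = 0, …, n - 1`. -/
def iter {α : Type*} (f : ℕ → α → α) (a : α) : ℕ → α
  | 0 => a
  | n + 1 => f n (iter f a n)

/-- Assignment to an array element. -/
def Arrays.set (A : Arrays) (id i j v : ℕ) : Arrays := fun id' i' j' =>
  if id' = id ∧ i' = i ∧ j' = j then v else A id' i' j'

/-- The value of an expression. -/
def Expr.eval (I : ℕ → ℕ) : Expr → (ℕ → ℕ) → Arrays → ℕ
  | cst c, _, _ => c
  | var x, ρ, _ => ρ x
  | add a b, ρ, A => a.eval I ρ A + b.eval I ρ A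
  | sub a b, ρ, A => a.eval I ρ A - b.eval I ρ A
  | ite c a b, ρ, A => if c.eval I ρ A ≠ 0 then a.eval I ρ A else b.eval I ρ A
  | inp a, ρ, A => I (a.eval I ρ A)
  | get id x y, ρ, A => A id (ρ x) (ρ y)
  | bsum x y a, ρ, A => ∑ i ∈ Finset.range (ρ y), a.eval I (Function.update ρ x i) A
  | bpar x y a, ρ, A =>
    (∑ i ∈ Finset.range (ρ y), if a.eval I (Function.update ρ x i) A ≠ 0 then 1 else 0) % 2

/-- The effect of a command. -/
def Cmd.exec (I : ℕ → ℕ) : Cmd → (ℕ → ℕ) → Arrays → Arrays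
  | skip, _, A => A
  | store id x y a, ρ, A => A.set id (ρ x) (ρ y) (a.eval I ρ A)
  | seq c₁ c₂, ρ, A => c₂.exec I ρ (c₁.exec I ρ A)
  | ite a c₁ c₂, ρ, A => if a.eval I ρ A ≠ 0 then c₁.exec I ρ A else c₂.exec I ρ A
  | loop x y c, ρ, A => iter (fun i A => c.exec I (Function.update ρ x i) A) A (ρ y)

/-! ## Runs of bounded length -/

/-- The program `p` started in `σ` halts within `K` steps in a state that satisfies `P`. -/
def Ex (p : Program) (σ : State) (K : ℕ) (P : State → Prop) : Prop :=
  ∃ k τ, Runs p σ k τ ∧ k ≤ K ∧ P τ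

namespace Ex

variable {σ : State} {P R : State → Prop} {p p' : Program} {K K' : ℕ}

theorem mono (h : Ex p σ K P) (hK : K ≤ K') (hP : ∀ τ, P τ → R τ) : Ex p σ K' R :=
  let ⟨k, τ, h1, h2, h3⟩ := h
  ⟨k, τ, h1, h2.trans hK, hP τ h3⟩

theorem const (x c : ℕ) (h : P ⟨Function.update σ.reg x c, σ.mem⟩) : Ex (.const x c) σ 1 P :=
  ⟨_, _, .const x c σ, le_rfl, h⟩

theorem add (x y z : ℕ) (h : P ⟨Function.update σ.reg x (σ.reg y + σ.reg z), σ.mem⟩) :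
    Ex (.add x y z) σ 1 P := ⟨_, _, .add x y z σ, le_rfl, h⟩

theorem sub (x y z : ℕ) (h : P ⟨Function.update σ.reg x (σ.reg y - σ.reg z), σ.mem⟩) :
    Ex (.sub x y z) σ 1 P := ⟨_, _, .sub x y z σ, le_rfl, h⟩

theorem load (x y : ℕ) (h : P ⟨Function.update σ.reg x (σ.mem (σ.reg y)), σ.mem⟩) :
    Ex (.load x y) σ 1 P := ⟨_, _, .load x y σ, le_rfl, h⟩

theorem store (x y : ℕ) (h : P ⟨σ.reg, Function.update σ.mem (σ.reg x) (σ.reg y)⟩) :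
    Ex (.store x y) σ 1 P := ⟨_, _, .store x y σ, le_rfl, h⟩

theorem seq (h : Ex p σ K P) (h' : ∀ τ, P τ → Ex p' τ K' R) : Ex (.seq p p') σ (K + K') R := by
  obtain ⟨k, τ, h1, h2, h3⟩ := h
  obtain ⟨k', υ, h1', h2', h3'⟩ := h' τ h3
  exact ⟨_, _, .seq h1 h1', add_le_add h2 h2', h3'⟩

theorem cond {x : ℕ} (h : σ.reg x ≠ 0 → Ex p σ K P) (h' : σ.reg x = 0 → Ex p' σ K' P) :
    Ex (.cond x p p') σ (K + K' + 1) P := by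
  by_cases hx : σ.reg x = 0
  · obtain ⟨k, τ, h1, h2, h3⟩ := h' hx
    exact ⟨_, _, .cond_false hx h1, by omega, h3⟩
  · obtain ⟨k, τ, h1, h2, h3⟩ := h hx
    exact ⟨_, _, .cond_true hx h1, by omega, h3⟩

theorem loop {x n : ℕ} (P : ℕ → State → Prop) (h0 : P 0 σ)
    (hc : ∀ i σ, i ≤ n → P i σ → σ.reg x = n - i)
    (hs : ∀ i σ, i < n → P i σ → Ex p σ K (P (i + 1))) :
    Ex (.loop x p) σ (n * (K + 1) + 1) (P n) := by
  have key : ∀ m i σ, i + m = n → P i σ → Ex (.loop x p) σ (m * (K + 1) + 1) (P n) := by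
    intro m
    induction m with
    | zero =>
      intro i σ hi hP
      obtain rfl : i = n := by omega
      exact ⟨_, _, .loop_done (by rw [hc i σ le_rfl hP, Nat.sub_self]), by omega, hP⟩
    | succ m ih =>
      intro i σ hi hP
      obtain ⟨k, τ, h1, h2, h3⟩ := hs i σ (by omega) hP
      obtain ⟨k', υ, h1', h2', h3'⟩ := ih (i + 1) τ (by omega) h3
      refine ⟨_, _, .loop_step (by rw [hc i σ (by omega) hP]; omega) h1 h1', ?_, h3'⟩
      rw [Nat.succ_mul]; omega
  exact key n 0 σ (by omega) h0

end Ex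

/-! ## Compilation -/

/-- The address of an array element relative to the base address. -/
def enc (id i j : ℕ) : ℕ := 2 ^ i * (2 * (2 ^ j * (2 * id + 1)) + 1)

theorem two_pow_mul_odd_inj {a b x y : ℕ} (h : 2 ^ a * (2 * x + 1) = 2 ^ b * (2 * y + 1)) :
    a = b ∧ x = y := by
  induction a generalizing b with
  | zero =>
    cases b with
    | zero => exact ⟨rfl, by simpa using h⟩
    | succ b => rw [pow_succ] at h; exfalso; simp only [pow_zero, one_mul, mul_assoc] at h
                rw [mul_left_comm] at h; omega
  | succ a ih =>
    cases b with
    | zero => rw [pow_succ] at h; exfalso; simp only [pow_zero, one_mul, mul_assoc] at h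
              rw [mul_left_comm] at h; omega
    | succ b =>
      rw [pow_succ, pow_succ, mul_right_comm, mul_right_comm (2 ^ b)] at h
      obtain ⟨h1, h2⟩ := ih (Nat.eq_of_mul_eq_mul_right two_pos h)
      exact ⟨by rw [h1], h2⟩

/-- Unique splitting into a power of two and an odd number, used twice. This pairing is computable
by repeated doubling, hence with additions only, in a number of steps linear in the indices; the
addresses may be exponentially large. -/
theorem enc_inj {id i j id' i' j' : ℕ} (h : enc id i j = enc id' i' j') :
    id = id' ∧ i = i' ∧ j = j' := by
  obtain ⟨h1, h2⟩ := two_pow_mul_odd_inj h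
  obtain ⟨h3, h4⟩ := two_pow_mul_odd_inj h2
  exact ⟨h4, h1, h3⟩

/-- The register of the variable `x`. -/
abbrev vreg (x : ℕ) : ℕ := 2 * x + 2

/-- The temporary register at depth `d`. -/
abbrev treg (d : ℕ) : ℕ := 2 * d + 1

theorem vreg_ne_treg (x d : ℕ) : vreg x ≠ treg d := by
  change 2 * x + 2 ≠ 2 * d + 1
  omega

theorem treg_inj {d e : ℕ} : treg d = treg e ↔ d = e := by
  change 2 * d + 1 = 2 * e + 1 ↔ d = e
  omega

theorem vreg_inj {x y : ℕ} : vreg x = vreg y ↔ x = y := by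
  change 2 * x + 2 = 2 * y + 2 ↔ x = y
  omega

/-- The machine state represents the input `I`, the variables `ρ` and the arrays `A`. -/
structure Rel (I : ℕ → ℕ) (b : ℕ) (ρ : ℕ → ℕ) (A : Arrays) (σ : State) : Prop where
  base : σ.reg 0 = b
  var : ∀ x, σ.reg (vreg x) = ρ x
  inp : ∀ i, i < b → σ.mem i = I i
  arr : ∀ id i j, σ.mem (b + enc id i j) = A id i j

theorem Rel.set_treg {I : ℕ → ℕ} {b : ℕ} {ρ : ℕ → ℕ} {A : Arrays} {σ : State}
    (h : Rel I b ρ A σ) (d v : ℕ) : Rel I b ρ A ⟨Function.update σ.reg (treg d) v, σ.mem⟩ where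
  base := (Function.update_of_ne (show 0 ≠ treg d from (Nat.succ_ne_zero _).symm) v σ.reg).trans h.base
  var x := by rw [← h.var x]; exact Function.update_of_ne (vreg_ne_treg x d) _ _
  inp := h.inp
  arr := h.arr

theorem Rel.set_vreg {I : ℕ → ℕ} {b : ℕ} {ρ : ℕ → ℕ} {A : Arrays} {σ : State}
    (h : Rel I b ρ A σ) (x v : ℕ) :
    Rel I b (Function.update ρ x v) A ⟨Function.update σ.reg (vreg x) v, σ.mem⟩ where
  base := (Function.update_of_ne (show 0 ≠ vreg x from (Nat.succ_ne_zero _).symm) v σ.reg).trans h.base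
  var y := by
    by_cases hy : y = x
    · subst hy; simp
    · rw [Function.update_of_ne hy, ← h.var y]
      exact Function.update_of_ne (fun h => hy (vreg_inj.1 h)) _ _
  inp := h.inp
  arr := h.arr

/-- The temporary registers below depth `d` agree. -/
def Keep (d : ℕ) (σ τ : State) : Prop := ∀ e, e < d → τ.reg (treg e) = σ.reg (treg e)

theorem Keep.refl (d : ℕ) (σ : State) : Keep d σ σ := fun _ _ => rfl

theorem Keep.trans {d : ℕ} {σ τ υ : State} (h : Keep d σ τ) (h' : Keep d τ υ) : Keep d σ υ :=
  fun e he => (h' e he).trans (h e he)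

theorem Keep.mono {d d' : ℕ} {σ τ : State} (h : Keep d' σ τ) (hd : d ≤ d') : Keep d σ τ :=
  fun e he => h e (he.trans_le hd)

theorem Keep.set_treg {d d' : ℕ} {σ τ : State} (h : Keep d σ τ) (hd : d ≤ d') (v : ℕ)
    (m : ℕ → ℕ) : Keep d σ ⟨Function.update τ.reg (treg d') v, m⟩ := fun e he => by
  rw [← h e he]; exact Function.update_of_ne (fun h => by rw [treg_inj] at h; omega) _ _

theorem Keep.set_vreg {d : ℕ} {σ τ : State} (h : Keep d σ τ) (x v : ℕ)
    (m : ℕ → ℕ) : Keep d σ ⟨Function.update τ.reg (vreg x) v, m⟩ := fun e he => by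
  rw [← h e he]; exact Function.update_of_ne (vreg_ne_treg x e).symm _ _

/-- Multiplies the temporary register `d` by the power of two of the variable `y`. -/
def dbl (y d : ℕ) : Program :=
  .seq (.const (treg (d + 2)) 1) (.seq (.const (treg (d + 1)) 0)
    (.seq (.add (treg (d + 1)) (vreg y) (treg (d + 1)))
      (.loop (treg (d + 1)) (.seq (.add (treg d) (treg d) (treg d))
        (.sub (treg (d + 1)) (treg (d + 1)) (treg (d + 2)))))))

/-- Computes the address of an array element in the temporary register `d`. -/
def addr (id x y d : ℕ) : Program :=
  .seq (.const (treg d) (2 * id + 1)) (.seq (dbl y d) (.seq (.add (treg d) (treg d) (treg d))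
    (.seq (.const (treg (d + 1)) 1) (.seq (.add (treg d) (treg d) (treg (d + 1)))
      (.seq (dbl x d) (.add (treg d) (treg d) 0))))))

/-- Repeats a program with the variable `x` running from `0` to the variable `y` minus `1`. -/
def forLoop (x y d : ℕ) (p : Program) : Program :=
  .seq (.const (treg (d + 3)) 1) (.seq (.const (treg (d + 1)) 0)
    (.seq (.add (treg (d + 2)) (vreg x) (treg (d + 1)))
      (.seq (.add (treg (d + 1)) (vreg y) (treg (d + 1)))
        (.seq (.const (vreg x) 0)
          (.seq (.loop (treg (d + 1)) (.seq p (.seq (.add (vreg x) (vreg x) (treg (d + 3)))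
              (.sub (treg (d + 1)) (treg (d + 1)) (treg (d + 3))))))
            (.seq (.const (treg (d + 3)) 0) (.add (vreg x) (treg (d + 2)) (treg (d + 3)))))))))

section Compile

variable {I : ℕ → ℕ} {b : ℕ} {ρ : ℕ → ℕ} {A : Arrays} {σ : State}

theorem ex_dbl (y d : ℕ) (h : Rel I b ρ A σ) :
    Ex (dbl y d) σ (3 * ρ y + 4) fun τ => Rel I b ρ A τ ∧ Keep d σ τ ∧
      τ.reg (treg d) = σ.reg (treg d) * 2 ^ ρ y ∧ τ.mem = σ.mem := by
  refine Ex.mono (Ex.seq (Ex.const _ _ rfl) ?_) (K := 1 + (1 + (1 + (ρ y * 3 + 1)))) (by omega)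
    fun _ h => h
  rintro _ rfl
  refine Ex.seq (Ex.const _ _ rfl) ?_
  rintro _ rfl
  refine Ex.seq (Ex.add _ _ _ rfl) ?_
  rintro _ rfl
  refine (Ex.loop (K := 2) (n := ρ y) (fun i τ => Rel I b ρ A τ ∧ Keep d σ τ ∧
      τ.reg (treg d) = σ.reg (treg d) * 2 ^ i ∧ τ.reg (treg (d + 1)) = ρ y - i ∧
      τ.reg (treg (d + 2)) = 1 ∧ τ.mem = σ.mem) ?_ (fun i τ _ h => h.2.2.2.1) ?_).mono le_rfl
      fun τ h => ⟨h.1, h.2.1, h.2.2.1, h.2.2.2.2.2⟩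
  · refine ⟨((h.set_treg _ _).set_treg _ _).set_treg _ _, ?_, ?_, ?_, ?_, rfl⟩
    · exact (((Keep.refl d σ).set_treg (by omega) _ _).set_treg (by omega) _ _).set_treg (by omega) _ _
    · simp
    · have := h.var y
      simp [this, vreg_ne_treg]
    · simp [Function.update_apply]
  · rintro i τ hi ⟨h1, h2, h3, h4, h5, h6⟩
    refine Ex.seq (Ex.add _ _ _ rfl) (K := 1) (K' := 1) ?_
    rintro _ rfl
    refine Ex.sub _ _ _ ⟨(h1.set_treg _ _).set_treg _ _,
      (h2.set_treg le_rfl _ _).set_treg (by omega) _ _, ?_, ?_, ?_, h6⟩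
    · simp [h3]; ring
    · simp [h4, h5]; omega
    · simp [h5]

theorem ex_addr (id x y d : ℕ) (h : Rel I b ρ A σ) :
    Ex (addr id x y d) σ (3 * ρ y + 3 * ρ x + 13) fun τ => Rel I b ρ A τ ∧ Keep d σ τ ∧
      τ.reg (treg d) = b + enc id (ρ x) (ρ y) := by
  refine Ex.mono (Ex.seq (Ex.const _ _ rfl) ?_)
    (K := 1 + ((3 * ρ y + 4) + (1 + (1 + (1 + ((3 * ρ x + 4) + 1)))))) (by omega) fun _ h => h
  rintro _ rfl
  refine Ex.seq (ex_dbl y d (h.set_treg _ _)) ?_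
  rintro τ ⟨h1, k1, e1, -⟩
  refine Ex.seq (Ex.add _ _ _ rfl) ?_
  rintro _ rfl
  refine Ex.seq (Ex.const _ _ rfl) ?_
  rintro _ rfl
  refine Ex.seq (Ex.add _ _ _ rfl) ?_
  rintro _ rfl
  refine Ex.seq (ex_dbl x d (((h1.set_treg _ _).set_treg _ _).set_treg _ _)) ?_
  rintro υ ⟨h2, k2, e2, -⟩
  refine Ex.add _ _ _ ⟨h2.set_treg _ _, ?_, ?_⟩
  · refine Keep.set_treg ?_ le_rfl _ _
    refine Keep.trans ?_ k2
    refine Keep.set_treg (Keep.set_treg (Keep.set_treg ?_ le_rfl _ _) (by omega) _ _) le_rfl _ _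
    exact Keep.trans ((Keep.refl d σ).set_treg le_rfl _ _) k1
  · simp only [Function.update_self, e2, h2.base, enc]
    simp [e1]
    ring

/-- The value `s i` is an accumulator in the register at depth `d`. The input `If i` may depend on
the round because the output loop overwrites input cells. -/
theorem ex_forLoop {If : ℕ → ℕ → ℕ} {Af : ℕ → Arrays} {s : ℕ → ℕ} (x y d : ℕ) {p : Program} {K : ℕ}
    (h : Rel (If 0) b ρ (Af 0) σ) (hs : σ.reg (treg d) = s 0)
    (hp : ∀ i τ, i < ρ y → Rel (If i) b (Function.update ρ x i) (Af i) τ → τ.reg (treg d) = s i →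
      τ.reg (treg (d + 3)) = 1 →
      Ex p τ K fun υ => Rel (If (i + 1)) b (Function.update ρ x i) (Af (i + 1)) υ ∧
        (∀ e, e < d + 4 → e ≠ d → υ.reg (treg e) = τ.reg (treg e)) ∧ υ.reg (treg d) = s (i + 1)) :
    Ex (forLoop x y d p) σ (ρ y * (K + 3) + 8) fun τ => Rel (If (ρ y)) b ρ (Af (ρ y)) τ ∧
      Keep d σ τ ∧ τ.reg (treg d) = s (ρ y) := by
  refine Ex.mono (Ex.seq (Ex.const _ _ rfl) ?_)
    (K := 1 + (1 + (1 + (1 + (1 + ((ρ y * ((K + (1 + 1)) + 1) + 1) + (1 + 1))))))) (by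
      have : K + (1 + 1) + 1 = K + 3 := by ring
      rw [this]; omega) fun _ h => h
  rintro _ rfl
  refine Ex.seq (Ex.const _ _ rfl) ?_
  rintro _ rfl
  refine Ex.seq (Ex.add _ _ _ rfl) ?_
  rintro _ rfl
  refine Ex.seq (Ex.add _ _ _ rfl) ?_
  rintro _ rfl
  refine Ex.seq (Ex.const _ _ rfl) ?_
  rintro _ rfl
  refine Ex.seq (Ex.loop (n := ρ y) (fun i τ => Rel (If i) b (Function.update ρ x i) (Af i) τ ∧
    Keep d σ τ ∧ τ.reg (treg d) = s i ∧ τ.reg (treg (d + 1)) = ρ y - i ∧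
      τ.reg (treg (d + 2)) = ρ x ∧ τ.reg (treg (d + 3)) = 1) ?_ (fun i τ _ h => h.2.2.2.1) ?_) ?_
  · refine ⟨((((h.set_treg _ _).set_treg _ _).set_treg _ _).set_treg _ _).set_vreg _ _, ?_, ?_, ?_,
      ?_, ?_⟩
    · exact (((((Keep.refl d σ).set_treg (by omega) _ _).set_treg (by omega) _ _).set_treg
        (by omega) _ _).set_treg (by omega) _ _).set_vreg _ _ _
    · simp [Function.update_apply, hs]
      intro h; omega
    · have := h.var y
      simp [Function.update_apply, this]
      grind
    · have := h.var x
      simp [Function.update_apply, this]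
      grind
    · simp [Function.update_apply]
      grind
  · rintro i τ hi ⟨h1, k1, e1, e2, e3, e4⟩
    refine Ex.seq (hp i τ hi h1 e1 e4) ?_
    rintro υ ⟨h2, k2, e5⟩
    refine Ex.seq (K := 1) (K' := 1) (Ex.add _ _ _ rfl) ?_
    rintro _ rfl
    have f2 := k2 (d + 1) (by omega) (by omega)
    have f3 := k2 (d + 2) (by omega) (by omega)
    have f4 := k2 (d + 3) (by omega) (by omega)
    refine Ex.sub _ _ _ ⟨?_, ?_, ?_, ?_, ?_, ?_⟩
    · have := (h2.set_vreg x (i + 1)).set_treg (d + 1) (ρ y - (i + 1))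
      rw [Function.update_idem] at this
      convert this using 3
      · rw [h2.var, Function.update_self, f4, e4]
      · simp [Function.update_apply, f2, f4, e2, e4]
        grind
    · refine Keep.set_treg (Keep.set_vreg ?_ _ _ _) (by omega) _ _
      exact fun e he => (k2 e (by omega) (by omega)).trans (k1 e he)
    · simp [Function.update_apply, e5]
      grind
    · simp [Function.update_apply, f2, f4, e2, e4]
      grind
    · simp [Function.update_apply, f3, e3]
      grind
    · simp [Function.update_apply, f4, e4]
      grind
  · rintro τ ⟨h1, k1, e1, e2, e3, e4⟩
    refine Ex.seq (Ex.const _ _ rfl) ?_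
    rintro _ rfl
    refine Ex.add _ _ _ ⟨?_, ?_, ?_⟩
    · have := (h1.set_treg (d + 3) 0).set_vreg x (ρ x)
      rw [Function.update_idem, Function.update_eq_self] at this
      convert this using 3
      simp [e3]
    · exact (k1.set_treg (by omega) _ _).set_vreg _ _ _
    · simp [Function.update_apply, e1]
      grind

/-- The program for an expression; the value ends up in the temporary register `d`. -/
def Expr.compile : Expr → ℕ → Program
  | cst c, d => .const (treg d) c
  | var x, d => .seq (.const (treg d) 0) (.add (treg d) (vreg x) (treg d))
  | add a a', d => .seq (a.compile d) (.seq (a'.compile (d + 1)) (.add (treg d) (treg d) (treg (d + 1))))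
  | sub a a', d => .seq (a.compile d) (.seq (a'.compile (d + 1)) (.sub (treg d) (treg d) (treg (d + 1))))
  | ite c a a', d => .seq (c.compile d) (.cond (treg d) (a.compile d) (a'.compile d))
  | inp a, d => .seq (a.compile d) (.seq (.sub (treg (d + 1)) 0 (treg d))
      (.cond (treg (d + 1)) (.load (treg d) (treg d)) (.const (treg d) 0)))
  | get id x y, d => .seq (addr id x y d) (.load (treg d) (treg d))
  | bsum x y a, d => .seq (.const (treg d) 0) (forLoop x y d
      (.seq (a.compile (d + 4)) (.add (treg d) (treg d) (treg (d + 4)))))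
  | bpar x y a, d => .seq (.const (treg d) 0) (forLoop x y d
      (.seq (a.compile (d + 4)) (.cond (treg (d + 4)) (.sub (treg d) (treg (d + 3)) (treg d))
        (.const (treg (d + 4)) 0))))

/-- The program for a command, using temporary registers from `d` on. -/
def Cmd.compile : Cmd → ℕ → Program
  | skip, d => .const (treg d) 0
  | store id x y a, d => .seq (addr id x y d) (.seq (a.compile (d + 1)) (.store (treg d) (treg (d + 1))))
  | seq c c', d => .seq (c.compile d) (c'.compile d)
  | ite a c c', d => .seq (a.compile d) (.cond (treg d) (c.compile d) (c'.compile d))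
  | loop x y c, d => forLoop x y d (c.compile (d + 4))

theorem le_pow_mul {B p n c k : ℕ} (hB : 2 ≤ B) (h : n ≤ c * p) (hc : c ≤ 2 ^ k) : n ≤ B ^ k * p :=
  h.trans (Nat.mul_le_mul_right _ (hc.trans (Nat.pow_le_pow_left hB k)))

theorem update_le {N x i : ℕ} (hN : ∀ x, ρ x ≤ N) (hi : i ≤ N) (y : ℕ) :
    Function.update ρ x i y ≤ N := by
  rw [Function.update_apply]; split_ifs
  exacts [hi, hN y]

/-- Variables change only as loop indices, which stay below another variable. So `N` bounds all of
them throughout, each loop multiplies the cost by at most about `N`, and the degree `K` depends on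
the expression alone. -/
theorem Expr.ex_compile (e : Expr) : ∃ K, ∀ (d N : ℕ) (I : ℕ → ℕ) (b : ℕ) (ρ : ℕ → ℕ) (A : Arrays)
    (σ : State), (∀ x, ρ x ≤ N) → (∀ i, b ≤ i → I i = 0) → Rel I b ρ A σ →
    Ex (e.compile d) σ ((N + 2) ^ K) fun τ =>
      Rel I b ρ A τ ∧ Keep d σ τ ∧ τ.reg (treg d) = e.eval I ρ A := by
  have pos : ∀ N K, 1 ≤ (N + 2) ^ K := fun N K => Nat.one_le_pow _ _ (by omega)
  induction e with
  | cst c =>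
    refine ⟨0, fun d N I b ρ A σ hN hI h => Ex.const _ _ ⟨h.set_treg _ _,
      (Keep.refl d σ).set_treg le_rfl _ _, by simp [eval]⟩⟩
  | var x =>
    refine ⟨1, fun d N I b ρ A σ hN hI h => ?_⟩
    refine Ex.mono (Ex.seq (Ex.const _ _ rfl) (K' := 1) ?_) (by rw [pow_one]; omega) fun _ h => h
    rintro _ rfl
    refine Ex.add _ _ _ ⟨(h.set_treg _ _).set_treg _ _,
      ((Keep.refl d σ).set_treg le_rfl _ _).set_treg le_rfl _ _, ?_⟩
    have := h.var x
    simp [vreg_ne_treg, this, eval]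
  | add a a' ih ih' =>
    obtain ⟨K, ih⟩ := ih
    obtain ⟨K', ih'⟩ := ih'
    refine ⟨2 + (K + K'), fun d N I b ρ A σ hN hI h => ?_⟩
    refine Ex.mono (Ex.seq (ih d N I b ρ A σ hN hI h) (K' := (N + 2) ^ K' + 1) ?_) ?_ fun _ h => h
    · rintro τ ⟨h1, k1, e1⟩
      refine Ex.seq (ih' (d + 1) N I b ρ A τ hN hI h1) ?_
      rintro υ ⟨h2, k2, e2⟩
      refine Ex.add _ _ _ ⟨h2.set_treg _ _, (k1.trans (k2.mono (by omega))).set_treg le_rfl _ _, ?_⟩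
      have := k2 d (by omega)
      simp [e2, this, e1, eval]
    · have h1 := pos N K
      have h2 := pos N K'
      rw [pow_add (N + 2) 2]
      refine le_pow_mul (c := 3) (by omega) ?_ (by norm_num)
      rw [pow_add]; nlinarith
  | sub a a' ih ih' =>
    obtain ⟨K, ih⟩ := ih
    obtain ⟨K', ih'⟩ := ih'
    refine ⟨2 + (K + K'), fun d N I b ρ A σ hN hI h => ?_⟩
    refine Ex.mono (Ex.seq (ih d N I b ρ A σ hN hI h) (K' := (N + 2) ^ K' + 1) ?_) ?_ fun _ h => h
    · rintro τ ⟨h1, k1, e1⟩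
      refine Ex.seq (ih' (d + 1) N I b ρ A τ hN hI h1) ?_
      rintro υ ⟨h2, k2, e2⟩
      refine Ex.sub _ _ _ ⟨h2.set_treg _ _, (k1.trans (k2.mono (by omega))).set_treg le_rfl _ _, ?_⟩
      have := k2 d (by omega)
      simp [e2, this, e1, eval]
    · have h1 := pos N K
      have h2 := pos N K'
      rw [pow_add (N + 2) 2]
      refine le_pow_mul (c := 3) (by omega) ?_ (by norm_num)
      rw [pow_add]; nlinarith
  | ite c a a' ihc ih ih' =>
    obtain ⟨K₀, ihc⟩ := ihc
    obtain ⟨K, ih⟩ := ih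
    obtain ⟨K', ih'⟩ := ih'
    refine ⟨2 + (K₀ + K + K'), fun d N I b ρ A σ hN hI h => ?_⟩
    refine Ex.mono (Ex.seq (ihc d N I b ρ A σ hN hI h) (K' := (N + 2) ^ K + (N + 2) ^ K' + 1) ?_)
      ?_ fun _ h => h
    · rintro τ ⟨h1, k1, e1⟩
      refine Ex.cond (fun h0 => ?_) fun h0 => ?_
      · refine (ih d N I b ρ A τ hN hI h1).mono le_rfl ?_
        rintro υ ⟨h2, k2, e2⟩
        rw [e1] at h0
        exact ⟨h2, k1.trans k2, by rw [e2, eval, if_pos h0]⟩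
      · refine (ih' d N I b ρ A τ hN hI h1).mono le_rfl ?_
        rintro υ ⟨h2, k2, e2⟩
        rw [e1] at h0
        exact ⟨h2, k1.trans k2, by rw [e2, eval, if_neg (not_not.2 h0)]⟩
    · have h0 := pos N K₀
      have h1 := pos N K
      have h2 := pos N K'
      rw [pow_add (N + 2) 2]
      refine le_pow_mul (c := 4) (by omega) ?_ (by norm_num)
      rw [pow_add, pow_add]
      have h3 := Nat.mul_le_mul h0 h1
      have h4 := Nat.mul_le_mul h3 h2
      have h5 : (N + 2) ^ K₀ ≤ (N + 2) ^ K₀ * (N + 2) ^ K * (N + 2) ^ K' := by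
        rw [mul_assoc]; exact Nat.le_mul_of_pos_right _ (by positivity)
      have h6 : (N + 2) ^ K ≤ (N + 2) ^ K₀ * (N + 2) ^ K * (N + 2) ^ K' := by
        rw [mul_comm ((N + 2) ^ K₀), mul_assoc]; exact Nat.le_mul_of_pos_right _ (by positivity)
      have h7 : (N + 2) ^ K' ≤ (N + 2) ^ K₀ * (N + 2) ^ K * (N + 2) ^ K' :=
        Nat.le_mul_of_pos_left _ (by positivity)
      omega
  | inp a ih =>
    obtain ⟨K, ih⟩ := ih
    refine ⟨3 + K, fun d N I b ρ A σ hN hI h => ?_⟩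
    refine Ex.mono (Ex.seq (ih d N I b ρ A σ hN hI h) (K' := 1 + (1 + 1 + 1)) ?_) ?_ fun _ h => h
    · rintro τ ⟨h1, k1, e1⟩
      -- The truncated difference tests whether the address is below `b`. Cells from `b` on belong
      -- to the arrays, so a read beyond the input is answered by `0`.
      refine Ex.seq (Ex.sub _ _ _ rfl) ?_
      rintro _ rfl
      have hd : treg d ≠ treg (d + 1) := fun h => by rw [treg_inj] at h; omega
      refine Ex.cond (fun h0 => Ex.load _ _ ⟨(h1.set_treg _ _).set_treg _ _,
        (k1.set_treg (by omega) _ _).set_treg le_rfl _ _, ?_⟩) fun h0 => Ex.const _ _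
          ⟨(h1.set_treg _ _).set_treg _ _, (k1.set_treg (by omega) _ _).set_treg le_rfl _ _, ?_⟩
      · simp only [Function.update_self, h1.base, e1] at h0
        simp only [Function.update_self, Function.update_of_ne hd, e1, eval]
        exact h1.inp _ (by omega)
      · simp only [Function.update_self, h1.base, e1] at h0
        simp only [Function.update_self, eval]
        exact (hI _ (by omega)).symm
    · have h1 := pos N K
      rw [pow_add]
      exact le_pow_mul (c := 5) (by omega) (by omega) (by norm_num)
  | get id x y =>
    refine ⟨5, fun d N I b ρ A σ hN hI h => ?_⟩
    refine Ex.mono (Ex.seq (ex_addr id x y d h) (K' := 1) ?_) ?_ fun _ h => h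
    · rintro τ ⟨h1, k1, e1⟩
      refine Ex.load _ _ ⟨h1.set_treg _ _, k1.set_treg le_rfl _ _, ?_⟩
      dsimp only
      rw [Function.update_self, e1, h1.arr, eval]
    · have h1 := hN x
      have h2 := hN y
      have h3 : 3 * ρ y + 3 * ρ x + 13 + 1 ≤ 7 * (N + 2) := by omega
      have := le_pow_mul (B := N + 2) (k := 3) (by omega) h3 (by norm_num)
      exact this.trans (by rw [← pow_succ]; exact Nat.pow_le_pow_right (by omega) (by omega))
  | bsum x y a ih =>
    obtain ⟨K, ih⟩ := ih
    refine ⟨5 + (K + 1), fun d N I b ρ A σ hN hI h => ?_⟩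
    refine Ex.mono (Ex.seq (Ex.const _ _ rfl) (K' := ρ y * ((N + 2) ^ K + 1 + 3) + 8) ?_) ?_
      fun _ h => h
    · rintro _ rfl
      refine (ex_forLoop (If := fun _ => I) (Af := fun _ => A)
        (s := fun m => ∑ i ∈ Finset.range m, a.eval I (Function.update ρ x i) A) x y d
        (h.set_treg _ _) (by simp) ?_).mono le_rfl ?_
      · intro i τ hi hτ hs _
        refine Ex.seq (ih (d + 4) N I b _ A τ (update_le hN (hi.le.trans (hN y))) hI hτ) ?_
        rintro υ ⟨h2, k2, e2⟩
        refine Ex.add _ _ _ ⟨h2.set_treg _ _, fun e he hne => ?_, ?_⟩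
        · rw [← k2 e he]
          exact Function.update_of_ne (fun h => hne (treg_inj.1 h)) _ _
        · dsimp only
          rw [Function.update_self, e2, k2 d (by omega), hs, Finset.sum_range_succ]
      · rintro τ ⟨h1, k1, e1⟩
        exact ⟨h1, ((Keep.refl d σ).set_treg le_rfl _ _).trans k1, e1⟩
    · have h1 := pos N K
      have h2 := hN y
      rw [pow_add]
      refine le_pow_mul (c := 20) (by omega) ?_ (by norm_num)
      rw [pow_succ]
      nlinarith
  | bpar x y a ih =>
    obtain ⟨K, ih⟩ := ih
    refine ⟨5 + (K + 1), fun d N I b ρ A σ hN hI h => ?_⟩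
    refine Ex.mono (Ex.seq (Ex.const _ _ rfl) (K' := ρ y * ((N + 2) ^ K + (1 + 1 + 1) + 3) + 8) ?_)
      ?_ fun _ h => h
    · rintro _ rfl
      refine (ex_forLoop (If := fun _ => I) (Af := fun _ => A)
        (s := fun m => (∑ i ∈ Finset.range m,
          if a.eval I (Function.update ρ x i) A ≠ 0 then 1 else 0) % 2) x y d
        (h.set_treg _ _) (by simp) ?_).mono le_rfl ?_
      · intro i τ hi hτ hs h3
        refine Ex.seq (ih (d + 4) N I b _ A τ (update_le hN (hi.le.trans (hN y))) hI hτ) ?_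
        rintro υ ⟨h2, k2, e2⟩
        -- The parity `s` is toggled to `1 - s`; the loop keeps the constant `1` in the register at
        -- depth `d + 3`.
        refine Ex.cond (fun h0 => Ex.sub _ _ _ ⟨h2.set_treg _ _, fun e he hne => ?_, ?_⟩)
          fun h0 => Ex.const _ _ ⟨h2.set_treg _ _, fun e he hne => ?_, ?_⟩
        · rw [← k2 e he]
          exact Function.update_of_ne (fun h => hne (treg_inj.1 h)) _ _
        · rw [e2] at h0
          dsimp only
          rw [Function.update_self, k2 d (by omega), k2 (d + 3) (by omega), hs, h3,
            Finset.sum_range_succ, if_pos h0]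
          omega
        · rw [← k2 e he]
          exact Function.update_of_ne (fun h => by rw [treg_inj] at h; omega) _ _
        · rw [e2] at h0
          dsimp only
          rw [Function.update_of_ne (fun h => by rw [treg_inj] at h; omega), k2 d (by omega), hs,
            Finset.sum_range_succ, if_neg (not_not.2 h0), add_zero]
      · rintro τ ⟨h1, k1, e1⟩
        exact ⟨h1, ((Keep.refl d σ).set_treg le_rfl _ _).trans k1, e1⟩
    · have h1 := pos N K
      have h2 := hN y
      rw [pow_add]
      refine le_pow_mul (c := 20) (by omega) ?_ (by norm_num)
      rw [pow_succ]
      nlinarith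

theorem Rel.store (h : Rel I b ρ A σ) (id i j v : ℕ) :
    Rel I b ρ (A.set id i j v) ⟨σ.reg, Function.update σ.mem (b + enc id i j) v⟩ where
  base := h.base
  var := h.var
  inp k hk := by
    rw [← h.inp k hk]
    exact Function.update_of_ne (by omega) _ _
  arr id' i' j' := by
    dsimp only [Arrays.set]
    split_ifs with h'
    · obtain ⟨rfl, rfl, rfl⟩ := h'
      exact Function.update_self _ _ _
    · rw [← h.arr]
      exact Function.update_of_ne (fun h => h' (enc_inj (Nat.add_left_cancel h))) _ _

theorem Cmd.ex_compile (c : Cmd) : ∃ K, ∀ (d N : ℕ) (I : ℕ → ℕ) (b : ℕ) (ρ : ℕ → ℕ) (A : Arrays)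
    (σ : State), (∀ x, ρ x ≤ N) → (∀ i, b ≤ i → I i = 0) → Rel I b ρ A σ →
    Ex (c.compile d) σ ((N + 2) ^ K) fun τ => Rel I b ρ (c.exec I ρ A) τ ∧ Keep d σ τ := by
  have pos : ∀ N K, 1 ≤ (N + 2) ^ K := fun N K => Nat.one_le_pow _ _ (by omega)
  induction c with
  | skip =>
    exact ⟨0, fun d N I b ρ A σ hN hI h => Ex.const _ _ ⟨h.set_treg _ _,
      (Keep.refl d σ).set_treg le_rfl _ _⟩⟩
  | store id x y a =>
    obtain ⟨K, ih⟩ := a.ex_compile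
    refine ⟨5 + (K + 1), fun d N I b ρ A σ hN hI h => ?_⟩
    refine Ex.mono (Ex.seq (ex_addr id x y d h) (K' := (N + 2) ^ K + 1) ?_) ?_ fun _ h => h
    · rintro τ ⟨h1, k1, e1⟩
      refine Ex.seq (ih (d + 1) N I b ρ A τ hN hI h1) ?_
      rintro υ ⟨h2, k2, e2⟩
      refine Ex.store _ _ ⟨?_, k1.trans (k2.mono (by omega))⟩
      rw [k2 d (by omega), e1, e2]
      exact h2.store id (ρ x) (ρ y) _
    · have h1 := pos N K
      have h2 := hN y
      have h3 := hN x
      rw [pow_add]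
      refine le_pow_mul (c := 20) (by omega) ?_ (by norm_num)
      rw [pow_succ]
      nlinarith
  | seq c c' ih ih' =>
    obtain ⟨K, ih⟩ := ih
    obtain ⟨K', ih'⟩ := ih'
    refine ⟨1 + (K + K'), fun d N I b ρ A σ hN hI h => ?_⟩
    refine Ex.mono (Ex.seq (ih d N I b ρ A σ hN hI h) (K' := (N + 2) ^ K') ?_) ?_ fun _ h => h
    · rintro τ ⟨h1, k1⟩
      exact (ih' d N I b ρ _ τ hN hI h1).mono le_rfl fun υ h2 => ⟨h2.1, k1.trans h2.2⟩
    · have h1 := pos N K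
      have h2 := pos N K'
      rw [pow_add (N + 2) 1]
      refine le_pow_mul (c := 2) (by omega) ?_ (by norm_num)
      rw [pow_add]; nlinarith
  | ite a c c' ih ih' =>
    obtain ⟨K₀, iha⟩ := a.ex_compile
    obtain ⟨K, ih⟩ := ih
    obtain ⟨K', ih'⟩ := ih'
    refine ⟨2 + (K₀ + K + K'), fun d N I b ρ A σ hN hI h => ?_⟩
    refine Ex.mono (Ex.seq (iha d N I b ρ A σ hN hI h) (K' := (N + 2) ^ K + (N + 2) ^ K' + 1) ?_)
      ?_ fun _ h => h
    · rintro τ ⟨h1, k1, e1⟩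
      refine Ex.cond (fun h0 => ?_) fun h0 => ?_
      · refine (ih d N I b ρ A τ hN hI h1).mono le_rfl ?_
        rintro υ ⟨h2, k2⟩
        rw [e1] at h0
        exact ⟨by rw [exec, if_pos h0]; exact h2, k1.trans k2⟩
      · refine (ih' d N I b ρ A τ hN hI h1).mono le_rfl ?_
        rintro υ ⟨h2, k2⟩
        rw [e1] at h0
        exact ⟨by rw [exec, if_neg (not_not.2 h0)]; exact h2, k1.trans k2⟩
    · have h0 := pos N K₀
      have h1 := pos N K
      have h2 := pos N K'
      rw [pow_add (N + 2) 2]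
      refine le_pow_mul (c := 4) (by omega) ?_ (by norm_num)
      rw [pow_add, pow_add]
      have h3 := Nat.mul_le_mul h0 h1
      have h4 := Nat.mul_le_mul h3 h2
      have h5 : (N + 2) ^ K₀ ≤ (N + 2) ^ K₀ * (N + 2) ^ K * (N + 2) ^ K' := by
        rw [mul_assoc]; exact Nat.le_mul_of_pos_right _ (by positivity)
      have h6 : (N + 2) ^ K ≤ (N + 2) ^ K₀ * (N + 2) ^ K * (N + 2) ^ K' := by
        rw [mul_comm ((N + 2) ^ K₀), mul_assoc]; exact Nat.le_mul_of_pos_right _ (by positivity)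
      have h7 : (N + 2) ^ K' ≤ (N + 2) ^ K₀ * (N + 2) ^ K * (N + 2) ^ K' :=
        Nat.le_mul_of_pos_left _ (by positivity)
      omega
  | loop x y c ih =>
    obtain ⟨K, ih⟩ := ih
    refine ⟨5 + (K + 1), fun d N I b ρ A σ hN hI h => ?_⟩
    refine (ex_forLoop (If := fun _ => I) (Af := iter (fun i A => c.exec I (Function.update ρ x i) A) A)
      (s := fun _ => σ.reg (treg d)) (K := (N + 2) ^ K) x y d h rfl ?_).mono ?_
      fun τ h => ⟨h.1, h.2.1⟩
    · intro i τ hi hτ hs _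
      refine (ih (d + 4) N I b _ _ τ (update_le hN (hi.le.trans (hN y))) hI hτ).mono le_rfl ?_
      rintro υ ⟨h2, k2⟩
      exact ⟨h2, fun e he _ => k2 e he, (k2 d (by omega)).trans hs⟩
    · have h1 := pos N K
      have h2 := hN y
      rw [pow_add]
      refine le_pow_mul (c := 20) (by omega) ?_ (by norm_num)
      rw [pow_succ]
      nlinarith

end Compile

end MemoryTime

/-! ### Initialization and output of the machine program -/

namespace MemoryTime

/-- The values of the variables that hold the parameters of the input. -/
def params (L ℓ n M : ℕ) : ℕ → ℕ :=
  Function.update (Function.update (Function.update (Function.update (Function.update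
    (Function.update (Function.update (fun _ => 0) 1 L) 9 ℓ) 2 (ℓ + 1)) 3 n) 4 M) 5 (n + n))
    6 (n + n + 1)

/-- Loads an input cell into a variable. -/
def loadVar (x c : ℕ) : Program := .seq (.const (treg 0) c) (.load (vreg x) (treg 0))

/-- Sets a variable to the successor of a variable. -/
def succVar (x y : ℕ) : Program := .seq (.const (treg 0) 1) (.add (vreg x) (vreg y) (treg 0))

/-- Loads the parameters and sets the base address to `(D + 5) * 2 ^ (n + M)`. -/
def setup (D : ℕ) : Program :=
  .seq (loadVar 1 1) (.seq (loadVar 9 2) (.seq (succVar 2 9) (.seq (loadVar 3 3) (.seq (loadVar 4 4)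
    (.seq (.add (vreg 5) (vreg 3) (vreg 3)) (.seq (succVar 6 5) (.seq (.const (treg 0) (D + 5))
      (.seq (dbl 3 0) (.seq (dbl 4 0) (.seq (.const (treg 1) 0) (.add 0 (treg 0) (treg 1))))))))))))

/-- Copies the array `3` to the first memory cells. -/
def outputLoop : Program :=
  forLoop 10 5 0 (.seq ((Expr.get 3 10 0).compile 4) (.store (vreg 10) (treg 4)))

/-- The complete program for a command. -/
def wrap (D : ℕ) (c : Cmd) : Program := .seq (setup D) (.seq (c.compile 0) outputLoop)

section Wrap

variable {I : ℕ → ℕ} {b : ℕ} {ρ : ℕ → ℕ} {A : Arrays} {σ : State}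

theorem ex_loadVar (x c : ℕ) (h : Rel I b ρ A σ) (hm : σ.mem = I) :
    Ex (loadVar x c) σ 2 fun τ => Rel I b (Function.update ρ x (I c)) A τ ∧ τ.mem = I := by
  refine Ex.seq (Ex.const _ _ rfl) (K := 1) (K' := 1) ?_
  rintro _ rfl
  refine Ex.load _ _ ⟨?_, hm⟩
  have := (h.set_treg 0 c).set_vreg x (I c)
  simpa [hm] using this

theorem ex_succVar (x y : ℕ) (h : Rel I b ρ A σ) (hm : σ.mem = I) :
    Ex (succVar x y) σ 2 fun τ => Rel I b (Function.update ρ x (ρ y + 1)) A τ ∧ τ.mem = I := by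
  refine Ex.seq (Ex.const _ _ rfl) (K := 1) (K' := 1) ?_
  rintro _ rfl
  refine Ex.add _ _ _ ⟨?_, hm⟩
  have := (h.set_treg 0 1).set_vreg x (ρ y + 1)
  have hy := h.var y
  simpa [Function.update_of_ne (vreg_ne_treg y 0), hy] using this

theorem ex_addVar (x y z : ℕ) (h : Rel I b ρ A σ) (hm : σ.mem = I) :
    Ex (.add (vreg x) (vreg y) (vreg z)) σ 1 fun τ =>
      Rel I b (Function.update ρ x (ρ y + ρ z)) A τ ∧ τ.mem = I := by
  refine Ex.add _ _ _ ⟨?_, hm⟩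
  rw [h.var, h.var]
  exact h.set_vreg x (ρ y + ρ z)

/-- The base address can be reached by `n + M` doublings and lies beyond the input. The memory above
it is zero, so all arrays start as zero. -/
theorem ex_setup (D : ℕ) {L ℓ n M : ℕ} (hL : I 1 = L) (hℓ : I 2 = ℓ) (hn : I 3 = n) (hM : I 4 = M)
    (hI : ∀ i, (D + 5) * 2 ^ (n + M) ≤ i → I i = 0) :
    Ex (setup D) ⟨fun _ => 0, I⟩ (3 * n + 3 * M + 30) fun τ =>
      Rel I ((D + 5) * 2 ^ (n + M)) (params L ℓ n M) 0 τ := by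
  -- As long as the base is `0`, the arrays are by definition whatever the memory contains.
  have h0 : Rel I 0 (fun _ => 0) (fun id i j => I (0 + enc id i j)) ⟨fun _ => 0, I⟩ :=
    ⟨rfl, fun _ => rfl, fun i hi => absurd hi (Nat.not_lt_zero i), fun _ _ _ => rfl⟩
  refine Ex.mono (Ex.seq (ex_loadVar 1 1 h0 rfl) (K' := 2 + (2 + (2 + (2 + (1 + (2 + (1 +
    ((3 * n + 4) + ((3 * M + 4) + (1 + 1)))))))))) ?_) (by omega) fun _ h => h
  rintro τ ⟨h1, m1⟩
  refine Ex.seq (ex_loadVar 9 2 h1 m1) ?_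
  rintro τ ⟨h2, m2⟩
  refine Ex.seq (ex_succVar 2 9 h2 m2) ?_
  rintro τ ⟨h3, m3⟩
  refine Ex.seq (ex_loadVar 3 3 h3 m3) ?_
  rintro τ ⟨h4, m4⟩
  refine Ex.seq (ex_loadVar 4 4 h4 m4) ?_
  rintro τ ⟨h5, m5⟩
  refine Ex.seq (ex_addVar 5 3 3 h5 m5) ?_
  rintro υ ⟨h7, m7⟩
  refine Ex.seq (ex_succVar 6 5 h7 m7) ?_
  rintro τ ⟨h8, m8⟩
  refine Ex.seq (Ex.const _ _ rfl) ?_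
  rintro _ rfl
  have hp : Rel I 0 (params L ℓ n M) (fun id i j => I (0 + enc id i j)) τ := by
    convert h8 using 1
    simp [params, hL, hℓ, hn, hM]
  have p3 : params L ℓ n M 3 = n := by simp [params]
  have p4 : params L ℓ n M 4 = M := by simp [params]
  have d1 := ex_dbl 3 0 (hp.set_treg 0 (D + 5))
  rw [p3] at d1
  refine Ex.seq d1 ?_
  rintro υ ⟨h9, -, e9, m9⟩
  have d2 := ex_dbl 4 0 h9
  rw [p4] at d2
  refine Ex.seq d2 ?_
  rintro υ' ⟨h10, -, e10, m10⟩
  refine Ex.seq (Ex.const _ _ rfl) ?_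
  rintro _ rfl
  have hm : υ'.mem = I := m10.trans (m9.trans m8)
  have hb : υ'.reg (treg 0) = (D + 5) * 2 ^ (n + M) := by
    rw [e10, e9]; simp [pow_add, mul_assoc]
  have hb' : Function.update υ'.reg (treg 1) 0 (treg 0) +
      Function.update υ'.reg (treg 1) 0 (treg 1) = (D + 5) * 2 ^ (n + M) := by
    rw [Function.update_self, Function.update_of_ne (fun h => by rw [treg_inj] at h; omega), hb,
      add_zero]
  refine Ex.add _ _ _ ⟨?_, fun x => ?_, fun i _ => ?_, fun id i j => ?_⟩
  · simp only [Function.update_self]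
    exact hb'
  · have := (h10.set_treg 1 0).var x
    dsimp only at this ⊢
    rw [Function.update_of_ne (by change 2 * x + 2 ≠ 0; omega), this]
  · exact congrFun hm i
  · exact (congrFun hm _).trans (hI _ (Nat.le_add_right _ _))

/-- Overwriting the input is harmless: the arrays lie above `b`, and the loop reads no input. -/
theorem ex_outputLoop : ∃ K, ∀ (N L ℓ n M : ℕ) (I : ℕ → ℕ) (b : ℕ) (A : Arrays) (σ : State),
    (∀ x, params L ℓ n M x ≤ N) → n + n ≤ b → (∀ i, b ≤ i → I i = 0) →
    Rel I b (params L ℓ n M) A σ →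
    Ex outputLoop σ ((N + 2) ^ K) fun τ => ∀ i, i < n + n → τ.mem i = A 3 i 0 := by
  obtain ⟨K, hK⟩ := (Expr.get 3 10 0).ex_compile
  refine ⟨5 + (K + 1), fun N L ℓ n M I b A σ hN hb hI h => ?_⟩
  have p5 : params L ℓ n M 5 = n + n := by simp [params]
  have p0 : params L ℓ n M 0 = 0 := by simp [params]
  refine (ex_forLoop (If := fun k i => if i < k then A 3 i 0 else I i) (Af := fun _ => A)
    (s := fun _ => σ.reg (treg 0)) (K := (N + 2) ^ K + 1) 10 5 0 (by simpa using h) rfl ?_).mono ?_ ?_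
  · intro i τ hi hτ hs h3
    rw [p5] at hi
    refine Ex.seq (hK 4 N _ b _ A τ (update_le hN ((hi.le.trans_eq p5.symm).trans (hN 5))) ?_ hτ) ?_
    · intro k hk
      rw [if_neg (by omega), hI k hk]
    · rintro υ ⟨h1, k1, e1⟩
      refine Ex.store _ _ ⟨⟨h1.base, h1.var, fun k hk => ?_, fun id k j => ?_⟩, fun e he _ => k1 e he,
        (k1 0 (by omega)).trans hs⟩
      · dsimp only
        rw [h1.var, Function.update_self, e1, Function.update_apply]
        by_cases hki : k = i
        · subst hki
          rw [if_pos rfl, if_pos (Nat.lt_succ_self k)]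
          simp [Expr.eval, p0]
        · rw [if_neg hki, h1.inp k hk]
          exact if_congr (by omega) rfl rfl
      · rw [← h1.arr]
        dsimp only
        rw [h1.var, Function.update_self]
        exact Function.update_of_ne (by omega) _ _
  · have h1 : 1 ≤ (N + 2) ^ K := Nat.one_le_pow _ _ (by omega)
    have h2 := hN 5
    rw [pow_add]
    refine le_pow_mul (c := 20) (by omega) ?_ (by norm_num)
    rw [pow_succ]
    nlinarith
  · rintro τ ⟨h1, -, -⟩ i hi
    rw [h1.inp i (by omega), p5, if_pos hi]

theorem exists_wrap (D : ℕ) (c : Cmd) : ∃ K, ∀ (N L ℓ n M : ℕ) (I : ℕ → ℕ),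
    (∀ x, params L ℓ n M x ≤ N) → I 1 = L → I 2 = ℓ → I 3 = n → I 4 = M →
    (∀ i, (D + 5) * 2 ^ (n + M) ≤ i → I i = 0) →
    Ex (wrap D c) ⟨fun _ => 0, I⟩ ((N + 2) ^ K) fun τ =>
      ∀ i, i < n + n → τ.mem i = c.exec I (params L ℓ n M) 0 3 i 0 := by
  obtain ⟨K, hK⟩ := c.ex_compile
  obtain ⟨K', hK'⟩ := ex_outputLoop
  refine ⟨5 + (1 + K + K'), fun N L ℓ n M I hN hL hℓ hn hM hI => ?_⟩
  have hb : n + n ≤ (D + 5) * 2 ^ (n + M) := by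
    have h1 : n < 2 ^ (n + M) := Nat.lt_two_pow_self.trans_le (Nat.pow_le_pow_right (by omega) (by omega))
    nlinarith
  refine (Ex.seq (ex_setup D hL hℓ hn hM hI) (fun τ h =>
    Ex.seq (hK 0 N I _ _ 0 τ hN hI h) fun υ h' => hK' N L ℓ n M I _ _ υ hN hb hI h'.1)).mono ?_
      fun _ h => h
  have h1 : 1 ≤ (N + 2) ^ K := Nat.one_le_pow _ _ (by omega)
  have h2 : 1 ≤ (N + 2) ^ K' := Nat.one_le_pow _ _ (by omega)
  have h3 := hN 3
  have h4 := hN 4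
  have p3 : params L ℓ n M 3 = n := by simp [params]
  have p4 : params L ℓ n M 4 = M := by simp [params]
  rw [p3] at h3
  rw [p4] at h4
  rw [pow_add]
  refine le_pow_mul (c := 32) (by omega) ?_ (by norm_num)
  rw [pow_add, pow_add, pow_one]
  have h5 : (N + 2) ^ K + (N + 2) ^ K' ≤ (N + 2) ^ K * (N + 2) ^ K' + 1 := by nlinarith
  have h6 := Nat.mul_le_mul h1 h2
  nlinarith

end Wrap

end MemoryTime

/-! ### Addresses of the input data -/

namespace MemoryTime

theorem length_flatMap_const {α β : Type*} (l : List α) (f : α → List β) (k : ℕ)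
    (h : ∀ a, (f a).length = k) : (l.flatMap f).length = l.length * k := by
  induction l with
  | nil => simp
  | cons a l ih => rw [List.flatMap_cons, List.length_append, ih, h, List.length_cons]; ring

theorem getD_flatMap {α β : Type*} (l : List α) (f : α → List β) (k : ℕ) (d : β)
    (h : ∀ a, (f a).length = k) (a i : ℕ) (ha : a < l.length) (hi : i < k) :
    (l.flatMap f).getD (a * k + i) d = (f l[a]).getD i d := by
  induction l generalizing a with
  | nil => simp at ha
  | cons b l ih =>
    rw [List.flatMap_cons]
    cases a with
    | zero => rw [List.getD_append _ _ _ _ (by rw [h]; omega)]; simp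
    | succ a =>
      have e : (a + 1) * k + i = a * k + i + k := by ring
      rw [List.getD_append_right _ _ _ _ (by rw [h]; omega), h, e, Nat.add_sub_cancel]
      exact ih a (by simpa using ha)

theorem getD_flatMap_finRange {β : Type*} {n : ℕ} (f : Fin n → List β) (k : ℕ) (d : β)
    (h : ∀ a, (f a).length = k) (a : Fin n) (i : ℕ) (hi : i < k) :
    ((List.finRange n).flatMap f).getD (a * k + i) d = (f a).getD i d := by
  rw [getD_flatMap _ f k d h a i (by simp) hi]
  simp

namespace Code

variable {D L : ℕ} (Q : Code D L) (ℓ : ℕ) (S : Q.Cluster)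

/-- The memory that holds the input. -/
def memory (i : ℕ) : ℕ := (Q.input ℓ S).getD i 0

theorem memory_header : Q.memory ℓ S 1 = L ∧ Q.memory ℓ S 2 = ℓ ∧ Q.memory ℓ S 3 = Q.n ∧
    Q.memory ℓ S 4 = Q.M := by simp [memory, input]

theorem input_lengths :
    ((List.finRange Q.n).flatMap fun j => (List.finRange D).map fun i => (Q.site j i).val).length
      = Q.n * D ∧
    ((List.finRange Q.M).flatMap fun a => (List.finRange D).map fun i => (Q.cube a i).val).length
      = Q.M * D ∧
    ((List.finRange Q.M).flatMap fun a => (List.finRange Q.n).flatMap fun j =>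
      [(Q.gen a j).1.val, (Q.gen a j).2.val]).length = Q.M * (Q.n + Q.n) := by
  refine ⟨?_, ?_, ?_⟩
  · rw [length_flatMap_const _ _ D (by simp)]; simp
  · rw [length_flatMap_const _ _ D (by simp)]; simp
  · rw [length_flatMap_const _ _ (Q.n + Q.n), List.length_finRange]
    intro a
    rw [length_flatMap_const _ _ 2 (by simp)]
    simp; ring

theorem memory_site (j : Fin Q.n) (i : Fin D) :
    Q.memory ℓ S (5 + (j * D + i)) = (Q.site j i).val := by
  obtain ⟨h1, h2, h3⟩ := Q.input_lengths
  have hj : (j : ℕ) * D + i < Q.n * D := by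
    have := Nat.mul_le_mul_right D (Nat.succ_le_of_lt j.2)
    rw [Nat.succ_mul] at this
    have := i.2
    omega
  rw [memory, input, List.getD_append _ _ _ _ (by simp [h1, h2, h3]; omega),
    List.getD_append _ _ _ _ (by simp [h1, h2]; omega),
    List.getD_append _ _ _ _ (by simp [h1]; omega),
    List.getD_append_right _ _ _ _ (by simp)]
  simp only [List.length_cons, List.length_nil, Nat.add_sub_cancel_left]
  rw [getD_flatMap_finRange _ D _ (by simp) j i i.2]
  simp [List.getD_eq_getElem?_getD]

theorem memory_cube (a : Fin Q.M) (i : Fin D) :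
    Q.memory ℓ S (5 + (Q.n * D + (a * D + i))) = (Q.cube a i).val := by
  obtain ⟨h1, h2, h3⟩ := Q.input_lengths
  have hj : (a : ℕ) * D + i < Q.M * D := by
    have := Nat.mul_le_mul_right D (Nat.succ_le_of_lt a.2)
    rw [Nat.succ_mul] at this
    have := i.2
    omega
  rw [memory, input, List.getD_append _ _ _ _ (by simp [h1, h2, h3]; omega),
    List.getD_append _ _ _ _ (by simp [h1, h2]; omega),
    List.getD_append_right _ _ _ _ (by simp [h1]; omega)]
  rw [List.length_append, h1, show [D, L, ℓ, Q.n, Q.M].length = 5 from rfl,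
    show 5 + (Q.n * D + (a * D + i)) - (5 + Q.n * D) = a * D + i by omega,
    getD_flatMap_finRange _ D _ (by simp) a i i.2]
  simp [List.getD_eq_getElem?_getD]

theorem memory_gen (a : Fin Q.M) (j : Fin Q.n) :
    Q.memory ℓ S (5 + (Q.n * D + (Q.M * D + (a * (Q.n + Q.n) + 2 * j)))) = (Q.gen a j).1.val ∧
    Q.memory ℓ S (5 + (Q.n * D + (Q.M * D + (a * (Q.n + Q.n) + (2 * j + 1))))) =
      (Q.gen a j).2.val := by
  obtain ⟨h1, h2, h3⟩ := Q.input_lengths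
  have key : ∀ c, c < 2 → Q.memory ℓ S (5 + (Q.n * D + (Q.M * D + (a * (Q.n + Q.n) + (2 * j + c)))))
      = [(Q.gen a j).1.val, (Q.gen a j).2.val].getD c 0 := by
    intro c hc
    have hj : (a : ℕ) * (Q.n + Q.n) + (2 * j + c) < Q.M * (Q.n + Q.n) := by
      have := Nat.mul_le_mul_right (Q.n + Q.n) (Nat.succ_le_of_lt a.2)
      rw [Nat.succ_mul] at this
      have := j.2
      omega
    rw [memory, input, List.getD_append _ _ _ _ (by
        rw [List.length_append, List.length_append, List.length_append, h1, h2, h3]; simp; omega),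
      List.getD_append_right _ _ _ _ (by
        rw [List.length_append, List.length_append, h1, h2]; simp; omega)]
    rw [List.length_append, List.length_append, h1, h2, show [D, L, ℓ, Q.n, Q.M].length = 5 from rfl,
      show ∀ x, 5 + (Q.n * D + (Q.M * D + x)) - (5 + Q.n * D + Q.M * D) = x by omega,
      getD_flatMap_finRange _ (Q.n + Q.n) _ ?_ a _ (by omega),
      mul_comm 2 (j : ℕ), getD_flatMap_finRange _ 2 _ (by simp) j c hc]
    intro a
    rw [length_flatMap_const _ _ 2 (by simp)]
    simp; ring
  exact ⟨key 0 (by omega), key 1 (by omega)⟩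

theorem memory_syndrome (a : Fin Q.M) :
    Q.memory ℓ S (5 + (Q.n * D + (Q.M * D + (Q.M * (Q.n + Q.n) + a)))) = if a ∈ S then 1 else 0 := by
  obtain ⟨h1, h2, h3⟩ := Q.input_lengths
  rw [memory, input, List.getD_append_right _ _ _ _ (by
      rw [List.length_append, List.length_append, List.length_append, h1, h2, h3]; simp; omega)]
  rw [List.length_append, List.length_append, List.length_append, h1, h2, h3,
    show [D, L, ℓ, Q.n, Q.M].length = 5 from rfl,
    show ∀ x y, 5 + (Q.n * D + (Q.M * D + (y + x))) - (5 + Q.n * D + Q.M * D + y) = x by omega]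
  simp [List.getD_eq_getElem?_getD]

/-- The input occupies `5 + n D + M D + 2 n M + M` cells, which is at most `(D + 5) (n + 1) (M +
1)`. -/
theorem memory_eq_zero {i : ℕ} (hi : (D + 5) * 2 ^ (Q.n + Q.M) ≤ i) : Q.memory ℓ S i = 0 := by
  obtain ⟨h1, h2, h3⟩ := Q.input_lengths
  rw [memory, List.getD_eq_default]
  refine le_trans ?_ hi
  rw [input]
  rw [List.length_append, List.length_append, List.length_append, List.length_append, h1, h2, h3]
  have e1 : Q.n + 1 ≤ 2 ^ Q.n := Nat.lt_two_pow_self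
  have e2 : Q.M + 1 ≤ 2 ^ Q.M := Nat.lt_two_pow_self
  have e3 := Nat.mul_le_mul_left (D + 5) (Nat.mul_le_mul e1 e2)
  rw [← pow_add] at e3
  refine le_trans ?_ e3
  simp only [List.length_cons, List.length_nil, List.length_map, List.length_finRange]
  nlinarith [Nat.zero_le (D * Q.n * Q.M), Nat.zero_le (Q.n * Q.M)]


theorem params_le {q r : ℕ} {α γ : ℝ} (hD : 1 ≤ D) [NeZero L] (h : Q.Admissible q r α γ ℓ)
    : ∀ x, params L ℓ Q.n Q.M x ≤ 4 * (q + r + 1) * L ^ D := by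
  have hn : Q.n ≤ q * L ^ D := by
    simpa using card_le_mul_pow (ι := Fin Q.n) h.site_le
  have hM : Q.M ≤ r * L ^ D := by
    simpa using card_le_mul_pow (ι := Fin Q.M) h.cube_le
  have hL : L ≤ L ^ D := Nat.le_self_pow (by omega) L
  have hL1 : 1 ≤ L := NeZero.one_le
  have hℓ : 2 * ℓ ≤ L := h.scale_le
  have e : 4 * (q + r + 1) * L ^ D = 4 * (q * L ^ D) + 4 * (r * L ^ D) + 4 * L ^ D := by ring
  intro x
  rw [e]
  simp only [params, Function.update_apply]
  split_ifs <;> omega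

end Code

end MemoryTime

namespace MemoryTime

/-! ## Truth values, assignments and loops -/

/-- The truth value of a number. -/
def bit (v : ℕ) : ZMod 2 := if v = 0 then 0 else 1

theorem bit_eq_zero {v : ℕ} : bit v = 0 ↔ v = 0 := by
  unfold bit; split_ifs with h <;> simp [h]

theorem bit_ne_zero {v : ℕ} : bit v ≠ 0 ↔ v ≠ 0 := bit_eq_zero.not

theorem bit_val (x : ZMod 2) : bit x.val = x := by
  revert x; decide

theorem bit_sum_mod (n : ℕ) (f : ℕ → ℕ) :
    bit ((∑ i ∈ Finset.range n, if f i ≠ 0 then 1 else 0) % 2) = ∑ i ∈ Finset.range n, bit (f i) := by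
  have h : ∀ m : ℕ, bit (m % 2) = (m : ZMod 2) := fun m => by
    have := bit_val (m : ZMod 2)
    rwa [ZMod.val_natCast] at this
  rw [h, Nat.cast_sum]
  refine Finset.sum_congr rfl fun i _ => ?_
  unfold bit
  split_ifs with h1 h2 <;> simp_all

namespace Expr

/-- Conjunction. -/
def and (a b : Expr) : Expr := .ite a b (.cst 0)
/-- Disjunction. -/
def or (a b : Expr) : Expr := .ite a (.cst 1) b
/-- Negation. -/
def not (a : Expr) : Expr := .ite a (.cst 0) (.cst 1)
/-- Exclusive disjunction. -/
def xor (a b : Expr) : Expr := .ite a b.not b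
/-- Equality. -/
def eq (a b : Expr) : Expr := ((a.sub b).or (b.sub a)).not
/-- The relation `≤`. -/
def le (a b : Expr) : Expr := (a.sub b).not

variable {I : ℕ → ℕ} {ρ : ℕ → ℕ} {A : Arrays} (a b : Expr) (x y : ℕ)

theorem and_ne : (a.and b).eval I ρ A ≠ 0 ↔ a.eval I ρ A ≠ 0 ∧ b.eval I ρ A ≠ 0 := by
  simp only [and, eval]; split_ifs <;> simp_all

theorem or_ne : (a.or b).eval I ρ A ≠ 0 ↔ a.eval I ρ A ≠ 0 ∨ b.eval I ρ A ≠ 0 := by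
  simp only [or, eval]; split_ifs <;> simp_all

theorem not_ne : a.not.eval I ρ A ≠ 0 ↔ ¬ a.eval I ρ A ≠ 0 := by
  simp only [not, eval]; split_ifs <;> simp_all

theorem eq_ne : (a.eq b).eval I ρ A ≠ 0 ↔ a.eval I ρ A = b.eval I ρ A := by
  rw [eq, not_ne, or_ne]; simp only [eval]; omega

theorem le_ne : (a.le b).eval I ρ A ≠ 0 ↔ a.eval I ρ A ≤ b.eval I ρ A := by
  rw [le, not_ne]; simp only [eval]; omega

theorem bsum_ne : (bsum x y a).eval I ρ A ≠ 0 ↔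
    ∃ i < ρ y, a.eval I (Function.update ρ x i) A ≠ 0 := by
  simp [eval]

theorem bit_and : bit ((a.and b).eval I ρ A) = bit (a.eval I ρ A) * bit (b.eval I ρ A) := by
  simp only [and, eval, bit]; split_ifs <;> simp_all

theorem bit_xor : bit ((a.xor b).eval I ρ A) = bit (a.eval I ρ A) + bit (b.eval I ρ A) := by
  simp only [xor, not, eval, bit]; split_ifs <;> simp_all; decide

/-- The expression reads the array `id`. -/
def Reads (id : ℕ) : Expr → Prop
  | cst _ | var _ => False
  | add a b | sub a b => a.Reads id ∨ b.Reads id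
  | ite c a b => c.Reads id ∨ a.Reads id ∨ b.Reads id
  | inp a | bsum _ _ a | bpar _ _ a => a.Reads id
  | get id' _ _ => id = id'

theorem eval_congr {e : Expr} {B : Arrays} (h : ∀ id, e.Reads id → B id = A id) :
    e.eval I ρ B = e.eval I ρ A := by
  induction e generalizing ρ with
  | cst | var => rfl
  | add a b iha ihb | sub a b iha ihb =>
    simp only [eval, iha fun id hid => h id (Or.inl hid), ihb fun id hid => h id (Or.inr hid)]
  | ite c a b ihc iha ihb =>
    simp only [eval, ihc fun id hid => h id (Or.inl hid), iha fun id hid => h id (Or.inr (Or.inl hid)),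
      ihb fun id hid => h id (Or.inr (Or.inr hid))]
  | inp a ih | bsum x y a ih | bpar x y a ih => simp only [eval, ih h]
  | get id x y => simp only [eval, h id rfl]

theorem bit_bpar : bit ((bpar x y a).eval I ρ A) =
    ∑ i ∈ Finset.range (ρ y), bit (a.eval I (Function.update ρ x i) A) := bit_sum_mod _ _

end Expr

theorem iter_induction {α : Type*} {f : ℕ → α → α} {a : α} {n : ℕ} (P : ℕ → α → Prop) (h0 : P 0 a)
    (hs : ∀ i a, i < n → P i a → P (i + 1) (f i a)) : P n (iter f a n) := by
  induction n with
  | zero => exact h0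
  | succ n ih => exact hs n _ n.lt_succ_self (ih fun i a hi => hs i a (hi.trans n.lt_succ_self))

/-- The command does not change the array `id`. -/
def Cmd.Keeps (id : ℕ) (c : Cmd) : Prop := ∀ I ρ A, c.exec I ρ A id = A id

theorem Cmd.Keeps.seq {id : ℕ} {c c' : Cmd} (h : c.Keeps id) (h' : c'.Keeps id) :
    (c.seq c').Keeps id := fun I ρ A => (h' I ρ _).trans (h I ρ A)

theorem Cmd.Keeps.ite {id : ℕ} {a : Expr} {c c' : Cmd} (h : c.Keeps id) (h' : c'.Keeps id) :
    (Cmd.ite a c c').Keeps id := fun I ρ A => by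
  rw [exec]; split_ifs
  exacts [h I ρ A, h' I ρ A]

theorem Cmd.Keeps.loop {id x y : ℕ} {c : Cmd} (h : c.Keeps id) : (Cmd.loop x y c).Keeps id :=
  fun I _ A => iter_induction (fun _ B => B id = A id) rfl fun _ B _ hB => (h I _ B).trans hB

theorem Cmd.Keeps.store {id id' x y : ℕ} {a : Expr} (h : id ≠ id') :
    (Cmd.store id' x y a).Keeps id := fun I ρ A => by
  funext i j
  simp [exec, Arrays.set, h]

theorem Cmd.Keeps.skip {id : ℕ} : Cmd.skip.Keeps id := fun _ _ _ => rfl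

/-- Assigns to the array elements `(i, 0)` with `i` below the variable `X`. -/
def assign1 (id x X : ℕ) (e : Expr) : Cmd := .loop x X (.store id x 0 e)

/-- Assigns to the array elements `(i, j)` with `i`, `j` below the variables `X`, `Y`. -/
def assign2 (id x X y Y : ℕ) (e : Expr) : Cmd := .loop x X (.loop y Y (.store id x y e))

theorem keeps_assign1 {id id' x X : ℕ} {e : Expr} (h : id ≠ id') : (assign1 id' x X e).Keeps id :=
  .loop (.store h)

theorem keeps_assign2 {id id' x X y Y : ℕ} {e : Expr} (h : id ≠ id') :
    (assign2 id' x X y Y e).Keeps id := .loop (.loop (.store h))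

section Assign

variable {I : ℕ → ℕ} {ρ : ℕ → ℕ} {A : Arrays} {id x X y Y : ℕ} {e : Expr} {v : ℕ → ℕ → ℕ}

/-- The expression may read the element about to be replaced, which allows updates in place, but no
other element of the same array. -/
theorem get_assign2 (hxy : x ≠ y) (hY : Y ≠ x)
    (he : ∀ i j (B : Arrays), i < ρ X → j < ρ Y → (∀ id', id' ≠ id → B id' = A id') → B id i j = A id i j →
      e.eval I (Function.update (Function.update ρ x i) y j) B = v i j)
    {i j : ℕ} (hi : i < ρ X) (hj : j < ρ Y) : (assign2 id x X y Y e).exec I ρ A id i j = v i j := by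
  refine (iter_induction (fun m (B : Arrays) => (∀ id', id' ≠ id → B id' = A id') ∧
    (∀ i j, i < m → j < ρ Y → B id i j = v i j) ∧ ∀ i j, m ≤ i → B id i j = A id i j) ?_ ?_).2.1 i j hi hj
  · exact ⟨fun _ _ => rfl, fun i j hi => by omega, fun _ _ _ => rfl⟩
  rintro m B hm ⟨h1, h2, h3⟩
  have key := iter_induction (f := fun j B' =>
    (Cmd.store id x y e).exec I (Function.update (Function.update ρ x m) y j) B') (a := B)
    (n := Function.update ρ x m Y) (fun l (B' : Arrays) => (∀ id', id' ≠ id → B' id' = A id') ∧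
      (∀ i, i ≠ m → B' id i = B id i) ∧ (∀ j, j < l → B' id m j = v m j) ∧
        ∀ j, l ≤ j → B' id m j = B id m j)
    ⟨h1, fun _ _ => rfl, fun j hj => by omega, fun _ _ => rfl⟩ ?_
  · obtain ⟨k1, k2, k3, k4⟩ := key
    refine ⟨k1, fun i j hi hj => ?_, fun i j hi => ?_⟩
    · by_cases him : i = m
      · subst him
        exact k3 j (by rwa [Function.update_of_ne hY])
      · exact (congrFun (k2 i him) j).trans (h2 i j (by omega) hj)
    · exact (congrFun (k2 i (by omega)) j).trans (h3 i j (by omega))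
  · rintro l B' hl ⟨k1, k2, k3, k4⟩
    rw [Function.update_of_ne hY] at hl
    have hv := he m l B' hm hl k1 ((k4 l le_rfl).trans (h3 m l le_rfl))
    simp only [Cmd.exec, Function.update_self, Function.update_of_ne hxy, hv]
    refine ⟨fun id' h => ?_, fun i h => ?_, fun j hj => ?_, fun j hj => ?_⟩
    · funext a b
      rw [Arrays.set, if_neg (fun h' => h h'.1), k1 _ h]
    · funext b
      rw [Arrays.set, if_neg (fun h' => h h'.2.1), k2 i h]
    · by_cases hjl : j = l
      · subst hjl
        rw [Arrays.set, if_pos ⟨rfl, rfl, rfl⟩]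
      · rw [Arrays.set, if_neg (fun h' => hjl h'.2.2), k3 j (by omega)]
    · rw [Arrays.set, if_neg (fun h' => by omega), k4 j (by omega)]

theorem get_assign1 {v : ℕ → ℕ} (hx : x ≠ 0) (h0 : ρ 0 = 0)
    (he : ∀ i (B : Arrays), i < ρ X → (∀ id', id' ≠ id → B id' = A id') → B id i 0 = A id i 0 →
      e.eval I (Function.update ρ x i) B = v i)
    {i : ℕ} (hi : i < ρ X) : (assign1 id x X e).exec I ρ A id i 0 = v i := by
  refine (iter_induction (fun m (B : Arrays) => (∀ id', id' ≠ id → B id' = A id') ∧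
    (∀ i, i < m → B id i 0 = v i) ∧ ∀ i, m ≤ i → B id i 0 = A id i 0) ?_ ?_).2.1 i hi
  · exact ⟨fun _ _ => rfl, fun i hi => by omega, fun _ _ => rfl⟩
  rintro m B hm ⟨h1, h2, h3⟩
  have hv := he m B hm h1 (h3 m le_rfl)
  simp only [Cmd.exec, Function.update_self, Function.update_of_ne hx.symm, hv, h0]
  refine ⟨fun id' h => ?_, fun j hj => ?_, fun j hj => ?_⟩
  · funext a b
    rw [Arrays.set, if_neg (fun h' => h h'.1), h1 _ h]
  · by_cases hjl : j = m
    · subst hjl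
      rw [Arrays.set, if_pos ⟨rfl, rfl, rfl⟩]
    · rw [Arrays.set, if_neg (fun h' => hjl h'.2.1), h2 j (by omega)]
  · rw [Arrays.set, if_neg (fun h' => by omega), h3 j (by omega)]

end Assign

/-- If every run of the body of a loop raises a flag exactly under a condition, the loop raises the
flag exactly if the condition holds for some value of the loop variable. -/
theorem loop_flag {I : ℕ → ℕ} {ρ : ℕ → ℕ} {A : Arrays} {x y : ℕ} {c : Cmd} (Inv flag : Arrays → Prop)
    (test : ℕ → Prop) (hA : Inv A)
    (hc : ∀ i B, i < ρ y → Inv B → Inv (c.exec I (Function.update ρ x i) B) ∧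
      (flag (c.exec I (Function.update ρ x i) B) ↔ flag B ∨ test i)) :
    Inv ((Cmd.loop x y c).exec I ρ A) ∧
      (flag ((Cmd.loop x y c).exec I ρ A) ↔ flag A ∨ ∃ i < ρ y, test i) := by
  refine iter_induction (fun m B => Inv B ∧ (flag B ↔ flag A ∨ ∃ i < m, test i)) ⟨hA, by simp⟩ ?_
  rintro m B hm ⟨h1, h2⟩
  obtain ⟨h3, h4⟩ := hc m B hm h1
  refine ⟨h3, h4.trans ?_⟩
  rw [h2, or_assoc]
  refine or_congr_right ⟨?_, ?_⟩
  · rintro (⟨i, hi, h⟩ | h)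
    exacts [⟨i, by omega, h⟩, ⟨m, by omega, h⟩]
  · rintro ⟨i, hi, h⟩
    by_cases him : i = m
    · exact Or.inr (him ▸ h)
    · exact Or.inl ⟨i, by omega, h⟩

/-! ## Gaussian elimination -/

/-- The map `x ↦ x + F x • T` is the identity on the kernel of `F`, and it projects onto the kernel
along `T` if `F T = 1`. The number of rows is unchanged: the row equal to `T` becomes zero, and no
record of pivots is needed. -/
theorem span_eliminate {ι V : Type*} [AddCommGroup V] [Module (ZMod 2) V] (r : ι → V)
    (F : V →ₗ[ZMod 2] ZMod 2) {T : V} (hT : T ∈ Submodule.span (ZMod 2) (Set.range r))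
    (h : ∀ k, F (r k) ≠ 0 → F T = 1) :
    Submodule.span (ZMod 2) (Set.range fun k => r k + F (r k) • T) =
      Submodule.span (ZMod 2) (Set.range r) ⊓ LinearMap.ker F := by
  set φ : V →ₗ[ZMod 2] V := LinearMap.id + F.smulRight T with hφ
  have e : (Set.range fun k => r k + F (r k) • T) = φ '' Set.range r := by
    rw [← Set.range_comp]; rfl
  apply le_antisymm
  · rw [Submodule.span_le]
    rintro _ ⟨k, rfl⟩
    refine ⟨add_mem (Submodule.subset_span ⟨k, rfl⟩) (Submodule.smul_mem _ _ hT), ?_⟩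
    change F (r k + F (r k) • T) = 0
    rw [map_add, map_smul, smul_eq_mul]
    by_cases h0 : F (r k) = 0
    · simp [h0]
    · rw [h k h0, zmod_two_ne_zero_iff.1 h0]; decide
  · rintro x ⟨hx, hF⟩
    rw [e, Submodule.span_image]
    refine ⟨x, hx, ?_⟩
    rw [hφ]
    simp [LinearMap.mem_ker.1 hF]

/-- The functional with coefficients `c i` for `i < W`. -/
def functional (W : ℕ) (c : ℕ → ZMod 2) : (ℕ → ZMod 2) →ₗ[ZMod 2] ZMod 2 where
  toFun v := ∑ i ∈ Finset.range W, c i * v i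
  map_add' v w := by simp [mul_add, Finset.sum_add_distrib]
  map_smul' a v := by simp [Finset.mul_sum, mul_left_comm]

/-- The row `k` of the array `6`. -/
def rowVec (W : ℕ) (A : Arrays) (k : Fin W) : ℕ → ZMod 2 := fun i => if i < W then bit (A 6 k i) else 0

/-- The span of the rows of the array `6`. -/
def rowSpan (W : ℕ) (A : Arrays) : Submodule (ZMod 2) (ℕ → ZMod 2) :=
  Submodule.span (ZMod 2) (Set.range (rowVec W A))

/-- Restricts the row span to the kernel of a functional, whose coefficient `i` is the value of the
expression `f` with the variable `11` set to `i`. -/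
def elim (f : Expr) : Cmd :=
  .seq (assign1 7 10 6 (.bpar 11 6 (f.and (.get 6 10 11))))
    (.seq (assign1 8 11 6 (.bpar 10 6 (((Expr.get 7 10 0).and
        (Expr.bsum 12 10 (.get 7 12 0)).not).and (.get 6 10 11))))
      (assign2 6 10 6 11 6 ((Expr.get 6 10 11).xor ((Expr.get 7 10 0).and (.get 8 11 0)))))

theorem keeps_elim {id : ℕ} {f : Expr} (h : id ≠ 6 ∧ id ≠ 7 ∧ id ≠ 8) : (elim f).Keeps id :=
  .seq (keeps_assign1 h.2.1) (.seq (keeps_assign1 h.2.2) (keeps_assign2 h.1))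

theorem mem_rowSpan_elim {I : ℕ → ℕ} {ρ : ℕ → ℕ} {A : Arrays} {f : Expr} {W : ℕ} {c : ℕ → ZMod 2}
    (h0 : ρ 0 = 0) (hW : ρ 6 = W)
    (hf : ∀ k i, i < W → bit (f.eval I (Function.update (Function.update ρ 10 k) 11 i) A) = c i)
    (hf' : ∀ k i B, (∀ id, id ≠ 7 → B id = A id) →
      f.eval I (Function.update (Function.update ρ 10 k) 11 i) B =
      f.eval I (Function.update (Function.update ρ 10 k) 11 i) A) {v : ℕ → ZMod 2} :
    v ∈ rowSpan W ((elim f).exec I ρ A) ↔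
      v ∈ rowSpan W A ∧ ∑ i ∈ Finset.range W, c i * v i = 0 := by
  set A₁ := (assign1 7 10 6 (.bpar 11 6 (f.and (.get 6 10 11)))).exec I ρ A with hA₁
  set A₂ := (assign1 8 11 6 (.bpar 10 6 (((Expr.get 7 10 0).and
        (Expr.bsum 12 10 (.get 7 12 0)).not).and (.get 6 10 11)))).exec I ρ A₁ with hA₂
  set A₃ := (elim f).exec I ρ A with hA₃
  have e1 : ∀ id, id ≠ 7 → A₁ id = A id := fun id h => keeps_assign1 h I ρ A
  have e2 : ∀ id, id ≠ 8 → A₂ id = A₁ id := fun id h => keeps_assign1 h I ρ A₁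
  set F := functional W c with hF
  have s1 : ∀ k : Fin W, bit (A₁ 7 k 0) = F (rowVec W A k) := by
    intro k
    rw [hA₁, get_assign1 (v := fun k => ((Expr.bpar 11 6 (f.and (.get 6 10 11))).eval I
      (Function.update ρ 10 k) A)) (by norm_num) h0 ?_ (by rw [hW]; exact k.2)]
    · rw [Expr.bit_bpar]
      simp only [Function.update_of_ne (show (6 : ℕ) ≠ 10 by norm_num), hW, Expr.bit_and]
      refine Finset.sum_congr rfl fun i hi => ?_
      rw [hf _ _ (Finset.mem_range.1 hi)]
      simp [rowVec, Finset.mem_range.1 hi, Expr.eval]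
    · intro k B hk hB _
      simp only [Expr.eval, Expr.and]
      congr 1
      refine Finset.sum_congr rfl fun i hi => ?_
      rw [hf' k i B hB, hB 6 (by norm_num)]
  -- This weight selects the first row on which the functional does not vanish, so `T` is that row,
  -- or zero if there is none.
  let w : Fin W → ZMod 2 := fun k => bit (A₁ 7 k 0) * if ∃ l < (k : ℕ), A₁ 7 l 0 ≠ 0 then 0 else 1
  set T : ℕ → ZMod 2 := ∑ k, w k • rowVec W A k with hT
  have s2 : ∀ i, i < W → bit (A₂ 8 i 0) = T i := by
    intro i hi
    rw [hA₂, get_assign1 (v := fun i => ((Expr.bpar 10 6 (((Expr.get 7 10 0).and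
        (Expr.bsum 12 10 (.get 7 12 0)).not).and (.get 6 10 11))).eval I
      (Function.update ρ 11 i) A₁)) (by norm_num) h0 ?_ (by rw [hW]; exact hi)]
    · rw [Expr.bit_bpar]
      simp only [Function.update_of_ne (show (6 : ℕ) ≠ 11 by norm_num), hW, Expr.bit_and, hT,
        Finset.sum_apply]
      rw [Finset.sum_range]
      refine Finset.sum_congr rfl fun k _ => ?_
      simp only [Pi.smul_apply, smul_eq_mul, rowVec, if_pos hi, w]
      congr 1
      · congr 1
        · simp [Expr.eval, h0]
        · have := (Expr.bsum 12 10 (.get 7 12 0)).not_ne (I := I) (A := A₁)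
            (ρ := Function.update (Function.update ρ 11 i) 10 k)
          rw [Expr.bsum_ne] at this
          simp only [Expr.eval, Function.update_self] at this
          simp only [ne_eq, OfNat.zero_ne_ofNat, not_false_eq_true, Function.update_of_ne, h0] at this
          rw [bit]
          split_ifs <;> grind
      · simp [Expr.eval, e1]
    · intro k B hk hB _
      exact Expr.eval_congr fun id hid => hB id (by simp [Expr.Reads, Expr.and, Expr.not] at hid; omega)
  have loc : ∀ (B C : Arrays) (ρ : ℕ → ℕ), B 6 (ρ 10) (ρ 11) = C 6 (ρ 10) (ρ 11) → B 7 = C 7 →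
      B 8 = C 8 → ((Expr.get 6 10 11).xor ((Expr.get 7 10 0).and (.get 8 11 0))).eval I ρ B =
        ((Expr.get 6 10 11).xor ((Expr.get 7 10 0).and (.get 8 11 0))).eval I ρ C := by
    intro B C ρ h6 h7 h8
    by_cases a : C 6 (ρ 10) (ρ 11) = 0 <;> by_cases b : C 7 (ρ 10) (ρ 0) = 0 <;>
      by_cases c : C 8 (ρ 11) (ρ 0) = 0 <;>
      simp [Expr.eval, Expr.xor, Expr.and, Expr.not, h6, h7, h8, a, b, c]
  have s3 : rowVec W A₃ = fun k => rowVec W A k + F (rowVec W A k) • T := by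
    funext k i
    simp only [rowVec, Pi.add_apply, Pi.smul_apply, smul_eq_mul]
    split_ifs with hi
    · have : A₃ 6 k i = ((Expr.get 6 10 11).xor ((Expr.get 7 10 0).and (.get 8 11 0))).eval I
          (Function.update (Function.update ρ 10 k) 11 i) A₂ :=
        get_assign2 (v := fun k i => ((Expr.get 6 10 11).xor ((Expr.get 7 10 0).and
          (.get 8 11 0))).eval I (Function.update (Function.update ρ 10 k) 11 i) A₂)
          (by norm_num) (by norm_num) (fun i j B _ _ hB hB' => loc B A₂ _ (by simpa using hB')
            (hB 7 (by norm_num)) (hB 8 (by norm_num)))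
          (by rw [hW]; exact k.2) (by rw [hW]; exact hi)
      rw [this, Expr.bit_xor, Expr.bit_and]
      simp only [Expr.eval]
      simp only [ne_eq, OfNat.zero_ne_ofNat, not_false_eq_true, Function.update_of_ne, h0,
        Function.update_self, Nat.reduceEqDiff]
      rw [s2 i hi, e2 7 (by norm_num), s1, e2 6 (by norm_num), e1 6 (by norm_num)]
    · have : T i = 0 := by simp [hT, rowVec, hi]
      simp [this]
  rw [rowSpan, s3, span_eliminate _ F (T := T)]
  · rfl
  · exact sum_mem fun k _ => Submodule.smul_mem _ _ (Submodule.subset_span ⟨k, rfl⟩)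
  · intro k hk
    have hex : ∃ k, ∃ hk : k < W, A₁ 7 k 0 ≠ 0 := by
      rw [← s1, bit_ne_zero] at hk
      exact ⟨k, k.2, hk⟩
    classical
    obtain ⟨hlt, hne⟩ := Nat.find_spec hex
    set k₀ : Fin W := ⟨Nat.find hex, hlt⟩ with hk₀
    have hw : ∀ k, w k = if k = k₀ then 1 else 0 := by
      intro k
      simp only [w]
      rcases lt_trichotomy k k₀ with h | h | h
      · have : A₁ 7 k 0 = 0 := by
          by_contra h'
          exact Nat.find_min hex (Fin.lt_def.1 h) ⟨k.2, h'⟩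
        rw [if_neg h.ne, this]; simp [bit]
      · subst h
        rw [if_pos rfl, if_neg, mul_one, bit, if_neg hne]
        rintro ⟨l, hl, hl'⟩
        exact Nat.find_min hex hl ⟨hl.trans hlt, hl'⟩
      · rw [if_neg h.ne', if_pos ⟨Nat.find hex, Fin.lt_def.1 h, hne⟩, mul_zero]
    have hTk : T = rowVec W A k₀ := by simp [hT, hw]
    rw [hTk, ← s1, bit, if_neg hne]

end MemoryTime

namespace MemoryTime

/-! ## Solving for a Pauli operator with a given syndrome -/

/-- The variables from `0` to `9` hold the parameters of the input. -/
structure Env (L ℓ n M : ℕ) (ρ : ℕ → ℕ) : Prop where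
  v0 : ρ 0 = 0
  v1 : ρ 1 = L
  v2 : ρ 2 = ℓ + 1
  v3 : ρ 3 = n
  v4 : ρ 4 = M
  v5 : ρ 5 = n + n
  v6 : ρ 6 = n + n + 1
  v9 : ρ 9 = ℓ

theorem Env.params (L ℓ n M : ℕ) : Env L ℓ n M (params L ℓ n M) := by
  constructor <;> simp [MemoryTime.params]

theorem Env.update {L ℓ n M : ℕ} {ρ : ℕ → ℕ} (h : Env L ℓ n M ρ) {x : ℕ} (hx : 10 ≤ x) (v : ℕ) :
    Env L ℓ n M (Function.update ρ x v) := by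
  obtain ⟨h0, h1, h2, h3, h4, h5, h6, h9⟩ := h
  constructor <;> rw [Function.update_of_ne (by omega)] <;> assumption

namespace Expr

/-- Multiplication by a constant. -/
def mulConst : ℕ → Expr → Expr
  | 0, _ => cst 0
  | k + 1, e => add (mulConst k e) e

variable {I : ℕ → ℕ} {ρ : ℕ → ℕ} {A : Arrays}

theorem eval_mulConst (k : ℕ) (e : Expr) : (mulConst k e).eval I ρ A = e.eval I ρ A * k := by
  induction k with
  | zero => rfl
  | succ k ih => rw [mulConst, eval, ih]; ring

/-- Half of a variable. -/
def half (x : ℕ) : Expr := bsum 20 x (bpar 21 20 (cst 1))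

theorem eval_half (x : ℕ) : (half x).eval I ρ A = ρ x / 2 := by
  have h : ∀ m, ∑ i ∈ Finset.range m, i % 2 = m / 2 := by
    intro m
    induction m with
    | zero => rfl
    | succ m ih => rw [Finset.sum_range_succ, ih]; omega
  simp only [half, eval, Function.update_self]
  simpa using h (ρ x)

/-- The position of the other component of the same qubit. -/
def swap (x : ℕ) : Expr := ite (bpar 20 x (cst 1)) ((var x).sub (cst 1)) ((var x).add (cst 1))

theorem eval_swap (x : ℕ) :
    (swap x).eval I ρ A = if ρ x % 2 = 0 then ρ x + 1 else ρ x - 1 := by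
  simp [swap, eval]
  split_ifs <;> omega

/-- The component `e` of the generator `a`. -/
def gen (D a : ℕ) (e : Expr) : Expr :=
  inp ((cst 5).add ((mulConst D (var 3)).add ((mulConst D (var 4)).add ((bsum 20 a (var 5)).add e))))

/-- The measured syndrome at the generator `a`. -/
def synd (D a : ℕ) : Expr :=
  inp ((cst 5).add ((mulConst D (var 3)).add ((mulConst D (var 4)).add
    ((bsum 20 4 (var 5)).add (var a)))))

theorem reads_mulConst {id k : ℕ} {e : Expr} (h : (mulConst k e).Reads id) : e.Reads id := by
  induction k with
  | zero => exact h.elim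
  | succ k ih => exact h.elim ih _root_.id

end Expr

/-- The components of a Pauli operator as a sequence of bits. -/
def pbit {n : ℕ} (P : Pauli n) (i : ℕ) : ZMod 2 :=
  if h : i / 2 < n then if i % 2 = 0 then (P ⟨i / 2, h⟩).1 else (P ⟨i / 2, h⟩).2 else 0

theorem pbit_even {n : ℕ} (P : Pauli n) (j : Fin n) : pbit P (2 * j) = (P j).1 := by
  simp [pbit]

theorem pbit_odd {n : ℕ} (P : Pauli n) (j : Fin n) : pbit P (2 * j + 1) = (P j).2 := by
  have h : (2 * (j : ℕ) + 1) / 2 = j := by omega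
  have h' : (2 * (j : ℕ) + 1) % 2 = 1 := by omega
  simp [pbit, h, h']

theorem pbit_add {n : ℕ} (P P' : Pauli n) (i : ℕ) : pbit (P + P') i = pbit P i + pbit P' i := by
  unfold pbit; split_ifs <;> simp

theorem pbit_zero {n : ℕ} (i : ℕ) : pbit (0 : Pauli n) i = 0 := by
  unfold pbit; split_ifs <;> simp

theorem pbit_ext {n : ℕ} {P P' : Pauli n} (h : ∀ i, i < n + n → pbit P i = pbit P' i) : P = P' := by
  funext j
  have h1 := h (2 * j) (by omega)
  have h2 := h (2 * j + 1) (by omega)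
  rw [pbit_even, pbit_even] at h1
  rw [pbit_odd, pbit_odd] at h2
  exact Prod.ext h1 h2

/-- The Pauli operator with given components. -/
def ofBits (n : ℕ) (v : ℕ → ZMod 2) : Pauli n := fun j => (v (2 * j), v (2 * j + 1))

theorem pbit_ofBits {n : ℕ} (v : ℕ → ZMod 2) {i : ℕ} (hi : i < n + n) : pbit (ofBits n v) i = v i := by
  have h : i / 2 < n := by omega
  rw [pbit, dif_pos h]
  split_ifs with h2
  · exact congrArg v (by dsimp only; omega)
  · exact congrArg v (by dsimp only; omega)

theorem sum_range_pairs {M : Type*} [AddCommMonoid M] (f : ℕ → M) (n : ℕ) :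
    ∑ i ∈ Finset.range (n + n), f i = ∑ j : Fin n, (f (2 * j) + f (2 * j + 1)) := by
  rw [← Finset.sum_range fun j => f (2 * j) + f (2 * j + 1)]
  induction n with
  | zero => rfl
  | succ n ih =>
    rw [Finset.sum_range_succ _ n, ← ih, show n + 1 + (n + 1) = n + n + 1 + 1 by ring,
      Finset.sum_range_succ, Finset.sum_range_succ, two_mul, add_assoc]

/-- The form pairs each component of `P` with the other component of `G` at the same qubit, which is
the neighbour of `i` of opposite parity. -/
theorem symp_eq_sum {n : ℕ} (G P : Pauli n) : symp G P = ∑ i ∈ Finset.range (n + n),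
    pbit G (if i % 2 = 0 then i + 1 else i - 1) * pbit P i := by
  rw [sum_range_pairs, symp]
  refine Finset.sum_congr rfl fun j _ => ?_
  rw [if_pos (by omega), if_neg (by omega), Nat.add_sub_cancel, pbit_even, pbit_odd, pbit_even,
    pbit_odd]
  ring

theorem Code.bit_gen {D L : ℕ} (Q : Code D L) (ℓ : ℕ) (S : Q.Cluster) {ρ : ℕ → ℕ} {A : Arrays}
    (h : Env L ℓ Q.n Q.M ρ) {a : ℕ} {e : Expr} (ha : ρ a < Q.M)
    (he : e.eval (Q.memory ℓ S) ρ A < Q.n + Q.n) :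
    bit ((Expr.gen D a e).eval (Q.memory ℓ S) ρ A) =
      pbit (Q.gen ⟨ρ a, ha⟩) (e.eval (Q.memory ℓ S) ρ A) := by
  simp only [Expr.gen, Expr.eval, Expr.eval_mulConst, h.v3, h.v4,
    Function.update_of_ne (show (5 : ℕ) ≠ 20 by norm_num), h.v5, Finset.sum_const, Finset.card_range,
    smul_eq_mul]
  set i := e.eval (Q.memory ℓ S) ρ A with hi
  have hj : i / 2 < Q.n := by omega
  obtain ⟨h1, h2⟩ := Q.memory_gen ℓ S ⟨ρ a, ha⟩ ⟨i / 2, hj⟩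
  rw [pbit, dif_pos hj]
  dsimp only at h1 h2
  split_ifs with h3
  · rw [show 2 * (i / 2) = i by omega] at h1
    rw [h1, bit_val]
  · rw [show 2 * (i / 2) + 1 = i by omega] at h2
    rw [h2, bit_val]

theorem Code.eval_synd {D L : ℕ} (Q : Code D L) (ℓ : ℕ) (S : Q.Cluster) {ρ : ℕ → ℕ} {A : Arrays}
    (h : Env L ℓ Q.n Q.M ρ) {a : ℕ} (ha : ρ a < Q.M) :
    (Expr.synd D a).eval (Q.memory ℓ S) ρ A = if ⟨ρ a, ha⟩ ∈ S then 1 else 0 := by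
  simp only [Expr.synd, Expr.eval, Expr.eval_mulConst, h.v3, h.v4,
    Function.update_of_ne (show (5 : ℕ) ≠ 20 by norm_num), h.v5, Finset.sum_const, Finset.card_range,
    smul_eq_mul]
  exact Q.memory_syndrome ℓ S ⟨ρ a, ha⟩

theorem mem_rowSpan_loop_elim {I : ℕ → ℕ} {ρ : ℕ → ℕ} {A : Arrays} {f : Expr} {W y : ℕ}
    (c : ℕ → ℕ → ZMod 2) (h0 : ρ 0 = 0) (hW : ρ 6 = W)
    (hf : ∀ r k i, r < ρ y → i < W → bit (f.eval I
      (Function.update (Function.update (Function.update ρ 14 r) 10 k) 11 i) A) = c r i)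
    (hr : ∀ id, f.Reads id → id ≠ 6 ∧ id ≠ 7 ∧ id ≠ 8) {v : ℕ → ZMod 2} :
    v ∈ rowSpan W ((Cmd.loop 14 y (elim f)).exec I ρ A) ↔
      v ∈ rowSpan W A ∧ ∀ r < ρ y, ∑ i ∈ Finset.range W, c r i * v i = 0 := by
  refine (iter_induction (fun m B => (∀ id, id ≠ 6 ∧ id ≠ 7 ∧ id ≠ 8 → B id = A id) ∧
    (v ∈ rowSpan W B ↔ v ∈ rowSpan W A ∧ ∀ r < m, ∑ i ∈ Finset.range W, c r i * v i = 0))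
    ⟨fun _ _ => rfl, by simp⟩ ?_).2
  rintro m B hm ⟨h1, h2⟩
  refine ⟨fun id h => (keeps_elim h I _ B).trans (h1 id h), ?_⟩
  rw [mem_rowSpan_elim (W := W) (c := c m) (by simpa using h0) (by simpa using hW), h2, and_assoc]
  · refine and_congr_right fun _ => ⟨fun ⟨h, h'⟩ r hr => ?_, fun h =>
      ⟨fun r hr => h r (by omega), h m (by omega)⟩⟩
    rcases Nat.lt_succ_iff_lt_or_eq.1 hr with hr | rfl
    exacts [h r hr, h']
  · intro k i hi
    rw [Expr.eval_congr fun id hid => h1 id (hr id hid)]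
    exact hf m k i hm hi
  · exact fun k i B' hB' => Expr.eval_congr fun id hid => hB' id (hr id hid).2.1

/-- Initializes the rows of the array `6` with the standard basis. -/
def basisRows : Cmd := assign2 6 10 6 11 6 ((Expr.var 10).eq (.var 11))

theorem mem_rowSpan_basisRows {I : ℕ → ℕ} {ρ : ℕ → ℕ} {A : Arrays} {W : ℕ} (hW : ρ 6 = W)
    {v : ℕ → ZMod 2} : v ∈ rowSpan W (basisRows.exec I ρ A) ↔ ∀ i, W ≤ i → v i = 0 := by
  have hr : rowVec W (basisRows.exec I ρ A) = fun k : Fin W => Pi.single (k : ℕ) (1 : ZMod 2) := by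
    funext k i
    rw [rowVec]
    split_ifs with hi
    · rw [basisRows, get_assign2 (v := fun k i => ((Expr.var 10).eq (.var 11)).eval I
        (Function.update (Function.update ρ 10 k) 11 i) A) (by norm_num) (by norm_num) ?_
        (by rw [hW]; exact k.2) (by rw [hW]; exact hi)]
      · rw [bit]
        have := Expr.eq_ne (.var 10) (.var 11) (I := I) (A := A)
          (ρ := Function.update (Function.update ρ 10 k) 11 i)
        simp only [Expr.eval, Function.update_self] at this
        rw [Function.update_of_ne (by norm_num), Function.update_self] at this
        rw [Pi.single_apply]
        split_ifs <;> grind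
      · intro i j B _ _ _ _
        exact Expr.eval_congr fun id hid => by simp [Expr.Reads, Expr.eq, Expr.or, Expr.not] at hid
    · rw [Pi.single_eq_of_ne (by have := k.2; omega)]
  rw [rowSpan, hr]
  constructor
  · intro hv i hi
    induction hv using Submodule.span_induction with
    | mem x hx =>
      obtain ⟨k, rfl⟩ := hx
      exact Pi.single_eq_of_ne (by have := k.2; omega) _
    | zero => rfl
    | add x y _ _ hx hy => rw [Pi.add_apply, hx, hy, add_zero]
    | smul a x _ hx => rw [Pi.smul_apply, hx, smul_zero]
  · intro hv
    have : v = ∑ k : Fin W, v k • Pi.single (k : ℕ) (1 : ZMod 2) := by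
      funext i
      rw [Finset.sum_apply]
      by_cases hi : i < W
      · rw [Finset.sum_eq_single ⟨i, hi⟩]
        · simp
        · intro k _ hk
          have : i ≠ k := fun h => hk (Fin.ext h.symm)
          simp [this]
        · simp
      · rw [hv i (by omega), Finset.sum_eq_zero]
        intro k _
        have : i ≠ k := by have := k.2; omega
        simp [this]
    rw [this]
    exact sum_mem fun k _ => Submodule.smul_mem _ _ (Submodule.subset_span ⟨k, rfl⟩)

/-- Raises the flag in the array `9` if some Pauli operator has the syndrome in the array `2`, is
supported on the components in the array `5` and agrees with the array `4` on the components up to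
the variable `13`. -/
def solve (D : ℕ) : Cmd :=
  .seq basisRows (.seq
    (.loop 14 4 (elim (.ite ((Expr.var 11).eq (.var 5)) (.get 2 14 0) (.gen D 14 (.swap 11))))) (.seq
    (.loop 14 5 (elim (((Expr.var 11).eq (.var 14)).and (Expr.get 5 14 0).not))) (.seq
    (.loop 14 5 (elim (((Expr.var 14).le (.var 13)).and (((Expr.var 11).eq (.var 14)).xor
      (((Expr.var 11).eq (.var 5)).and (.get 4 14 0))))))
    (.store 9 0 0 ((Expr.get 9 0 0).or (.bsum 10 6 (.get 6 10 5)))))))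

theorem keeps_solve {id D : ℕ} (h : id ≠ 6 ∧ id ≠ 7 ∧ id ≠ 8 ∧ id ≠ 9) : (solve D).Keeps id := by
  have h' : id ≠ 6 ∧ id ≠ 7 ∧ id ≠ 8 := ⟨h.1, h.2.1, h.2.2.1⟩
  exact .seq (keeps_assign2 h.1) (.seq (.loop (keeps_elim h')) (.seq (.loop (keeps_elim h'))
    (.seq (.loop (keeps_elim h')) (.store h.2.2.2))))

theorem bit_eq_ite {I : ℕ → ℕ} {ρ : ℕ → ℕ} {A : Arrays} (a b : Expr) :
    bit ((a.eq b).eval I ρ A) = if a.eval I ρ A = b.eval I ρ A then 1 else 0 := by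
  rw [bit]
  have := Expr.eq_ne a b (I := I) (ρ := ρ) (A := A)
  split_ifs <;> grind

theorem exists_row_iff {W : ℕ} {A : Arrays} {m : ℕ} (hm : m < W) :
    (∃ k < W, A 6 k m ≠ 0) ↔ ∃ v ∈ rowSpan W A, v m = 1 := by
  constructor
  · rintro ⟨k, hk, h⟩
    refine ⟨_, Submodule.subset_span ⟨⟨k, hk⟩, rfl⟩, ?_⟩
    rw [rowVec, if_pos hm]
    exact if_neg h
  · rintro ⟨v, hv, h1⟩
    by_contra! h
    have : v m = 0 := by
      clear h1
      induction hv using Submodule.span_induction with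
      | mem x hx =>
        obtain ⟨k, rfl⟩ := hx
        rw [rowVec, if_pos hm, h k k.2]; rfl
      | zero => rfl
      | add x y _ _ hx hy => rw [Pi.add_apply, hx, hy, add_zero]
      | smul a x _ hx => rw [Pi.smul_apply, hx, smul_zero]
    rw [this] at h1
    exact absurd h1 (by decide)

/-- The affine system is made homogeneous by a component with index `2 n` that carries the constant
terms. Starting from the whole space, the row span is cut down by one constraint after another. A
solution exists exactly if a surviving vector, or equivalently one of the rows, has last component
`1`. -/
theorem flag_solve {D L : ℕ} (Q : Code D L) (ℓ : ℕ) (S : Q.Cluster) {ρ : ℕ → ℕ} {A : Arrays}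
    (h : Env L ℓ Q.n Q.M ρ) :
    (solve D).exec (Q.memory ℓ S) ρ A 9 0 0 ≠ 0 ↔ A 9 0 0 ≠ 0 ∨ ∃ P : Pauli Q.n,
      (∀ r : Fin Q.M, symp (Q.gen r) P = bit (A 2 r 0)) ∧
      (∀ i < Q.n + Q.n, A 5 i 0 = 0 → pbit P i = 0) ∧
      ∀ i < Q.n + Q.n, i ≤ ρ 13 → pbit P i = bit (A 4 i 0) := by
  set I := Q.memory ℓ S
  set W := Q.n + Q.n + 1 with hW
  set A₁ := basisRows.exec I ρ A with hA₁
  set A₂ := (Cmd.loop 14 4 (elim (.ite ((Expr.var 11).eq (.var 5)) (.get 2 14 0)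
    (.gen D 14 (.swap 11))))).exec I ρ A₁ with hA₂
  set A₃ := (Cmd.loop 14 5 (elim (((Expr.var 11).eq (.var 14)).and (Expr.get 5 14 0).not))).exec I ρ A₂
    with hA₃
  set A₄ := (Cmd.loop 14 5 (elim (((Expr.var 14).le (.var 13)).and (((Expr.var 11).eq (.var 14)).xor
      (((Expr.var 11).eq (.var 5)).and (.get 4 14 0)))))).exec I ρ A₃ with hA₄
  have e1 : ∀ id, id ≠ 6 → A₁ id = A id := fun id h => keeps_assign2 h I ρ A
  have e2 : ∀ id, id ≠ 6 ∧ id ≠ 7 ∧ id ≠ 8 → A₂ id = A id := fun id h =>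
    ((Cmd.Keeps.loop (keeps_elim h)) I ρ A₁).trans (e1 id h.1)
  have e3 : ∀ id, id ≠ 6 ∧ id ≠ 7 ∧ id ≠ 8 → A₃ id = A id := fun id h =>
    ((Cmd.Keeps.loop (keeps_elim h)) I ρ A₂).trans (e2 id h)
  have e4 : ∀ id, id ≠ 6 ∧ id ≠ 7 ∧ id ≠ 8 → A₄ id = A id := fun id h =>
    ((Cmd.Keeps.loop (keeps_elim h)) I ρ A₃).trans (e3 id h)
  have hlast : (solve D).exec I ρ A 9 0 0 =
      ((Expr.get 9 0 0).or (.bsum 10 6 (.get 6 10 5))).eval I ρ A₄ := by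
    change (A₄.set 9 (ρ 0) (ρ 0) _) 9 0 0 = _
    rw [Arrays.set, h.v0, if_pos ⟨rfl, rfl, rfl⟩]
  rw [hlast, Expr.or_ne, Expr.bsum_ne]
  have hget : (Expr.get 9 0 0).eval I ρ A₄ = A 9 0 0 := by
    rw [Expr.eval, h.v0, e4 9 (by norm_num)]
  rw [hget]
  refine or_congr_right ?_
  simp only [Expr.eval, Function.update_self, Function.update_of_ne (show (5 : ℕ) ≠ 10 by norm_num), h.v5,
    h.v6]
  refine (exists_row_iff (W := W) (Nat.lt_succ_self _)).trans ?_
  have m4 : ∀ v, v ∈ rowSpan W A₄ ↔ v ∈ rowSpan W A₃ ∧ ∀ r < Q.n + Q.n, ∑ i ∈ Finset.range W,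
      (if r ≤ ρ 13 then (if i = r then 1 else 0) +
        (if i = Q.n + Q.n then 1 else 0) * bit (A 4 r 0) else 0) * v i = 0 := by
    intro v
    rw [← h.v5]
    refine mem_rowSpan_loop_elim (fun r i => if r ≤ ρ 13 then (if i = r then 1 else 0) +
        (if i = ρ 5 then 1 else 0) * bit (A 4 r 0) else 0) h.v0 h.v6 ?_ ?_
    · intro r k i _ _
      have hle := Expr.le_ne (.var 14) (.var 13) (I := I) (A := A₃) (ρ :=
        (Function.update (Function.update (Function.update ρ 14 r) 10 k) 11 i))
      rw [← bit_ne_zero, zmod_two_ne_zero_iff] at hle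
      have hle' := bit_ne_zero.not.trans ((Expr.le_ne (.var 14) (.var 13) (I := I) (A := A₃) (ρ :=
        (Function.update (Function.update (Function.update ρ 14 r) 10 k) 11 i))).not)
      rw [not_not] at hle'
      rw [Expr.bit_and, Expr.bit_xor, Expr.bit_and, bit_eq_ite, bit_eq_ite]
      simp only [Expr.eval] at hle hle' ⊢
      simp only [ne_eq, Nat.reduceEqDiff, not_false_eq_true, Function.update_of_ne, Function.update_self,
        OfNat.zero_ne_ofNat, h.v0] at hle hle' ⊢
      rw [e3 4 (by norm_num)]
      split_ifs with h1 <;> grind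
    · intro id hid
      simp [Expr.Reads, Expr.and, Expr.xor, Expr.eq, Expr.le, Expr.or, Expr.not] at hid
      omega
  have m3 : ∀ v, v ∈ rowSpan W A₃ ↔ v ∈ rowSpan W A₂ ∧ ∀ r < Q.n + Q.n, ∑ i ∈ Finset.range W,
      ((if i = r then 1 else 0) * if A 5 r 0 = 0 then 1 else 0) * v i = 0 := by
    intro v
    rw [← h.v5]
    refine mem_rowSpan_loop_elim (fun r i => (if i = r then 1 else 0) * if A 5 r 0 = 0 then 1 else 0)
      h.v0 h.v6 ?_ ?_
    · intro r k i _ _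
      rw [Expr.bit_and, bit_eq_ite]
      simp only [Expr.eval, Expr.not]
      simp only [ne_eq, Nat.reduceEqDiff, not_false_eq_true, Function.update_of_ne, Function.update_self,
        OfNat.zero_ne_ofNat, h.v0]
      rw [e2 5 (by norm_num)]
      congr 1
      split_ifs <;> simp_all [bit]
    · intro id hid
      simp [Expr.Reads, Expr.and, Expr.eq, Expr.or, Expr.not] at hid
      omega
  have m2 : ∀ v, v ∈ rowSpan W A₂ ↔ (∀ i, W ≤ i → v i = 0) ∧ ∀ r : Fin Q.M, ∑ i ∈ Finset.range W,
      (if i = Q.n + Q.n then bit (A 2 r 0) else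
        pbit (Q.gen r) (if i % 2 = 0 then i + 1 else i - 1)) * v i = 0 := by
    intro v
    rw [← mem_rowSpan_basisRows (I := I) (A := A) h.v6]
    refine (mem_rowSpan_loop_elim (fun r i => if i = Q.n + Q.n then bit (A 2 r 0) else
        if hr : r < Q.M then pbit (Q.gen ⟨r, hr⟩) (if i % 2 = 0 then i + 1 else i - 1) else 0)
      h.v0 h.v6 ?_ ?_).trans (and_congr_right fun _ => ?_)
    · intro r k i hr hi
      rw [h.v4] at hr
      set ρ' := Function.update (Function.update (Function.update ρ 14 r) 10 k) 11 i with hρ'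
      have env' : Env L ℓ Q.n Q.M ρ' := ((h.update (by norm_num) r).update (by norm_num) k).update
        (by norm_num) i
      have h11 : ρ' 11 = i := by simp [hρ']
      have h14 : ρ' 14 = r := by simp [hρ']
      have heq := Expr.eq_ne (.var 11) (.var 5) (I := I) (A := A₁) (ρ := ρ')
      simp only [Expr.eval, h11, env'.v5] at heq
      rw [Expr.eval]
      by_cases hi' : i = Q.n + Q.n
      · rw [if_pos (heq.2 hi'), if_pos hi']
        simp only [Expr.eval, h14, env'.v0, e1 2 (by norm_num)]
      · rw [if_neg (heq.not.2 hi'), if_neg hi', dif_pos hr, Q.bit_gen ℓ S env' (by rw [h14]; exact hr)]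
        · simp only [h14, Expr.eval_swap, h11]
        · simp only [Expr.eval_swap, h11]
          split_ifs <;> omega
    · intro id hid
      have : id = 2 := by
        simp only [Expr.Reads, Expr.gen, Expr.swap, Expr.eq, Expr.or, Expr.not, or_false, false_or] at hid
        rcases hid with h | h | h
        · exact h
        · exact (Expr.reads_mulConst h).elim
        · exact (Expr.reads_mulConst h).elim
      omega
    · rw [h.v4]
      exact ⟨fun hh r => by simpa using hh r r.2, fun hh r hr => by simpa [hr] using hh ⟨r, hr⟩⟩
  simp only [m4, m3, m2]
  have two : ∀ a b : ZMod 2, a + b = 0 ↔ b = a := by decide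
  have single : ∀ (r : ℕ) (v : ℕ → ZMod 2), r < Q.n + Q.n →
      ∑ i ∈ Finset.range (Q.n + Q.n), (if i = r then 1 else 0) * v i = v r := by
    intro r v hr
    simp [hr]
  constructor
  · rintro ⟨v, ⟨⟨⟨hv, h2⟩, h3⟩, h4⟩, h1⟩
    refine ⟨ofBits Q.n v, fun r => ?_, fun i hi hA => ?_, fun i hi hb => ?_⟩
    · have := h2 r
      rw [hW, Finset.sum_range_succ, if_pos rfl, h1, mul_one, two] at this
      rw [this, symp_eq_sum]
      refine Finset.sum_congr rfl fun i hi => ?_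
      rw [Finset.mem_range] at hi
      rw [if_neg hi.ne, pbit_ofBits v hi]
    · have := h3 i hi
      rw [pbit_ofBits v hi]
      simpa [hA, hW, hi, hi.trans (Nat.lt_succ_self _)] using this
    · have := h4 i hi
      rw [pbit_ofBits v hi]
      simp only [if_pos hb] at this
      rw [hW, Finset.sum_range_succ, if_pos rfl, if_neg hi.ne', h1, zero_add, one_mul, mul_one, two,
        Finset.sum_congr rfl (g := fun j => (if j = i then 1 else 0) * v j), single i v hi] at this
      · exact this.symm
      · intro j hj
        rw [if_neg (Finset.mem_range.1 hj).ne, zero_mul, add_zero]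
  · rintro ⟨P, h2, h3, h4⟩
    set v : ℕ → ZMod 2 := fun i => if i < Q.n + Q.n then pbit P i else if i = Q.n + Q.n then 1 else 0
      with hv
    have hv1 : v (Q.n + Q.n) = 1 := by simp [hv]
    have hvi : ∀ i, i < Q.n + Q.n → v i = pbit P i := fun i hi => by simp [hv, hi]
    refine ⟨v, ⟨⟨⟨fun i hi => ?_, fun r => ?_⟩, fun r hr => ?_⟩, fun r hr => ?_⟩, hv1⟩
    · simp only [hv]
      rw [if_neg (by omega), if_neg (by omega)]
    · rw [hW, Finset.sum_range_succ, if_pos rfl, hv1, mul_one, two, ← h2 r, symp_eq_sum]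
      refine Finset.sum_congr rfl fun i hi => ?_
      rw [Finset.mem_range] at hi
      rw [if_neg hi.ne, hvi i hi]
    · by_cases hA : A 5 r 0 = 0
      · have := h3 r hr hA
        rw [← hvi r hr] at this
        simp [hA, hW, this]
      · simp [hA]
    · by_cases hb : r ≤ ρ 13
      · simp only [if_pos hb]
        rw [hW, Finset.sum_range_succ, if_pos rfl, if_neg hr.ne', hv1, zero_add, one_mul, mul_one, two,
          Finset.sum_congr rfl (g := fun j => (if j = r then 1 else 0) * v j), single r v hr, hvi r hr,
          h4 r hr hb]
        intro j hj
        rw [if_neg (Finset.mem_range.1 hj).ne, zero_mul, add_zero]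
      · simp [hb]

end MemoryTime

namespace MemoryTime

/-! ## Coordinates -/

section Lattice

variable {D L : ℕ} [NeZero L]

theorem val_sub_eq (x c : ZMod L) :
    (x - c).val = if c.val ≤ x.val then x.val - c.val else x.val + L - c.val := by
  split_ifs with h
  · exact ZMod.val_sub h
  · have hc := ZMod.val_lt c
    have e : x - c = ((x.val + L - c.val : ℕ) : ZMod L) := by
      rw [Nat.cast_sub (by omega), Nat.cast_add]
      simp
    rw [e, ZMod.val_natCast, Nat.mod_eq_of_lt (by omega)]

-- The decisive vertex of the elementary cube is the one opposite to its lower corner. The bound `R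
-- + 1 < L` prevents its offset from being reduced modulo `L`.
omit [NeZero L] in
theorem cubeIn_iff (Q : Code D L) {a : Fin Q.M} {c : Site D L} {R : ℕ} (hR : R + 1 < L) :
    Q.CubeIn a (box c R) ↔ ∀ i, (Q.cube a i - c i).val + 1 ≤ R := by
  have h1 : (1 : ZMod L).val = 1 := by
    have : Fact (1 < L) := ⟨by omega⟩
    exact ZMod.val_one L
  constructor
  · intro h i
    have h0 : (Q.cube a i - c i).val ≤ R := h (self_mem_box _ _) i
    have h2 : (fun i => Q.cube a i + 1) ∈ box (Q.cube a) 1 := fun i => by simp [h1]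
    have h3 := h h2 i
    rwa [show Q.cube a i + 1 - c i = Q.cube a i - c i + 1 by ring, ZMod.val_add_of_lt, h1] at h3
    rw [h1]; omega
  · intro h u hu i
    have h2 := hu i
    have h3 := h i
    have h4 := ZMod.val_add_le (u i - Q.cube a i) (Q.cube a i - c i)
    rw [sub_add_sub_cancel] at h4
    omega

/-- A site just below the cube has offset `-1`, which is represented by `L - 1`; hence the second
alternative. -/
theorem mem_nbhd_box_iff {u c : Site D L} {R : ℕ} (hR : R + 1 < L) :
    u ∈ nbhd 1 (box c R) ↔ ∀ i, (u i - c i).val ≤ R + 1 ∨ (u i - c i).val + 1 = L := by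
  have h1 : (1 : ZMod L).val = 1 := by
    have : Fact (1 < L) := ⟨by omega⟩
    exact ZMod.val_one L
  have hm1 : ∀ x : ZMod L, x ≠ 0 → (x - 1).val + 1 = x.val := by
    intro x hx
    have : 0 < x.val := Nat.pos_of_ne_zero fun h => hx ((ZMod.val_eq_zero x).1 h)
    rw [ZMod.val_sub (by rw [h1]; omega), h1]; omega
  have n1 : ((1 : ZMod L)).valMinAbs.natAbs ≤ 1 := by simpa using natAbs_valMinAbs_natCast_le (L := L) 1
  constructor
  · rintro ⟨v, hv, hd⟩ i
    have h2 := dist_le_iff.1 hd i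
    have h3 := hv i
    have h4 : (((u i - v i).valMinAbs : ℤ) : ZMod L) = u i - v i := ZMod.coe_valMinAbs _
    have h5 : (u i - v i).valMinAbs = 0 ∨ (u i - v i).valMinAbs = 1 ∨ (u i - v i).valMinAbs = -1 := by
      omega
    rcases h5 with h5 | h5 | h5
    · rw [h5, Int.cast_zero] at h4
      rw [sub_eq_zero.1 h4.symm]
      left; omega
    · rw [h5, Int.cast_one] at h4
      have h6 := ZMod.val_add_le (u i - v i) (v i - c i)
      rw [sub_add_sub_cancel, ← h4, h1] at h6
      left; omega
    · rw [h5, Int.cast_neg, Int.cast_one] at h4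
      have h6 : u i - c i = (v i - c i) - 1 := by
        rw [← sub_add_sub_cancel (u i) (v i) (c i), ← h4]; ring
      by_cases h0 : v i - c i = 0
      · right
        rw [h6, h0, val_sub_eq, h1, ZMod.val_zero, if_neg (by omega)]; omega
      · left
        have := hm1 _ h0
        rw [h6]; omega
  · intro h
    have key : ∀ i, ∃ y : ZMod L, (y - c i).val ≤ R ∧ (u i - y).valMinAbs.natAbs ≤ 1 := by
      intro i
      by_cases h2 : (u i - c i).val ≤ R
      · exact ⟨u i, h2, by simp⟩
      rcases h i with h3 | h3
      · refine ⟨u i - 1, ?_, by simpa using n1⟩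
        have h4 : u i - c i ≠ 0 := fun h0 => by simp [h0] at h2
        have := hm1 _ h4
        rw [show u i - 1 - c i = u i - c i - 1 by ring]; omega
      · refine ⟨u i + 1, ?_, ?_⟩
        · have h4 : u i + 1 - c i = 0 := by
            have : u i + 1 - c i = (((u i - c i).val + 1 : ℕ) : ZMod L) := by
              push_cast
              rw [ZMod.natCast_zmod_val]; ring
            rw [this, h3, ZMod.natCast_self]
          rw [h4, ZMod.val_zero]; omega
        · rw [show u i - (u i + 1) = -1 by ring, ZMod.natAbs_valMinAbs_neg]
          exact n1
    choose v hv hd using key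
    exact ⟨v, hv, dist_le_iff.2 hd⟩

theorem dist_le_iff_val {u v : Site D L} {s : ℕ} :
    dist u v ≤ s ↔ ∀ i, (u i - v i).val ≤ s ∨ L - (u i - v i).val ≤ s := by
  rw [dist_le_iff]
  refine forall_congr' fun i => ?_
  rw [ZMod.valMinAbs_natAbs_eq_min, min_le_iff]

end Lattice

/-! ## Extraction of the first solution -/

open Classical in
/-- The first `b` components of the lexicographically greatest Pauli operator with a property. -/
def lexPrefix {n : ℕ} (good : Pauli n → Prop) : ℕ → ℕ → ZMod 2
  | 0 => fun _ => 0
  | b + 1 => Function.update (lexPrefix good b) b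
      (if ∃ P, good P ∧ (∀ j < b, pbit P j = lexPrefix good b j) ∧ pbit P b = 1 then 1 else 0)

/-- The lexicographically greatest Pauli operator with a property, or the identity. -/
def lexPauli {n : ℕ} (good : Pauli n → Prop) : Pauli n := ofBits n (lexPrefix good (n + n))

/-- The greedy choice never fails: if no extension has component `1` at `b`, then the extension at
hand has component `0` there. -/
theorem exists_good_prefix {n : ℕ} {good : Pauli n → Prop} (h : ∃ P, good P) (b : ℕ) :
    ∃ P, good P ∧ ∀ j < b, pbit P j = lexPrefix good b j := by
  induction b with
  | zero =>
    obtain ⟨P, hP⟩ := h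
    exact ⟨P, hP, fun j hj => by omega⟩
  | succ b ih =>
    obtain ⟨P, hP, hP'⟩ := ih
    by_cases h1 : ∃ P, good P ∧ (∀ j < b, pbit P j = lexPrefix good b j) ∧ pbit P b = 1
    · obtain ⟨R, h2, h3, h4⟩ := h1
      refine ⟨R, h2, fun j hj => ?_⟩
      by_cases hjb : j = b
      · subst hjb
        rw [lexPrefix, Function.update_self, if_pos ⟨R, h2, h3, h4⟩, h4]
      · rw [lexPrefix, Function.update_of_ne hjb, h3 j (by omega)]
    · refine ⟨P, hP, fun j hj => ?_⟩
      by_cases hjb : j = b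
      · subst hjb
        rw [lexPrefix, Function.update_self, if_neg h1]
        by_contra h0
        exact h1 ⟨P, hP, hP', zmod_two_ne_zero_iff.1 h0⟩
      · rw [lexPrefix, Function.update_of_ne hjb, hP' j (by omega)]

theorem lexPauli_good {n : ℕ} {good : Pauli n → Prop} (h : ∃ P, good P) : good (lexPauli good) := by
  obtain ⟨P, h1, h2⟩ := exists_good_prefix h (n + n)
  have : lexPauli good = P := pbit_ext fun i hi => by
    rw [lexPauli, pbit_ofBits _ hi, h2 i hi]
  rwa [this]

theorem lexPauli_eq_zero {n : ℕ} {good : Pauli n → Prop} (h : ¬ ∃ P, good P) : lexPauli good = 0 := by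
  have : ∀ b j, lexPrefix good b j = 0 := by
    intro b
    induction b with
    | zero => exact fun _ => rfl
    | succ b ih =>
      intro j
      rw [lexPrefix, if_neg fun ⟨P, hP, _⟩ => h ⟨P, hP⟩, Function.update_apply]
      split_ifs
      exacts [rfl, ih j]
  exact pbit_ext fun i hi => by rw [lexPauli, pbit_ofBits _ hi, this, pbit_zero]

/-- Computes a Pauli operator in the array `4`, component by component. The command `c` decides
whether a prefix can be extended and raises the flag in the array `9` if so. -/
def extract (c : Cmd) : Cmd :=
  .loop 13 5 (.seq (.store 9 0 0 (.cst 0)) (.seq (.store 4 13 0 (.cst 1)) (.seq c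
    (.ite (.get 9 0 0) .skip (.store 4 13 0 (.cst 0))))))

theorem keeps_extract {id : ℕ} {c : Cmd} (hc : c.Keeps id) (h4 : id ≠ 4) (h9 : id ≠ 9) :
    (extract c).Keeps id :=
  .loop (.seq (.store h9) (.seq (.store h4) (.seq hc (.ite .skip (.store h4)))))

/-- A component `1` is written tentatively and revoked if the flag stays down. The invariant holds
the data that `c` relies on; writing to the arrays `4` and `9` must not affect it. -/
theorem exec_extract {L ℓ n M : ℕ} {I ρ : ℕ → ℕ} {A : Arrays} {c : Cmd} (good : Pauli n → Prop)
    (Inv : Arrays → Prop) (h : Env L ℓ n M ρ) (hA : Inv A)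
    (hInv : ∀ A B : Arrays, (∀ id, id ≠ 4 → id ≠ 9 → B id = A id) → Inv A → Inv B)
    (h4 : c.Keeps 4) (hc : ∀ b B, b < n + n → Inv B → Inv (c.exec I (Function.update ρ 13 b) B) ∧
      (c.exec I (Function.update ρ 13 b) B 9 0 0 ≠ 0 ↔ B 9 0 0 ≠ 0 ∨
        ∃ P, good P ∧ ∀ i < n + n, i ≤ b → pbit P i = bit (B 4 i 0))) :
    ∀ i < n + n, bit ((extract c).exec I ρ A 4 i 0) = pbit (lexPauli good) i := by
  have key := iter_induction (f := fun i A => (Cmd.seq (.store 9 0 0 (.cst 0))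
      (.seq (.store 4 13 0 (.cst 1)) (.seq c (.ite (.get 9 0 0) .skip (.store 4 13 0 (.cst 0)))))).exec I
        (Function.update ρ 13 i) A) (a := A) (n := ρ 5)
    (fun m B => Inv B ∧ ∀ i < m, bit (B 4 i 0) = lexPrefix good m i) ⟨hA, fun i hi => by omega⟩ ?_
  · intro i hi
    rw [lexPauli, pbit_ofBits _ hi, ← h.v5]
    exact key.2 i (by rw [h.v5]; exact hi)
  rintro m B hm ⟨h1, h2⟩
  rw [h.v5] at hm
  have env := h.update (show 10 ≤ 13 by norm_num) m
  set ρ' := Function.update ρ 13 m with hρ'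
  have h13 : ρ' 13 = m := Function.update_self _ _ _
  set B₁ : Arrays := (B.set 9 0 0 0).set 4 m 0 1 with hB₁
  set B₂ := c.exec I ρ' B₁ with hB₂
  have b1 : ∀ id, id ≠ 4 → id ≠ 9 → B₁ id = B id := by
    intro id i4 i9
    funext i j
    simp [hB₁, Arrays.set, i4, i9]
  have b4 : ∀ i, B₁ 4 i 0 = if i = m then 1 else B 4 i 0 := by
    intro i
    simp [hB₁, Arrays.set]
  have b9 : B₁ 9 0 0 = 0 := by simp [hB₁, Arrays.set]
  have hex : (Cmd.seq (.store 9 0 0 (.cst 0)) (.seq (.store 4 13 0 (.cst 1)) (.seq c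
      (.ite (.get 9 0 0) .skip (.store 4 13 0 (.cst 0)))))).exec I ρ' B =
        if B₂ 9 0 0 ≠ 0 then B₂ else B₂.set 4 m 0 0 := by
    simp only [Cmd.exec, Expr.eval, env.v0, h13]
    rfl
  obtain ⟨i2, f2⟩ := hc m B₁ hm (hInv B B₁ b1 h1)
  rw [b9] at f2
  have c4 : B₂ 4 = B₁ 4 := h4 I ρ' B₁
  have f3 : B₂ 9 0 0 ≠ 0 ↔
      ∃ P, good P ∧ (∀ j < m, pbit P j = lexPrefix good m j) ∧ pbit P m = 1 := by
    rw [f2]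
    simp only [ne_eq, not_true_eq_false, false_or]
    refine exists_congr fun P => and_congr_right fun _ => ⟨fun h => ⟨fun j hj => ?_, ?_⟩, ?_⟩
    · rw [h j (by omega) (by omega), b4, if_neg (by omega), h2 j hj]
    · rw [h m hm le_rfl, b4, if_pos rfl]; rfl
    · rintro ⟨h3, h5⟩ i hi him
      rw [b4]
      split_ifs with hm'
      · rw [hm', h5]; rfl
      · rw [h3 i (by omega), h2 i (by omega)]
  rw [hex]
  split_ifs with hf
  · refine ⟨i2, fun i hi => ?_⟩
    rw [c4, b4, lexPrefix, Function.update_apply, if_pos (f3.1 hf)]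
    split_ifs with him
    · rfl
    · exact h2 i (by omega)
  · refine ⟨hInv B₂ _ (fun id i4 i9 => ?_) i2, fun i hi => ?_⟩
    · funext a b
      simp [Arrays.set, i4]
    · rw [lexPrefix, Function.update_apply, if_neg (f3.not.1 hf)]
      simp only [Arrays.set, true_and, and_true]
      split_ifs with him
      · rfl
      · rw [c4, b4, if_neg him]
        exact h2 i (by omega)

end MemoryTime

namespace MemoryTime

/-! ## Search for smallest enclosing cubes -/

namespace Expr

/-- Disjunction of a family. -/
def any : ℕ → (ℕ → Expr) → Expr
  | 0, _ => cst 0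
  | k + 1, f => (any k f).or (f k)

theorem any_ne {I ρ : ℕ → ℕ} {A : Arrays} (k : ℕ) (f : ℕ → Expr) :
    (any k f).eval I ρ A ≠ 0 ↔ ∃ i < k, (f i).eval I ρ A ≠ 0 := by
  induction k with
  | zero => simp [any, eval]
  | succ k ih => rw [any, or_ne, ih, Nat.exists_lt_succ_right]

theorem reads_any {id k : ℕ} {f : ℕ → Expr} (h : (any k f).Reads id) : ∃ i, (f i).Reads id := by
  induction k with
  | zero => exact h.elim
  | succ k ih =>
    rcases h with h | h | h
    exacts [ih h, h.elim, ⟨k, h⟩]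

/-- A coordinate of the site of a qubit. -/
def siteCoord (D : ℕ) (e : Expr) (i : ℕ) : Expr := inp ((cst 5).add ((mulConst D e).add (cst i)))

/-- A coordinate of the cube of a generator. -/
def cubeCoord (D a i : ℕ) : Expr :=
  inp ((cst 5).add ((mulConst D (var 3)).add ((mulConst D (var a)).add (cst i))))

/-- Subtraction modulo `L`. -/
def diff (x c : Expr) : Expr := ite (c.sub x) ((x.add (var 1)).sub c) (x.sub c)

/-- The cube of linear size given by the variable `R` with corner given by the variables from `b` on
encloses the cluster in the array `2`. -/
def encloses (D R b : ℕ) : Expr :=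
  (bsum 17 4 ((get 2 17 0).and
    (any D fun i => (((diff (cubeCoord D 17 i) (var (b + i))).add (cst 1)).le (var R)).not))).not

/-- The expression is true for some values of the `k` variables from `b` on. -/
def anyCorner (b : ℕ) : ℕ → Expr → Expr
  | 0, e => e
  | k + 1, e => bsum (b + k) 1 (anyCorner b k e)

/-- A smallest enclosing cube of linear size given by the variable `15`. -/
def minCube (D : ℕ) : Expr :=
  (encloses D 15 40).and (bsum 16 15 (anyCorner (40 + D) D (encloses D 16 (40 + D)))).not

/-- The qubit of the component `18` lies in the neighbourhood of the cube. -/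
def allowed (D : ℕ) : Expr :=
  (any D fun i => (((diff (siteCoord D (half 18) i) (var (40 + i))).le ((var 15).add (cst 1))).or
    (((diff (siteCoord D (half 18) i) (var (40 + i))).add (cst 1)).eq (var 1))).not).not

theorem not_reads_allowed {D id : ℕ} : ¬ (allowed D).Reads id := by
  intro h
  rcases h with h | h | h
  · obtain ⟨i, h⟩ := reads_any h
    have hm : ¬ (mulConst D (half 18)).Reads id := fun h => by
      have := reads_mulConst h
      simp [half, Reads] at this
    simp [Reads, not, or, le, eq, diff, siteCoord, hm] at h
  · exact h
  · exact h

end Expr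

/-- Loops over all values of the `k` variables from `b` on. -/
def nest (b : ℕ) : ℕ → Cmd → Cmd
  | 0, c => c
  | k + 1, c => .loop (b + k) 1 (nest b k c)

theorem keeps_nest {id b k : ℕ} {c : Cmd} (h : c.Keeps id) : (nest b k c).Keeps id := by
  induction k with
  | zero => exact h
  | succ k ih => exact .loop ih

/-- Sets the `k` variables from `b` on. -/
def setVars (b k : ℕ) (f ρ : ℕ → ℕ) : ℕ → ℕ := fun x =>
  if b ≤ x ∧ x < b + k then f (x - b) else ρ x

theorem setVars_update (b k v : ℕ) (f ρ : ℕ → ℕ) :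
    setVars b k f (Function.update ρ (b + k) v) = setVars b (k + 1) (Function.update f k v) ρ := by
  funext x
  simp only [setVars, Function.update_apply]
  split_ifs <;> omega

theorem setVars_zero (b : ℕ) (f ρ : ℕ → ℕ) : setVars b 0 f ρ = ρ := by
  funext x
  rw [setVars, if_neg (by omega)]

theorem exists_setVars_succ (b k L : ℕ) (ρ : ℕ → ℕ) (p : (ℕ → ℕ) → Prop) :
    (∃ v < L, ∃ f : ℕ → ℕ, (∀ i < k, f i < L) ∧ p (setVars b k f (Function.update ρ (b + k) v))) ↔
      ∃ f : ℕ → ℕ, (∀ i < k + 1, f i < L) ∧ p (setVars b (k + 1) f ρ) := by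
  constructor
  · rintro ⟨v, hv, f, hf, h⟩
    refine ⟨Function.update f k v, fun i hi => ?_, by rwa [← setVars_update]⟩
    rw [Function.update_apply]
    split_ifs
    exacts [hv, hf i (by omega)]
  · rintro ⟨f, hf, h⟩
    refine ⟨f k, hf k (by omega), f, fun i hi => hf i (by omega), ?_⟩
    rwa [setVars_update, Function.update_eq_self]

theorem anyCorner_ne {I ρ : ℕ → ℕ} {A : Arrays} {b L : ℕ} (hb : 10 ≤ b) (k : ℕ) (e : Expr)
    (hL : ρ 1 = L) : (Expr.anyCorner b k e).eval I ρ A ≠ 0 ↔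
      ∃ f : ℕ → ℕ, (∀ i < k, f i < L) ∧ e.eval I (setVars b k f ρ) A ≠ 0 := by
  induction k generalizing ρ with
  | zero => simp [Expr.anyCorner, setVars_zero]
  | succ k ih =>
    rw [Expr.anyCorner, Expr.bsum_ne, hL, ← exists_setVars_succ (p := fun ρ => e.eval I ρ A ≠ 0)]
    refine exists_congr fun v => and_congr_right fun _ => ih ?_
    rw [Function.update_of_ne (by omega), hL]

/-- For the fixed dimension `D`, as many nested loops visit all `L ^ D` corners of cubes and still
form a single command. -/
theorem nest_flag {I ρ : ℕ → ℕ} {A : Arrays} {b L : ℕ} (hb : 10 ≤ b) (k : ℕ) {c : Cmd}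
    (Inv flag : Arrays → Prop) (test : (ℕ → ℕ) → Prop) (hL : ρ 1 = L) (hA : Inv A)
    (hc : ∀ f B, (∀ i < k, f i < L) → Inv B → Inv (c.exec I (setVars b k f ρ) B) ∧
      (flag (c.exec I (setVars b k f ρ) B) ↔ flag B ∨ test (setVars b k f ρ))) :
    Inv ((nest b k c).exec I ρ A) ∧ (flag ((nest b k c).exec I ρ A) ↔ flag A ∨
      ∃ f : ℕ → ℕ, (∀ i < k, f i < L) ∧ test (setVars b k f ρ)) := by
  induction k generalizing ρ A with
  | zero => simpa [nest, setVars_zero] using hc 0 A (by simp) hA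
  | succ k ih =>
    rw [← exists_setVars_succ, nest, ← hL]
    refine loop_flag Inv flag _ hA fun v B hv hB => ?_
    have h1 : Function.update ρ (b + k) v 1 = L := by rw [Function.update_of_ne (by omega), hL]
    rw [hL]
    refine ih h1 hB fun f B' hf hB' => ?_
    rw [setVars_update]
    refine hc _ B' (fun i hi => ?_) hB'
    rw [Function.update_apply]
    split_ifs
    exacts [hL ▸ hv, hf i (by omega)]

section Search

variable {D L : ℕ} [NeZero L]

/-- Sets the variables from `b` on to the coordinates of a site. -/
def withSite (b : ℕ) (c : Site D L) (ρ : ℕ → ℕ) : ℕ → ℕ :=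
  setVars b D (fun i => if h : i < D then (c ⟨i, h⟩).val else 0) ρ

omit [NeZero L] in
theorem withSite_coord (b : ℕ) (c : Site D L) (ρ : ℕ → ℕ) (i : Fin D) :
    withSite b c ρ (b + i) = (c i).val := by
  simp [withSite, setVars]

omit [NeZero L] in
theorem withSite_of_lt {b : ℕ} (c : Site D L) (ρ : ℕ → ℕ) {x : ℕ} (h : x < b) :
    withSite b c ρ x = ρ x := by
  simp [withSite, setVars, h]

omit [NeZero L] in
theorem Env.withSite {ℓ n M : ℕ} {ρ : ℕ → ℕ} (h : Env L ℓ n M ρ) {b : ℕ} (hb : 10 ≤ b) (c : Site D L) :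
    Env L ℓ n M (withSite b c ρ) := by
  obtain ⟨h0, h1, h2, h3, h4, h5, h6, h9⟩ := h
  constructor <;> rw [withSite_of_lt _ _ (by omega)] <;> assumption

omit [NeZero L] in
theorem exists_eq_withSite (b : ℕ) (ρ f : ℕ → ℕ) (hf : ∀ i < D, f i < L) :
    ∃ c : Site D L, setVars b D f ρ = withSite b c ρ := by
  refine ⟨fun i => (f i : ZMod L), ?_⟩
  funext x
  rw [withSite, setVars, setVars]
  split_ifs with h h'
  · rw [ZMod.val_natCast, Nat.mod_eq_of_lt (hf _ h')]
  · omega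
  · rfl

theorem exists_corner (b : ℕ) (ρ : ℕ → ℕ) (p : (ℕ → ℕ) → Prop) :
    (∃ f : ℕ → ℕ, (∀ i < D, f i < L) ∧ p (setVars b D f ρ)) ↔
      ∃ c : Site D L, p (withSite b c ρ) := by
  constructor
  · rintro ⟨f, hf, h⟩
    obtain ⟨c, hc⟩ := exists_eq_withSite b ρ f hf
    exact ⟨c, hc ▸ h⟩
  · rintro ⟨c, h⟩
    refine ⟨_, fun i hi => ?_, h⟩
    rw [dif_pos hi]
    exact ZMod.val_lt _

theorem eval_diff {I ρ : ℕ → ℕ} {A : Arrays} {a b : Expr} {x c : ZMod L} (hL : ρ 1 = L)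
    (ha : a.eval I ρ A = x.val) (hb : b.eval I ρ A = c.val) :
    (Expr.diff a b).eval I ρ A = (x - c).val := by
  rw [val_sub_eq]
  simp only [Expr.diff, Expr.eval, ha, hb, hL]
  split_ifs <;> omega

variable (Q : Code D L) (ℓ : ℕ) (S : Q.Cluster)

omit [NeZero L] in
theorem eval_cubeCoord {ρ : ℕ → ℕ} {A : Arrays} (h : Env L ℓ Q.n Q.M ρ) {x : ℕ} (a : Fin Q.M)
    (ha : ρ x = a) (i : Fin D) :
    (Expr.cubeCoord D x i).eval (Q.memory ℓ S) ρ A = (Q.cube a i).val := by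
  simp only [Expr.cubeCoord, Expr.eval, Expr.eval_mulConst, h.v3, ha]
  exact Q.memory_cube ℓ S a i

omit [NeZero L] in
theorem eval_siteCoord {ρ : ℕ → ℕ} {A : Arrays} {e : Expr} (j : Fin Q.n)
    (hj : e.eval (Q.memory ℓ S) ρ A = j) (i : Fin D) :
    (Expr.siteCoord D e i).eval (Q.memory ℓ S) ρ A = (Q.site j i).val := by
  simp only [Expr.siteCoord, Expr.eval, Expr.eval_mulConst, hj]
  exact Q.memory_site ℓ S j i

/-- The array `2` represents the cluster `C`. -/
def Holds (C : Q.Cluster) (A : Arrays) : Prop := ∀ a : Fin Q.M, A 2 a 0 ≠ 0 ↔ a ∈ C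

theorem encloses_ne {ρ : ℕ → ℕ} {A : Arrays} (h : Env L ℓ Q.n Q.M ρ) {C : Q.Cluster}
    (hC : Holds Q C A) {R b : ℕ} (hb : 18 ≤ b) (hR : R ≠ 17) (hRL : ρ R + 1 < L) {c : Site D L}
    (hc : ∀ i : Fin D, ρ (b + i) = (c i).val) :
    (Expr.encloses D R b).eval (Q.memory ℓ S) ρ A ≠ 0 ↔ ∀ a ∈ C, Q.CubeIn a (box c (ρ R)) := by
  rw [Expr.encloses, Expr.not_ne, Expr.bsum_ne, h.v4]
  have key : ∀ a : Fin Q.M, ((Expr.get 2 17 0).and (Expr.any D fun i =>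
      (((Expr.diff (Expr.cubeCoord D 17 i) (.var (b + i))).add (.cst 1)).le (.var R)).not)).eval
        (Q.memory ℓ S) (Function.update ρ 17 a) A ≠ 0 ↔ a ∈ C ∧ ¬ Q.CubeIn a (box c (ρ R)) := by
    intro a
    have env := h.update (show 10 ≤ 17 by norm_num) (a : ℕ)
    rw [Expr.and_ne, Expr.any_ne, cubeIn_iff Q hRL]
    refine and_congr ?_ ?_
    · simp only [Expr.eval, Function.update_self, env.v0]
      exact hC a
    · have e : ∀ i : Fin D, (((Expr.diff (Expr.cubeCoord D 17 i) (.var (b + i))).add (.cst 1)).le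
          (.var R)).not.eval (Q.memory ℓ S) (Function.update ρ 17 a) A ≠ 0 ↔
            ¬ (Q.cube a i - c i).val + 1 ≤ ρ R := by
        intro i
        have hd := eval_diff (b := .var (b + i)) (A := A) env.v1
          (eval_cubeCoord Q ℓ S env a (Function.update_self _ _ _) i) (c := c i) (by
            rw [Expr.eval, Function.update_of_ne (by omega), hc])
        rw [Expr.not_ne, Expr.le_ne]
        simp only [Expr.eval, hd, Function.update_of_ne hR]
      rw [not_forall]
      exact ⟨fun ⟨i, hi, h⟩ => ⟨⟨i, hi⟩, (e ⟨i, hi⟩).1 h⟩, fun ⟨i, h⟩ => ⟨i, i.2, (e i).2 h⟩⟩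
  constructor
  · intro hh a ha
    by_contra hn
    exact hh ⟨a, a.2, (key a).2 ⟨ha, hn⟩⟩
  · rintro hh ⟨a, ha, h'⟩
    obtain ⟨h1, h2⟩ := (key ⟨a, ha⟩).1 h'
    exact h2 (hh _ h1)

/-- Minimality concerns cubes of all sizes, but only the smaller ones have to be searched. Their
corner uses the variables from `40 + D` on, so as not to clash with the corner of the given cube. -/
theorem minCube_ne {ρ : ℕ → ℕ} {A : Arrays} (h : Env L ℓ Q.n Q.M ρ) {C : Q.Cluster}
    (hC : Holds Q C A) (hRL : ρ 15 + 1 < L) {c : Site D L}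
    (hc : ∀ i : Fin D, ρ (40 + i) = (c i).val) :
    (Expr.minCube D).eval (Q.memory ℓ S) ρ A ≠ 0 ↔ Q.IsMinCube C c (ρ 15) := by
  rw [Expr.minCube, Expr.and_ne, Expr.not_ne, Expr.bsum_ne,
    encloses_ne Q ℓ S h hC (by norm_num) (by norm_num) hRL hc]
  refine and_congr_right fun _ => ?_
  have key : ∀ R, R < ρ 15 → ((Expr.anyCorner (40 + D) D (Expr.encloses D 16 (40 + D))).eval
      (Q.memory ℓ S) (Function.update ρ 16 R) A ≠ 0 ↔
        ∃ c : Site D L, ∀ a ∈ C, Q.CubeIn a (box c R)) := by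
    intro R hR
    have env := h.update (show 10 ≤ 16 by norm_num) R
    rw [anyCorner_ne (by omega) D _ env.v1, exists_corner (p := fun ρ =>
      (Expr.encloses D 16 (40 + D)).eval (Q.memory ℓ S) ρ A ≠ 0)]
    refine exists_congr fun c' => ?_
    have h16 : withSite (40 + D) c' (Function.update ρ 16 R) 16 = R := by
      rw [withSite_of_lt _ _ (by omega), Function.update_self]
    rw [encloses_ne Q ℓ S (env.withSite (by omega) c') hC (by omega) (by norm_num)
      (by rw [h16]; omega) (withSite_coord _ c' _), h16]
  constructor
  · intro hh c' R' hc'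
    by_contra hlt
    exact hh ⟨R', by omega, (key R' (by omega)).2 ⟨c', hc'⟩⟩
  · rintro hh ⟨R, hR, h'⟩
    obtain ⟨c', hc'⟩ := (key R hR).1 h'
    have := hh c' R hc'
    omega

theorem allowed_ne {ρ : ℕ → ℕ} {A : Arrays} (h : Env L ℓ Q.n Q.M ρ) (hRL : ρ 15 + 1 < L)
    {c : Site D L} (hc : ∀ i : Fin D, ρ (40 + i) = (c i).val) (j : Fin Q.n) (hj : ρ 18 / 2 = j) :
    (Expr.allowed D).eval (Q.memory ℓ S) ρ A ≠ 0 ↔ Q.site j ∈ nbhd 1 (box c (ρ 15)) := by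
  rw [Expr.allowed, Expr.not_ne, Expr.any_ne, mem_nbhd_box_iff hRL]
  have e : ∀ i : Fin D, ((((Expr.diff (Expr.siteCoord D (.half 18) i) (.var (40 + i))).le
      ((Expr.var 15).add (.cst 1))).or
    (((Expr.diff (.siteCoord D (.half 18) i) (.var (40 + i))).add (.cst 1)).eq (.var 1))).not).eval
      (Q.memory ℓ S) ρ A ≠ 0 ↔
        ¬ ((Q.site j i - c i).val ≤ ρ 15 + 1 ∨ (Q.site j i - c i).val + 1 = L) := by
    intro i
    have hd := eval_diff (a := Expr.siteCoord D (.half 18) i) (b := .var (40 + i)) (A := A) h.v1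
      (eval_siteCoord Q ℓ S j (by rw [Expr.eval_half, hj]) i) (hc i)
    rw [Expr.not_ne, Expr.or_ne, Expr.le_ne, Expr.eq_ne, Expr.eval, hd]
    simp only [Expr.eval, h.v1, hd]
  constructor
  · intro hh i
    by_contra hn
    exact hh ⟨i, i.2, (e i).2 hn⟩
  · rintro hh ⟨i, hi, h'⟩
    exact (e ⟨i, hi⟩).1 h' (hh _)

/-- Decides whether a prefix extends to a Pauli operator on the neighbourhood of a smallest
enclosing cube with the syndrome in the array `2`. -/
def search (D : ℕ) : Cmd :=
  .loop 15 2 (nest 40 D (.ite (.minCube D) (.seq (assign1 5 18 5 (.allowed D)) (solve D)) .skip))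

theorem keeps_search {id D : ℕ} (h : id ≠ 5 ∧ id ≠ 6 ∧ id ≠ 7 ∧ id ≠ 8 ∧ id ≠ 9) :
    (search D).Keeps id :=
  .loop (keeps_nest (.ite (.seq (keeps_assign1 h.1) (keeps_solve h.2)) .skip))

/-- The Pauli operators that the neutrality test may return. -/
def Code.TestSolution (C : Q.Cluster) (P : Pauli Q.n) : Prop :=
  ∃ c R, Q.IsMinCube C c R ∧ R ≤ ℓ ∧ Q.syn P = C ∧ Q.SuppIn P (nbhd 1 (box c R))

omit [NeZero L] in
theorem syn_eq_iff {C : Q.Cluster} {A : Arrays} (hC : Holds Q C A) {P : Pauli Q.n} :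
    (∀ r : Fin Q.M, symp (Q.gen r) P = bit (A 2 r 0)) ↔ Q.syn P = C := by
  rw [Finset.ext_iff]
  refine forall_congr' fun r => ?_
  rw [Code.mem_syn, ← hC r, bit]
  rcases eq_or_ne (symp (Q.gen r) P) 0 with h | h
  · rw [h]; split_ifs with h' <;> simp [h']
  · rw [zmod_two_ne_zero_iff.1 h]; split_ifs with h' <;> simp [h']

omit [NeZero L] in
theorem suppIn_iff {U : Set (Site D L)} {A : Arrays} {P : Pauli Q.n}
    (hU : ∀ i < Q.n + Q.n, ∀ j : Fin Q.n, i / 2 = j → (A 5 i 0 ≠ 0 ↔ Q.site j ∈ U)) :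
    (∀ i < Q.n + Q.n, A 5 i 0 = 0 → pbit P i = 0) ↔ Q.SuppIn P U := by
  constructor
  · intro h j hj
    by_contra hn
    have h1 := hU (2 * j) (by omega) j (by omega)
    have h2 := hU (2 * j + 1) (by omega) j (by omega)
    have h3 := h (2 * j) (by omega) (by_contra fun h' => hn (h1.1 h'))
    have h4 := h (2 * j + 1) (by omega) (by_contra fun h' => hn (h2.1 h'))
    rw [pbit_even] at h3
    rw [pbit_odd] at h4
    exact hj (Prod.ext h3 h4)
  · intro h i hi hA
    have hj : i / 2 < Q.n := by omega
    have h1 : P ⟨i / 2, hj⟩ = 0 := by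
      by_contra hn
      exact (hU i hi ⟨i / 2, hj⟩ rfl).2 (h _ hn) hA
    rw [pbit, dif_pos hj, h1]
    simp

/-- A smallest enclosing cube need not be unique, and the specification accepts any of them. So all
sizes up to `ℓ` and all corners are tried, and the flag accumulates the disjunction. -/
theorem flag_search (hℓ : ℓ + 1 < L) {ρ : ℕ → ℕ} {A : Arrays} (h : Env L ℓ Q.n Q.M ρ)
    {C : Q.Cluster} (hC : Holds Q C A) :
    (search D).exec (Q.memory ℓ S) ρ A 9 0 0 ≠ 0 ↔ A 9 0 0 ≠ 0 ∨ ∃ P, Q.TestSolution ℓ C P ∧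
      ∀ i < Q.n + Q.n, i ≤ ρ 13 → pbit P i = bit (A 4 i 0) := by
  let test : ℕ → Site D L → Prop := fun R c => Q.IsMinCube C c R ∧ ∃ P, Q.syn P = C ∧
    Q.SuppIn P (nbhd 1 (box c R)) ∧ ∀ i < Q.n + Q.n, i ≤ ρ 13 → pbit P i = bit (A 4 i 0)
  have key := loop_flag (I := Q.memory ℓ S) (x := 15) (y := 2)
    (c := nest 40 D (.ite (.minCube D) (.seq (assign1 5 18 5 (.allowed D)) (solve D)) .skip))
    (fun B => B 2 = A 2 ∧ B 4 = A 4) (fun B => B 9 0 0 ≠ 0) (fun R => ∃ c, test R c) (ρ := ρ) (A := A)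
    ⟨rfl, rfl⟩ ?_
  · refine key.2.trans (or_congr_right ?_)
    rw [h.v2]
    constructor
    · rintro ⟨R, hR, c, h1, P, h2, h3, h4⟩
      exact ⟨P, ⟨c, R, h1, by omega, h2, h3⟩, h4⟩
    · rintro ⟨P, ⟨c, R, h1, hR, h2, h3⟩, h4⟩
      exact ⟨R, by omega, c, h1, P, h2, h3, h4⟩
  intro R B hR hB
  rw [h.v2] at hR
  have env := h.update (show 10 ≤ 15 by norm_num) R
  set ρ₁ := Function.update ρ 15 R with hρ₁
  have e : (∃ c, test R c) ↔ ∃ f : ℕ → ℕ, (∀ i < D, f i < L) ∧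
      ∃ c : Site D L, (∀ i : Fin D, setVars 40 D f ρ₁ (40 + i) = (c i).val) ∧ test R c := by
    rw [exists_corner (p := fun ρ' => ∃ c : Site D L, (∀ i : Fin D, ρ' (40 + i) = (c i).val) ∧ test R c)]
    constructor
    · rintro ⟨c, hc⟩
      exact ⟨c, c, withSite_coord _ _ _, hc⟩
    · rintro ⟨c, c', -, hc⟩
      exact ⟨c', hc⟩
  rw [e]
  refine nest_flag (by norm_num) D (fun B => B 2 = A 2 ∧ B 4 = A 4) (fun B => B 9 0 0 ≠ 0)
    (fun ρ' => ∃ c : Site D L, (∀ i : Fin D, ρ' (40 + i) = (c i).val) ∧ test R c) env.v1 hB ?_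
  rintro f B hf ⟨hB2, hB4⟩
  obtain ⟨c, hc⟩ := exists_eq_withSite 40 ρ₁ f hf
  rw [hc]
  set ρ₂ := withSite 40 c ρ₁ with hρ₂
  have hcoord : ∀ i : Fin D, ρ₂ (40 + i) = (c i).val := withSite_coord _ _ _
  have env₂ : Env L ℓ Q.n Q.M ρ₂ := env.withSite (by norm_num) c
  have h15 : ρ₂ 15 = R := by
    rw [hρ₂, withSite_of_lt _ _ (by norm_num), hρ₁, Function.update_self]
  have h13 : ρ₂ 13 = ρ 13 := by
    rw [hρ₂, withSite_of_lt _ _ (by norm_num), hρ₁, Function.update_of_ne (by norm_num)]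
  have hC' : Holds Q C B := fun a => by rw [hB2]; exact hC a
  have e' : (∃ c' : Site D L, (∀ i : Fin D, ρ₂ (40 + i) = (c' i).val) ∧ test R c') ↔ test R c := by
    constructor
    · rintro ⟨c', h1, h2⟩
      have : c' = c := funext fun i => ZMod.val_injective L ((h1 i).symm.trans (hcoord i))
      rwa [← this]
    · exact fun h => ⟨c, hcoord, h⟩
  rw [e', Cmd.exec]
  have hmin := minCube_ne Q ℓ S env₂ hC' (by omega) hcoord
  rw [h15] at hmin
  split_ifs with hm
  · set B₁ := (assign1 5 18 5 (.allowed D)).exec (Q.memory ℓ S) ρ₂ B with hB₁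
    have k1 : ∀ id, id ≠ 5 → B₁ id = B id := fun id hid => keeps_assign1 hid _ ρ₂ B
    have hC₁ : Holds Q C B₁ := fun a => by rw [k1 2 (by norm_num)]; exact hC' a
    rw [Cmd.exec]
    refine ⟨⟨?_, ?_⟩, ?_⟩
    · rw [keeps_solve (by norm_num) _ ρ₂ B₁, k1 2 (by norm_num), hB2]
    · rw [keeps_solve (by norm_num) _ ρ₂ B₁, k1 4 (by norm_num), hB4]
    · change (solve D).exec _ ρ₂ B₁ 9 0 0 ≠ 0 ↔ _
      rw [flag_solve Q ℓ S env₂, k1 9 (by norm_num), k1 4 (by norm_num), hB4, h13]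
      refine or_congr_right ?_
      simp only [test]
      rw [and_iff_right (hmin.1 hm)]
      refine exists_congr fun P => and_congr (syn_eq_iff Q hC₁) (and_congr_left fun _ =>
        suppIn_iff Q fun i hi j hj => ?_)
      rw [hB₁, get_assign1 (v := fun i => (Expr.allowed D).eval (Q.memory ℓ S)
        (Function.update ρ₂ 18 i) B) (by norm_num) env₂.v0 ?_ (by rw [env₂.v5]; exact hi)]
      · have := allowed_ne Q ℓ S (A := B) (env₂.update (show 10 ≤ 18 by norm_num) i) (c := c) (by
          rw [Function.update_of_ne (by norm_num)]; omega) (fun i' => by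
          rw [Function.update_of_ne (by omega), hcoord]) j (by rw [Function.update_self]; exact hj)
        rwa [Function.update_of_ne (by norm_num), h15] at this
      · exact fun i B' _ _ _ => Expr.eval_congr fun id hid => (Expr.not_reads_allowed hid).elim
  · refine ⟨⟨hB2, hB4⟩, ?_⟩
    rw [Cmd.exec]
    simp only [test]
    have := hmin.not.1 hm
    tauto

theorem exec_extract_search (hℓ : ℓ + 1 < L) {ρ : ℕ → ℕ} {A : Arrays} (h : Env L ℓ Q.n Q.M ρ)
    {C : Q.Cluster} (hC : Holds Q C A) : ∀ i < Q.n + Q.n,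
    bit ((extract (search D)).exec (Q.memory ℓ S) ρ A 4 i 0) =
      pbit (lexPauli (Q.TestSolution ℓ C)) i := by
  refine exec_extract (Q.TestSolution ℓ C) (Holds Q C) h hC (fun A B hAB hA a => ?_)
    (keeps_search (by norm_num)) fun b B hb hB => ⟨fun a => ?_, ?_⟩
  · rw [hAB 2 (by norm_num) (by norm_num)]; exact hA a
  · rw [keeps_search (by norm_num) _ _ B]; exact hB a
  · rw [flag_search Q ℓ S hℓ (h.update (by norm_num) b) hB, Function.update_self]

/-- Computes some Pauli operator with the syndrome in the array `2`. -/
def consistent (D : ℕ) : Cmd := extract (.seq (assign1 5 18 5 (.cst 1)) (solve D))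

omit [NeZero L] in
theorem exec_consistent {ρ : ℕ → ℕ} {A : Arrays} (h : Env L ℓ Q.n Q.M ρ)
    {C : Q.Cluster} (hC : Holds Q C A) : ∀ i < Q.n + Q.n,
    bit ((consistent D).exec (Q.memory ℓ S) ρ A 4 i 0) =
      pbit (lexPauli fun P => Q.syn P = C) i := by
  have kp : ∀ id, id ≠ 5 ∧ id ≠ 6 ∧ id ≠ 7 ∧ id ≠ 8 ∧ id ≠ 9 →
      (Cmd.seq (assign1 5 18 5 (.cst 1)) (solve D)).Keeps id := fun id h =>
    .seq (keeps_assign1 h.1) (keeps_solve h.2)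
  refine exec_extract (fun P => Q.syn P = C) (Holds Q C) h hC (fun A B hAB hA a => ?_)
    (kp 4 (by norm_num)) fun b B hb hB => ⟨fun a => ?_, ?_⟩
  · rw [hAB 2 (by norm_num) (by norm_num)]; exact hA a
  · rw [kp 2 (by norm_num) _ _ B]; exact hB a
  · have env := h.update (show 10 ≤ 13 by norm_num) b
    set ρ' := Function.update ρ 13 b with hρ'
    set B₁ := (assign1 5 18 5 (.cst 1)).exec (Q.memory ℓ S) ρ' B with hB₁
    have k1 : ∀ id, id ≠ 5 → B₁ id = B id := fun id hid => keeps_assign1 hid _ ρ' B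
    have hC₁ : Holds Q C B₁ := fun a => by rw [k1 2 (by norm_num)]; exact hB a
    have h5 : ∀ i < Q.n + Q.n, B₁ 5 i 0 = 1 := fun i hi =>
      get_assign1 (v := fun _ => 1) (by norm_num) env.v0 (fun _ _ _ _ _ => rfl)
        (by rw [env.v5]; exact hi)
    change (solve D).exec _ ρ' B₁ 9 0 0 ≠ 0 ↔ _
    rw [flag_solve Q ℓ S env, k1 9 (by norm_num), k1 4 (by norm_num), hρ',
      Function.update_self]
    refine or_congr_right (exists_congr fun P => and_congr (syn_eq_iff Q hC₁) ⟨fun h => h.2, fun h =>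
      ⟨fun i hi h0 => ?_, h⟩⟩)
    rw [h5 i hi] at h0
    exact absurd h0 one_ne_zero

end Search

end MemoryTime

namespace MemoryTime

/-! ## The renormalization group decoder as a command -/

section Assign

variable {I : ℕ → ℕ} {ρ : ℕ → ℕ} {A : Arrays} {id x X y Y : ℕ} {e : Expr}

theorem eval_assign1 (hx : x ≠ 0) (h0 : ρ 0 = 0) (he : ¬ e.Reads id) {i : ℕ} (hi : i < ρ X) :
    (assign1 id x X e).exec I ρ A id i 0 = e.eval I (Function.update ρ x i) A :=
  get_assign1 (v := fun i => e.eval I (Function.update ρ x i) A) hx h0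
    (fun _ _ _ hB _ => Expr.eval_congr fun _ hid => hB _ (by rintro rfl; exact he hid)) hi

theorem eval_assign2 (hxy : x ≠ y) (hY : Y ≠ x) (he : ¬ e.Reads id) {i j : ℕ} (hi : i < ρ X)
    (hj : j < ρ Y) : (assign2 id x X y Y e).exec I ρ A id i j =
      e.eval I (Function.update (Function.update ρ x i) y j) A :=
  get_assign2 (v := fun i j => e.eval I (Function.update (Function.update ρ x i) y j) A) hxy hY
    (fun _ _ _ _ _ hB _ => Expr.eval_congr fun _ hid => hB _ (by rintro rfl; exact he hid)) hi hj

end Assign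

namespace Code

variable {D L : ℕ} (Q : Code D L)

open Classical in
/-- A sum over components, indexed by the first elements of the components. -/
theorem EC_eq_sum (T : Q.Cluster → Pauli Q.n) (p : ℕ) (S : Q.Cluster) :
    Q.EC T p S = ∑ v : Fin Q.M,
      if v ∈ S ∧ ∀ u, u < v → ¬ (u ∈ S ∧ Q.Connected (2 ^ p) S u v) then
        T (S.filter fun b => Q.Connected (2 ^ p) S v b) else 0 := by
  rw [← Finset.sum_filter, EC]
  set rep := Finset.univ.filter fun v : Fin Q.M =>
    v ∈ S ∧ ∀ u, u < v → ¬ (u ∈ S ∧ Q.Connected (2 ^ p) S u v) with hrep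
  have e : Q.components (2 ^ p) S = rep.image fun v => S.filter fun b => Q.Connected (2 ^ p) S v b := by
    ext C
    simp only [components, Finset.mem_image, hrep, Finset.mem_filter, Finset.mem_univ, true_and]
    constructor
    · rintro ⟨a, ha, rfl⟩
      have hne : (S.filter fun b => Q.Connected (2 ^ p) S a b).Nonempty :=
        ⟨a, Finset.mem_filter.2 ⟨ha, .refl⟩⟩
      have hm := Finset.mem_filter.1 (Finset.min'_mem _ hne)
      -- The component is represented by its smallest generator.
      set m := (S.filter fun b => Q.Connected (2 ^ p) S a b).min' hne with hmdef
      refine ⟨m, ⟨hm.1, fun u hu hu' => ?_⟩, ?_⟩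
      · have := Finset.min'_le _ u (Finset.mem_filter.2 ⟨hu'.1, hm.2.trans hu'.2.symm⟩)
        exact absurd hu (not_lt.2 this)
      · ext b
        simp only [Finset.mem_filter]
        exact and_congr_right fun _ => ⟨fun h => hm.2.trans h, fun h => hm.2.symm.trans h⟩
    · rintro ⟨a, ⟨ha, -⟩, rfl⟩
      exact ⟨a, ha, rfl⟩
  rw [e, Finset.sum_image]
  intro v hv w hw hvw
  simp only [hrep, Finset.coe_filter, Finset.mem_univ, true_and, Set.mem_ofPred_eq] at hv hw
  have h1 : v ∈ S.filter fun b => Q.Connected (2 ^ p) S w b := by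
    rw [← show _ = S.filter fun b => Q.Connected (2 ^ p) S w b from hvw]
    exact Finset.mem_filter.2 ⟨hv.1, .refl⟩
  have h2 := (Finset.mem_filter.1 h1).2
  rcases lt_trichotomy v w with h | h | h
  · exact absurd ⟨hv.1, h2.symm⟩ (hw.2 v h)
  · exact h
  · exact absurd ⟨hw.1, h2⟩ (hv.2 w h)

/-- The output of the RG decoder: the accumulated correction if no defect is left, and the first
operator with the measured syndrome otherwise. -/
def rgDecoder (ℓ : ℕ) (S : Q.Cluster) : Pauli Q.n :=
  let s := Q.rgRun (fun C => lexPauli (Q.TestSolution ℓ C)) S (Nat.clog 2 ℓ)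
  if s.1 = ∅ then s.2 else lexPauli fun P => Q.syn P = S

theorem isRGDecoder_rgDecoder (ℓ : ℕ) : Q.IsRGDecoder ℓ (Q.rgDecoder ℓ) := by
  refine ⟨fun C => lexPauli (Q.TestSolution ℓ C), fun S => ⟨fun h => lexPauli_good h, fun h =>
    lexPauli_eq_zero h⟩, fun S hS => if_pos hS, fun P => ?_⟩
  rw [rgDecoder]
  split_ifs with h
  · rw [syn_rgRun, h]
    simp
  · exact lexPauli_good (good := fun R => Q.syn R = Q.syn P) ⟨P, rfl⟩

end Code

/-- Two defects are close at the current scale. -/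
def Expr.adjacent (D : ℕ) : Expr :=
  (Expr.get 0 22 0).and ((Expr.get 0 23 0).and
    (Expr.any D fun i =>
      (((diff (cubeCoord D 22 i) (cubeCoord D 23 i)).le (.get 11 0 0)).or
      (((var 1).sub (diff (cubeCoord D 22 i) (cubeCoord D 23 i))).le (.get 11 0 0))).not).not)

theorem Expr.reads_adjacent {D id : ℕ} (h : (adjacent D).Reads id) : id = 0 ∨ id = 11 := by
  have hm : ∀ x, ¬ (mulConst D (var x)).Reads id := fun x h => reads_mulConst h
  have hd : ∀ i x, ¬ (cubeCoord D x i).Reads id := fun i x h => by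
    simp [cubeCoord, Reads, hm] at h
  simp only [adjacent, and, not, Reads, or_false] at h
  rcases h with h | h | h
  · exact Or.inl h
  · exact Or.inl h
  · obtain ⟨i, h⟩ := reads_any h
    simp [Reads, not, or, le, diff, hd] at h
    exact Or.inr h

/-- Computes the connectivity of the defects in the array `10`. -/
def connect (D : ℕ) : Cmd :=
  .seq (assign2 10 22 4 23 4 (((Expr.var 22).eq (.var 23)).or (.adjacent D)))
    (.loop 24 4 (.seq
      (assign2 12 22 4 23 4 ((Expr.get 10 22 23).or ((Expr.get 10 22 24).and (.get 10 24 23))))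
      (assign2 10 22 4 23 4 (.get 12 22 23))))

theorem keeps_connect {D id : ℕ} (h : id ≠ 10 ∧ id ≠ 12) : (connect D).Keeps id :=
  .seq (keeps_assign2 h.1) (.loop (.seq (keeps_assign2 h.2) (keeps_assign2 h.1)))

/-- Adds the corrections of all components to the array `3`. -/
def correct (D : ℕ) : Cmd :=
  .loop 25 4 (.ite ((Expr.get 0 25 0).and
      (Expr.bsum 26 25 ((Expr.get 0 26 0).and (.get 10 26 25))).not)
    (.seq (assign1 2 27 4 ((Expr.get 0 27 0).and (.get 10 25 27)))
      (.seq (extract (search D)) (assign1 3 28 5 ((Expr.get 3 28 0).xor (.get 4 28 0))))) .skip)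

/-- Updates the syndrome in the array `0`. -/
def update (D : ℕ) : Cmd :=
  assign1 0 29 4 ((Expr.synd D 29).xor (.bpar 30 5 ((Expr.gen D 29 (.swap 30)).and (.get 3 30 0))))

/-- One level of the decoder. -/
def level (D : ℕ) : Cmd := .seq (connect D) (.seq (correct D) (update D))

/-- The decoder. -/
def decoder (D : ℕ) : Cmd :=
  .seq (assign1 0 27 4 (.synd D 27)) (.seq (.store 11 0 0 (.cst 1)) (.seq
    (.loop 31 9 (.seq (.ite ((Expr.var 9).sub (.get 11 0 0)) (level D) .skip)
      (.store 11 0 0 ((Expr.get 11 0 0).add (.get 11 0 0)))))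
    (.seq (.ite (.bsum 27 4 (.get 0 27 0)) (.seq (assign1 2 27 4 (.synd D 27))
        (.seq (consistent D) (assign1 3 28 5 (.get 4 28 0)))) .skip)
      (assign1 3 28 5 (Expr.get 3 28 0).not.not))))

section Decoder

variable {D L : ℕ} (Q : Code D L) (ℓ : ℕ) (S₀ : Q.Cluster)

/-- The array `0` represents the cluster `S`. -/
def Defects (S : Q.Cluster) (A : Arrays) : Prop := ∀ a : Fin Q.M, A 0 a 0 ≠ 0 ↔ a ∈ S

/-- The array `3` represents the Pauli operator `P`. -/
def Accumulated (P : Pauli Q.n) (A : Arrays) : Prop := ∀ i < Q.n + Q.n, bit (A 3 i 0) = pbit P i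

theorem adjacent_ne [NeZero L] {ρ : ℕ → ℕ} {A : Arrays} (h : Env L ℓ Q.n Q.M ρ) {S : Q.Cluster}
    (hS : Defects Q S A) (a b : Fin Q.M) (ha : ρ 22 = a) (hb : ρ 23 = b) :
    (Expr.adjacent D).eval (Q.memory ℓ S₀) ρ A ≠ 0 ↔
      a ∈ S ∧ b ∈ S ∧ dist (Q.cube a) (Q.cube b) ≤ A 11 0 0 := by
  rw [Expr.adjacent, Expr.and_ne, Expr.and_ne, Expr.not_ne, Expr.any_ne, dist_le_iff_val]
  refine and_congr ?_ (and_congr ?_ ?_)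
  · simp only [Expr.eval, ha, h.v0]
    exact hS a
  · simp only [Expr.eval, hb, h.v0]
    exact hS b
  · have e : ∀ i : Fin D, (((Expr.diff (Expr.cubeCoord D 22 i) (Expr.cubeCoord D 23 i)).le
        (.get 11 0 0)).or
      (((Expr.var 1).sub (Expr.diff (Expr.cubeCoord D 22 i) (Expr.cubeCoord D 23 i))).le
        (.get 11 0 0))).not.eval (Q.memory ℓ S₀) ρ A ≠ 0 ↔
        ¬ ((Q.cube a i - Q.cube b i).val ≤ A 11 0 0 ∨ L - (Q.cube a i - Q.cube b i).val ≤ A 11 0 0) := by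
      intro i
      have hd := eval_diff (A := A) h.v1 (eval_cubeCoord Q ℓ S₀ h a ha i)
        (eval_cubeCoord Q ℓ S₀ h b hb i)
      rw [Expr.not_ne, Expr.or_ne, Expr.le_ne, Expr.le_ne]
      simp only [Expr.eval, h.v1, h.v0, hd]
    constructor
    · intro hh i
      by_contra hn
      exact hh ⟨i, i.2, (e i).2 hn⟩
    · rintro hh ⟨i, hi, h'⟩
      exact (e ⟨i, hi⟩).1 h' (hh _)

/-- Warshall's algorithm: after `m` rounds the relation is closed under passing through any of the
first `m` generators. The array `12` buffers a round. Equal pairs are included from the start, since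
connectedness is a reflexive closure. -/
theorem connect_ne [NeZero L] {ρ : ℕ → ℕ} {A : Arrays} (h : Env L ℓ Q.n Q.M ρ) {S : Q.Cluster}
    (hS : Defects Q S A) (a b : Fin Q.M) :
    (connect D).exec (Q.memory ℓ S₀) ρ A 10 a b ≠ 0 ↔ Q.Connected (A 11 0 0) S a b := by
  set I := Q.memory ℓ S₀
  set A₁ := (assign2 10 22 4 23 4 (((Expr.var 22).eq (.var 23)).or (.adjacent D))).exec I ρ A with hA₁
  have h1 : ∀ a b : Fin Q.M, A₁ 10 a b ≠ 0 ↔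
      a = b ∨ (a ∈ S ∧ b ∈ S ∧ dist (Q.cube a) (Q.cube b) ≤ A 11 0 0) := by
    intro a b
    have env := (h.update (show 10 ≤ 22 by norm_num) a).update (show 10 ≤ 23 by norm_num) b
    rw [hA₁, eval_assign2 (by norm_num) (by norm_num) ?_ (by rw [h.v4]; exact a.2)
      (by rw [h.v4]; exact b.2), Expr.or_ne, Expr.eq_ne, adjacent_ne Q ℓ S₀ env hS a b]
    · simp [Expr.eval, Fin.ext_iff]
    · simp
    · simp
    · intro hid
      simp only [Expr.Reads, Expr.or, Expr.eq, Expr.not, or_false, false_or] at hid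
      have := Expr.reads_adjacent hid
      omega
  have key := iter_induction (f := fun i A => (Cmd.seq
      (assign2 12 22 4 23 4 ((Expr.get 10 22 23).or ((Expr.get 10 22 24).and (.get 10 24 23))))
      (assign2 10 22 4 23 4 (.get 12 22 23))).exec I (Function.update ρ 24 i) A) (a := A₁) (n := ρ 4)
    (fun m B => (∀ a b : Fin Q.M, B 10 a b ≠ 0 → Q.Connected (A 11 0 0) S a b) ∧
      (∀ a b : Fin Q.M, A₁ 10 a b ≠ 0 → B 10 a b ≠ 0) ∧
      ∀ k a b : Fin Q.M, (k : ℕ) < m → B 10 a k ≠ 0 → B 10 k b ≠ 0 → B 10 a b ≠ 0)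
    ⟨fun a b hab => ?_, fun _ _ h => h, fun _ _ _ hk => absurd hk (Nat.not_lt_zero _)⟩ ?_
  · obtain ⟨k1, k2, k3⟩ := key
    refine ⟨k1 a b, fun hab => ?_⟩
    induction hab with
    | refl => exact k2 _ _ ((h1 _ _).2 (Or.inl rfl))
    | tail _ hbc ih =>
      exact k3 _ _ _ (by rw [h.v4]; exact Fin.is_lt _) ih (k2 _ _ ((h1 _ _).2 (Or.inr hbc)))
  · rcases (h1 a b).1 hab with rfl | hab
    exacts [.refl, .single hab]
  · rintro m B hm ⟨k1, k2, k3⟩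
    rw [h.v4] at hm
    have env := h.update (show 10 ≤ 24 by norm_num) m
    set ρ' := Function.update ρ 24 m with hρ'
    set B₁ := (assign2 12 22 4 23 4 ((Expr.get 10 22 23).or
      ((Expr.get 10 22 24).and (.get 10 24 23)))).exec I ρ' B with hB₁
    have e : ∀ a b : Fin Q.M, (Cmd.seq
      (assign2 12 22 4 23 4 ((Expr.get 10 22 23).or ((Expr.get 10 22 24).and (.get 10 24 23))))
      (assign2 10 22 4 23 4 (.get 12 22 23))).exec I ρ' B 10 a b ≠ 0 ↔
        B 10 a b ≠ 0 ∨ (B 10 a m ≠ 0 ∧ B 10 m b ≠ 0) := by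
      intro a b
      change (assign2 10 22 4 23 4 (.get 12 22 23)).exec I ρ' B₁ 10 a b ≠ 0 ↔ _
      rw [eval_assign2 (by norm_num) (by norm_num) (by simp [Expr.Reads]) (by rw [env.v4]; exact a.2)
        (by rw [env.v4]; exact b.2)]
      have : (Expr.get 12 22 23).eval I (Function.update (Function.update ρ' 22 a) 23 b) B₁ =
          B₁ 12 a b := by simp [Expr.eval]
      rw [this, hB₁, eval_assign2 (by norm_num) (by norm_num) (by simp [Expr.Reads, Expr.or, Expr.and])
        (by rw [env.v4]; exact a.2) (by rw [env.v4]; exact b.2), Expr.or_ne, Expr.and_ne]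
      simp [Expr.eval, hρ']
    refine ⟨fun a b hab => ?_, fun a b hab => (e a b).2 (Or.inl (k2 a b hab)), fun k a b hk hak hkb => ?_⟩
    · rcases (e a b).1 hab with hab | ⟨ham, hmb⟩
      · exact k1 a b hab
      · exact (k1 a ⟨m, hm⟩ ham).trans (k1 ⟨m, hm⟩ b hmb)
    · rw [e] at hak hkb ⊢
      rcases Nat.lt_succ_iff_lt_or_eq.1 hk with hk | hk
      · rcases hak with hak | ⟨ham, hmk⟩ <;> rcases hkb with hkb | ⟨hkm, hmb⟩
        · exact Or.inl (k3 k a b hk hak hkb)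
        · exact Or.inr ⟨k3 k a ⟨m, hm⟩ hk hak hkm, hmb⟩
        · exact Or.inr ⟨ham, k3 k ⟨m, hm⟩ b hk hmk hkb⟩
        · exact Or.inr ⟨ham, hmb⟩
      · rw [hk] at hak hkb
        exact Or.inr ⟨hak.elim _root_.id fun h => h.1, hkb.elim _root_.id fun h => h.2⟩

theorem accumulated_add {ρ : ℕ → ℕ} {A : Arrays} {I : ℕ → ℕ} (h : Env L ℓ Q.n Q.M ρ) {P P' : Pauli Q.n}
    (hP : Accumulated Q P A) (hP' : ∀ i < Q.n + Q.n, bit (A 4 i 0) = pbit P' i) :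
    Accumulated Q (P + P')
      ((assign1 3 28 5 ((Expr.get 3 28 0).xor (.get 4 28 0))).exec I ρ A) := by
  intro i hi
  rw [get_assign1 (v := fun i => ((Expr.get 3 28 0).xor (.get 4 28 0)).eval I
    (Function.update ρ 28 i) A) (by norm_num) h.v0 ?_ (by rw [h.v5]; exact hi), Expr.bit_xor]
  · simp only [Expr.eval, Function.update_self, Function.update_of_ne (show (0 : ℕ) ≠ 28 by norm_num),
      h.v0]
    rw [hP i hi, hP' i hi, pbit_add]
  · intro i B _ hB hB3
    by_cases a : A 3 i 0 = 0 <;> by_cases b : A 4 i 0 = 0 <;>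
      simp [Expr.eval, Expr.xor, Expr.not, h.v0, hB 4 (by norm_num), hB3, a, b]

-- The round of `v` adds the correction of the component whose first element is `v`, if there is
-- one; the total is the sum in `EC_eq_sum`.
open Classical in
theorem exec_correct [NeZero L] (hℓ : ℓ + 1 < L) {ρ : ℕ → ℕ} {A : Arrays} (h : Env L ℓ Q.n Q.M ρ)
    {S : Q.Cluster} (hS : Defects Q S A) {p : ℕ} {P : Pauli Q.n} (hP : Accumulated Q P A)
    (hA : ∀ a b : Fin Q.M, A 10 a b ≠ 0 ↔ Q.Connected (2 ^ p) S a b) :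
    Accumulated Q (P + Q.EC (fun C => lexPauli (Q.TestSolution ℓ C)) p S)
      ((correct D).exec (Q.memory ℓ S₀) ρ A) := by
  set I := Q.memory ℓ S₀
  set T : Q.Cluster → Pauli Q.n := fun C => lexPauli (Q.TestSolution ℓ C) with hT
  let e : ℕ → Pauli Q.n := fun v => if hv : v < Q.M then
    (if (⟨v, hv⟩ : Fin Q.M) ∈ S ∧ ∀ u, u < (⟨v, hv⟩ : Fin Q.M) →
      ¬ (u ∈ S ∧ Q.Connected (2 ^ p) S u ⟨v, hv⟩) then
        T (S.filter fun b => Q.Connected (2 ^ p) S ⟨v, hv⟩ b) else 0) else 0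
  have hsum : Q.EC T p S = ∑ v ∈ Finset.range Q.M, e v := by
    rw [Q.EC_eq_sum, Finset.sum_range]
    refine Finset.sum_congr rfl fun v _ => ?_
    simp only [e, dif_pos v.2, Fin.eta]
  rw [hsum, ← h.v4]
  refine (iter_induction (fun m B => B 0 = A 0 ∧ B 10 = A 10 ∧
    Accumulated Q (P + ∑ v ∈ Finset.range m, e v) B) ⟨rfl, rfl, by simpa using hP⟩ ?_).2.2
  rintro m B hm ⟨hB0, hB10, hB⟩
  rw [h.v4] at hm
  have env := h.update (show 10 ≤ 25 by norm_num) m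
  set ρ' := Function.update ρ 25 m with hρ'
  have h25 : ρ' 25 = m := Function.update_self _ _ _
  set v : Fin Q.M := ⟨m, hm⟩ with hv
  have htest : ((Expr.get 0 25 0).and (Expr.bsum 26 25 ((Expr.get 0 26 0).and (.get 10 26 25))).not).eval
      I ρ' B ≠ 0 ↔ v ∈ S ∧ ∀ u, u < v → ¬ (u ∈ S ∧ Q.Connected (2 ^ p) S u v) := by
    rw [Expr.and_ne, Expr.not_ne, Expr.bsum_ne, h25]
    refine and_congr ?_ ?_
    · simp only [Expr.eval, h25, env.v0, hB0]
      exact hS v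
    · have e' : ∀ u : Fin Q.M, ((Expr.get 0 26 0).and (.get 10 26 25)).eval I
          (Function.update ρ' 26 u) B ≠ 0 ↔ u ∈ S ∧ Q.Connected (2 ^ p) S u v := by
        intro u
        rw [Expr.and_ne, ← hS u, ← hA u v]
        simp [Expr.eval, env.v0, h25, hB0, hB10, hv]
      constructor
      · intro hh u hu hu'
        exact hh ⟨u, hu, (e' u).2 hu'⟩
      · rintro hh ⟨u, hu, hu'⟩
        exact hh ⟨u, hu.trans hm⟩ hu ((e' _).1 hu')
  rw [Finset.sum_range_succ, ← add_assoc, Cmd.exec]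
  have hem : e m = if v ∈ S ∧ ∀ u, u < v → ¬ (u ∈ S ∧ Q.Connected (2 ^ p) S u v) then
        T (S.filter fun b => Q.Connected (2 ^ p) S v b) else 0 := by simp only [e, dif_pos hm, hv]
  by_cases ht : v ∈ S ∧ ∀ u, u < v → ¬ (u ∈ S ∧ Q.Connected (2 ^ p) S u v)
  · rw [if_pos (htest.2 ht), hem, if_pos ht]
    set B₁ := (assign1 2 27 4 ((Expr.get 0 27 0).and (.get 10 25 27))).exec I ρ' B with hB₁
    set B₂ := (extract (search D)).exec I ρ' B₁ with hB₂
    have k1 : ∀ id, id ≠ 2 → B₁ id = B id := fun id hid => keeps_assign1 hid _ ρ' B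
    have k2 : ∀ id, id ≠ 4 ∧ id ≠ 5 ∧ id ≠ 6 ∧ id ≠ 7 ∧ id ≠ 8 ∧ id ≠ 9 → B₂ id = B₁ id :=
      fun id hid => keeps_extract (keeps_search hid.2) hid.1 hid.2.2.2.2.2 _ ρ' B₁
    have hC : Holds Q (S.filter fun b => Q.Connected (2 ^ p) S v b) B₁ := by
      intro a
      rw [hB₁, eval_assign1 (by norm_num) env.v0 (by simp [Expr.Reads, Expr.and])
        (by rw [env.v4]; exact a.2), Expr.and_ne, Finset.mem_filter, ← hS a, ← hA v a]
      simp [Expr.eval, env.v0, h25, hB0, hB10, hv]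
    have h2 := exec_extract_search Q ℓ S₀ hℓ env hC
    change _ ∧ _ ∧ Accumulated Q _ ((assign1 3 28 5 ((Expr.get 3 28 0).xor (.get 4 28 0))).exec I ρ' B₂)
    refine ⟨?_, ?_, accumulated_add Q ℓ env (fun i hi => ?_) h2⟩
    · exact (keeps_assign1 (by norm_num) _ ρ' B₂).trans
        ((k2 0 (by norm_num)).trans ((k1 0 (by norm_num)).trans hB0))
    · exact (keeps_assign1 (by norm_num) _ ρ' B₂).trans
        ((k2 10 (by norm_num)).trans ((k1 10 (by norm_num)).trans hB10))
    · rw [k2 3 (by norm_num), k1 3 (by norm_num)]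
      exact hB i hi
  · rw [if_neg (htest.not.2 ht), hem, if_neg ht, add_zero]
    exact ⟨hB0, hB10, hB⟩

theorem keeps_correct {D id : ℕ} (h : id ≠ 2 ∧ id ≠ 3 ∧ id ≠ 4 ∧ id ≠ 5 ∧ id ≠ 6 ∧ id ≠ 7 ∧ id ≠ 8 ∧
    id ≠ 9) : (correct D).Keeps id :=
  .loop (.ite (.seq (keeps_assign1 h.1) (.seq (keeps_extract (keeps_search h.2.2.2) h.2.2.1
    h.2.2.2.2.2.2.2) (keeps_assign1 h.2.1))) .skip)

/-- The defects are recomputed from the measured syndrome and the accumulated correction. In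
`exec_level` the relation `syn_rgRun` identifies the result with the recursively defined remaining
syndrome. -/
theorem exec_update {ρ : ℕ → ℕ} {A : Arrays} (h : Env L ℓ Q.n Q.M ρ) {P : Pauli Q.n}
    (hP : Accumulated Q P A) :
    Defects Q (symmDiff S₀ (Q.syn P)) ((update D).exec (Q.memory ℓ S₀) ρ A) := by
  intro a
  have env := h.update (show 10 ≤ 29 by norm_num) (a : ℕ)
  set ρ' := Function.update ρ 29 a with hρ'
  have h29 : ρ' 29 = a := Function.update_self _ _ _
  rw [update, eval_assign1 (by norm_num) h.v0 ?_ (by rw [h.v4]; exact a.2)]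
  · rw [← bit_ne_zero, Expr.bit_xor, Expr.bit_bpar, Q.eval_synd ℓ S₀ env (by rw [h29]; exact a.2)]
    have e : ∑ i ∈ Finset.range (ρ' 5), bit (((Expr.gen D 29 (.swap 30)).and (.get 3 30 0)).eval
        (Q.memory ℓ S₀) (Function.update ρ' 30 i) A) = symp (Q.gen a) P := by
      rw [symp_eq_sum, env.v5]
      refine Finset.sum_congr rfl fun i hi => ?_
      rw [Finset.mem_range] at hi
      have env' := env.update (show 10 ≤ 30 by norm_num) i
      have h30 : Function.update ρ' 30 i 30 = i := Function.update_self _ _ _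
      have h29' : Function.update ρ' 30 i 29 = a := by rw [Function.update_of_ne (by norm_num), h29]
      rw [Expr.bit_and, Q.bit_gen ℓ S₀ env' (by rw [h29']; exact a.2)]
      · simp only [Expr.eval_swap, h30, h29', Fin.eta]
        congr 1
        simp only [Expr.eval, h30, env'.v0]
        exact hP i hi
      · rw [Expr.eval_swap, h30]
        split_ifs <;> omega
    rw [e, Finset.mem_symmDiff, Code.mem_syn]
    simp only [h29, Fin.eta]
    by_cases hs : symp (Q.gen a) P = 0
    · by_cases ha : a ∈ S₀ <;> simp [ha, hs, bit]
    · rw [zmod_two_ne_zero_iff.1 hs]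
      by_cases ha : a ∈ S₀ <;> simp [ha, bit]
      decide
  · intro hid
    have hm : ∀ x, ¬ (Expr.mulConst D (.var x)).Reads 0 := fun x h => Expr.reads_mulConst h
    simp [Expr.Reads, Expr.xor, Expr.not, Expr.synd, Expr.gen, Expr.swap, Expr.and, hm] at hid

theorem exec_level [NeZero L] (hℓ : ℓ + 1 < L) {ρ : ℕ → ℕ} {A : Arrays} (h : Env L ℓ Q.n Q.M ρ)
    {p : ℕ} (hscale : A 11 0 0 = 2 ^ p) {s : Q.Cluster × Pauli Q.n} (hs : Q.syn s.2 = symmDiff S₀ s.1)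
    (hS : Defects Q s.1 A) (hP : Accumulated Q s.2 A) :
    let E := Q.EC (fun C => lexPauli (Q.TestSolution ℓ C)) p s.1
    let B := (level D).exec (Q.memory ℓ S₀) ρ A
    Defects Q (symmDiff s.1 (Q.syn E)) B ∧ Accumulated Q (s.2 + E) B ∧ B 11 = A 11 := by
  intro E B
  set A₁ := (connect D).exec (Q.memory ℓ S₀) ρ A with hA₁
  set A₂ := (correct D).exec (Q.memory ℓ S₀) ρ A₁ with hA₂
  have k1 : ∀ id, id ≠ 10 ∧ id ≠ 12 → A₁ id = A id := fun id hid => keeps_connect hid _ ρ A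
  have hacc : Accumulated Q (s.2 + E) A₂ := by
    refine exec_correct Q ℓ S₀ hℓ h (fun a => ?_) (fun i hi => ?_) fun a b => ?_
    · rw [k1 0 (by norm_num)]; exact hS a
    · rw [k1 3 (by norm_num)]; exact hP i hi
    · rw [← hscale]; exact connect_ne Q ℓ S₀ h hS a b
  refine ⟨?_, fun i hi => ?_, ?_⟩
  · have := exec_update Q ℓ S₀ h hacc
    rwa [Code.syn_add, hs, symmDiff_assoc, symmDiff_symmDiff_cancel_left] at this
  · have : B 3 = A₂ 3 := keeps_assign1 (by norm_num) _ ρ A₂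
    rw [this]; exact hacc i hi
  · have h3 : B 11 = A₂ 11 := keeps_assign1 (by norm_num) _ ρ A₂
    exact h3.trans ((keeps_correct (by norm_num) _ ρ A₁).trans (k1 11 (by norm_num)))

/-- The loop makes `ℓ` rounds, which suffices because `Nat.clog 2 ℓ ≤ ℓ`. The test `2 ^ m < ℓ` turns
the superfluous rounds idle, hence the minimum in the invariant. The double negation at the end
turns truth values into the bits `0` and `1`. -/
theorem exec_decoder [NeZero L] (hℓ : ℓ + 1 < L) {ρ : ℕ → ℕ} (h : Env L ℓ Q.n Q.M ρ) :
    ∀ i < Q.n + Q.n, (decoder D).exec (Q.memory ℓ S₀) ρ 0 3 i 0 = (pbit (Q.rgDecoder ℓ S₀) i).val := by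
  set I := Q.memory ℓ S₀ with hI
  set T : Q.Cluster → Pauli Q.n := fun C => lexPauli (Q.TestSolution ℓ C) with hT
  have hm : ∀ id x, ¬ (Expr.mulConst D (.var x)).Reads id := fun id x h => Expr.reads_mulConst h
  have hsynd : ∀ id, ¬ (Expr.synd D 27).Reads id := fun id h => by
    simp [Expr.Reads, Expr.synd, hm] at h
  have esynd : ∀ B (a : Fin Q.M), (Expr.synd D 27).eval I (Function.update ρ 27 a) B ≠ 0 ↔ a ∈ S₀ := by
    intro B a
    have h27 : Function.update ρ 27 (a : ℕ) 27 = a := Function.update_self _ _ _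
    rw [Q.eval_synd ℓ S₀ (h.update (by norm_num) _) (by rw [h27]; exact a.2)]
    simp only [h27, Fin.eta]
    by_cases ha : a ∈ S₀ <;> simp [ha]
  set A₁ := (assign1 0 27 4 (.synd D 27)).exec I ρ 0 with hA₁
  set A₂ := (Cmd.store 11 0 0 (.cst 1)).exec I ρ A₁ with hA₂
  set A₃ := (Cmd.loop 31 9 (.seq (.ite ((Expr.var 9).sub (.get 11 0 0)) (level D) .skip)
      (.store 11 0 0 ((Expr.get 11 0 0).add (.get 11 0 0))))).exec I ρ A₂ with hA₃
  set A₄ := (Cmd.ite (.bsum 27 4 (.get 0 27 0)) (.seq (assign1 2 27 4 (.synd D 27))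
        (.seq (consistent D) (assign1 3 28 5 (.get 4 28 0)))) .skip).exec I ρ A₃ with hA₄
  have hloop := iter_induction (f := fun i A => (Cmd.seq (.ite ((Expr.var 9).sub (.get 11 0 0)) (level D)
      .skip) (.store 11 0 0 ((Expr.get 11 0 0).add (.get 11 0 0)))).exec I (Function.update ρ 31 i) A)
    (a := A₂) (n := ρ 9) (fun m B => B 11 0 0 = 2 ^ m ∧
      Defects Q (Q.rgRun T S₀ (min m (Nat.clog 2 ℓ))).1 B ∧
      Accumulated Q (Q.rgRun T S₀ (min m (Nat.clog 2 ℓ))).2 B) ?_ ?_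
  · obtain ⟨-, h2, h3⟩ : A₃ 11 0 0 = 2 ^ ρ 9 ∧
      Defects Q (Q.rgRun T S₀ (min (ρ 9) (Nat.clog 2 ℓ))).1 A₃ ∧
      Accumulated Q (Q.rgRun T S₀ (min (ρ 9) (Nat.clog 2 ℓ))).2 A₃ := hloop
    rw [h.v9, min_eq_right (Nat.clog_le_of_le_pow Nat.lt_two_pow_self.le)] at h2 h3
    have hlast : ∀ i < Q.n + Q.n, (decoder D).exec I ρ 0 3 i 0 = (bit (A₄ 3 i 0)).val := by
      intro i hi
      have : (decoder D).exec I ρ 0 3 i 0 = if A₄ 3 i 0 = 0 then 0 else 1 := by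
        change (assign1 3 28 5 (Expr.get 3 28 0).not.not).exec I ρ A₄ 3 i 0 = _
        refine get_assign1 (v := fun i => if A₄ 3 i 0 = 0 then 0 else 1) (by norm_num) h.v0 ?_
          (by rw [h.v5]; exact hi)
        intro i B _ _ hB
        by_cases a : A₄ 3 i 0 = 0 <;> simp [Expr.eval, Expr.not, h.v0, hB, a]
      rw [this, bit]
      split_ifs <;> rfl
    intro i hi
    rw [hlast i hi]
    congr 1
    have htest : (Expr.bsum 27 4 (.get 0 27 0)).eval I ρ A₃ ≠ 0 ↔
        (Q.rgRun T S₀ (Nat.clog 2 ℓ)).1 ≠ ∅ := by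
      rw [Expr.bsum_ne, h.v4, ← Finset.nonempty_iff_ne_empty]
      have e : ∀ a : Fin Q.M, (Expr.get 0 27 0).eval I (Function.update ρ 27 a) A₃ ≠ 0 ↔
          a ∈ (Q.rgRun T S₀ (Nat.clog 2 ℓ)).1 := by
        intro a
        rw [← h2 a]
        simp [Expr.eval, h.v0]
      exact ⟨fun ⟨a, ha, h'⟩ => ⟨⟨a, ha⟩, (e ⟨a, ha⟩).1 h'⟩, fun ⟨a, h'⟩ => ⟨a, a.2, (e a).2 h'⟩⟩
    rw [Code.rgDecoder]
    by_cases hemp : (Q.rgRun T S₀ (Nat.clog 2 ℓ)).1 = ∅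
    · have : A₄ = A₃ := by
        rw [hA₄, Cmd.exec, if_neg (htest.not.2 (not_not.2 hemp))]; rfl
      rw [this, if_pos hemp]
      exact h3 i hi
    · set B₁ := (assign1 2 27 4 (.synd D 27)).exec I ρ A₃ with hB₁
      set B₂ := (consistent D).exec I ρ B₁ with hB₂
      have e4 : A₄ = (assign1 3 28 5 (.get 4 28 0)).exec I ρ B₂ := by
        rw [hA₄, Cmd.exec, if_pos (htest.2 hemp)]; rfl
      have hC : Holds Q S₀ B₁ := by
        intro a
        rw [hB₁, eval_assign1 (by norm_num) h.v0 (hsynd 2) (by rw [h.v4]; exact a.2)]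
        exact esynd _ a
      rw [e4, if_neg hemp, eval_assign1 (by norm_num) h.v0 (by simp [Expr.Reads])
        (by rw [h.v5]; exact hi)]
      have := exec_consistent Q ℓ S₀ h hC i hi
      simpa [Expr.eval, h.v0] using this
  · have e11 : A₂ 11 0 0 = 1 := by simp [hA₂, Cmd.exec, Arrays.set, h.v0, Expr.eval]
    have e2 : ∀ id, id ≠ 11 → A₂ id = A₁ id := fun id hid => Cmd.Keeps.store hid _ ρ A₁
    refine ⟨by simp [e11], fun a => ?_, fun i hi => ?_⟩
    · rw [e2 0 (by norm_num), hA₁, eval_assign1 (by norm_num) h.v0 (hsynd 0) (by rw [h.v4]; exact a.2)]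
      simpa [Code.rgRun] using esynd _ a
    · rw [e2 3 (by norm_num), hA₁, keeps_assign1 (by norm_num) _ ρ 0]
      simp [Code.rgRun, pbit_zero, bit]
  · rintro m B hm ⟨h1, h2, h3⟩
    rw [h.v9] at hm
    have env := h.update (show 10 ≤ 31 by norm_num) m
    set ρ' := Function.update ρ 31 m with hρ'
    have hstep : ∀ B' : Arrays, B' 11 0 0 = 2 ^ m → ∀ s : Q.Cluster × Pauli Q.n, Defects Q s.1 B' →
        Accumulated Q s.2 B' →
        let B'' := (Cmd.store 11 0 0 ((Expr.get 11 0 0).add (.get 11 0 0))).exec I ρ' B'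
        B'' 11 0 0 = 2 ^ (m + 1) ∧ Defects Q s.1 B'' ∧ Accumulated Q s.2 B'' := by
      intro B' e11 s hs1 hs2 B''
      have e2 : ∀ id, id ≠ 11 → B'' id = B' id := fun id hid => Cmd.Keeps.store hid _ ρ' B'
      refine ⟨?_, fun a => ?_, fun i hi => ?_⟩
      · simp [B'', Cmd.exec, Arrays.set, env.v0, Expr.eval, e11, pow_succ, mul_two]
      · rw [e2 0 (by norm_num)]; exact hs1 a
      · rw [e2 3 (by norm_num)]; exact hs2 i hi
    have htest : ((Expr.var 9).sub (.get 11 0 0)).eval I ρ' B ≠ 0 ↔ m < Nat.clog 2 ℓ := by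
      rw [Nat.lt_clog_iff_pow_lt (by norm_num), ← h1]
      simp only [Expr.eval, env.v9, env.v0]
      omega
    set B' := (Cmd.ite ((Expr.var 9).sub (.get 11 0 0)) (level D) .skip).exec I ρ' B with hB'
    by_cases ht : m < Nat.clog 2 ℓ
    · have e : B' = (level D).exec I ρ' B := by rw [hB', Cmd.exec, if_pos (htest.2 ht)]
      rw [min_eq_left ht.le] at h2 h3
      rw [min_eq_left (Nat.succ_le_of_lt ht)]
      obtain ⟨k1, k2, k3⟩ := exec_level Q ℓ S₀ hℓ env h1 (Q.syn_rgRun T S₀ m) h2 h3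
      exact hstep B' (by rw [e, k3]; exact h1) (Q.rgRun T S₀ (m + 1)) (by rw [e]; exact k1)
        (by rw [e]; exact k2)
    · have e : B' = B := by rw [hB', Cmd.exec, if_neg (htest.not.2 ht)]; rfl
      rw [min_eq_right (by omega)] at h2 h3 ⊢
      exact hstep B' (by rw [e]; exact h1) _ (by rw [e]; exact h2) (by rw [e]; exact h3)

end Decoder

end MemoryTime

/-! ### The decoder is computed in polynomial time -/

namespace MemoryTime

namespace Code

theorem exists_program (D q r : ℕ) (α γ : ℝ) (hD : 1 ≤ D) :
    ∃ (prog : Program) (L₀ K : ℕ), ∀ (L : ℕ) [NeZero L] (Q : Code D L) (ℓ : ℕ), L₀ ≤ L →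
      Q.Admissible q r α γ ℓ → ∃ dec : Q.Cluster → Pauli Q.n,
        Q.IsRGDecoder ℓ dec ∧ Q.ComputesWithin ℓ prog dec (K * L ^ K) := by
  obtain ⟨K, hK⟩ := exists_wrap D (decoder D)
  -- From `3 ≤ L` and `2 ℓ ≤ L` follows `ℓ + 1 < L`, so cubes of size up to `ℓ` do not wrap around.
  -- The sum serves both as coefficient and as exponent.
  refine ⟨wrap D (decoder D), 3, (6 * (q + r + 1)) ^ K + D * K, fun L _ Q ℓ hL hQ =>
    ⟨Q.rgDecoder ℓ, Q.isRGDecoder_rgDecoder ℓ, fun S => ?_⟩⟩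
  have hℓ : 2 * ℓ ≤ L := hQ.scale_le
  obtain ⟨h1, h2, h3, h4⟩ := Q.memory_header ℓ S
  obtain ⟨k, τ, hrun, hk, hτ⟩ := hK _ L ℓ Q.n Q.M (Q.memory ℓ S) (Q.params_le ℓ hD hQ) h1 h2 h3 h4
    fun i hi => Q.memory_eq_zero ℓ S hi
  refine ⟨k, τ, hrun, hk.trans ?_, fun j => ?_⟩
  · have hpos : 1 ≤ L ^ D := Nat.one_le_pow _ _ (by omega)
    calc (4 * (q + r + 1) * L ^ D + 2) ^ K ≤ (6 * (q + r + 1) * L ^ D) ^ K :=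
          Nat.pow_le_pow_left (by nlinarith) K
      _ = (6 * (q + r + 1)) ^ K * L ^ (D * K) := by rw [mul_pow, ← pow_mul]
      _ ≤ _ := Nat.mul_le_mul (Nat.le_add_right _ _)
          (Nat.pow_le_pow_right (by omega) (Nat.le_add_left _ _))
  · have hdec := exec_decoder Q ℓ S (by omega) (Env.params L ℓ Q.n Q.M)
    rw [hτ _ (by omega), hτ _ (by omega), hdec _ (by omega), hdec _ (by omega), pbit_even, pbit_odd]
    exact ⟨rfl, rfl⟩

end Code

end MemoryTime

end

/-! ### The main theorem -/

theorem mainTheorem9 (D q r w : ℕ) (α γ J κ hmax : ℝ)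
    (hD : 1 ≤ D) (hα : 1 ≤ α) (hγ : 0 < γ) (hJ : 0 < J) :
    ∃ (prog : MemoryTime.Program)
      (dec : (L : ℕ) → (Q : MemoryTime.Code D L) → ℕ → Q.Cluster → MemoryTime.Pauli Q.n)
      (c c' C : ℝ) (L₀ K : ℕ), 0 < c ∧ 0 < c' ∧ 0 < C ∧
      -- the decoder is the RG decoder, and one program computes it in polynomial time
      (∀ (L : ℕ) [NeZero L] (Q : MemoryTime.Code D L) (ℓ : ℕ), L₀ ≤ L →
        Q.Admissible q r α γ ℓ →
          Q.IsRGDecoder ℓ (dec L Q ℓ) ∧ Q.ComputesWithin ℓ prog (dec L Q ℓ) (K * L ^ K)) ∧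
      -- the bound on the storage error, and the resulting bound on the memory time
      (∀ (L : ℕ) [NeZero L] (Q : MemoryTime.Code D L) (ℓ : ℕ), L₀ ≤ L →
        Q.Admissible q r α γ ℓ →
        ∀ β : ℝ, 0 < β → (L : ℝ) ≤ Real.exp (c' * β) →
        ∀ B : MemoryTime.Code.Bath Q.n, Q.IsDaviesBath w κ hmax β B →
        ∀ ρ : ℝ → MemoryTime.Op Q.n, Q.IsEvolution J B ρ →
          (∀ t : ℝ, 0 ≤ t →
            Q.storageError (dec L Q ℓ) ρ t ≤ C * t * 2 ^ Q.k * (L : ℝ) ^ ((D : ℝ) - c * β)) ∧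
          ∀ ε : ℝ, 0 < ε →
            ENNReal.ofReal (ε / (C * 2 ^ Q.k) * (L : ℝ) ^ (c * β - (D : ℝ))) ≤
              MemoryTime.memoryTime (Q.storageError (dec L Q ℓ) ρ) ε) ∧
      -- the memory time at sizes of the order of the optimal one, for bounded `k`
      (∀ (ε : ℝ) (k₀ : ℕ) (μ δ : ℝ), 0 < ε → 0 < δ → δ < μ → μ ≤ 1 →
        ∃ β₀ : ℝ, ∀ β : ℝ, β₀ ≤ β →
        ∀ (L : ℕ) [NeZero L] (Q : MemoryTime.Code D L) (ℓ : ℕ),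
        Real.exp (μ * c' * β) ≤ L → (L : ℝ) ≤ Real.exp (c' * β) →
        Q.Admissible q r α γ ℓ → Q.k ≤ k₀ →
        ∀ B : MemoryTime.Code.Bath Q.n, Q.IsDaviesBath w κ hmax β B →
        ∀ ρ : ℝ → MemoryTime.Op Q.n, Q.IsEvolution J B ρ →
          ENNReal.ofReal (Real.exp (δ * c * c' * β ^ 2)) ≤
            MemoryTime.memoryTime (Q.storageError (dec L Q ℓ) ρ) ε) := by
  classical
  obtain ⟨prog, L₁, K, hprog⟩ := MemoryTime.Code.exists_program D q r α γ hD
  obtain ⟨c, c', C, L₂, hc, hc', hC, herr⟩ :=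
    MemoryTime.Code.exists_error_bound D q r w α γ J κ hmax hD hγ hJ
  let good : (L : ℕ) → (Q : MemoryTime.Code D L) → ℕ → (Q.Cluster → MemoryTime.Pauli Q.n) → Prop :=
    fun L Q ℓ dec => Q.IsRGDecoder ℓ dec ∧ Q.ComputesWithin ℓ prog dec (K * L ^ K)
  -- One decoder is fixed for each code before the bath is chosen. The identity is a mere default
  -- where the program computes no RG decoder in time.
  let dec : (L : ℕ) → (Q : MemoryTime.Code D L) → ℕ → Q.Cluster → MemoryTime.Pauli Q.n :=
    fun L Q ℓ => if h : ∃ dec, good L Q ℓ dec then h.choose else fun _ => 0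
  have hdec : ∀ (L : ℕ) [NeZero L] (Q : MemoryTime.Code D L) (ℓ : ℕ), max L₁ L₂ ≤ L →
      Q.Admissible q r α γ ℓ → good L Q ℓ (dec L Q ℓ) := by
    intro L _ Q ℓ hL hQ
    have h : ∃ dec, good L Q ℓ dec := hprog L Q ℓ ((le_max_left _ _).trans hL) hQ
    have : dec L Q ℓ = h.choose := dif_pos h
    rw [this]
    exact h.choose_spec
  have hmem : ∀ (L : ℕ) [NeZero L] (Q : MemoryTime.Code D L) (ℓ : ℕ), max L₁ L₂ ≤ L →
      Q.Admissible q r α γ ℓ → ∀ β : ℝ, 0 < β → (L : ℝ) ≤ Real.exp (c' * β) →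
        ∀ B : MemoryTime.Code.Bath Q.n, Q.IsDaviesBath w κ hmax β B →
        ∀ ρ : ℝ → MemoryTime.Op Q.n, Q.IsEvolution J B ρ → ∀ ε : ℝ,
            ENNReal.ofReal (ε / (C * 2 ^ Q.k) * (L : ℝ) ^ (c * β - (D : ℝ))) ≤
              MemoryTime.memoryTime (Q.storageError (dec L Q ℓ) ρ) ε := by
    intro L _ Q ℓ hL hQ β hβ hLβ B hB ρ hρ ε
    have hL0 : (0 : ℝ) < L := by exact_mod_cast Nat.pos_of_ne_zero (NeZero.ne L)
    refine MemoryTime.Code.le_memoryTime (by positivity) (Real.rpow_pos_of_pos hL0 _) fun t ht => ?_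
    rw [← Real.rpow_neg hL0.le, neg_sub]
    have h := herr L Q ℓ ((le_max_right _ _).trans hL) hQ β hβ hLβ _ (hdec L Q ℓ hL hQ).1 B hB ρ hρ t ht
    rwa [mul_right_comm C] at h
  refine ⟨prog, dec, c, c', C, max L₁ L₂, K, hc, hc', hC, hdec, ?_, ?_⟩
  · intro L _ Q ℓ hL hQ β hβ hLβ B hB ρ hρ
    exact ⟨herr L Q ℓ ((le_max_right _ _).trans hL) hQ β hβ hLβ _ (hdec L Q ℓ hL hQ).1 B hB ρ hρ,
      fun ε _ => hmem L Q ℓ hL hQ β hβ hLβ B hB ρ hρ ε⟩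
  · intro ε k₀ μ δ hε hδ hδμ _
    obtain ⟨β₀, h⟩ := MemoryTime.Code.exists_beta (D := D) hc hc' hC (max L₁ L₂) k₀ hε hδ hδμ
    refine ⟨β₀, fun β hβ L _ Q ℓ hL1 hL2 hQ hk B hB ρ hρ => ?_⟩
    -- The threshold `β₀` also ensures that `L`, being at least `exp (μ c' β)`, exceeds the minimal
    -- size required by the previous bounds.
    obtain ⟨hβ0, h⟩ := h β hβ
    obtain ⟨hL, h⟩ := h L Q.k hL1 hk
    exact (ENNReal.ofReal_le_ofReal h).trans (hmem L Q ℓ hL hQ β hβ0 hL2 B hB ρ hρ ε)
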